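/- **Conventions.** Multicategories and polycategories are symmetric. A *$\ast$-polycategory* is a symmetric polycategory $\mathcal P$ with an involution $A\mapsto A^{\bullet}$ on objects (strict: $A^{\bullet\bullet}=A$) and, for every bijection $\sigma$ between the entries of $(\Gamma;\Delta)$ and those of $(\Gamma';\Delta')$ which preserves objects, except that an object changing sides is replaced by its dual, a map $f\mapsto f^{\sigma}$, $\mathcal P(\Gamma;\Delta)\to\mathcal P(\Gamma';\Delta')$; these maps extend the symmetric action, are functorial in $\sigma$, and are compatible with composition: $g^{\rho}\circ_{A} f^{\sigma}=(g\circ_{A} f)^{\tau}$ if $\sigma,\rho$ leave the object $A$ along which one composes on its side, and $f^{\sigma}\circ_{A^{\bullet}} g^{\rho}=(g\circ_{A} f)^{\tau}$ if both move it to the other side, where $\tau$ is the induced bijection. Functors of $\ast$-polycategories preserve all this structure strictly. A *presheaf of ($\ast$-)polycategories* on a multicategory $\mathcal C$ assigns to each finite list $\Gamma$ of objects of $\mathcal C$ a ($\ast$-)polycategory $\Omega(\Gamma)$, with strictly functorial actions, by functors of ($\ast$-)polycategories, of permutations of lists and of the arrows $f:\Delta\to A$ of $\mathcal C$, $f^{*}:\Omega(\Gamma,A)\to\Omega(\Gamma,\Delta)$;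 for $x\in\Omega(\Gamma,A)$ write $x\circ_A f=f^{*}x$. **The construction.** For a presheaf $\Omega$ of polycategories on $\mathcal C$, the presheaf $\mathrm{Adj}_{\mathcal C}(\Omega)$ is as follows. An object of $\mathrm{Adj}_{\mathcal C}(\Omega)(\Gamma)$ is a triple $\phi=(\phi^{+},\phi^{-},\underline\phi)$ of objects $\phi^{\pm}$ of $\mathcal C$ and an object $\underline\phi$ of $\Omega(\Gamma,\phi^{-},\phi^{+})$. A polyarrow $(\phi_1,\dots,\phi_m)\to(\psi_1,\dots,\psi_n)$ consists of arrows of $\mathcal C$ $$f_j:(\phi_1^{+},\dots,\phi_m^{+},\psi_1^{-},\dots,\widehat{\psi_j^{-}},\dots,\psi_n^{-})\to\psi_j^{+},\qquad g_i:(\phi_1^{+},\dots,\widehat{\phi_i^{+}},\dots,\phi_m^{+},\psi_1^{-},\dots,\psi_n^{-})\to\phi_i^{-}$$ ($1\le j\le n$, $1\le i\le m$) and a polyarrow $\alpha:(\underline\phi_1\circ_{\phi_1^{-}} g_1,\dots,\underline\phi_m\circ_{\phi_m^{-}} g_m)\to(\underline\psi_1\circ_{\psi_1^{+}} f_1,\dots,\underline\psi_n\circ_{\psi_n^{+}}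 f_n)$ in $\Omega(\Gamma,\phi_1^{+},\dots,\phi_m^{+},\psi_1^{-},\dots,\psi_n^{-})$. The composite of polyarrows $(f',g',\alpha')$ and $(f,g,\alpha)$ along $\psi_j=\phi'_k$ is obtained by composing in $\mathcal C$ each component of $(f',g')$ other than $g'_k$ with $f_j$ at $\psi_j^{+}$, and each component of $(f,g)$ other than $f_j$ with $g'_k$ at $\psi_j^{-}$, and by taking the composite of $f_j^{*}\alpha'$ and $(g'_k)^{*}\alpha$ in $\Omega$. Permutations and arrows of $\mathcal C$ act through $\Omega$. **Theorem.** If $\Omega$ is a presheaf of $\ast$-polycategories on a multicategory $\mathcal C$, then so is $\mathrm{Adj}_{\mathcal C}(\Omega)$, with duals $(\phi^{+},\phi^{-},\underline\phi)^{\bullet}=(\phi^{-},\phi^{+},\underline\phi^{\bullet})$, where $\underline\phi^{\bullet}$ is the dual of $\underline\phi$ in $\Omega(\Gamma,\phi^{-},\phi^{+})$, transported to $\Omega(\Gamma,\phi^{+},\phi^{-})$ by the symmetry, and where a bijection $\sigma$ acts on polyarrows by permuting the arrows $f_j,g_i$ and by the action of $\sigma$ in $\Omega$ on $\alpha$. **Double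 Chu constructions.** Let $\mathcal K=(\mathcal C,\Omega)$ be a (strict) 2-multicategory with a 2-presheaf, i.e. with categories $\mathcal C(\Gamma;A)$ and $\Omega(\Gamma)$ and strictly functorial operations. For a category $\mathcal X$, let $\mathcal X_{\mathsf{fpd}}$ be the $\ast$-polycategory with the objects of $\mathcal X$, each of them its own dual, whose polyarrows $\Gamma\to\Delta$ are the cliques on the list $(\Gamma,\Delta)$, i.e. families $\theta_{ij}$ of isomorphisms between any two of its entries with $\theta_{ii}=1$ and $\theta_{jk}\theta_{ij}=\theta_{ik}$; one composes along an object by composing the isomorphisms through this object. Put $\mathrm{Chu}_0(\mathcal K)=\mathrm{Adj}_{\mathcal C}(\Omega_{\mathsf{fpd}})()$; this involves only the identity 2-cells between the arrows of $\mathcal C$. Let $\mathcal K^{\mathbf 2}$ be the 2-multicategory with 2-presheaf whose objects are the unary arrows of $\mathcal C$, whose arrows $(h_1,\dots,h_m)\to k$ are the squares $(f,g,\theta)$ with $\theta:k\circ f\Rightarrow g\circ(h_1,\dots,h_m)$, whose elements at $(h_1,\dots,h_m)$ are the triples $(x,y,\theta)$ of elements $x,y$ of $\Omega$ and a 2-cell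 $\theta:x\Rightarrow y\circ(h_1,\dots,h_m)$, and whose 2-cells are commuting cylinders. The *double Chu construction* $\mathbb{C}\mathsf{hu}(\mathcal C,\Omega)$ has $\mathrm{Chu}_0(\mathcal K)$ as its object-of-objects, $\mathrm{Chu}_0(\mathcal K^{\mathbf 2})$ as its object-of-morphisms, and source, target, identities and composition given componentwise by the tops and bottoms of squares and cylinders, by vertical identity squares, and by vertical composition of squares. **Corollary.** Every double Chu construction $\mathbb{C}\mathsf{hu}(\mathcal C,\Omega)$ is a $\ast$-poly double category, i.e. an internal category in the category of $\ast$-polycategories: $\mathrm{Chu}_0(\mathcal K)$ and $\mathrm{Chu}_0(\mathcal K^{\mathbf 2})$ are $\ast$-polycategories, the source, target, identity and composition maps (the latter on the pullback of target and source) are functors of $\ast$-polycategories, and they satisfy the axioms of a category. -/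

import Mathlib

universe u v w u₁ v₁

set_option linter.checkUnivs false

/-! ## Bijections between index sets -/

namespace ChuDialectica

/-- A bijection carrying `a` to `b` restricts to the complements of `a` and `b`. -/
def neEquiv {α β : Type} (σ : α ≃ β) {a : α} {b : β} (h : σ a = b) :
    {x // x ≠ a} ≃ {y // y ≠ b} :=
  σ.subtypeEquiv fun x => by subst h; simp

@[simp] theorem neEquiv_apply {α β : Type} (σ : α ≃ β) {a : α} {b : β} (h : σ a = b)
    (x : {x // x ≠ a}) : neEquiv σ h x = ⟨σ x.1, fun e => x.2 (σ.injective (e.trans h.symm))⟩ := rfl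

/-- Removing an element of the right summand. -/
def neInr {α β : Type} (b : β) : {x : α ⊕ β // x ≠ Sum.inr b} ≃ α ⊕ {y // y ≠ b} where
  toFun
    | ⟨Sum.inl a, _⟩ => Sum.inl a
    | ⟨Sum.inr y, h⟩ => Sum.inr ⟨y, fun e => h (e ▸ rfl)⟩
  invFun
    | Sum.inl a => ⟨Sum.inl a, Sum.inl_ne_inr⟩
    | Sum.inr y => ⟨Sum.inr y.1, fun e => y.2 (Sum.inr.inj e)⟩
  left_inv := by rintro ⟨_ | _, _⟩ <;> rfl
  right_inv := by rintro (_ | _) <;> rfl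

/-- Replacing the element `b` of the right summand by the block `γ`. -/
def plugInr {α β γ δ : Type} {b : β} (e : {y : β // y ≠ b} ⊕ γ ≃ δ) :
    {x : α ⊕ β // x ≠ Sum.inr b} ⊕ γ ≃ α ⊕ δ :=
  (((neInr b).sumCongr (Equiv.refl γ)).trans (Equiv.sumAssoc α _ γ)).trans
    ((Equiv.refl α).sumCongr e)

@[simp] theorem plugInr_inl_inl {α β γ δ : Type} {b : β} (e : {y : β // y ≠ b} ⊕ γ ≃ δ) (a : α)
    (h : (Sum.inl a : α ⊕ β) ≠ Sum.inr b) : plugInr e (Sum.inl ⟨Sum.inl a, h⟩) = Sum.inl a := rfl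

@[simp] theorem plugInr_inl_inr {α β γ δ : Type} {b : β} (e : {y : β // y ≠ b} ⊕ γ ≃ δ) (y : β)
    (h : (Sum.inr y : α ⊕ β) ≠ Sum.inr b) :
    plugInr e (Sum.inl ⟨Sum.inr y, h⟩) = Sum.inr (e (Sum.inl ⟨y, fun k => h (k ▸ rfl)⟩)) := rfl

@[simp] theorem plugInr_inr {α β γ δ : Type} {b : β} (e : {y : β // y ≠ b} ⊕ γ ≃ δ) (c : γ) :
    (plugInr e (Sum.inr c) : α ⊕ δ) = Sum.inr (e (Sum.inr c)) := rfl

/-- Replacing the element `a` of the left summand by the block `γ`. -/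
def plugInl {α : Type} (a : α) (γ β : Type) :
    {x : α ⊕ β // x ≠ Sum.inl a} ⊕ γ ≃ ({y : α // y ≠ a} ⊕ γ) ⊕ β where
  toFun
    | Sum.inl ⟨Sum.inl x, h⟩ => Sum.inl (Sum.inl ⟨x, fun e => h (congrArg Sum.inl e)⟩)
    | Sum.inl ⟨Sum.inr y, _⟩ => Sum.inr y
    | Sum.inr c => Sum.inl (Sum.inr c)
  invFun
    | Sum.inl (Sum.inl x) => Sum.inl ⟨Sum.inl x.1, fun e => x.2 (Sum.inl.inj e)⟩
    | Sum.inl (Sum.inr c) => Sum.inr c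
    | Sum.inr y => Sum.inl ⟨Sum.inr y, Sum.inr_ne_inl⟩
  left_inv := by rintro (⟨_ | _, _⟩ | _) <;> rfl
  right_inv := by rintro ((_ | _) | _) <;> rfl

/-- Replacing two different elements `a`, `b` of `α` by the blocks `β` (for `a`) and `γ` (for `b`):
the two orders of doing so agree. -/
def swapSlots {α β γ : Type} {a b : α} (hab : a ≠ b) :
    {x : {i // i ≠ a} ⊕ β // x ≠ Sum.inl ⟨b, hab.symm⟩} ⊕ γ ≃
      {x : {i // i ≠ b} ⊕ γ // x ≠ Sum.inl ⟨a, hab⟩} ⊕ β where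
  toFun
    | Sum.inl ⟨Sum.inl i, h⟩ =>
        Sum.inl ⟨Sum.inl ⟨i.1, fun e => h (congrArg Sum.inl (Subtype.ext e))⟩,
          fun e => i.2 (congrArg Subtype.val (Sum.inl.inj e))⟩
    | Sum.inl ⟨Sum.inr x, _⟩ => Sum.inr x
    | Sum.inr c => Sum.inl ⟨Sum.inr c, Sum.inr_ne_inl⟩
  invFun
    | Sum.inl ⟨Sum.inl i, h⟩ =>
        Sum.inl ⟨Sum.inl ⟨i.1, fun e => h (congrArg Sum.inl (Subtype.ext e))⟩,
          fun e => i.2 (congrArg Subtype.val (Sum.inl.inj e))⟩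
    | Sum.inl ⟨Sum.inr x, _⟩ => Sum.inr x
    | Sum.inr c => Sum.inl ⟨Sum.inr c, Sum.inr_ne_inl⟩
  left_inv := by rintro (⟨_ | _, _⟩ | _) <;> rfl
  right_inv := by rintro (⟨_ | _, _⟩ | _) <;> rfl

/-- Replacing an element by a one-element block. -/
noncomputable def plugUnit {α : Type} (a : α) : {x // x ≠ a} ⊕ Unit ≃ α where
  toFun := Sum.elim Subtype.val fun _ => a
  invFun x := open Classical in if h : x = a then Sum.inr () else Sum.inl ⟨x, h⟩
  left_inv := by
    rintro (⟨x, h⟩ | _)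
    · simp [h]
    · simp
  right_inv x := by by_cases h : x = a <;> simp [h]

@[simp] theorem plugUnit_inl {α : Type} (a : α) (x : {x // x ≠ a}) :
    plugUnit a (Sum.inl x) = x.1 := rfl

@[simp] theorem plugUnit_inr {α : Type} (a : α) (x : Unit) : plugUnit a (Sum.inr x) = a := rfl

/-- Replacing the only element by the block `α`. -/
def unitPlug {α : Type} : {x : Unit // x ≠ ()} ⊕ α ≃ α where
  toFun := Sum.elim (fun x => (x.2 rfl).elim) id
  invFun := Sum.inr
  left_inv := by rintro (⟨_, h⟩ | _); exacts [(h rfl).elim, rfl]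
  right_inv _ := rfl

@[simp] theorem unitPlug_inr {α : Type} (x : α) : unitPlug (Sum.inr x) = x := rfl

/-- The permutation `A ⊕ (B ⊕ C) ≃ B ⊕ (A ⊕ C)`. -/
def leftSwap {α β γ : Type} : α ⊕ (β ⊕ γ) ≃ β ⊕ (α ⊕ γ) where
  toFun := Sum.elim (Sum.inr ∘ Sum.inl) (Sum.elim Sum.inl (Sum.inr ∘ Sum.inr))
  invFun := Sum.elim (Sum.inr ∘ Sum.inl) (Sum.elim Sum.inl (Sum.inr ∘ Sum.inr))
  left_inv := by rintro (_ | _ | _) <;> rfl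
  right_inv := by rintro (_ | _ | _) <;> rfl

/-! ## Multicategories and presheaves on them -/

/-- A symmetric multicategory.  Throughout, finite lists are families indexed by finite types (a
list of length `n` being a family indexed by `Fin n`, and any finite family being identified with
lists by the symmetric action), and arrows are collected over all their domains and codomains:
`Arr ι` is the set of all multiarrows `f : (src f i)_{i : ι} ⟶ tgt f`. -/
structure Multicat where
  Obj : Type u
  Arr : (ι : Type) → [Finite ι] → Type v
  src : ∀ {ι : Type} [Finite ι], Arr ι → ι → Obj
  tgt : ∀ {ι : Type} [Finite ι], Arr ι → Obj
  /-- The symmetric action. -/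
  act : ∀ {ι κ : Type} [Finite ι] [Finite κ], ι ≃ κ → Arr ι → Arr κ
  /-- Identities. -/
  one : Obj → Arr Unit
  /-- The composite `g ∘ f` at the input `q` of `g`. -/
  comp : ∀ {ι κ : Type} [Finite ι] [Finite κ] (g : Arr κ) (q : κ) (f : Arr ι),
    src g q = tgt f → Arr ({x // x ≠ q} ⊕ ι)
  src_act : ∀ {ι κ : Type} [Finite ι] [Finite κ] (σ : ι ≃ κ) (f : Arr ι) (i : ι),
    src (act σ f) (σ i) = src f i
  tgt_act : ∀ {ι κ : Type} [Finite ι] [Finite κ] (σ : ι ≃ κ) (f : Arr ι), tgt (act σ f) = tgt f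
  src_one : ∀ (A : Obj) (i : Unit), src (one A) i = A
  tgt_one : ∀ A : Obj, tgt (one A) = A
  src_comp_inl : ∀ {ι κ : Type} [Finite ι] [Finite κ] (g : Arr κ) (q : κ) (f : Arr ι)
    (h : src g q = tgt f) (x : {x // x ≠ q}), src (comp g q f h) (Sum.inl x) = src g x.1
  src_comp_inr : ∀ {ι κ : Type} [Finite ι] [Finite κ] (g : Arr κ) (q : κ) (f : Arr ι)
    (h : src g q = tgt f) (i : ι), src (comp g q f h) (Sum.inr i) = src f i
  tgt_comp : ∀ {ι κ : Type} [Finite ι] [Finite κ] (g : Arr κ) (q : κ) (f : Arr ι)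
    (h : src g q = tgt f), tgt (comp g q f h) = tgt g
  act_refl : ∀ {ι : Type} [Finite ι] (f : Arr ι), act (Equiv.refl ι) f = f
  act_act : ∀ {ι κ μ : Type} [Finite ι] [Finite κ] [Finite μ] (σ : ι ≃ κ) (τ : κ ≃ μ) (f : Arr ι),
    act τ (act σ f) = act (σ.trans τ) f
  one_comp : ∀ {ι : Type} [Finite ι] (A : Obj) (f : Arr ι) (h : src (one A) () = tgt f),
    comp (one A) () f h = act unitPlug.symm f
  comp_one : ∀ {κ : Type} [Finite κ] (g : Arr κ) (q : κ) (A : Obj) (h : src g q = tgt (one A)),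
    comp g q (one A) h = act (plugUnit q).symm g
  assoc : ∀ {ι κ μ : Type} [Finite ι] [Finite κ] [Finite μ] (k : Arr μ) (r : μ) (g : Arr κ) (q : κ)
    (f : Arr ι) (h₁ : src k r = tgt g) (h₂ : src (comp k r g h₁) (Sum.inr q) = tgt f)
    (h₃ : src g q = tgt f) (h₄ : src k r = tgt (comp g q f h₃)),
    comp (comp k r g h₁) (Sum.inr q) f h₂ =
      act (plugInr (Equiv.refl _)).symm (comp k r (comp g q f h₃) h₄)
  exchange : ∀ {ι κ μ : Type} [Finite ι] [Finite κ] [Finite μ] (k : Arr μ) (r s : μ) (hrs : r ≠ s)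
    (g : Arr κ) (f : Arr ι) (h₁ : src k r = tgt g)
    (h₂ : src (comp k r g h₁) (Sum.inl ⟨s, hrs.symm⟩) = tgt f) (h₃ : src k s = tgt f)
    (h₄ : src (comp k s f h₃) (Sum.inl ⟨r, hrs⟩) = tgt g),
    comp (comp k r g h₁) (Sum.inl ⟨s, hrs.symm⟩) f h₂ =
      act (swapSlots hrs).symm (comp (comp k s f h₃) (Sum.inl ⟨r, hrs⟩) g h₄)
  equivariance : ∀ {ι ι' κ κ' : Type} [Finite ι] [Finite ι'] [Finite κ] [Finite κ']
    (σ : κ ≃ κ') (τ : ι ≃ ι') (g : Arr κ) (q : κ) (q' : κ') (hq : σ q = q') (f : Arr ι)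
    (h : src g q = tgt f) (h' : src (act σ g) q' = tgt (act τ f)),
    comp (act σ g) q' (act τ f) h' = act ((neEquiv σ hq).sumCongr τ) (comp g q f h)

namespace Multicat

/-- The context obtained from `Γ` by replacing the entry `p` by the domain of `f`. -/
def subCtx (C : Multicat.{u, v}) {ι κ : Type} [Finite κ] (Γ : ι → C.Obj) (p : ι) (f : C.Arr κ) :
    {x // x ≠ p} ⊕ κ → C.Obj :=
  Sum.elim (fun x => Γ x.1) (C.src f)

end Multicat

/-- The data of a presheaf of sets on a multicategory. -/
structure SetPshData (C : Multicat.{u, v}) where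
  El : ∀ {ι : Type} [Finite ι], (ι → C.Obj) → Type w
  act : ∀ {ι κ : Type} [Finite ι] [Finite κ] {Γ : ι → C.Obj} {Δ : κ → C.Obj} (σ : ι ≃ κ),
    (∀ i, Δ (σ i) = Γ i) → El Γ → El Δ
  sub : ∀ {ι κ : Type} [Finite ι] [Finite κ] {Γ : ι → C.Obj} (p : ι) (f : C.Arr κ),
    C.tgt f = Γ p → El Γ → El (C.subCtx Γ p f)

/-- The axioms of a presheaf of sets on a multicategory. -/
structure SetPshData.IsPsh {C : Multicat.{u, v}} (M : SetPshData.{u, v, w} C) : Prop where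
  act_refl : ∀ {ι : Type} [Finite ι] {Γ : ι → C.Obj} (h : ∀ i, Γ (Equiv.refl ι i) = Γ i)
    (x : M.El Γ), M.act (Equiv.refl ι) h x = x
  act_act : ∀ {ι κ μ : Type} [Finite ι] [Finite κ] [Finite μ] {Γ : ι → C.Obj} {Δ : κ → C.Obj}
    {Θ : μ → C.Obj} (σ : ι ≃ κ) (τ : κ ≃ μ) (h₁ : ∀ i, Δ (σ i) = Γ i) (h₂ : ∀ i, Θ (τ i) = Δ i)
    (h₃ : ∀ i, Θ (σ.trans τ i) = Γ i) (x : M.El Γ),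
    M.act τ h₂ (M.act σ h₁ x) = M.act (σ.trans τ) h₃ x
  sub_one : ∀ {ι : Type} [Finite ι] {Γ : ι → C.Obj} (p : ι) (A : C.Obj)
    (h₁ : C.tgt (C.one A) = Γ p)
    (h₂ : ∀ i, C.subCtx Γ p (C.one A) ((plugUnit p).symm i) = Γ i) (x : M.El Γ),
    M.sub p (C.one A) h₁ x = M.act (plugUnit p).symm h₂ x
  sub_comm : ∀ {ι κ μ : Type} [Finite ι] [Finite κ] [Finite μ] {Γ : ι → C.Obj} (p q : ι)
    (hpq : p ≠ q) (f : C.Arr κ) (g : C.Arr μ) (h₁ : C.tgt f = Γ p)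
    (h₂ : C.tgt g = C.subCtx Γ p f (Sum.inl ⟨q, hpq.symm⟩)) (h₃ : C.tgt g = Γ q)
    (h₄ : C.tgt f = C.subCtx Γ q g (Sum.inl ⟨p, hpq⟩))
    (h₅ : ∀ i, C.subCtx (C.subCtx Γ p f) (Sum.inl ⟨q, hpq.symm⟩) g ((swapSlots hpq).symm i) =
      C.subCtx (C.subCtx Γ q g) (Sum.inl ⟨p, hpq⟩) f i) (x : M.El Γ),
    M.sub (Sum.inl ⟨q, hpq.symm⟩) g h₂ (M.sub p f h₁ x) =
      M.act (swapSlots hpq).symm h₅ (M.sub (Sum.inl ⟨p, hpq⟩) f h₄ (M.sub q g h₃ x))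
  sub_comp : ∀ {ι κ μ : Type} [Finite ι] [Finite κ] [Finite μ] {Γ : ι → C.Obj} (p : ι)
    (g : C.Arr κ) (q : κ) (f : C.Arr μ) (hgf : C.src g q = C.tgt f)
    (h₁ : C.tgt (C.comp g q f hgf) = Γ p) (h₂ : C.tgt g = Γ p)
    (h₃ : C.tgt f = C.subCtx Γ p g (Sum.inr q))
    (h₄ : ∀ i, C.subCtx Γ p (C.comp g q f hgf) (plugInr (Equiv.refl _) i) =
      C.subCtx (C.subCtx Γ p g) (Sum.inr q) f i) (x : M.El Γ),
    M.sub p (C.comp g q f hgf) h₁ x =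
      M.act (plugInr (Equiv.refl _)) h₄ (M.sub (Sum.inr q) f h₃ (M.sub p g h₂ x))
  sub_act : ∀ {ι κ κ' : Type} [Finite ι] [Finite κ] [Finite κ'] {Γ : ι → C.Obj} (p : ι)
    (f : C.Arr κ) (ρ : κ ≃ κ') (h₁ : C.tgt (C.act ρ f) = Γ p) (h₂ : C.tgt f = Γ p)
    (h₃ : ∀ i, C.subCtx Γ p (C.act ρ f) ((Equiv.refl _).sumCongr ρ i) = C.subCtx Γ p f i)
    (x : M.El Γ),
    M.sub p (C.act ρ f) h₁ x = M.act ((Equiv.refl _).sumCongr ρ) h₃ (M.sub p f h₂ x)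
  act_sub : ∀ {ι ι' κ : Type} [Finite ι] [Finite ι'] [Finite κ] {Γ : ι → C.Obj} {Δ : ι' → C.Obj}
    (τ : ι ≃ ι') (p : ι) (p' : ι') (hp : τ p = p') (f : C.Arr κ) (h₁ : ∀ i, Δ (τ i) = Γ i)
    (h₂ : C.tgt f = Δ p') (h₃ : C.tgt f = Γ p)
    (h₄ : ∀ i, C.subCtx Δ p' f ((neEquiv τ hp).sumCongr (Equiv.refl κ) i) = C.subCtx Γ p f i)
    (x : M.El Γ),
    M.sub p' f h₂ (M.act τ h₁ x) =
      M.act ((neEquiv τ hp).sumCongr (Equiv.refl κ)) h₄ (M.sub p f h₃ x)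

/-! ## Polycategories and `∗`-polycategories -/

/-- The typed operations of a symmetric polycategory.  `Arr m n` is the set of all polyarrows
`(src f i)_{i : m} ⟶ (tgt f j)_{j : n}`. -/
structure PolyData where
  Obj : Type u
  Arr : (m n : Type) → [Finite m] → [Finite n] → Type v
  src : ∀ {m n : Type} [Finite m] [Finite n], Arr m n → m → Obj
  tgt : ∀ {m n : Type} [Finite m] [Finite n], Arr m n → n → Obj
  /-- The symmetric action. -/
  perm : ∀ {m n m' n' : Type} [Finite m] [Finite n] [Finite m'] [Finite n'],
    m ≃ m' → n ≃ n' → Arr m n → Arr m' n'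
  /-- Identities. -/
  one : Obj → Arr Unit Unit
  /-- The composite of `g` and `f` along the input `k` of `g` and the output `j` of `f`. -/
  comp : ∀ {m n p q : Type} [Finite m] [Finite n] [Finite p] [Finite q] (g : Arr p q) (k : p)
    (f : Arr m n) (j : n), src g k = tgt f j → Arr ({x // x ≠ k} ⊕ m) ({y // y ≠ j} ⊕ q)
  src_perm : ∀ {m n m' n' : Type} [Finite m] [Finite n] [Finite m'] [Finite n'] (ρ : m ≃ m')
    (τ : n ≃ n') (f : Arr m n) (i : m), src (perm ρ τ f) (ρ i) = src f i
  tgt_perm : ∀ {m n m' n' : Type} [Finite m] [Finite n] [Finite m'] [Finite n'] (ρ : m ≃ m')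
    (τ : n ≃ n') (f : Arr m n) (j : n), tgt (perm ρ τ f) (τ j) = tgt f j
  src_one : ∀ (A : Obj) (i : Unit), src (one A) i = A
  tgt_one : ∀ (A : Obj) (i : Unit), tgt (one A) i = A
  src_comp : ∀ {m n p q : Type} [Finite m] [Finite n] [Finite p] [Finite q] (g : Arr p q) (k : p)
    (f : Arr m n) (j : n) (h : src g k = tgt f j) (i : {x // x ≠ k} ⊕ m),
    src (comp g k f j h) i = Sum.elim (fun x => src g x.1) (src f) i
  tgt_comp : ∀ {m n p q : Type} [Finite m] [Finite n] [Finite p] [Finite q] (g : Arr p q) (k : p)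
    (f : Arr m n) (j : n) (h : src g k = tgt f j) (i : {y // y ≠ j} ⊕ q),
    tgt (comp g k f j h) i = Sum.elim (fun y => tgt f y.1) (tgt g) i

/-- The axioms of a symmetric polycategory. -/
structure PolyData.IsPoly (P : PolyData.{u, v}) : Prop where
  perm_refl : ∀ {m n : Type} [Finite m] [Finite n] (f : P.Arr m n),
    P.perm (Equiv.refl m) (Equiv.refl n) f = f
  perm_perm : ∀ {m n m' n' m'' n'' : Type} [Finite m] [Finite n] [Finite m'] [Finite n']
    [Finite m''] [Finite n''] (ρ : m ≃ m') (τ : n ≃ n') (ρ' : m' ≃ m'') (τ' : n' ≃ n'')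
    (f : P.Arr m n), P.perm ρ' τ' (P.perm ρ τ f) = P.perm (ρ.trans ρ') (τ.trans τ') f
  one_comp : ∀ {m n : Type} [Finite m] [Finite n] (A : P.Obj) (f : P.Arr m n) (j : n)
    (h : P.src (P.one A) () = P.tgt f j),
    P.comp (P.one A) () f j h = P.perm unitPlug.symm (plugUnit j).symm f
  comp_one : ∀ {p q : Type} [Finite p] [Finite q] (g : P.Arr p q) (k : p) (A : P.Obj)
    (h : P.src g k = P.tgt (P.one A) ()),
    P.comp g k (P.one A) () h = P.perm (plugUnit k).symm unitPlug.symm g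
  assoc : ∀ {m n p q r s : Type} [Finite m] [Finite n] [Finite p] [Finite q] [Finite r] [Finite s]
    (h : P.Arr r s) (c : r) (g : P.Arr p q) (k : p) (d : q) (f : P.Arr m n) (j : n)
    (h₁ : P.src h c = P.tgt g d) (h₂ : P.src (P.comp h c g d h₁) (Sum.inr k) = P.tgt f j)
    (h₃ : P.src g k = P.tgt f j) (h₄ : P.src h c = P.tgt (P.comp g k f j h₃) (Sum.inr d)),
    P.comp (P.comp h c g d h₁) (Sum.inr k) f j h₂ =
      P.perm (plugInr (Equiv.refl _)).symm (plugInr (Equiv.refl _))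
        (P.comp h c (P.comp g k f j h₃) (Sum.inr d) h₄)
  exchange_inputs : ∀ {m n p q r s : Type} [Finite m] [Finite n] [Finite p] [Finite q] [Finite r]
    [Finite s] (h : P.Arr r s) (c c' : r) (hc : c ≠ c') (g : P.Arr p q) (d : q) (f : P.Arr m n)
    (j : n) (h₁ : P.src h c = P.tgt g d)
    (h₂ : P.src (P.comp h c g d h₁) (Sum.inl ⟨c', hc.symm⟩) = P.tgt f j)
    (h₃ : P.src h c' = P.tgt f j)
    (h₄ : P.src (P.comp h c' f j h₃) (Sum.inl ⟨c, hc⟩) = P.tgt g d),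
    P.comp (P.comp h c g d h₁) (Sum.inl ⟨c', hc.symm⟩) f j h₂ =
      P.perm (swapSlots hc).symm leftSwap
        (P.comp (P.comp h c' f j h₃) (Sum.inl ⟨c, hc⟩) g d h₄)
  exchange_outputs : ∀ {m n p q r s : Type} [Finite m] [Finite n] [Finite p] [Finite q] [Finite r]
    [Finite s] (h : P.Arr r s) (c : r) (g : P.Arr p q) (k : p) (f : P.Arr m n) (j j' : n)
    (hj : j ≠ j') (h₁ : P.src g k = P.tgt f j)
    (h₂ : P.src h c = P.tgt (P.comp g k f j h₁) (Sum.inl ⟨j', hj.symm⟩))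
    (h₃ : P.src h c = P.tgt f j')
    (h₄ : P.src g k = P.tgt (P.comp h c f j' h₃) (Sum.inl ⟨j, hj⟩)),
    P.comp h c (P.comp g k f j h₁) (Sum.inl ⟨j', hj.symm⟩) h₂ =
      P.perm leftSwap (swapSlots hj).symm
        (P.comp g k (P.comp h c f j' h₃) (Sum.inl ⟨j, hj⟩) h₄)
  equivariance : ∀ {m n p q m' n' p' q' : Type} [Finite m] [Finite n] [Finite p] [Finite q]
    [Finite m'] [Finite n'] [Finite p'] [Finite q'] (ρ : p ≃ p') (τ : q ≃ q') (ρ' : m ≃ m')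
    (τ' : n ≃ n') (g : P.Arr p q) (k : p) (k' : p') (hk : ρ k = k') (f : P.Arr m n) (j : n)
    (j' : n') (hj : τ' j = j') (h : P.src g k = P.tgt f j)
    (h' : P.src (P.perm ρ τ g) k' = P.tgt (P.perm ρ' τ' f) j'),
    P.comp (P.perm ρ τ g) k' (P.perm ρ' τ' f) j' h' =
      P.perm ((neEquiv ρ hk).sumCongr ρ') ((neEquiv τ' hj).sumCongr τ) (P.comp g k f j h)

/-- The entries of a composite, i.e. its inputs and outputs together, are the entries of the two
factors other than those along which one composes. -/
def glue {m n p q : Type} (k : p) (j : n) :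
    {e : p ⊕ q // e ≠ Sum.inl k} ⊕ {e : m ⊕ n // e ≠ Sum.inr j} ≃
      ({x // x ≠ k} ⊕ m) ⊕ ({y // y ≠ j} ⊕ q) where
  toFun
    | Sum.inl ⟨Sum.inl x, h⟩ => Sum.inl (Sum.inl ⟨x, fun e => h (congrArg Sum.inl e)⟩)
    | Sum.inl ⟨Sum.inr y, _⟩ => Sum.inr (Sum.inr y)
    | Sum.inr ⟨Sum.inl x, _⟩ => Sum.inl (Sum.inr x)
    | Sum.inr ⟨Sum.inr y, h⟩ => Sum.inr (Sum.inl ⟨y, fun e => h (congrArg Sum.inr e)⟩)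
  invFun
    | Sum.inl (Sum.inl x) => Sum.inl ⟨Sum.inl x.1, fun e => x.2 (Sum.inl.inj e)⟩
    | Sum.inr (Sum.inr y) => Sum.inl ⟨Sum.inr y, Sum.inr_ne_inl⟩
    | Sum.inl (Sum.inr x) => Sum.inr ⟨Sum.inl x, Sum.inl_ne_inr⟩
    | Sum.inr (Sum.inl y) => Sum.inr ⟨Sum.inr y.1, fun e => y.2 (Sum.inr.inj e)⟩
  left_inv := by rintro (⟨_ | _, _⟩ | ⟨_ | _, _⟩) <;> rfl
  right_inv := by rintro ((_ | _) | (_ | _)) <;> rfl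

/-- The typed operations of a `∗`-polycategory: those of a polycategory, a strict involution on
objects, and an action of all bijections of entries, where an object changing sides is dualized. -/
structure StarPolyData extends PolyData.{u, v} where
  dual : Obj → Obj
  dual_dual : ∀ A, dual (dual A) = A
  /-- The extended symmetric action. -/
  sact : ∀ {m n m' n' : Type} [Finite m] [Finite n] [Finite m'] [Finite n'],
    m ⊕ n ≃ m' ⊕ n' → Arr m n → Arr m' n'
  entry_sact : ∀ {m n m' n' : Type} [Finite m] [Finite n] [Finite m'] [Finite n']
    (σ : m ⊕ n ≃ m' ⊕ n') (f : Arr m n) (e : m ⊕ n),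
    Sum.elim (src (sact σ f)) (fun j => dual (tgt (sact σ f) j)) (σ e) =
      Sum.elim (src f) (fun j => dual (tgt f j)) e

/-- The axioms of a `∗`-polycategory. -/
structure StarPolyData.IsStarPoly (P : StarPolyData.{u, v}) : Prop where
  isPoly : P.IsPoly
  /-- The extended action restricts to the symmetric action of the polycategory. -/
  sact_sumCongr : ∀ {m n m' n' : Type} [Finite m] [Finite n] [Finite m'] [Finite n'] (ρ : m ≃ m')
    (τ : n ≃ n') (f : P.Arr m n), P.sact (ρ.sumCongr τ) f = P.perm ρ τ f
  sact_sact : ∀ {m n m' n' m'' n'' : Type} [Finite m] [Finite n] [Finite m'] [Finite n']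
    [Finite m''] [Finite n''] (σ : m ⊕ n ≃ m' ⊕ n') (τ : m' ⊕ n' ≃ m'' ⊕ n'') (f : P.Arr m n),
    P.sact τ (P.sact σ f) = P.sact (σ.trans τ) f
  /-- `g ^ ρ ∘ f ^ σ = (g ∘ f) ^ τ`, where `σ`, `ρ` keep the object along which one composes on its
  side. -/
  equivariance : ∀ {m n p q m' n' p' q' : Type} [Finite m] [Finite n] [Finite p] [Finite q]
    [Finite m'] [Finite n'] [Finite p'] [Finite q'] (ρ : p ⊕ q ≃ p' ⊕ q') (σ : m ⊕ n ≃ m' ⊕ n')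
    (g : P.Arr p q) (k : p) (k' : p') (hk : ρ (Sum.inl k) = Sum.inl k') (f : P.Arr m n) (j : n)
    (j' : n') (hj : σ (Sum.inr j) = Sum.inr j') (h : P.src g k = P.tgt f j)
    (h' : P.src (P.sact ρ g) k' = P.tgt (P.sact σ f) j'),
    P.comp (P.sact ρ g) k' (P.sact σ f) j' h' =
      P.sact ((glue k j).symm.trans (((neEquiv ρ hk).sumCongr (neEquiv σ hj)).trans (glue k' j')))
        (P.comp g k f j h)
  /-- `f ^ σ ∘ g ^ ρ = (g ∘ f) ^ τ`, where the object `A` along which one composes `g ∘ f` is moved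
  to the other side by both `σ` and `ρ`, so that the left side is a composite along the dual of
  `A`. -/
  equivariance_dual : ∀ {m n p q m' n' p' q' : Type} [Finite m] [Finite n] [Finite p] [Finite q]
    [Finite m'] [Finite n'] [Finite p'] [Finite q'] (ρ : p ⊕ q ≃ p' ⊕ q') (σ : m ⊕ n ≃ m' ⊕ n')
    (g : P.Arr p q) (k : p) (k' : q') (hk : ρ (Sum.inl k) = Sum.inr k') (f : P.Arr m n) (j : n)
    (j' : m') (hj : σ (Sum.inr j) = Sum.inl j') (h : P.src g k = P.tgt f j)
    (h' : P.src (P.sact σ f) j' = P.tgt (P.sact ρ g) k'),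
    P.comp (P.sact σ f) j' (P.sact ρ g) k' h' =
      P.sact ((glue k j).symm.trans
        (((Equiv.sumComm _ _).trans ((neEquiv σ hj).sumCongr (neEquiv ρ hk))).trans (glue j' k')))
        (P.comp g k f j h)

/-- The maps underlying a functor of polycategories. -/
@[ext]
structure PolyMap (P : PolyData.{u, v}) (Q : PolyData.{u₁, v₁}) where
  obj : P.Obj → Q.Obj
  arr : ∀ {m n : Type} [Finite m] [Finite n], P.Arr m n → Q.Arr m n
  src_arr : ∀ {m n : Type} [Finite m] [Finite n] (f : P.Arr m n) (i : m),
    Q.src (arr f) i = obj (P.src f i)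
  tgt_arr : ∀ {m n : Type} [Finite m] [Finite n] (f : P.Arr m n) (j : n),
    Q.tgt (arr f) j = obj (P.tgt f j)

/-- A functor of polycategories preserves all the operations. -/
structure PolyMap.IsFunctor {P : PolyData.{u, v}} {Q : PolyData.{u₁, v₁}} (F : PolyMap P Q) :
    Prop where
  perm : ∀ {m n m' n' : Type} [Finite m] [Finite n] [Finite m'] [Finite n'] (ρ : m ≃ m')
    (τ : n ≃ n') (f : P.Arr m n), F.arr (P.perm ρ τ f) = Q.perm ρ τ (F.arr f)
  one : ∀ A : P.Obj, F.arr (P.one A) = Q.one (F.obj A)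
  comp : ∀ {m n p q : Type} [Finite m] [Finite n] [Finite p] [Finite q] (g : P.Arr p q) (k : p)
    (f : P.Arr m n) (j : n) (h : P.src g k = P.tgt f j)
    (h' : Q.src (F.arr g) k = Q.tgt (F.arr f) j),
    F.arr (P.comp g k f j h) = Q.comp (F.arr g) k (F.arr f) j h'

/-- A functor of `∗`-polycategories. -/
structure IsStarFunctor (P : StarPolyData.{u, v}) (Q : StarPolyData.{u₁, v₁})
    (F : PolyMap P.toPolyData Q.toPolyData) : Prop where
  isFunctor : F.IsFunctor
  dual : ∀ A : P.Obj, F.obj (P.dual A) = Q.dual (F.obj A)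
  sact : ∀ {m n m' n' : Type} [Finite m] [Finite n] [Finite m'] [Finite n']
    (σ : m ⊕ n ≃ m' ⊕ n') (f : P.Arr m n), F.arr (P.sact σ f) = Q.sact σ (F.arr f)

/-! ## Presheaves of polycategories on a multicategory -/

/-- The data of a presheaf of polycategories on a multicategory: a polycategory `fib Γ` for each
finite list `Γ` of objects, acted on by bijections and by the arrows of the multicategory. -/
structure PolyPshData (C : Multicat.{u, v}) where
  fib : ∀ {ι : Type} [Finite ι], (ι → C.Obj) → PolyData.{u₁, v₁}
  act : ∀ {ι κ : Type} [Finite ι] [Finite κ] {Γ : ι → C.Obj} {Δ : κ → C.Obj} (σ : ι ≃ κ),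
    (∀ i, Δ (σ i) = Γ i) → PolyMap (fib Γ) (fib Δ)
  sub : ∀ {ι κ : Type} [Finite ι] [Finite κ] {Γ : ι → C.Obj} (p : ι) (f : C.Arr κ),
    C.tgt f = Γ p → PolyMap (fib Γ) (fib (C.subCtx Γ p f))

namespace PolyPshData

/-- The presheaf of sets of objects. -/
def objs {C : Multicat.{u, v}} (Ω : PolyPshData.{u, v, u₁, v₁} C) : SetPshData.{u, v, u₁} C where
  El Γ := (Ω.fib Γ).Obj
  act σ h := (Ω.act σ h).obj
  sub p f h := (Ω.sub p f h).obj

/-- The presheaf of sets of polyarrows of a given shape. -/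
def arrs {C : Multicat.{u, v}} (Ω : PolyPshData.{u, v, u₁, v₁} C) (m n : Type) [Finite m]
    [Finite n] : SetPshData.{u, v, v₁} C where
  El Γ := (Ω.fib Γ).Arr m n
  act σ h := (Ω.act σ h).arr
  sub p f h := (Ω.sub p f h).arr

/-- The axioms of a presheaf of polycategories.  (Equality of functors means equality on objects and
on polyarrows.) -/
structure IsPolyPsh {C : Multicat.{u, v}} (Ω : PolyPshData.{u, v, u₁, v₁} C) : Prop where
  isPoly : ∀ {ι : Type} [Finite ι] (Γ : ι → C.Obj), (Ω.fib Γ).IsPoly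
  act_isFunctor : ∀ {ι κ : Type} [Finite ι] [Finite κ] {Γ : ι → C.Obj} {Δ : κ → C.Obj}
    (σ : ι ≃ κ) (h : ∀ i, Δ (σ i) = Γ i), (Ω.act σ h).IsFunctor
  sub_isFunctor : ∀ {ι κ : Type} [Finite ι] [Finite κ] {Γ : ι → C.Obj} (p : ι) (f : C.Arr κ)
    (h : C.tgt f = Γ p), (Ω.sub p f h).IsFunctor
  objs_isPsh : Ω.objs.IsPsh
  arrs_isPsh : ∀ (m n : Type) [Finite m] [Finite n], (Ω.arrs m n).IsPsh

end PolyPshData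

/-- The data of a presheaf of `∗`-polycategories on a multicategory. -/
structure StarPshData (C : Multicat.{u, v}) extends PolyPshData.{u, v, u₁, v₁} C where
  dual : ∀ {ι : Type} [Finite ι] {Γ : ι → C.Obj}, (fib Γ).Obj → (fib Γ).Obj
  sact : ∀ {ι : Type} [Finite ι] {Γ : ι → C.Obj} {m n m' n' : Type} [Finite m] [Finite n]
    [Finite m'] [Finite n'], m ⊕ n ≃ m' ⊕ n' → (fib Γ).Arr m n → (fib Γ).Arr m' n'
  dual_dual : ∀ {ι : Type} [Finite ι] {Γ : ι → C.Obj} (x : (fib Γ).Obj), dual (dual x) = x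
  entry_sact : ∀ {ι : Type} [Finite ι] {Γ : ι → C.Obj} {m n m' n' : Type} [Finite m] [Finite n]
    [Finite m'] [Finite n'] (σ : m ⊕ n ≃ m' ⊕ n') (f : (fib Γ).Arr m n) (e : m ⊕ n),
    Sum.elim ((fib Γ).src (sact σ f)) (fun j => dual ((fib Γ).tgt (sact σ f) j)) (σ e) =
      Sum.elim ((fib Γ).src f) (fun j => dual ((fib Γ).tgt f j)) e
  act_dual : ∀ {ι κ : Type} [Finite ι] [Finite κ] {Γ : ι → C.Obj} {Δ : κ → C.Obj} (σ : ι ≃ κ)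
    (h : ∀ i, Δ (σ i) = Γ i) (x : (fib Γ).Obj), (act σ h).obj (dual x) = dual ((act σ h).obj x)
  sub_dual : ∀ {ι κ : Type} [Finite ι] [Finite κ] {Γ : ι → C.Obj} (p : ι) (f : C.Arr κ)
    (h : C.tgt f = Γ p) (x : (fib Γ).Obj), (sub p f h).obj (dual x) = dual ((sub p f h).obj x)

namespace StarPshData

/-- The value of a presheaf of `∗`-polycategories at a list of objects. -/
def starFib {C : Multicat.{u, v}} (Ω : StarPshData.{u, v, u₁, v₁} C) {ι : Type} [Finite ι]
    (Γ : ι → C.Obj) : StarPolyData.{u₁, v₁} where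
  toPolyData := Ω.fib Γ
  dual := Ω.dual
  sact := Ω.sact
  dual_dual := Ω.dual_dual
  entry_sact := Ω.entry_sact

/-- The axioms of a presheaf of `∗`-polycategories. -/
structure IsStarPsh {C : Multicat.{u, v}} (Ω : StarPshData.{u, v, u₁, v₁} C) : Prop where
  isPolyPsh : Ω.IsPolyPsh
  isStarPoly : ∀ {ι : Type} [Finite ι] (Γ : ι → C.Obj), (Ω.starFib Γ).IsStarPoly
  act_isStarFunctor : ∀ {ι κ : Type} [Finite ι] [Finite κ] {Γ : ι → C.Obj} {Δ : κ → C.Obj}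
    (σ : ι ≃ κ) (h : ∀ i, Δ (σ i) = Γ i), IsStarFunctor (Ω.starFib Γ) (Ω.starFib Δ) (Ω.act σ h)
  sub_isStarFunctor : ∀ {ι κ : Type} [Finite ι] [Finite κ] {Γ : ι → C.Obj} (p : ι) (f : C.Arr κ)
    (h : C.tgt f = Γ p),
    IsStarFunctor (Ω.starFib Γ) (Ω.starFib (C.subCtx Γ p f)) (Ω.sub p f h)

end StarPshData

/-! ## The Chu–Dialectica construction -/

section Adj

variable {C : Multicat.{u, v}}

/-- The list `Γ, φ⁻, φ⁺` (indexed by `ι ⊕ Bool`). -/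
def adjCtx {X : Type u} {ι : Type} (Γ : ι → X) (minus plus : X) : ι ⊕ Bool → X :=
  Sum.elim Γ fun s => cond s plus minus

/-- The objects of `Adj(Ω)(Γ)`: triples `(φ⁺, φ⁻, φ̲)` with `φ̲ ∈ Ω(Γ, φ⁻, φ⁺)`. -/
structure AdjObj (Ω : PolyPshData.{u, v, u₁, v₁} C) {ι : Type} [Finite ι] (Γ : ι → C.Obj) where
  plus : C.Obj
  minus : C.Obj
  form : (Ω.fib (adjCtx Γ minus plus)).Obj

theorem eq_not_of_inr_ne {ι : Type} {y s : Bool} (h : (Sum.inr y : ι ⊕ Bool) ≠ Sum.inr s) :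
    y = !s := by
  cases s <;> cases y <;> simp_all

/-- Of the two positions `φ⁻`, `φ⁺` (indexed by `Bool`), the position `s` is replaced by a list
indexed by `{x : E // x ≠ e}`, and the other one is renamed to `e`. -/
noncomputable def pullIndex {E : Type} (s : Bool) (e : E) :
    {y : Bool // y ≠ s} ⊕ {x : E // x ≠ e} ≃ E where
  toFun := Sum.elim (fun _ => e) Subtype.val
  invFun x := open Classical in if h : x = e then Sum.inl ⟨!s, by simp⟩ else Sum.inr ⟨x, h⟩
  left_inv := by
    rintro (⟨y, h⟩ | ⟨x, h⟩)
    · cases s <;> cases y <;> simp_all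
    · simp [h]
  right_inv x := by by_cases h : x = e <;> simp [h]

@[simp] theorem pullIndex_inl {E : Type} (s : Bool) (e : E) (y : {y : Bool // y ≠ s}) :
    pullIndex s e (Sum.inl y) = e := rfl

@[simp] theorem pullIndex_inr {E : Type} (s : Bool) (e : E) (y : {x : E // x ≠ e}) :
    pullIndex s e (Sum.inr y) = y.1 := rfl

theorem slot_inr {ι E : Type} (s : Bool) {e a : E} (he : a ≠ e) :
    plugInr (α := ι) (pullIndex s e) (Sum.inr ⟨a, he⟩) = Sum.inr a := rfl

theorem slot_inl {ι E : Type} (s s' : Bool) (e : E) (h : (Sum.inr s' : ι ⊕ Bool) ≠ Sum.inr s) :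
    plugInr (pullIndex s e) (Sum.inl ⟨Sum.inr s', h⟩) = Sum.inr e := rfl

/-- Let `form ∈ Ω(Γ, φ⁻, φ⁺)`, let `g` be an arrow into `φ⁻` (`s = false`) or `φ⁺` (`s = true`), the
inputs of which are the objects `Φ x` for `x ≠ e`, and let `Φ e` be the other one of `φ⁻`, `φ⁺`. Then
`pull` is the element `g^* form` of `Ω(Γ, Φ)`. -/
noncomputable def pull (Ω : PolyPshData.{u, v, u₁, v₁} C) {ι E : Type} [Finite ι] [Finite E]
    {Γ : ι → C.Obj} (φ : AdjObj Ω Γ) (s : Bool) (Φ : E → C.Obj) (e : E) (g : C.Arr {x // x ≠ e})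
    (hsrc : ∀ x, C.src g x = Φ x.1) (htgt : C.tgt g = cond s φ.plus φ.minus)
    (hΦ : Φ e = cond s φ.minus φ.plus) : (Ω.fib (Sum.elim Γ Φ)).Obj :=
  (Ω.act (plugInr (pullIndex s e)) (by
    rintro (⟨_ | y, h⟩ | x)
    · rfl
    · obtain rfl := eq_not_of_inr_ne h
      simp only [plugInr_inl_inr, pullIndex_inl, Sum.elim_inr, hΦ, Multicat.subCtx, Sum.elim_inl,
        adjCtx]
      cases s <;> rfl
    · simp [Multicat.subCtx, hsrc])).obj
    ((Ω.sub (Sum.inr s) g htgt).obj φ.form)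

/-- The list `φ₁⁺, …, φ_m⁺, ψ₁⁻, …, ψ_n⁻`. -/
def posCtx {Ω : PolyPshData.{u, v, u₁, v₁} C} {ι m n : Type} [Finite ι] {Γ : ι → C.Obj}
    (φ : m → AdjObj Ω Γ) (ψ : n → AdjObj Ω Γ) : m ⊕ n → C.Obj :=
  Sum.elim (fun i => (φ i).plus) (fun j => (ψ j).minus)

/-- The list `φ₁⁻, …, φ_m⁻, ψ₁⁺, …, ψ_n⁺`. -/
def negCtx {Ω : PolyPshData.{u, v, u₁, v₁} C} {ι m n : Type} [Finite ι] {Γ : ι → C.Obj}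
    (φ : m → AdjObj Ω Γ) (ψ : n → AdjObj Ω Γ) : m ⊕ n → C.Obj :=
  Sum.elim (fun i => (φ i).minus) (fun j => (ψ j).plus)

/-- The polyarrows of `Adj(Ω)(Γ)`. The primary components are `prim (inr j) = f_j` and
`prim (inl i) = g_i`: the one at `e` has as its domain the list `φ₁⁺, …, φ_m⁺, ψ₁⁻, …, ψ_n⁻` with the
entry `e` omitted. The secondary component is `sec`. -/
structure AdjArr (Ω : PolyPshData.{u, v, u₁, v₁} C) {ι : Type} [Finite ι] (Γ : ι → C.Obj)
    (m n : Type) [Finite m] [Finite n] where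
  src : m → AdjObj Ω Γ
  tgt : n → AdjObj Ω Γ
  prim : ∀ e : m ⊕ n, C.Arr {x // x ≠ e}
  src_prim : ∀ (e : m ⊕ n) (x : {x // x ≠ e}), C.src (prim e) x = posCtx src tgt x.1
  tgt_prim : ∀ e : m ⊕ n, C.tgt (prim e) = negCtx src tgt e
  sec : (Ω.fib (Sum.elim Γ (posCtx src tgt))).Arr m n
  src_sec : ∀ i, (Ω.fib _).src sec i =
    pull Ω (src i) false (posCtx src tgt) (Sum.inl i) (prim (Sum.inl i)) (src_prim _) (tgt_prim _)
      rfl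
  tgt_sec : ∀ j, (Ω.fib _).tgt sec j =
    pull Ω (tgt j) true (posCtx src tgt) (Sum.inr j) (prim (Sum.inr j)) (src_prim _) (tgt_prim _)
      rfl

variable {Ω : PolyPshData.{u, v, u₁, v₁} C} {ι : Type} [Finite ι] {Γ : ι → C.Obj}

/-- `pull` only depends on the underlying data. -/
theorem pull_congr {E : Type} [Finite E] {φ φ' : AdjObj Ω Γ} (hφ : φ = φ') (s : Bool)
    {Φ Φ' : E → C.Obj} (hΦΦ : Φ = Φ') (e : E) {g g' : C.Arr {x // x ≠ e}} (hg : g = g') (h₁ h₂ h₃ h₁' h₂' h₃') :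
    HEq (pull Ω φ s Φ e g h₁ h₂ h₃) (pull Ω φ' s Φ' e g' h₁' h₂' h₃') := by
  subst hφ hΦΦ hg; rfl


theorem SetPshData.IsPsh.act_act_eq {M : SetPshData.{u, v, w} C} (hM : M.IsPsh)
    {ι κ κ' μ : Type} [Finite ι] [Finite κ] [Finite κ'] [Finite μ] {Γ : ι → C.Obj} {Δ : κ → C.Obj}
    {Δ' : κ' → C.Obj} {Θ : μ → C.Obj} {σ : ι ≃ κ} {τ : κ ≃ μ} {σ' : ι ≃ κ'} {τ' : κ' ≃ μ}
    {h₁ : ∀ i, Δ (σ i) = Γ i} {h₂ : ∀ i, Θ (τ i) = Δ i} {h₁' : ∀ i, Δ' (σ' i) = Γ i}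
    {h₂' : ∀ i, Θ (τ' i) = Δ' i} (h : ∀ i, τ (σ i) = τ' (σ' i)) (x : M.El Γ) :
    M.act τ h₂ (M.act σ h₁ x) = M.act τ' h₂' (M.act σ' h₁' x) := by
  rw [hM.act_act σ τ h₁ h₂ (fun i => (h₂ (σ i)).trans (h₁ i)),
    hM.act_act σ' τ' h₁' h₂' (fun i => (h₂' (σ' i)).trans (h₁' i))]
  have : σ.trans τ = σ'.trans τ' := Equiv.ext h
  congr 1

/-- The element `pull` is compatible with bijections of the entries. -/
theorem act_pull (hΩ : Ω.objs.IsPsh) {E E' : Type} [Finite E] [Finite E'] (σ : E ≃ E')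
    (φ : AdjObj Ω Γ) (s : Bool) (Φ : E → C.Obj) (Φ' : E' → C.Obj) (e : E) (e' : E') (he : σ e = e')
    (g : C.Arr {x // x ≠ e}) (h₀ : ∀ x, Sum.elim Γ Φ' ((Equiv.refl ι).sumCongr σ x) = Sum.elim Γ Φ x)
    (h₁ h₂ h₃ h₁' h₂' h₃') :
    (Ω.act ((Equiv.refl ι).sumCongr σ) h₀).obj (pull Ω φ s Φ e g h₁ h₂ h₃) =
      pull Ω φ s Φ' e' (C.act (neEquiv σ he) g) h₁' h₂' h₃' := by
  have A := hΩ.sub_act (Γ := adjCtx Γ φ.minus φ.plus) (Sum.inr s) g (neEquiv σ he) h₂' h₂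
    (by
      rintro (x | x)
      · rfl
      · simpa [Multicat.subCtx] using C.src_act (neEquiv σ he) g x) φ.form
  refine Eq.trans ?_ (congrArg (Ω.act (plugInr (pullIndex s e')) _).obj A.symm)
  refine hΩ.act_act_eq (M := Ω.objs) ?_ _
  rintro (⟨x | x, hx⟩ | x) <;> simp [he]

/-- Composition of the maps underlying functors of polycategories. -/
@[simps]
def PolyMap.trans {P : PolyData.{u, v}} {Q R : PolyData.{u₁, v₁}} (F : PolyMap P Q)
    (G : PolyMap Q R) : PolyMap P R where
  obj := G.obj ∘ F.obj
  arr f := G.arr (F.arr f)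
  src_arr f i := by rw [G.src_arr, F.src_arr]; rfl
  tgt_arr f i := by rw [G.tgt_arr, F.tgt_arr]; rfl

/-- Let `Z` arise from `E` by replacing `a` by the block `F`. Then `Z` without `z` arises from `E`
without `e` by replacing `a` by `F`, if `z` corresponds to `e ≠ a`. -/
def plugNe {E F Z : Type} {a : E} (w : {x : E // x ≠ a} ⊕ F ≃ Z) {e : E} (he : a ≠ e) {z : Z}
    (hz : w (Sum.inl ⟨e, he.symm⟩) = z) :
    {x : {x : E // x ≠ e} // x ≠ ⟨a, he⟩} ⊕ F ≃ {t : Z // t ≠ z} :=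
  Equiv.trans
    { toFun := fun
        | Sum.inl x => ⟨Sum.inl ⟨x.1.1, fun k => x.2 (Subtype.ext k)⟩,
            fun k => x.1.2 (congrArg Subtype.val (Sum.inl.inj k))⟩
        | Sum.inr f => ⟨Sum.inr f, Sum.inr_ne_inl⟩
      invFun := fun
        | ⟨Sum.inl x, h⟩ => Sum.inl ⟨⟨x.1, fun k => h (congrArg Sum.inl (Subtype.ext k))⟩,
            fun k => x.2 (congrArg Subtype.val k)⟩
        | ⟨Sum.inr f, _⟩ => Sum.inr f
      left_inv := by rintro (_ | _) <;> rfl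
      right_inv := by rintro ⟨_ | _, _⟩ <;> rfl }
    (neEquiv w hz)

@[simp] theorem plugNe_inl {E F Z : Type} {a : E} (w : {x : E // x ≠ a} ⊕ F ≃ Z) {e : E}
    (he : a ≠ e) {z : Z} (hz : w (Sum.inl ⟨e, he.symm⟩) = z) (x) :
    (plugNe w he hz (Sum.inl x)).1 = w (Sum.inl ⟨x.1.1, fun k => x.2 (Subtype.ext k)⟩) := rfl

@[simp] theorem plugNe_inr {E F Z : Type} {a : E} (w : {x : E // x ≠ a} ⊕ F ≃ Z) {e : E}
    (he : a ≠ e) {z : Z} (hz : w (Sum.inl ⟨e, he.symm⟩) = z) (x) :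
    (plugNe w he hz (Sum.inr x)).1 = w (Sum.inr x) := rfl

/-- The composite `g ∘ r` at the entry `a`, where `g` has all the entries of `E` but `e` as its
inputs, regarded as having all the entries of `Z` but `z` as its inputs. -/
def plugArr {E F Z : Type} [Finite E] [Finite F] [Finite Z] {a : E} (w : {x : E // x ≠ a} ⊕ F ≃ Z)
    {e : E} (he : a ≠ e) (z : Z) (hz : w (Sum.inl ⟨e, he.symm⟩) = z) (g : C.Arr {x // x ≠ e})
    (r : C.Arr F) (h : C.src g ⟨a, he⟩ = C.tgt r) : C.Arr {t // t ≠ z} :=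
  C.act (plugNe w he hz) (C.comp g ⟨a, he⟩ r h)

theorem src_plugArr {E F Z : Type} [Finite E] [Finite F] [Finite Z] {a : E}
    {w : {x : E // x ≠ a} ⊕ F ≃ Z} {e : E} {he : a ≠ e} {z : Z}
    {hz : w (Sum.inl ⟨e, he.symm⟩) = z} {g : C.Arr {x // x ≠ e}} {r : C.Arr F}
    {h : C.src g ⟨a, he⟩ = C.tgt r} {Φ : E → C.Obj} {Ψ : Z → C.Obj}
    (hg : ∀ x, C.src g x = Φ x.1) (hl : ∀ x, Ψ (w (Sum.inl x)) = Φ x.1)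
    (hr : ∀ x, Ψ (w (Sum.inr x)) = C.src r x) (t : {t // t ≠ z}) :
    C.src (plugArr w he z hz g r h) t = Ψ t.1 := by
  obtain ⟨t, rfl⟩ := (plugNe w he hz).surjective t
  unfold plugArr
  rw [C.src_act]
  rcases t with t | t
  · rw [C.src_comp_inl, hg, plugNe_inl, hl]
  · rw [C.src_comp_inr, plugNe_inr, hr]

theorem tgt_plugArr {E F Z : Type} [Finite E] [Finite F] [Finite Z] {a : E}
    {w : {x : E // x ≠ a} ⊕ F ≃ Z} {e : E} {he : a ≠ e} {z : Z}
    {hz : w (Sum.inl ⟨e, he.symm⟩) = z} {g : C.Arr {x // x ≠ e}} {r : C.Arr F}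
    {h : C.src g ⟨a, he⟩ = C.tgt r} : C.tgt (plugArr w he z hz g r h) = C.tgt g := by
  unfold plugArr
  rw [C.tgt_act, C.tgt_comp]

/-- The action `r^* : Ω(Γ, Φ) ⟶ Ω(Γ, Ψ)` of an arrow `r` into the entry `Φ a`. -/
def plugMap (Ω : PolyPshData.{u, v, u₁, v₁} C) {ι : Type} [Finite ι] (Γ : ι → C.Obj) {E F Z : Type}
    [Finite E] [Finite F] [Finite Z] {a : E} (w : {x : E // x ≠ a} ⊕ F ≃ Z) (r : C.Arr F)
    (Φ : E → C.Obj) (Ψ : Z → C.Obj) (h : C.tgt r = Φ a) (hl : ∀ x, Ψ (w (Sum.inl x)) = Φ x.1)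
    (hr : ∀ x, Ψ (w (Sum.inr x)) = C.src r x) :
    PolyMap (Ω.fib (Sum.elim Γ Φ)) (Ω.fib (Sum.elim Γ Ψ)) :=
  (Ω.sub (Γ := Sum.elim Γ Φ) (Sum.inr a) r h).trans (Ω.act (plugInr w) (by
    rintro (⟨_ | x, hx⟩ | x) <;> simp [Multicat.subCtx, hl, hr]))

theorem SetPshData.IsPsh.act_act_act_eq {M : SetPshData.{u, v, w} C} (hM : M.IsPsh)
    {ι κ κ' μ' μ : Type} [Finite ι] [Finite κ] [Finite κ'] [Finite μ] [Finite μ'] {Γ : ι → C.Obj}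
    {Δ : κ → C.Obj} {Δ' : κ' → C.Obj} {Θ' : μ' → C.Obj} {Θ : μ → C.Obj} {σ : ι ≃ κ} {τ : κ ≃ μ}
    {σ' : ι ≃ κ'} {τ' : κ' ≃ μ'} {υ : μ' ≃ μ}
    {h₁ : ∀ i, Δ (σ i) = Γ i} {h₂ : ∀ i, Θ (τ i) = Δ i} {h₁' : ∀ i, Δ' (σ' i) = Γ i}
    {h₂' : ∀ i, Θ' (τ' i) = Δ' i} {h₃ : ∀ i, Θ (υ i) = Θ' i}
    (h : ∀ i, τ (σ i) = υ (τ' (σ' i))) (x : M.El Γ) :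
    M.act τ h₂ (M.act σ h₁ x) = M.act υ h₃ (M.act τ' h₂' (M.act σ' h₁' x)) := by
  rw [hM.act_act σ' τ' h₁' h₂' (fun i => (h₂' (σ' i)).trans (h₁' i))]
  exact hM.act_act_eq h x

theorem plugMap_pull (hΩ : Ω.objs.IsPsh) {E F Z : Type}
    [Finite E] [Finite F] [Finite Z] {a : E} (w : {x : E // x ≠ a} ⊕ F ≃ Z) (r : C.Arr F)
    (Φ : E → C.Obj) (Ψ : Z → C.Obj) (h : C.tgt r = Φ a) (hl : ∀ x, Ψ (w (Sum.inl x)) = Φ x.1)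
    (hr : ∀ x, Ψ (w (Sum.inr x)) = C.src r x) {e : E} (he : a ≠ e) (z : Z)
    (hz : w (Sum.inl ⟨e, he.symm⟩) = z) (φ : AdjObj Ω Γ) (s : Bool) (g : C.Arr {x // x ≠ e})
    (hgr : C.src g ⟨a, he⟩ = C.tgt r) (h₁ h₂ h₃ h₁' h₂' h₃') :
    (plugMap Ω Γ w r Φ Ψ h hl hr).obj (pull Ω φ s Φ e g h₁ h₂ h₃) =
      pull Ω φ s Ψ z (plugArr w he z hz g r hgr) h₁' h₂' h₃' := by
  have h₂'' : C.tgt (C.comp g ⟨a, he⟩ r hgr) = cond s φ.plus φ.minus := by rw [C.tgt_comp, h₂]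
  have A := hΩ.sub_act (Γ := adjCtx Γ φ.minus φ.plus) (Sum.inr s) (C.comp g ⟨a, he⟩ r hgr)
    (plugNe w he hz) h₂' h₂'' (by
      rintro (x | x)
      · rfl
      · simpa [Multicat.subCtx] using C.src_act (plugNe w he hz) _ x) φ.form
  have B := hΩ.sub_comp (Γ := adjCtx Γ φ.minus φ.plus) (Sum.inr s) g ⟨a, he⟩ r hgr h₂'' h₂
    (by simpa [Multicat.subCtx] using hgr.symm) (by
      rintro (⟨x | x, hx⟩ | x)
      · rfl
      · simp [Multicat.subCtx, C.src_comp_inl]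
      · simp [Multicat.subCtx, C.src_comp_inr]) φ.form
  have D := hΩ.act_sub (Γ := C.subCtx (adjCtx Γ φ.minus φ.plus) (Sum.inr s) g)
    (Δ := Sum.elim Γ Φ) (plugInr (pullIndex s e)) (Sum.inr ⟨a, he⟩) (Sum.inr a) (slot_inr s he) r
    (by
      rintro (⟨_ | y, h⟩ | x)
      · rfl
      · obtain rfl := eq_not_of_inr_ne h
        simp only [plugInr_inl_inr, pullIndex_inl, Sum.elim_inr, h₃, Multicat.subCtx, Sum.elim_inl,
          adjCtx]
        cases s <;> rfl
      · simp [Multicat.subCtx, h₁]) h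
    (by simpa [Multicat.subCtx] using hgr.symm) (by
      rintro (⟨⟨_ | y, h⟩ | x, hx⟩ | x)
      · rfl
      · obtain rfl := eq_not_of_inr_ne h
        simp [h₃, Multicat.subCtx, adjCtx]
      · simp [Multicat.subCtx, h₁]
      · simp [Multicat.subCtx]) (show Ω.objs.El _ from (Ω.sub (Sum.inr s) g h₂).obj φ.form)
  refine (congrArg (Ω.act (plugInr w) _).obj D).trans ?_
  refine Eq.trans ?_ (congrArg (Ω.act (plugInr (pullIndex s z)) _).obj (A.trans
    (congrArg (Ω.objs.act _ _) B)).symm)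
  refine hΩ.act_act_act_eq (M := Ω.objs) ?_ _
  rintro (⟨⟨x | x, hx'⟩ | x, hx⟩ | x) <;> simp [hz]

theorem plugMap_pull_self (hΩ : Ω.objs.IsPsh) {E F Z : Type} [Finite E] [Finite F] [Finite Z]
    {a : E} (w : {x : E // x ≠ a} ⊕ F ≃ Z) (r : C.Arr F) (Φ : E → C.Obj) (Ψ : Z → C.Obj)
    (h : C.tgt r = Φ a) (hl : ∀ x, Ψ (w (Sum.inl x)) = Φ x.1)
    (hr : ∀ x, Ψ (w (Sum.inr x)) = C.src r x) (φ : AdjObj Ω Γ) (s s' : Bool)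
    (g : C.Arr {x : E // x ≠ a}) (h₁ h₂ h₃) (hns : (Sum.inr s' : ι ⊕ Bool) ≠ Sum.inr s)
    (h₄ : C.tgt r = C.subCtx (adjCtx Γ φ.minus φ.plus) (Sum.inr s) g (Sum.inl ⟨Sum.inr s', hns⟩))
    (h₅ : ∀ i, Sum.elim Γ Ψ
      (plugInr w ((neEquiv (plugInr (pullIndex s a)) (slot_inl s s' a hns)).sumCongr (Equiv.refl _) i)) =
        C.subCtx (C.subCtx (adjCtx Γ φ.minus φ.plus) (Sum.inr s) g)
          (Sum.inl ⟨Sum.inr s', hns⟩) r i) :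
    (plugMap Ω Γ w r Φ Ψ h hl hr).obj (pull Ω φ s Φ a g h₁ h₂ h₃) =
      (Ω.act (((neEquiv (plugInr (pullIndex s a)) (slot_inl s s' a hns)).sumCongr (Equiv.refl _)).trans
        (plugInr w)) h₅).obj ((Ω.sub (Sum.inl ⟨Sum.inr s', hns⟩) r h₄).obj
          ((Ω.sub (Γ := adjCtx Γ φ.minus φ.plus) (Sum.inr s) g h₂).obj φ.form)) := by
  have h₆ : ∀ i, C.subCtx (Sum.elim Γ Φ) (Sum.inr a) r
      ((neEquiv (plugInr (pullIndex s a)) (slot_inl s s' a hns)).sumCongr (Equiv.refl _) i) =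
        C.subCtx (C.subCtx (adjCtx Γ φ.minus φ.plus) (Sum.inr s) g)
          (Sum.inl ⟨Sum.inr s', hns⟩) r i := by
    rintro (⟨⟨_ | y, h⟩ | x, hx⟩ | x)
    · rfl
    · obtain rfl := eq_not_of_inr_ne h
      obtain rfl := eq_not_of_inr_ne hns
      exact (hx rfl).elim
    · simp [Multicat.subCtx, h₁]
    · simp [Multicat.subCtx]
  have D := hΩ.act_sub (Γ := C.subCtx (adjCtx Γ φ.minus φ.plus) (Sum.inr s) g)
    (Δ := Sum.elim Γ Φ) (plugInr (pullIndex s a)) (Sum.inl ⟨Sum.inr s', hns⟩) (Sum.inr a)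
    (slot_inl s s' a hns) r (by
      rintro (⟨_ | y, h⟩ | x)
      · rfl
      · obtain rfl := eq_not_of_inr_ne h
        simp only [plugInr_inl_inr, pullIndex_inl, Sum.elim_inr, h₃, Multicat.subCtx,
          Sum.elim_inl, adjCtx]
        cases s <;> rfl
      · simp [Multicat.subCtx, h₁]) h h₄ h₆
    (show Ω.objs.El _ from (Ω.sub (Sum.inr s) g h₂).obj φ.form)
  exact (congrArg (Ω.act (plugInr w) _).obj D).trans (hΩ.act_act _ _ _ _ h₅ _)

theorem plugMap_pull_cross (hΩ : Ω.objs.IsPsh) {E F Z : Type} [Finite E] [Finite F] [Finite Z]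
    {a : E} {b : F} (w : {x : E // x ≠ a} ⊕ {y : F // y ≠ b} ≃ Z)
    (w' : {y : F // y ≠ b} ⊕ {x : E // x ≠ a} ≃ Z) (hw : ∀ x, w' x.swap = w x)
    (g : C.Arr {x : E // x ≠ a}) (r : C.Arr {y : F // y ≠ b}) (Φ : E → C.Obj) (Φ' : F → C.Obj)
    (Ψ : Z → C.Obj) (h h' hl hr hl' hr') (φ : AdjObj Ω Γ) (s s' : Bool) (hs : s ≠ s')
    (h₁ h₂ h₃ h₁' h₂' h₃') :
    (plugMap Ω Γ w r Φ Ψ h hl hr).obj (pull Ω φ s Φ a g h₁ h₂ h₃) =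
      (plugMap Ω Γ w' g Φ' Ψ h' hl' hr').obj (pull Ω φ s' Φ' b r h₁' h₂' h₃') := by
  have hns : (Sum.inr s : ι ⊕ Bool) ≠ Sum.inr s' := fun k => hs (Sum.inr.inj k)
  have hs' : s' = !s := eq_not_of_inr_ne hns.symm
  have k₁ : C.tgt r = C.subCtx (adjCtx Γ φ.minus φ.plus) (Sum.inr s) g
      (Sum.inl ⟨Sum.inr s', hns.symm⟩) := by simpa [Multicat.subCtx, adjCtx] using h₂'
  have k₂ : C.tgt g = C.subCtx (adjCtx Γ φ.minus φ.plus) (Sum.inr s') r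
      (Sum.inl ⟨Sum.inr s, hns⟩) := by simpa [Multicat.subCtx, adjCtx] using h₂
  refine (plugMap_pull_self hΩ w r Φ Ψ h hl hr φ s s' g h₁ h₂ h₃ hns.symm k₁ ?_).trans ?_
  · rintro (⟨⟨_ | y, h⟩ | x, hx⟩ | x)
    · rfl
    · obtain rfl := eq_not_of_inr_ne h
      exact (hx (by subst hs'; rfl)).elim
    · simp [Multicat.subCtx, h₁, hl]
    · simp [Multicat.subCtx, hr]
  refine Eq.trans ?_ (plugMap_pull_self hΩ w' g Φ' Ψ h' hl' hr' φ s' s r h₁' h₂' h₃' hns k₂ ?_).symm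
  swap
  · rintro (⟨⟨_ | y, h⟩ | x, hx⟩ | x)
    · rfl
    · obtain rfl := eq_not_of_inr_ne h
      exact (hx (by subst hs'; simp)).elim
    · simp [Multicat.subCtx, h₁', hl']
    · simp [Multicat.subCtx, hr']
  have A := hΩ.sub_comm (Γ := adjCtx Γ φ.minus φ.plus) (Sum.inr s) (Sum.inr s') hns g r h₂ k₁ h₂' k₂
    (by rintro (⟨⟨_ | y, h⟩ | x, hx⟩ | x) <;> rfl) φ.form
  refine (congrArg (Ω.objs.act _ _) A).trans ((hΩ.act_act _ _ _ _ ?_ _).trans ?_)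
  · rintro (⟨⟨_ | y, h⟩ | x, hx⟩ | x)
    · rfl
    · obtain rfl := eq_not_of_inr_ne h
      exact (hx (by subst hs'; simp)).elim
    · simp [swapSlots, Multicat.subCtx, hr, h₁']
    · simp [swapSlots, Multicat.subCtx, h₁, hl]
  refine congrFun ?_ _
  congr 1
  ext (⟨⟨_ | y, h⟩ | x, hx⟩ | x)
  · rfl
  · obtain rfl := eq_not_of_inr_ne h
    exact (hx (by subst hs'; simp)).elim
  · exact congrArg Sum.inr (hw (Sum.inr x)).symm
  · exact congrArg Sum.inr (hw (Sum.inl x)).symm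

/-- The action of bijections on the polyarrows of `Adj(Ω)(Γ)`. -/
def adjPerm (hΩ : Ω.objs.IsPsh) {m n m' n' : Type} [Finite m] [Finite n] [Finite m'] [Finite n']
    (ρ : m ≃ m') (τ : n ≃ n') (f : AdjArr Ω Γ m n) : AdjArr Ω Γ m' n' :=
  have hpos : ∀ e, posCtx (f.src ∘ ρ.symm) (f.tgt ∘ τ.symm) ((ρ.sumCongr τ) e) =
      posCtx f.src f.tgt e := by rintro (e | e) <;> simp [posCtx]
  have hneg : ∀ e, negCtx (f.src ∘ ρ.symm) (f.tgt ∘ τ.symm) ((ρ.sumCongr τ) e) =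
      negCtx f.src f.tgt e := by rintro (e | e) <;> simp [negCtx]
  have hctx : ∀ x, Sum.elim Γ (posCtx (f.src ∘ ρ.symm) (f.tgt ∘ τ.symm))
      ((Equiv.refl ι).sumCongr (ρ.sumCongr τ) x) = Sum.elim Γ (posCtx f.src f.tgt) x := by
    rintro (x | x)
    · rfl
    · exact hpos x
  have hsrc : ∀ (e : m' ⊕ n') (x : {x // x ≠ e}),
      C.src (C.act (neEquiv (ρ.sumCongr τ) ((ρ.sumCongr τ).apply_symm_apply e))
        (f.prim ((ρ.sumCongr τ).symm e))) x =
          posCtx (f.src ∘ ρ.symm) (f.tgt ∘ τ.symm) x.1 := by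
    intro e x
    obtain ⟨x, rfl⟩ := (neEquiv (ρ.sumCongr τ)
      ((ρ.sumCongr τ).apply_symm_apply e)).surjective x
    rw [C.src_act, f.src_prim]
    exact (hpos _).symm
  have htgt : ∀ e, C.tgt (C.act (neEquiv (ρ.sumCongr τ) ((ρ.sumCongr τ).apply_symm_apply e))
        (f.prim ((ρ.sumCongr τ).symm e))) = negCtx (f.src ∘ ρ.symm) (f.tgt ∘ τ.symm) e := by
    intro e
    rw [C.tgt_act, f.tgt_prim, ← hneg, Equiv.apply_symm_apply]
  { src := f.src ∘ ρ.symm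
    tgt := f.tgt ∘ τ.symm
    prim := fun e => C.act (neEquiv (ρ.sumCongr τ) ((ρ.sumCongr τ).apply_symm_apply e))
      (f.prim ((ρ.sumCongr τ).symm e))
    src_prim := hsrc
    tgt_prim := htgt
    sec := (Ω.fib _).perm ρ τ ((Ω.act ((Equiv.refl ι).sumCongr (ρ.sumCongr τ)) hctx).arr f.sec)
    src_sec := fun i => by
      have e₁ := (Ω.fib _).src_perm ρ τ ((Ω.act _ hctx).arr f.sec) (ρ.symm i)
      rw [Equiv.apply_symm_apply] at e₁
      refine e₁.trans (((Ω.act _ hctx).src_arr _ _).trans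
        ((congrArg _ (f.src_sec (ρ.symm i))).trans ?_))
      exact act_pull hΩ (ρ.sumCongr τ) _ false _ _ (Sum.inl (ρ.symm i)) (Sum.inl i)
        ((ρ.sumCongr τ).apply_symm_apply (Sum.inl i)) _ hctx _ _ _ (hsrc (Sum.inl i)) _ _
    tgt_sec := fun j => by
      have e₁ := (Ω.fib _).tgt_perm ρ τ ((Ω.act _ hctx).arr f.sec) (τ.symm j)
      rw [Equiv.apply_symm_apply] at e₁
      refine e₁.trans (((Ω.act _ hctx).tgt_arr _ _).trans
        ((congrArg _ (f.tgt_sec (τ.symm j))).trans ?_))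
      exact act_pull hΩ (ρ.sumCongr τ) _ true _ _ (Sum.inr (τ.symm j)) (Sum.inr j)
        ((ρ.sumCongr τ).apply_symm_apply (Sum.inr j)) _ hctx _ _ _ (hsrc (Sum.inr j)) _ _ }

theorem pull_one (hΩ : Ω.objs.IsPsh) (φ : AdjObj Ω Γ) {E : Type} [Finite E] (s : Bool)
    (Φ : E → C.Obj) (e : E) (ε : Unit ≃ {x // x ≠ e}) (β : Bool ≃ E) (hβ : β (!s) = e)
    (hβ' : β s = (ε ()).1) (h : ∀ x, Sum.elim Γ Φ ((Equiv.refl ι).sumCongr β x) =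
      adjCtx Γ φ.minus φ.plus x) (A : C.Obj) (hA : A = cond s φ.plus φ.minus) (h₁ h₂ h₃) :
    pull Ω φ s Φ e (C.act ε (C.one A)) h₁ h₂ h₃ =
      (Ω.act (Γ := adjCtx Γ φ.minus φ.plus) ((Equiv.refl ι).sumCongr β) h).obj φ.form := by
  have hA' : C.tgt (C.one A) = adjCtx Γ φ.minus φ.plus (Sum.inr s) := (C.tgt_one A).trans hA
  have B := hΩ.sub_one (Γ := adjCtx Γ φ.minus φ.plus) (Sum.inr s) A hA' (by
    intro x
    obtain ⟨x, rfl⟩ := (plugUnit (Sum.inr s)).surjective x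
    rw [Equiv.symm_apply_apply]
    rcases x with x | x
    · rfl
    · simp [Multicat.subCtx, C.src_one, hA, adjCtx]) φ.form
  have D := hΩ.sub_act (Γ := adjCtx Γ φ.minus φ.plus) (Sum.inr s) (C.one A) ε h₂ hA' (by
      rintro (x | x)
      · rfl
      · simpa [Multicat.subCtx] using C.src_act ε _ x) φ.form
  refine (congrArg (Ω.act (plugInr (pullIndex s e)) _).obj (D.trans
    (congrArg (Ω.objs.act _ _) B))).trans ?_
  refine Eq.trans ?_ (hΩ.act_refl (fun _ => rfl) _)
  refine (hΩ.act_act_act_eq (M := Ω.objs) (h₁ := h) (h₂ := fun _ => rfl) ?_ _).symm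
  intro x
  obtain ⟨x, rfl⟩ := (plugUnit (Sum.inr s)).surjective x
  rw [Equiv.symm_apply_apply]
  rcases x with ⟨x | x, hx⟩ | x
  · rfl
  · obtain rfl := eq_not_of_inr_ne hx
    simp [hβ]
  · simp [hβ']

/-- The identities of `Adj(Ω)(Γ)`. -/
def adjOne (hΩ : Ω.objs.IsPsh) (φ : AdjObj Ω Γ) : AdjArr Ω Γ Unit Unit where
  src _ := φ
  tgt _ := φ
  prim
    | Sum.inl _ => C.act ⟨fun _ => ⟨Sum.inr (), Sum.inr_ne_inl⟩, fun _ => (), fun _ => rfl, by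
        rintro ⟨_ | _, h⟩; exacts [(h rfl).elim, rfl]⟩ (C.one φ.minus)
    | Sum.inr _ => C.act ⟨fun _ => ⟨Sum.inl (), Sum.inl_ne_inr⟩, fun _ => (), fun _ => rfl, by
        rintro ⟨_ | _, h⟩; exacts [rfl, (h rfl).elim]⟩ (C.one φ.plus)
  src_prim := by
    rintro (e | e) ⟨x | x, h⟩
    · exact (h rfl).elim
    · exact (C.src_act _ _ ()).trans (C.src_one _ _)
    · exact (C.src_act _ _ ()).trans (C.src_one _ _)
    · exact (h rfl).elim
  tgt_prim := by
    rintro (e | e)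
    · exact (C.tgt_act _ _).trans (C.tgt_one _)
    · exact (C.tgt_act _ _).trans (C.tgt_one _)
  sec := (Ω.fib _).one ((Ω.act (Γ := adjCtx Γ φ.minus φ.plus) ((Equiv.refl ι).sumCongr
    ⟨fun s => cond s (Sum.inl ()) (Sum.inr ()), Sum.elim (fun _ => true) (fun _ => false),
      by rintro (_ | _) <;> rfl, by rintro (_ | _) <;> rfl⟩)
    (by rintro (_ | _ | _) <;> rfl)).obj φ.form)
  src_sec i := ((Ω.fib _).src_one _ _).trans
    (pull_one hΩ φ false _ _ _ _ rfl rfl _ _ rfl _ _ _).symm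
  tgt_sec i := ((Ω.fib _).tgt_one _ _).trans
    (pull_one hΩ φ true _ _ _ _ rfl rfl _ _ rfl _ _ _).symm

/-- The composition of `Adj(Ω)(Γ)`. -/
def adjComp (hΩ : Ω.objs.IsPsh) {m n p q : Type} [Finite m] [Finite n] [Finite p] [Finite q]
    (g : AdjArr Ω Γ p q) (k : p) (f : AdjArr Ω Γ m n) (j : n) (h : g.src k = f.tgt j) :
    AdjArr Ω Γ ({x // x ≠ k} ⊕ m) ({y // y ≠ j} ⊕ q) :=
  have hk : C.tgt (g.prim (Sum.inl k)) = posCtx f.src f.tgt (Sum.inr j) :=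
    (g.tgt_prim _).trans (congrArg AdjObj.minus h)
  have hj : C.tgt (f.prim (Sum.inr j)) = posCtx g.src g.tgt (Sum.inl k) :=
    (f.tgt_prim _).trans (congrArg AdjObj.plus h.symm)
  let src : {x // x ≠ k} ⊕ m → AdjObj Ω Γ := Sum.elim (fun x => g.src x.1) f.src
  let tgt : {y // y ≠ j} ⊕ q → AdjObj Ω Γ := Sum.elim (fun y => f.tgt y.1) g.tgt
  let w := glue (m := m) (q := q) k j
  let w' := (Equiv.sumComm _ _).trans w
  have hg : ∀ (e) (he : Sum.inl k ≠ e), C.src (g.prim e) ⟨Sum.inl k, he⟩ = C.tgt (f.prim (Sum.inr j)) :=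
    fun e he => (g.src_prim _ _).trans hj.symm
  have hf : ∀ (e) (he : Sum.inr j ≠ e), C.src (f.prim e) ⟨Sum.inr j, he⟩ = C.tgt (g.prim (Sum.inl k)) :=
    fun e he => (f.src_prim _ _).trans hk.symm
  let prim : ∀ e : ({x // x ≠ k} ⊕ m) ⊕ ({y // y ≠ j} ⊕ q), C.Arr {x // x ≠ e} := fun
    | Sum.inl (Sum.inl x) => plugArr w (e := Sum.inl x.1) (fun e => x.2 (Sum.inl.inj e).symm) _ rfl
        (g.prim (Sum.inl x.1)) (f.prim (Sum.inr j)) (hg _ _)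
    | Sum.inl (Sum.inr i) => plugArr w' (e := Sum.inl i) Sum.inr_ne_inl _ rfl
        (f.prim (Sum.inl i)) (g.prim (Sum.inl k)) (hf _ _)
    | Sum.inr (Sum.inl y) => plugArr w' (e := Sum.inr y.1) (fun e => y.2 (Sum.inr.inj e).symm) _ rfl
        (f.prim (Sum.inr y.1)) (g.prim (Sum.inl k)) (hf _ _)
    | Sum.inr (Sum.inr l) => plugArr w (e := Sum.inr l) Sum.inl_ne_inr _ rfl
        (g.prim (Sum.inr l)) (f.prim (Sum.inr j)) (hg _ _)
  have hgl : ∀ x, posCtx src tgt (w (Sum.inl x)) = posCtx g.src g.tgt x.1 := by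
    rintro ⟨_ | _, _⟩ <;> rfl
  have hfl : ∀ x, posCtx src tgt (w' (Sum.inl x)) = posCtx f.src f.tgt x.1 := by
    rintro ⟨_ | _, _⟩ <;> rfl
  have hgr : ∀ x, posCtx src tgt (w (Sum.inr x)) = C.src (f.prim (Sum.inr j)) x := fun x =>
    (hfl x).trans (f.src_prim _ _).symm
  have hfr : ∀ x, posCtx src tgt (w' (Sum.inr x)) = C.src (g.prim (Sum.inl k)) x := fun x =>
    (hgl x).trans (g.src_prim _ _).symm
  have hsrc : ∀ e x, C.src (prim e) x = posCtx src tgt x.1 := by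
    rintro ((e | e) | (e | e)) x
    · exact src_plugArr (g.src_prim _) hgl hgr x
    · exact src_plugArr (f.src_prim _) hfl hfr x
    · exact src_plugArr (f.src_prim _) hfl hfr x
    · exact src_plugArr (g.src_prim _) hgl hgr x
  have htgt : ∀ e, C.tgt (prim e) = negCtx src tgt e := by
    rintro ((e | e) | (e | e))
    · exact tgt_plugArr.trans (g.tgt_prim _)
    · exact tgt_plugArr.trans (f.tgt_prim _)
    · exact tgt_plugArr.trans (f.tgt_prim _)
    · exact tgt_plugArr.trans (g.tgt_prim _)
  let G := plugMap Ω Γ w (f.prim (Sum.inr j)) (posCtx g.src g.tgt) (posCtx src tgt) hj hgl hgr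
  let F := plugMap Ω Γ w' (g.prim (Sum.inl k)) (posCtx f.src f.tgt) (posCtx src tgt) hk hfl hfr
  have hGF : (Ω.fib _).src (G.arr g.sec) k = (Ω.fib _).tgt (F.arr f.sec) j := by
    rw [G.src_arr, F.tgt_arr, g.src_sec, f.tgt_sec]
    have e₁ := plugMap_pull_cross hΩ w w' (by rintro (_ | _) <;> rfl) (g.prim (Sum.inl k))
      (f.prim (Sum.inr j)) (posCtx g.src g.tgt) (posCtx f.src f.tgt) (posCtx src tgt) hj hk hgl hgr
      hfl hfr (g.src k) false true (by simp) (g.src_prim _) (g.tgt_prim _) rfl (f.src_prim _)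
      ((f.tgt_prim _).trans (congrArg AdjObj.plus h.symm)) (congrArg AdjObj.minus h.symm)
    refine e₁.trans (congrArg F.obj (eq_of_heq ?_))
    exact pull_congr h true rfl (Sum.inr j) rfl _ _ _ _ _ _
  { src := src
    tgt := tgt
    prim := prim
    src_prim := hsrc
    tgt_prim := htgt
    sec := (Ω.fib _).comp (G.arr g.sec) k (F.arr f.sec) j hGF
    src_sec := by
      rintro (x | i)
      · refine ((Ω.fib _).src_comp _ _ _ _ _ _).trans ((G.src_arr _ _).trans
          ((congrArg G.obj (g.src_sec _)).trans ?_))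
        exact plugMap_pull hΩ w _ _ _ hj hgl hgr (fun e => x.2 (Sum.inl.inj e).symm) _ rfl _ _ _ (hg _ _) _ _ _
          _ _ _
      · refine ((Ω.fib _).src_comp _ _ _ _ _ _).trans ((F.src_arr _ _).trans
          ((congrArg F.obj (f.src_sec _)).trans ?_))
        exact plugMap_pull hΩ w' _ _ _ hk hfl hfr Sum.inr_ne_inl _ rfl _ _ _ (hf _ _) _ _ _
          _ _ _
    tgt_sec := by
      rintro (y | l)
      · refine ((Ω.fib _).tgt_comp _ _ _ _ _ _).trans ((F.tgt_arr _ _).trans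
          ((congrArg F.obj (f.tgt_sec _)).trans ?_))
        exact plugMap_pull hΩ w' _ _ _ hk hfl hfr (fun e => y.2 (Sum.inr.inj e).symm) _ rfl _ _ _ (hf _ _) _ _ _
          _ _ _
      · refine ((Ω.fib _).tgt_comp _ _ _ _ _ _).trans ((G.tgt_arr _ _).trans
          ((congrArg G.obj (g.tgt_sec _)).trans ?_))
        exact plugMap_pull hΩ w _ _ _ hj hgl hgr Sum.inl_ne_inr _ rfl _ _ _ (hg _ _) _ _ _
          _ _ _ }

/-- The polycategory `Adj(Ω)(Γ)`. -/
def adjFib (hΩ : Ω.objs.IsPsh) (Γ : ι → C.Obj) :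
    PolyData.{max u u₁, max u v u₁ v₁} where
  Obj := AdjObj Ω Γ
  Arr m n _ _ := AdjArr Ω Γ m n
  src f := f.src
  tgt f := f.tgt
  perm := adjPerm hΩ
  one := adjOne hΩ
  comp := adjComp hΩ
  src_perm ρ _ f i := congrArg f.src (ρ.symm_apply_apply i)
  tgt_perm _ τ f j := congrArg f.tgt (τ.symm_apply_apply j)
  src_one _ _ := rfl
  tgt_one _ _ := rfl
  src_comp _ _ _ _ _ _ := rfl
  tgt_comp _ _ _ _ _ _ := rfl

/-- The action of a bijection `Γ ≅ Δ` on the objects of `Adj(Ω)`. -/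
def adjActObj {κ : Type} [Finite κ] {Δ : κ → C.Obj} (σ : ι ≃ κ) (h : ∀ i, Δ (σ i) = Γ i)
    (φ : AdjObj Ω Γ) : AdjObj Ω Δ where
  plus := φ.plus
  minus := φ.minus
  form := (Ω.act (σ.sumCongr (Equiv.refl Bool)) (by rintro (x | x); exacts [h x, rfl])).obj φ.form

/-- The action of an arrow `f` into `Γ p` on the objects of `Adj(Ω)`. -/
def adjSubObj {κ : Type} [Finite κ] (p : ι) (f : C.Arr κ) (h : C.tgt f = Γ p) (φ : AdjObj Ω Γ) :
    AdjObj Ω (C.subCtx Γ p f) where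
  plus := φ.plus
  minus := φ.minus
  form := (Ω.act (plugInl p κ Bool) (by rintro (⟨x | x, h⟩ | x) <;> rfl)).obj
    ((Ω.sub (Γ := adjCtx Γ φ.minus φ.plus) (Sum.inl p) f h).obj φ.form)

theorem act_ctx_pull (hΩ : Ω.objs.IsPsh) {κ E : Type} [Finite κ] [Finite E] {Δ : κ → C.Obj}
    (σ : ι ≃ κ) (h : ∀ i, Δ (σ i) = Γ i) (φ : AdjObj Ω Γ) (s : Bool) (Φ : E → C.Obj) (e : E)
    (g : C.Arr {x // x ≠ e})
    (h₀ : ∀ x, Sum.elim Δ Φ (σ.sumCongr (Equiv.refl E) x) = Sum.elim Γ Φ x) (h₁ h₂ h₃) :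
    (Ω.act (σ.sumCongr (Equiv.refl E)) h₀).obj (pull Ω φ s Φ e g h₁ h₂ h₃) =
      pull Ω (adjActObj σ h φ) s Φ e g h₁ h₂ h₃ := by
  have hs : σ.sumCongr (Equiv.refl Bool) (Sum.inr s) = Sum.inr s := by simp
  have A := hΩ.act_sub (Γ := adjCtx Γ φ.minus φ.plus) (Δ := adjCtx Δ φ.minus φ.plus)
    (σ.sumCongr (Equiv.refl Bool)) (Sum.inr s) (Sum.inr s) hs g
    (by rintro (x | x); exacts [h x, rfl]) h₂ h₂ (by
      rintro (⟨x | x, hx⟩ | x)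
      · exact h x
      · rfl
      · rfl) φ.form
  refine Eq.trans ?_ (congrArg (Ω.act (plugInr (pullIndex s e)) _).obj A).symm
  refine hΩ.act_act_eq (M := Ω.objs) ?_ _
  rintro (⟨x | x, hx⟩ | x) <;> simp

theorem sub_ctx_pull (hΩ : Ω.objs.IsPsh) {κ E : Type} [Finite κ] [Finite E]
    (p : ι) (f : C.Arr κ) (h : C.tgt f = Γ p) (φ : AdjObj Ω Γ) (s : Bool) (Φ : E → C.Obj) (e : E)
    (g : C.Arr {x // x ≠ e})
    (h₀ : ∀ x, Sum.elim (C.subCtx Γ p f) Φ (plugInl p κ E x) =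
      C.subCtx (Sum.elim Γ Φ) (Sum.inl p) f x) (h₁ h₂ h₃) :
    (Ω.act (plugInl p κ E) h₀).obj ((Ω.sub (Γ := Sum.elim Γ Φ) (Sum.inl p) f h).obj
      (pull Ω φ s Φ e g h₁ h₂ h₃)) =
      pull Ω (adjSubObj p f h φ) s Φ e g h₁ h₂ h₃ := by
  have hp : plugInr (pullIndex s e) (Sum.inl ⟨Sum.inl p, Sum.inl_ne_inr⟩) = Sum.inl p := rfl
  have hs : plugInl p κ Bool (Sum.inl ⟨Sum.inr s, Sum.inr_ne_inl⟩) = Sum.inr s := rfl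
  have A := hΩ.act_sub (Γ := C.subCtx (adjCtx Γ φ.minus φ.plus) (Sum.inr s) g)
    (Δ := Sum.elim Γ Φ) (plugInr (pullIndex s e)) (Sum.inl ⟨Sum.inl p, Sum.inl_ne_inr⟩) (Sum.inl p)
    hp f (by
      rintro (⟨_ | y, h⟩ | x)
      · rfl
      · obtain rfl := eq_not_of_inr_ne h
        simp only [plugInr_inl_inr, pullIndex_inl, Sum.elim_inr, h₃, Multicat.subCtx,
          Sum.elim_inl, adjCtx]
        cases s <;> rfl
      · simp [Multicat.subCtx, h₁]) h h (by
      rintro (⟨⟨_ | y, h⟩ | x, hx⟩ | x)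
      · rfl
      · obtain rfl := eq_not_of_inr_ne h
        simp [h₃, Multicat.subCtx, adjCtx]
      · simp [Multicat.subCtx, h₁]
      · rfl) (show Ω.objs.El _ from (Ω.sub (Sum.inr s) g h₂).obj φ.form)
  have B := hΩ.act_sub (Γ := C.subCtx (adjCtx Γ φ.minus φ.plus) (Sum.inl p) f)
    (Δ := adjCtx (C.subCtx Γ p f) φ.minus φ.plus) (plugInl p κ Bool)
    (Sum.inl ⟨Sum.inr s, Sum.inr_ne_inl⟩) (Sum.inr s) hs g
    (by rintro (⟨x | x, h⟩ | x) <;> rfl) h₂ h₂ (by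
      rintro (⟨⟨_ | y, h⟩ | x, hx⟩ | x) <;> rfl)
    (show Ω.objs.El _ from (Ω.sub (Γ := adjCtx Γ φ.minus φ.plus) (Sum.inl p) f h).obj φ.form)
  have D := hΩ.sub_comm (Γ := adjCtx Γ φ.minus φ.plus) (Sum.inl p) (Sum.inr s) Sum.inl_ne_inr f g h
    h₂ h₂ h (by rintro (⟨⟨_ | y, h⟩ | x, hx⟩ | x) <;> rfl) φ.form
  refine (congrArg (Ω.act (plugInl p κ E) _).obj A).trans ?_
  refine Eq.trans ?_ (congrArg (Ω.act (plugInr (pullIndex s e)) _).obj (B.trans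
    (congrArg (Ω.objs.act _ _) D))).symm
  refine hΩ.act_act_act_eq (M := Ω.objs) ?_ _
  rintro (⟨⟨x | x, hx'⟩ | x, hx⟩ | x) <;> rfl

/-- The map `Adj(Ω)(Γ) ⟶ Adj(Ω)(Δ)` induced by a bijection `Γ ≅ Δ`. -/
def adjAct (hΩ : Ω.objs.IsPsh) {κ : Type} [Finite κ] {Δ : κ → C.Obj} (σ : ι ≃ κ)
    (h : ∀ i, Δ (σ i) = Γ i) : PolyMap (adjFib hΩ Γ) (adjFib hΩ Δ) where
  obj := adjActObj σ h
  arr {m n _ _} f :=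
    { src := fun i => adjActObj σ h (f.src i)
      tgt := fun j => adjActObj σ h (f.tgt j)
      prim := f.prim
      src_prim := f.src_prim
      tgt_prim := f.tgt_prim
      sec := (Ω.act (Γ := Sum.elim Γ (posCtx f.src f.tgt)) (Δ := Sum.elim Δ (posCtx f.src f.tgt))
        (σ.sumCongr (Equiv.refl _)) (by rintro (x | x); exacts [h x, rfl])).arr f.sec
      src_sec := fun i => ((Ω.act _ _).src_arr _ _).trans ((congrArg _ (f.src_sec i)).trans
        (act_ctx_pull hΩ σ h _ _ _ _ _ _ _ _ _))
      tgt_sec := fun j => ((Ω.act _ _).tgt_arr _ _).trans ((congrArg _ (f.tgt_sec j)).trans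
        (act_ctx_pull hΩ σ h _ _ _ _ _ _ _ _ _)) }
  src_arr _ _ := rfl
  tgt_arr _ _ := rfl

/-- The map `f^* : Adj(Ω)(Γ) ⟶ Adj(Ω)(Γ')` induced by an arrow `f` into the entry `Γ p`. -/
def adjSub (hΩ : Ω.objs.IsPsh) {κ : Type} [Finite κ] (p : ι) (f : C.Arr κ) (h : C.tgt f = Γ p) :
    PolyMap (adjFib hΩ Γ) (adjFib hΩ (C.subCtx Γ p f)) where
  obj := adjSubObj p f h
  arr {m n _ _} a :=
    { src := fun i => adjSubObj p f h (a.src i)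
      tgt := fun j => adjSubObj p f h (a.tgt j)
      prim := a.prim
      src_prim := a.src_prim
      tgt_prim := a.tgt_prim
      sec := (Ω.act (Δ := Sum.elim (C.subCtx Γ p f) (posCtx a.src a.tgt)) (plugInl p κ _)
        (by rintro (⟨x | x, h⟩ | x) <;> rfl)).arr
          ((Ω.sub (Γ := Sum.elim Γ (posCtx a.src a.tgt)) (Sum.inl p) f h).arr a.sec)
      src_sec := fun i => ((Ω.act _ _).src_arr _ _).trans ((congrArg _
        (((Ω.sub _ _ _).src_arr _ _).trans (congrArg _ (a.src_sec i)))).trans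
          (sub_ctx_pull hΩ p f h _ _ _ _ _ _ _ _ _))
      tgt_sec := fun j => ((Ω.act _ _).tgt_arr _ _).trans ((congrArg _
        (((Ω.sub _ _ _).tgt_arr _ _).trans (congrArg _ (a.tgt_sec j)))).trans
          (sub_ctx_pull hΩ p f h _ _ _ _ _ _ _ _ _)) }
  src_arr _ _ := rfl
  tgt_arr _ _ := rfl

/-- The Chu–Dialectica construction `Adj(Ω)` of a presheaf `Ω` of polycategories. (The presheaf laws
for the objects of `Ω` are needed to see that the operations of `Adj(Ω)` are well-typed.) -/
def PolyPshData.adj (Ω : PolyPshData.{u, v, u₁, v₁} C) (hΩ : Ω.objs.IsPsh) :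
    PolyPshData.{u, v, max u u₁, max u v u₁ v₁} C where
  fib Γ := adjFib hΩ Γ
  act σ h := adjAct hΩ σ h
  sub p f h := adjSub hΩ p f h

end Adj

section StarAdj

variable {C : Multicat.{u, v}} (Ω : StarPshData.{u, v, u₁, v₁} C) {ι : Type} [Finite ι]
  {Γ : ι → C.Obj}

/-- The dual `(φ⁻, φ⁺, φ̲•)` of `(φ⁺, φ⁻, φ̲)`. -/
def adjDual (φ : AdjObj Ω.toPolyPshData Γ) : AdjObj Ω.toPolyPshData Γ where
  plus := φ.minus
  minus := φ.plus
  form := Ω.dual ((Ω.act (Γ := adjCtx Γ φ.minus φ.plus) (Δ := adjCtx Γ φ.plus φ.minus)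
    ((Equiv.refl ι).sumCongr Equiv.boolNot) (by rintro (x | _ | _) <;> rfl)).obj φ.form)

variable {Ω}

theorem AdjObj.ext' {Ω : PolyPshData.{u, v, u₁, v₁} C} {φ ψ : AdjObj Ω Γ} (h₁ : φ.plus = ψ.plus)
    (h₂ : φ.minus = ψ.minus) (h₃ : HEq φ.form ψ.form) : φ = ψ := by
  cases φ; cases ψ; cases h₁; cases h₂; cases h₃; rfl

theorem adjDual_adjDual (hΩ : Ω.objs.IsPsh) (φ : AdjObj Ω.toPolyPshData Γ) :
    adjDual Ω (adjDual Ω φ) = φ := by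
  refine AdjObj.ext' rfl rfl (heq_of_eq ?_)
  refine ((congrArg Ω.dual (Ω.act_dual _ _ _)).trans (Ω.dual_dual _)).trans ?_
  refine (hΩ.act_act (M := Ω.objs) _ _ _ _ (by intro x; rcases x with x | _ | _ <;> rfl) _).trans ?_
  refine Eq.trans ?_ (hΩ.act_refl (M := Ω.objs) (fun _ => rfl) φ.form)
  have : ((Equiv.refl ι).sumCongr Equiv.boolNot).trans ((Equiv.refl ι).sumCongr Equiv.boolNot) =
      Equiv.refl (ι ⊕ Bool) := by
    ext (x | _ | _) <;> rfl
  congr 1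

theorem pull_adjDual (hΩ : Ω.objs.IsPsh) {E : Type} [Finite E] (φ : AdjObj Ω.toPolyPshData Γ)
    (s s' : Bool) (hs : s' = !s) (Φ : E → C.Obj) (e : E) (g : C.Arr {x // x ≠ e})
    (h₁ h₂ h₃ h₁' h₂' h₃') :
    pull Ω.toPolyPshData (adjDual Ω φ) s Φ e g h₁ h₂ h₃ =
      Ω.dual (pull Ω.toPolyPshData φ s' Φ e g h₁' h₂' h₃') := by
  have hp : (Equiv.refl ι).sumCongr Equiv.boolNot (Sum.inr s') = Sum.inr s := by
    subst hs; simp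
  have A := hΩ.act_sub (Γ := adjCtx Γ φ.minus φ.plus) (Δ := adjCtx Γ φ.plus φ.minus)
    ((Equiv.refl ι).sumCongr Equiv.boolNot) (Sum.inr s') (Sum.inr s) hp g
    (by rintro (x | _ | _) <;> rfl) h₂ h₂' (by
      rintro (⟨x | _ | _, hx⟩ | x) <;> rfl) φ.form
  refine (congrArg _ (Ω.sub_dual _ _ _ _)).trans ((Ω.act_dual _ _ _).trans (congrArg Ω.dual ?_))
  refine (congrArg (Ω.act (plugInr (pullIndex s e)) _).obj A).trans ?_
  have B : ∀ x, (((neEquiv ((Equiv.refl ι).sumCongr Equiv.boolNot) hp).sumCongr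
      (Equiv.refl {x // x ≠ e})).trans (plugInr (pullIndex s e))) x =
        plugInr (pullIndex s' e) x := by
    rintro (⟨x | x, hx⟩ | x) <;> simp
  refine (hΩ.act_act (M := Ω.objs) _ _ _ _ (fun i => ?_) _).trans ?_
  · rw [B]
    rcases i with ⟨_ | y, h⟩ | x
    · rfl
    · obtain rfl := eq_not_of_inr_ne h
      simp only [plugInr_inl_inr, pullIndex_inl, Sum.elim_inr, h₃', Multicat.subCtx, Sum.elim_inl,
        adjCtx]
      cases s' <;> rfl
    · simp [Multicat.subCtx, h₁]
  · have B' := Equiv.ext B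
    unfold pull PolyPshData.objs
    congr 1

/-- The entries of a polyarrow: its inputs and the duals of its outputs. -/
def adjEntry {m n : Type} [Finite m] [Finite n] (f : AdjArr Ω.toPolyPshData Γ m n) (e : m ⊕ n) :
    AdjObj Ω.toPolyPshData Γ :=
  Sum.elim f.src (fun j => adjDual Ω (f.tgt j)) e

theorem posCtx_eq {m n : Type} [Finite m] [Finite n] (f : AdjArr Ω.toPolyPshData Γ m n)
    (e : m ⊕ n) : posCtx f.src f.tgt e = (adjEntry f e).plus := by
  rcases e with _ | _ <;> rfl

theorem negCtx_eq {m n : Type} [Finite m] [Finite n] (f : AdjArr Ω.toPolyPshData Γ m n)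
    (e : m ⊕ n) : negCtx f.src f.tgt e = (adjEntry f e).minus := by
  rcases e with _ | _ <;> rfl

theorem sec_entry (hΩ : Ω.objs.IsPsh) {m n : Type} [Finite m] [Finite n]
    (f : AdjArr Ω.toPolyPshData Γ m n) (e : m ⊕ n) :
    Sum.elim ((Ω.fib _).src f.sec) (fun j => Ω.dual ((Ω.fib _).tgt f.sec j)) e =
      pull Ω.toPolyPshData (adjEntry f e) false (posCtx f.src f.tgt) e (f.prim e) (f.src_prim e)
        ((f.tgt_prim e).trans (negCtx_eq f e)) (posCtx_eq f e) := by
  rcases e with i | j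
  · exact f.src_sec i
  · exact (congrArg Ω.dual (f.tgt_sec j)).trans
      (pull_adjDual hΩ (f.tgt j) false true rfl _ _ _ _ _ _ _ _ _).symm

/-- The extended symmetric action on `Adj(Ω)(Γ)`. -/
def adjSact (hΩ : Ω.objs.IsPsh) {m n m' n' : Type} [Finite m] [Finite n] [Finite m'] [Finite n']
    (σ : m ⊕ n ≃ m' ⊕ n') (f : AdjArr Ω.toPolyPshData Γ m n) :
    AdjArr Ω.toPolyPshData Γ m' n' :=
  let src : m' → AdjObj Ω.toPolyPshData Γ := fun i => adjEntry f (σ.symm (Sum.inl i))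
  let tgt : n' → AdjObj Ω.toPolyPshData Γ := fun j => adjDual Ω (adjEntry f (σ.symm (Sum.inr j)))
  have hpos : ∀ e, posCtx src tgt e = posCtx f.src f.tgt (σ.symm e) := by
    rintro (i | j)
    exacts [(posCtx_eq f _).symm, (posCtx_eq f _).symm]
  have hneg : ∀ e, negCtx src tgt e = negCtx f.src f.tgt (σ.symm e) := by
    rintro (i | j)
    exacts [(negCtx_eq f _).symm, (negCtx_eq f _).symm]
  have hsrc : ∀ e x, C.src (C.act (neEquiv σ (σ.apply_symm_apply e)) (f.prim (σ.symm e))) x =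
      posCtx src tgt x.1 := by
    intro e x
    obtain ⟨x, rfl⟩ := (neEquiv σ (σ.apply_symm_apply e)).surjective x
    rw [C.src_act, f.src_prim, hpos]
    exact congrArg (posCtx f.src f.tgt) (σ.symm_apply_apply _).symm
  have htgt : ∀ e, C.tgt (C.act (neEquiv σ (σ.apply_symm_apply e)) (f.prim (σ.symm e))) =
      negCtx src tgt e := fun e => (C.tgt_act _ _).trans ((f.tgt_prim _).trans (hneg e).symm)
  have hact : ∀ x, Sum.elim Γ (posCtx src tgt) ((Equiv.refl ι).sumCongr σ x) =
      Sum.elim Γ (posCtx f.src f.tgt) x := by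
    rintro (x | x)
    · rfl
    · exact (hpos _).trans (congrArg (posCtx f.src f.tgt) (σ.symm_apply_apply x))
  let sec := (Ω.act ((Equiv.refl ι).sumCongr σ) hact).arr f.sec
  have hsec : ∀ e' : m' ⊕ n',
      Sum.elim ((Ω.fib _).src (Ω.sact σ sec)) (fun j => Ω.dual ((Ω.fib _).tgt (Ω.sact σ sec) j)) e' =
        pull Ω.toPolyPshData (adjEntry f (σ.symm e')) false (posCtx src tgt) e'
          (C.act (neEquiv σ (σ.apply_symm_apply e')) (f.prim (σ.symm e'))) (hsrc e')
          ((htgt e').trans ((hneg e').trans (negCtx_eq f _)))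
          ((hpos e').trans (posCtx_eq f _)) := by
    intro e'
    refine (congrArg (Sum.elim ((Ω.fib _).src (Ω.sact σ sec))
      (fun j => Ω.dual ((Ω.fib _).tgt (Ω.sact σ sec) j))) (σ.apply_symm_apply e').symm).trans ?_
    refine (Ω.entry_sact σ sec (σ.symm e')).trans ?_
    refine Eq.trans ?_ (act_pull hΩ σ _ _ _ _ _ e' (σ.apply_symm_apply e') _ hact (f.src_prim _)
      ((f.tgt_prim _).trans (negCtx_eq f _)) (posCtx_eq f _) _ _ _)
    refine Eq.trans ?_ (congrArg (Ω.act ((Equiv.refl ι).sumCongr σ) hact).obj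
      (sec_entry hΩ f (σ.symm e')))
    generalize σ.symm e' = e
    rcases e with i | j
    · exact (Ω.act _ _).src_arr _ _
    · exact (congrArg Ω.dual ((Ω.act _ _).tgt_arr _ _)).trans (Ω.act_dual _ _ _).symm
  { src := src
    tgt := tgt
    prim := fun e => C.act (neEquiv σ (σ.apply_symm_apply e)) (f.prim (σ.symm e))
    src_prim := hsrc
    tgt_prim := htgt
    sec := Ω.sact σ sec
    src_sec := fun i => hsec (Sum.inl i)
    tgt_sec := fun j => (Ω.dual_dual _).symm.trans ((congrArg Ω.dual (hsec (Sum.inr j))).trans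
      (pull_adjDual hΩ _ true false rfl _ _ _ _ _ _ _ _ _).symm) }

theorem adjActObj_dual (hΩ : Ω.objs.IsPsh) {κ : Type} [Finite κ] {Δ : κ → C.Obj} (σ : ι ≃ κ)
    (h : ∀ i, Δ (σ i) = Γ i) (φ : AdjObj Ω.toPolyPshData Γ) :
    adjActObj σ h (adjDual Ω φ) = adjDual Ω (adjActObj σ h φ) := by
  refine AdjObj.ext' rfl rfl (heq_of_eq ?_)
  refine (Ω.act_dual _ _ _).trans (congrArg Ω.dual ?_)
  refine hΩ.act_act_eq (M := Ω.objs) ?_ _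
  rintro (x | x) <;> rfl

theorem adjSubObj_dual (hΩ : Ω.objs.IsPsh) {κ : Type} [Finite κ] (p : ι) (f : C.Arr κ)
    (h : C.tgt f = Γ p) (φ : AdjObj Ω.toPolyPshData Γ) :
    adjSubObj p f h (adjDual Ω φ) = adjDual Ω (adjSubObj p f h φ) := by
  refine AdjObj.ext' rfl rfl (heq_of_eq ?_)
  refine ((congrArg _ (Ω.sub_dual _ _ _ _)).trans (Ω.act_dual _ _ _)).trans (congrArg Ω.dual ?_)
  have hp : (Equiv.refl ι).sumCongr Equiv.boolNot (Sum.inl p) = Sum.inl p := rfl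
  have A := hΩ.act_sub (Γ := adjCtx Γ φ.minus φ.plus) (Δ := adjCtx Γ φ.plus φ.minus)
    ((Equiv.refl ι).sumCongr Equiv.boolNot) (Sum.inl p) (Sum.inl p) hp f
    (by rintro (x | _ | _) <;> rfl) h h (by
      rintro (⟨x | _ | _, hx⟩ | x) <;> rfl) φ.form
  refine (congrArg (Ω.act (plugInl p κ Bool) _).obj A).trans ?_
  refine hΩ.act_act_eq (M := Ω.objs) ?_ _
  rintro (⟨x | x, hx⟩ | x) <;> rfl

/-- The Chu–Dialectica construction of a presheaf of `∗`-polycategories: `Adj(Ω)` with the duals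
`(φ⁺, φ⁻, φ̲)• = (φ⁻, φ⁺, φ̲•)`. -/
def StarPshData.adj (Ω : StarPshData.{u, v, u₁, v₁} C) (hΩ : Ω.objs.IsPsh) :
    StarPshData.{u, v, max u u₁, max u v u₁ v₁} C where
  toPolyPshData := Ω.toPolyPshData.adj hΩ
  dual := adjDual Ω
  sact := adjSact hΩ
  dual_dual := adjDual_adjDual hΩ
  entry_sact := by
    intro ι _ Γ m n m' n' _ _ _ _ σ f e
    obtain ⟨e, rfl⟩ := σ.symm.surjective e
    rw [σ.apply_symm_apply]
    rcases e with i | j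
    · rfl
    · exact adjDual_adjDual hΩ _
  act_dual σ h x := adjActObj_dual hΩ σ h x
  sub_dual p f h x := adjSubObj_dual hΩ p f h x

end StarAdj

/-! ## Co-subunary polycategories -/

/-- The possible codomains of arity one (`true`) or zero (`false`). -/
abbrev Cod (X : Type u) : Bool → Type u
  | true => X
  | false => PUnit

/-- The functoriality of `Cod`. -/
def Cod.map {X : Type u} {Y : Type v} (f : X → Y) : {b : Bool} → Cod X b → Cod Y b
  | true, x => f x
  | false, _ => PUnit.unit

/-- A co-subunary polycategory with set of objects `O`, i.e. a symmetric multicategory (`b = true`)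
together with a presheaf of sets on it (`b = false`): `Arr ι b` is the set of all arrows with the list
`src f` of inputs (indexed by `ι`) and with one output (`b = true`) or no output (`b = false`). -/
structure CoSub (O : Type u) where
  Arr : (ι : Type) → [Finite ι] → Bool → Type v
  src : ∀ {ι : Type} [Finite ι] {b : Bool}, Arr ι b → ι → O
  tgt : ∀ {ι : Type} [Finite ι] {b : Bool}, Arr ι b → Cod O b
  /-- The symmetric action. -/
  act : ∀ {ι κ : Type} [Finite ι] [Finite κ] {b : Bool}, ι ≃ κ → Arr ι b → Arr κ b
  /-- Identities. -/
  one : O → Arr Unit true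
  /-- The composite `g ∘ f` at the input `q` of `g`. -/
  comp : ∀ {ι κ : Type} [Finite ι] [Finite κ] {b : Bool} (g : Arr κ b) (q : κ) (f : Arr ι true),
    src g q = tgt f → Arr ({x // x ≠ q} ⊕ ι) b
  src_act : ∀ {ι κ : Type} [Finite ι] [Finite κ] {b : Bool} (σ : ι ≃ κ) (f : Arr ι b) (i : ι),
    src (act σ f) (σ i) = src f i
  tgt_act : ∀ {ι κ : Type} [Finite ι] [Finite κ] {b : Bool} (σ : ι ≃ κ) (f : Arr ι b),
    tgt (act σ f) = tgt f
  src_one : ∀ (A : O) (i : Unit), src (one A) i = A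
  tgt_one : ∀ A : O, tgt (one A) = A
  src_comp_inl : ∀ {ι κ : Type} [Finite ι] [Finite κ] {b : Bool} (g : Arr κ b) (q : κ)
    (f : Arr ι true) (h : src g q = tgt f) (x : {x // x ≠ q}),
    src (comp g q f h) (Sum.inl x) = src g x.1
  src_comp_inr : ∀ {ι κ : Type} [Finite ι] [Finite κ] {b : Bool} (g : Arr κ b) (q : κ)
    (f : Arr ι true) (h : src g q = tgt f) (i : ι), src (comp g q f h) (Sum.inr i) = src f i
  tgt_comp : ∀ {ι κ : Type} [Finite ι] [Finite κ] {b : Bool} (g : Arr κ b) (q : κ)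
    (f : Arr ι true) (h : src g q = tgt f), tgt (comp g q f h) = tgt g
  act_refl : ∀ {ι : Type} [Finite ι] {b : Bool} (f : Arr ι b), act (Equiv.refl ι) f = f
  act_act : ∀ {ι κ μ : Type} [Finite ι] [Finite κ] [Finite μ] {b : Bool} (σ : ι ≃ κ) (τ : κ ≃ μ)
    (f : Arr ι b), act τ (act σ f) = act (σ.trans τ) f
  one_comp : ∀ {ι : Type} [Finite ι] (A : O) (f : Arr ι true) (h : src (one A) () = tgt f),
    comp (one A) () f h = act unitPlug.symm f
  comp_one : ∀ {κ : Type} [Finite κ] {b : Bool} (g : Arr κ b) (q : κ) (A : O)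
    (h : src g q = tgt (one A)), comp g q (one A) h = act (plugUnit q).symm g
  assoc : ∀ {ι κ μ : Type} [Finite ι] [Finite κ] [Finite μ] {b : Bool} (k : Arr μ b) (r : μ)
    (g : Arr κ true) (q : κ) (f : Arr ι true) (h₁ : src k r = tgt g)
    (h₂ : src (comp k r g h₁) (Sum.inr q) = tgt f)
    (h₃ : src g q = tgt f) (h₄ : src k r = tgt (comp g q f h₃)),
    comp (comp k r g h₁) (Sum.inr q) f h₂ =
      act (plugInr (Equiv.refl _)).symm (comp k r (comp g q f h₃) h₄)
  exchange : ∀ {ι κ μ : Type} [Finite ι] [Finite κ] [Finite μ] {b : Bool} (k : Arr μ b) (r s : μ)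
    (hrs : r ≠ s) (g : Arr κ true) (f : Arr ι true) (h₁ : src k r = tgt g)
    (h₂ : src (comp k r g h₁) (Sum.inl ⟨s, hrs.symm⟩) = tgt f) (h₃ : src k s = tgt f)
    (h₄ : src (comp k s f h₃) (Sum.inl ⟨r, hrs⟩) = tgt g),
    comp (comp k r g h₁) (Sum.inl ⟨s, hrs.symm⟩) f h₂ =
      act (swapSlots hrs).symm (comp (comp k s f h₃) (Sum.inl ⟨r, hrs⟩) g h₄)
  equivariance : ∀ {ι ι' κ κ' : Type} [Finite ι] [Finite ι'] [Finite κ] [Finite κ'] {b : Bool}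
    (σ : κ ≃ κ') (τ : ι ≃ ι') (g : Arr κ b) (q : κ) (q' : κ') (hq : σ q = q') (f : Arr ι true)
    (h : src g q = tgt f) (h' : src (act σ g) q' = tgt (act τ f)),
    comp (act σ g) q' (act τ f) h' = act ((neEquiv σ hq).sumCongr τ) (comp g q f h)

namespace CoSub

variable {O : Type u}

/-- The multicategory of co-unary arrows. -/
def multicat (X : CoSub.{u, v} O) : Multicat.{u, v} where
  Obj := O
  Arr ι _ := X.Arr ι true
  src := X.src
  tgt := X.tgt
  act := X.act
  one := X.one
  comp := X.comp
  src_act := X.src_act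
  tgt_act := X.tgt_act
  src_one := X.src_one
  tgt_one := X.tgt_one
  src_comp_inl := X.src_comp_inl
  src_comp_inr := X.src_comp_inr
  tgt_comp := X.tgt_comp
  act_refl := X.act_refl
  act_act := X.act_act
  one_comp := X.one_comp
  comp_one := X.comp_one
  assoc := X.assoc
  exchange := X.exchange
  equivariance := X.equivariance

/-- An identity-on-objects functor of co-subunary polycategories. -/
structure Hom (X : CoSub.{u, v} O) (Y : CoSub.{u, w} O) where
  arr : ∀ {ι : Type} [Finite ι] {b : Bool}, X.Arr ι b → Y.Arr ι b
  src_arr : ∀ {ι : Type} [Finite ι] {b : Bool} (f : X.Arr ι b) (i : ι),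
    Y.src (arr f) i = X.src f i
  tgt_arr : ∀ {ι : Type} [Finite ι] {b : Bool} (f : X.Arr ι b), Y.tgt (arr f) = X.tgt f
  arr_act : ∀ {ι κ : Type} [Finite ι] [Finite κ] {b : Bool} (σ : ι ≃ κ) (f : X.Arr ι b),
    arr (X.act σ f) = Y.act σ (arr f)
  arr_one : ∀ A : O, arr (X.one A) = Y.one A
  arr_comp : ∀ {ι κ : Type} [Finite ι] [Finite κ] {b : Bool} (g : X.Arr κ b) (q : κ)
    (f : X.Arr ι true) (h : X.src g q = X.tgt f) (h' : Y.src (arr g) q = Y.tgt (arr f)),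
    arr (X.comp g q f h) = Y.comp (arr g) q (arr f) h'

variable (X : CoSub.{u, v} O) {ι κ μ : Type} [Finite ι] [Finite κ] [Finite μ] {b : Bool}

theorem comp_congr {g g' : X.Arr κ b} (hg : g = g') (q : κ) {f f' : X.Arr ι true} (hf : f = f')
    (h h') : X.comp g q f h = X.comp g' q f' h' := by
  subst hg hf; rfl

theorem act_congr {σ τ : ι ≃ κ} (h : ∀ i, σ i = τ i) {f g : X.Arr ι b} (hf : f = g) :
    X.act σ f = X.act τ g := by
  rw [Equiv.ext h, hf]

theorem act_self {σ : ι ≃ ι} (h : ∀ i, σ i = i) (f : X.Arr ι b) : X.act σ f = f := by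
  rw [Equiv.ext (g := Equiv.refl ι) h, X.act_refl]

theorem src_act' (σ : ι ≃ κ) (f : X.Arr ι b) (i : κ) : X.src (X.act σ f) i = X.src f (σ.symm i) := by
  rw [← X.src_act σ f, σ.apply_symm_apply]

theorem comp_act_left {κ' : Type} [Finite κ'] (σ : κ ≃ κ') (g : X.Arr κ b) (q : κ) (q' : κ')
    (hq : σ q = q') (f : X.Arr ι true) (h h') :
    X.comp (X.act σ g) q' f h' = X.act ((neEquiv σ hq).sumCongr (Equiv.refl _)) (X.comp g q f h) := by
  have := X.equivariance σ (Equiv.refl ι) g q q' hq f h (by rw [X.act_refl]; exact h')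
  rw [← this]
  exact X.comp_congr rfl _ (X.act_refl f).symm _ _

theorem comp_act_right {ι' : Type} [Finite ι'] (τ : ι ≃ ι') (g : X.Arr κ b) (q : κ)
    (f : X.Arr ι true) (h h') :
    X.comp g q (X.act τ f) h' = X.act ((Equiv.refl _).sumCongr τ) (X.comp g q f h) := by
  have := X.equivariance (Equiv.refl κ) τ g q q rfl f h (by rw [X.act_refl]; exact h')
  refine (X.comp_congr (X.act_refl g).symm _ rfl _ _).trans (this.trans (X.act_congr ?_ rfl))
  rintro (x | x) <;> rfl

/-- The composite of `x` and the unary arrow `u` at the input `p` of `x`, with the list of inputs still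
indexed in the same way (and `x` itself if `u` does not end at the input `p` of `x`). -/
noncomputable def step (x : X.Arr κ b) (p : κ) (u : X.Arr Unit true) : X.Arr κ b :=
  open Classical in
  if h : X.src x p = X.tgt u then X.act (plugUnit p) (X.comp x p u h) else x

variable {X}

theorem step_pos {x : X.Arr κ b} {p : κ} {u : X.Arr Unit true} (h : X.src x p = X.tgt u) :
    X.step x p u = X.act (plugUnit p) (X.comp x p u h) := dif_pos h

theorem step_neg {x : X.Arr κ b} {p : κ} {u : X.Arr Unit true} (h : X.src x p ≠ X.tgt u) :
    X.step x p u = x := dif_neg h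

theorem src_step_of_ne {x : X.Arr κ b} {p : κ} {u : X.Arr Unit true} {q : κ} (hq : q ≠ p) :
    X.src (X.step x p u) q = X.src x q := by
  by_cases h : X.src x p = X.tgt u
  · rw [step_pos h]
    have := X.src_act (plugUnit p) (X.comp x p u h) (Sum.inl ⟨q, hq⟩)
    rw [X.src_comp_inl] at this
    exact this
  · rw [step_neg h]

theorem src_step_self {x : X.Arr κ b} {p : κ} {u : X.Arr Unit true} (h : X.src x p = X.tgt u) :
    X.src (X.step x p u) p = X.src u () := by
  rw [step_pos h]
  have := X.src_act (plugUnit p) (X.comp x p u h) (Sum.inr ())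
  rw [X.src_comp_inr] at this
  exact this

theorem tgt_step {x : X.Arr κ b} {p : κ} {u : X.Arr Unit true} :
    X.tgt (X.step x p u) = X.tgt x := by
  by_cases h : X.src x p = X.tgt u
  · rw [step_pos h, X.tgt_act, X.tgt_comp]
  · rw [step_neg h]

theorem act_step (σ : ι ≃ κ) (x : X.Arr ι b) (p : ι) (u : X.Arr Unit true) :
    X.act σ (X.step x p u) = X.step (X.act σ x) (σ p) u := by
  by_cases h : X.src x p = X.tgt u
  · have h' : X.src (X.act σ x) (σ p) = X.tgt u := by rw [X.src_act, h]
    rw [step_pos h, step_pos h', X.comp_act_left σ x p (σ p) rfl u h, X.act_act, X.act_act]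
    exact X.act_congr (by rintro (x | x) <;> rfl) rfl
  · rw [step_neg h, step_neg (by rwa [X.src_act])]

theorem step_comp_inl (x : X.Arr κ b) (q : κ) (y : X.Arr ι true) (h) (p : {x // x ≠ q})
    (u : X.Arr Unit true) (h') :
    X.step (X.comp x q y h) (Sum.inl p) u = X.comp (X.step x p.1 u) q y h' := by
  by_cases hu : X.src x p.1 = X.tgt u
  · have hu' : X.src (X.comp x q y h) (Sum.inl p) = X.tgt u := by rw [X.src_comp_inl, hu]
    have h₄ : X.src (X.comp x p.1 u hu) (Sum.inl ⟨q, p.2.symm⟩) = X.tgt y := by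
      rw [X.src_comp_inl, h]
    rw [step_pos hu']
    refine (congrArg _ (X.exchange x q p.1 p.2.symm y u h hu' hu h₄)).trans ?_
    refine Eq.trans ?_ (X.comp_congr (step_pos hu).symm q rfl
      (by rw [← step_pos hu]; exact h') h')
    rw [X.comp_act_left (plugUnit p.1) _ (Sum.inl ⟨q, p.2.symm⟩) q rfl y h₄, X.act_act]
    exact X.act_congr (by rintro (⟨x | x, hx⟩ | x) <;> rfl) rfl
  · rw [step_neg (by rwa [X.src_comp_inl])]
    exact X.comp_congr (step_neg hu).symm q rfl _ _

theorem step_comp_inr (x : X.Arr κ b) (q : κ) (y : X.Arr ι true) (h) (p : ι)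
    (u : X.Arr Unit true) (h') :
    X.step (X.comp x q y h) (Sum.inr p) u = X.comp x q (X.step y p u) h' := by
  by_cases hu : X.src y p = X.tgt u
  · have hu' : X.src (X.comp x q y h) (Sum.inr p) = X.tgt u := by rw [X.src_comp_inr, hu]
    have h₄ : X.src x q = X.tgt (X.comp y p u hu) := by rw [X.tgt_comp, h]
    rw [step_pos hu']
    refine (congrArg _ (X.assoc x q y p u h hu' hu h₄)).trans ?_
    refine Eq.trans ?_ (X.comp_congr rfl q (step_pos hu).symm
      (by rw [← step_pos hu]; exact h') h')
    rw [X.comp_act_right (plugUnit p) x q _ h₄, X.act_act]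
    exact X.act_congr (by rintro (x | x | x) <;> rfl) rfl
  · rw [step_neg (by rwa [X.src_comp_inr])]
    exact X.comp_congr rfl q (step_neg hu).symm _ _

theorem step_comm (x : X.Arr κ b) {p q : κ} (hpq : p ≠ q) (u v : X.Arr Unit true) :
    X.step (X.step x p u) q v = X.step (X.step x q v) p u := by
  by_cases hu : X.src x p = X.tgt u
  · have hu' : X.src (X.step x q v) p = X.tgt u := by rw [src_step_of_ne hpq, hu]
    rw [step_pos hu, step_pos hu', ← step_comp_inl (p := ⟨q, hpq.symm⟩) x p u hu v hu', act_step]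
    rfl
  · rw [step_neg hu, step_neg (p := p) (by rwa [src_step_of_ne hpq])]

/-- The composite of `f` and the unary arrow `v` at the output of `f`, if there is one (and `f` itself
if there is none, or if `v` does not start there). -/
noncomputable def post (X : CoSub.{u, v} O) :
    {b : Bool} → Cod (X.Arr Unit true) b → X.Arr κ b → X.Arr κ b
  | true, v, f => open Classical in
      if h : X.src v () = X.tgt f then X.act unitPlug (X.comp v () f h) else f
  | false, _, f => f

theorem post_pos {v : X.Arr Unit true} {f : X.Arr κ true} (h : X.src v () = X.tgt f) :
    X.post (b := true) v f = X.act unitPlug (X.comp v () f h) := dif_pos h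

theorem post_neg {v : X.Arr Unit true} {f : X.Arr κ true} (h : X.src v () ≠ X.tgt f) :
    X.post (b := true) v f = f := dif_neg h

instance (u : κ → X.Arr Unit true) :
    LeftCommutative fun (p : κ) (y : X.Arr κ b) => X.step y p (u p) where
  left_comm p q y := by
    by_cases h : p = q
    · rw [h]
    · exact step_comm y (Ne.symm h) _ _

/-- The composite of `x` and the unary arrows `u p`, for `p ∈ S`, at the inputs `p` of `x`. -/
noncomputable def substOn (X : CoSub.{u, v} O) (S : Finset κ) (x : X.Arr κ b)
    (u : κ → X.Arr Unit true) : X.Arr κ b :=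
  S.1.foldr (fun p y => X.step y p (u p)) x

/-- The composite of `x` and the unary arrows `u p` at all its inputs `p`. -/
noncomputable def substAll (X : CoSub.{u, v} O) (x : X.Arr κ b) (u : κ → X.Arr Unit true) :
    X.Arr κ b :=
  X.substOn (Set.finite_univ (α := κ)).toFinset x u

/-- The composite of `x` and the unary arrows `u p` at all its inputs `p` other than `q`. -/
noncomputable def substNe (X : CoSub.{u, v} O) (q : κ) (x : X.Arr κ b) (u : κ → X.Arr Unit true) :
    X.Arr κ b :=
  X.substOn (Set.toFinite {p : κ | p ≠ q}).toFinset x u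

@[simp] theorem substOn_empty (x : X.Arr κ b) (u : κ → X.Arr Unit true) :
    X.substOn ∅ x u = x := rfl

theorem substOn_cons {S : Finset κ} {p : κ} (hp : p ∉ S) (x : X.Arr κ b)
    (u : κ → X.Arr Unit true) :
    X.substOn (S.cons p hp) x u = X.step (X.substOn S x u) p (u p) := by
  unfold substOn
  rw [Finset.cons_val, Multiset.foldr_cons]

theorem src_substOn_of_notMem (S : Finset κ) (x : X.Arr κ b) (u : κ → X.Arr Unit true) {q : κ}
    (hq : q ∉ S) : X.src (X.substOn S x u) q = X.src x q := by
  induction S using Finset.cons_induction with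
  | empty => rfl
  | cons p S hp ih =>
    rw [Finset.mem_cons, not_or] at hq
    rw [substOn_cons, src_step_of_ne hq.1, ih hq.2]

theorem src_substOn_of_mem (S : Finset κ) (x : X.Arr κ b) (u : κ → X.Arr Unit true)
    {q : κ} (h : X.src x q = X.tgt (u q)) (hq : q ∈ S) :
    X.src (X.substOn S x u) q = X.src (u q) () := by
  induction S using Finset.cons_induction with
  | empty => simp at hq
  | cons p S hp ih =>
    rw [substOn_cons]
    by_cases hqp : q = p
    · subst hqp
      rw [src_step_self]
      rw [src_substOn_of_notMem S x u hp, h]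
    · rw [src_step_of_ne hqp]
      exact ih ((Finset.mem_cons.1 hq).resolve_left hqp)

theorem tgt_substOn (S : Finset κ) (x : X.Arr κ b) (u : κ → X.Arr Unit true) :
    X.tgt (X.substOn S x u) = X.tgt x := by
  induction S using Finset.cons_induction with
  | empty => rfl
  | cons p S hp ih => rw [substOn_cons, tgt_step, ih]

theorem src_substAll (x : X.Arr κ b) (u : κ → X.Arr Unit true) {q : κ}
    (h : X.src x q = X.tgt (u q)) : X.src (X.substAll x u) q = X.src (u q) () :=
  src_substOn_of_mem _ x u h (by simp)

theorem tgt_substAll (x : X.Arr κ b) (u : κ → X.Arr Unit true) :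
    X.tgt (X.substAll x u) = X.tgt x := tgt_substOn _ _ _

theorem src_substNe_self (q : κ) (x : X.Arr κ b) (u : κ → X.Arr Unit true) :
    X.src (X.substNe q x u) q = X.src x q := src_substOn_of_notMem _ _ _ (by simp)

theorem src_substNe_of_ne (q : κ) (x : X.Arr κ b) (u : κ → X.Arr Unit true) {p : κ} (hp : p ≠ q)
    (h : X.src x p = X.tgt (u p)) : X.src (X.substNe q x u) p = X.src (u p) () :=
  src_substOn_of_mem _ _ _ h (by simpa using hp)

theorem tgt_substNe (q : κ) (x : X.Arr κ b) (u : κ → X.Arr Unit true) :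
    X.tgt (X.substNe q x u) = X.tgt x := tgt_substOn _ _ _

theorem substOn_congr (S : Finset κ) (x : X.Arr κ b) {u u' : κ → X.Arr Unit true}
    (h : ∀ p ∈ S, u p = u' p) : X.substOn S x u = X.substOn S x u' := by
  induction S using Finset.cons_induction with
  | empty => rfl
  | cons p S hp ih =>
    rw [substOn_cons, substOn_cons, h p (Finset.mem_cons_self _ _),
      ih fun q hq => h q (Finset.mem_cons_of_mem hq)]

theorem substAll_eq_step (q : κ) (x : X.Arr κ b) (u : κ → X.Arr Unit true) :
    X.substAll x u = X.step (X.substNe q x u) q (u q) := by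
  unfold substAll substNe
  rw [← substOn_cons (by simp)]
  congr 1
  ext p
  simp [Classical.em]

theorem act_substOn (σ : ι ≃ κ) (S : Finset ι) (x : X.Arr ι b) (u : κ → X.Arr Unit true) :
    X.act σ (X.substOn S x (u ∘ σ)) = X.substOn (S.map σ.toEmbedding) (X.act σ x) u := by
  induction S using Finset.cons_induction with
  | empty => rfl
  | cons p S hp ih =>
    rw [substOn_cons, Finset.map_cons, substOn_cons, act_step, ih]
    rfl

theorem act_substAll (σ : ι ≃ κ) (x : X.Arr ι b) (u : κ → X.Arr Unit true) :
    X.act σ (X.substAll x (u ∘ σ)) = X.substAll (X.act σ x) u := by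
  unfold substAll
  rw [act_substOn]
  congr 1
  ext p
  simp

theorem act_substNe (σ : ι ≃ κ) (q : ι) (x : X.Arr ι b) (u : κ → X.Arr Unit true) :
    X.act σ (X.substNe q x (u ∘ σ)) = X.substNe (σ q) (X.act σ x) u := by
  unfold substNe
  rw [act_substOn]
  congr 1
  ext p
  obtain ⟨p, rfl⟩ := σ.surjective p
  simp

theorem substOn_comp (x : X.Arr κ b) (q : κ) (y : X.Arr ι true) (h) (S : Finset {p : κ // p ≠ q})
    (T : Finset ι) (u : {p // p ≠ q} ⊕ ι → X.Arr Unit true) (u' : κ → X.Arr Unit true)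
    (hu : ∀ p : {p // p ≠ q}, u' p.1 = u (Sum.inl p)) (h') :
    X.substOn (S.disjSum T) (X.comp x q y h) u =
      X.comp (X.substOn (S.map (Function.Embedding.subtype _)) x u') q
        (X.substOn T y (u ∘ Sum.inr)) h' := by
  classical
  induction S using Finset.cons_induction with
  | empty =>
    induction T using Finset.cons_induction with
    | empty => exact X.comp_congr rfl _ rfl _ _
    | cons p T hp ih =>
      have e : (∅ : Finset {p : κ // p ≠ q}).disjSum (T.cons p hp) =
          ((∅ : Finset {p : κ // p ≠ q}).disjSum T).cons (Sum.inr p) (by simpa using hp) := by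
        ext (x | x) <;> simp
      have h'' : X.src (X.substOn ((∅ : Finset {p : κ // p ≠ q}).map
        (Function.Embedding.subtype _)) x u') q = X.tgt (X.substOn T y (u ∘ Sum.inr)) := by
          rw [tgt_substOn]; exact h
      rw [e, substOn_cons, ih h'', step_comp_inr (h' := by rw [tgt_step]; exact h'')]
      exact X.comp_congr rfl _ (substOn_cons hp _ _).symm _ _
  | cons p S hp ih =>
    have e : (S.cons p hp).disjSum T =
        (S.disjSum T).cons (Sum.inl p) (by simpa using hp) := by
      ext (x | x) <;> simp
    have hS : q ∉ S.map (Function.Embedding.subtype _) := by simp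
    have h'' : X.src (X.substOn (S.map (Function.Embedding.subtype _)) x u') q =
        X.tgt (X.substOn T y (u ∘ Sum.inr)) := by
      rw [src_substOn_of_notMem _ _ _ hS, tgt_substOn]; exact h
    rw [e, substOn_cons, ih h'', step_comp_inl
      (h' := by rw [src_step_of_ne p.2.symm]; exact h'')]
    refine X.comp_congr ?_ _ rfl _ _
    rw [← hu, Finset.map_cons, substOn_cons]
    rfl

theorem substAll_comp (x : X.Arr κ b) (q : κ) (y : X.Arr ι true) (h)
    (u : {p // p ≠ q} ⊕ ι → X.Arr Unit true) (u' : κ → X.Arr Unit true)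
    (hu : ∀ p : {p // p ≠ q}, u' p.1 = u (Sum.inl p)) (h') :
    X.substAll (X.comp x q y h) u =
      X.comp (X.substNe q x u') q (X.substAll y (u ∘ Sum.inr)) h' := by
  have h₁ : (Set.finite_univ (α := {p // p ≠ q} ⊕ ι)).toFinset =
      (Set.finite_univ (α := {p // p ≠ q})).toFinset.disjSum
        (Set.finite_univ (α := ι)).toFinset := by
    ext (x | x) <;> simp
  have h₂ : (Set.finite_univ (α := {p // p ≠ q})).toFinset.map (Function.Embedding.subtype _) =
      (Set.toFinite {p : κ | p ≠ q}).toFinset := by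
    ext x; simp
  have e := X.comp_congr (congrArg (fun S => X.substOn S x u') h₂) q
    (rfl : X.substAll y (u ∘ Sum.inr) = _) (by simp only [h₂]; exact h') h'
  refine Eq.trans ?_ e
  unfold substAll
  rw [h₁]
  exact substOn_comp x q y h _ _ u u' hu _

theorem substNe_comp_inr (x : X.Arr κ b) (q : κ) (y : X.Arr ι true) (h) (r : ι)
    (u : {p // p ≠ q} ⊕ ι → X.Arr Unit true) (u' : κ → X.Arr Unit true)
    (hu : ∀ p : {p // p ≠ q}, u' p.1 = u (Sum.inl p)) (h') :
    X.substNe (Sum.inr r) (X.comp x q y h) u =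
      X.comp (X.substNe q x u') q (X.substNe r y (u ∘ Sum.inr)) h' := by
  have h₁ : (Set.toFinite {p : {p // p ≠ q} ⊕ ι | p ≠ Sum.inr r}).toFinset =
      (Set.finite_univ (α := {p // p ≠ q})).toFinset.disjSum
        (Set.toFinite {p : ι | p ≠ r}).toFinset := by
    ext (x | x) <;> simp
  have h₂ : (Set.finite_univ (α := {p // p ≠ q})).toFinset.map (Function.Embedding.subtype _) =
      (Set.toFinite {p : κ | p ≠ q}).toFinset := by
    ext x; simp
  have e := X.comp_congr (congrArg (fun S => X.substOn S x u') h₂) q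
    (rfl : X.substNe r y (u ∘ Sum.inr) = _) (by simp only [h₂]; exact h') h'
  refine Eq.trans ?_ e
  unfold substNe
  rw [h₁]
  exact substOn_comp x q y h _ _ u u' hu _

/-- The composite of `x` and the unary arrows `u p` at all its inputs `p` other than `q` and `r`. -/
noncomputable def substNe₂ (X : CoSub.{u, v} O) (q r : κ) (x : X.Arr κ b)
    (u : κ → X.Arr Unit true) : X.Arr κ b :=
  X.substOn (Set.toFinite {p : κ | p ≠ q ∧ p ≠ r}).toFinset x u

theorem substNe₂_comm (q r : κ) (x : X.Arr κ b) (u : κ → X.Arr Unit true) :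
    X.substNe₂ q r x u = X.substNe₂ r q x u := by
  unfold substNe₂
  congr 1
  ext p
  simp [and_comm]

theorem substNe_eq_step {q r : κ} (hqr : q ≠ r) (x : X.Arr κ b) (u : κ → X.Arr Unit true) :
    X.substNe q x u = X.step (X.substNe₂ q r x u) r (u r) := by
  unfold substNe substNe₂
  rw [← substOn_cons (by simp)]
  congr 1
  ext p
  by_cases hp : p = r
  · subst hp; simpa using hqr.symm
  · simp [hp]

theorem substNe_comp_inl (x : X.Arr κ b) (q : κ) (y : X.Arr ι true) (h) (r : {p // p ≠ q})
    (u : {p // p ≠ q} ⊕ ι → X.Arr Unit true) (u' : κ → X.Arr Unit true)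
    (hu : ∀ p : {p // p ≠ q}, u' p.1 = u (Sum.inl p)) (h') :
    X.substNe (Sum.inl r) (X.comp x q y h) u =
      X.comp (X.substNe₂ q r.1 x u') q (X.substAll y (u ∘ Sum.inr)) h' := by
  have h₁ : (Set.toFinite {p : {p // p ≠ q} ⊕ ι | p ≠ Sum.inl r}).toFinset =
      (Set.toFinite {p : {p // p ≠ q} | p ≠ r}).toFinset.disjSum
        (Set.finite_univ (α := ι)).toFinset := by
    ext (x | x) <;> simp
  have h₂ : (Set.toFinite {p : {p // p ≠ q} | p ≠ r}).toFinset.map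
      (Function.Embedding.subtype _) =
      (Set.toFinite {p : κ | p ≠ q ∧ p ≠ r.1}).toFinset := by
    ext x; simp [Subtype.ext_iff, and_comm]
  have e := X.comp_congr (congrArg (fun S => X.substOn S x u') h₂) q
    (rfl : X.substAll y (u ∘ Sum.inr) = _) (by simp only [h₂]; exact h') h'
  refine Eq.trans ?_ e
  unfold substNe substAll
  rw [h₁]
  exact substOn_comp x q y h _ _ u u' hu _

theorem src_post {v : Cod (X.Arr Unit true) b} {f : X.Arr κ b} (i : κ) :
    X.src (X.post v f) i = X.src f i := by
  cases b with
  | false => rfl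
  | true =>
    by_cases h : X.src v () = X.tgt f
    · rw [post_pos h]
      have := X.src_act unitPlug (X.comp v () f h) (Sum.inr i)
      rwa [X.src_comp_inr] at this
    · exact congrArg (X.src · i) (dif_neg h)

theorem tgt_post {v : X.Arr Unit true} {f : X.Arr κ true} (h : X.src v () = X.tgt f) :
    X.tgt (X.post (b := true) v f) = X.tgt v := by
  rw [post_pos h, X.tgt_act, X.tgt_comp]

theorem post_act (σ : ι ≃ κ) (v : Cod (X.Arr Unit true) b) (f : X.Arr ι b) :
    X.post v (X.act σ f) = X.act σ (X.post v f) := by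
  cases b with
  | false => rfl
  | true =>
    by_cases h : X.src v () = X.tgt f
    · rw [post_pos h, post_pos (by rw [X.tgt_act, h]), X.comp_act_right σ v () f h, X.act_act,
        X.act_act]
      refine X.act_congr ?_ rfl
      rintro (⟨_, x⟩ | x)
      exacts [(x rfl).elim, rfl]
    · rw [post_neg (by rwa [X.tgt_act]), post_neg h]

theorem post_comp (v : Cod (X.Arr Unit true) b) (x : X.Arr κ b) (q : κ) (y : X.Arr ι true) (h h') :
    X.post v (X.comp x q y h) = X.comp (X.post v x) q y h' := by
  cases b with
  | false => rfl
  | true =>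
    by_cases hv : X.src v () = X.tgt x
    · have hv' : X.src v () = X.tgt (X.comp x q y h) := by rw [X.tgt_comp, hv]
      have h₂ : X.src (X.comp v () x hv) (Sum.inr q) = X.tgt y := by rw [X.src_comp_inr, h]
      rw [post_pos hv']
      refine Eq.trans ?_ (X.comp_congr (post_pos hv).symm q rfl
        (by rw [← post_pos hv]; exact h') h')
      rw [X.comp_act_left unitPlug _ (Sum.inr q) q rfl y h₂, X.assoc v () x q y hv h₂ h hv',
        X.act_act]
      refine X.act_congr ?_ rfl
      rintro (⟨_, x⟩ | x | x)
      exacts [(x rfl).elim, rfl, rfl]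
    · rw [post_neg (by rwa [X.tgt_comp])]
      exact X.comp_congr (post_neg hv).symm _ rfl _ _

theorem comp_step (x : X.Arr κ b) (q : κ) (v : X.Arr Unit true) (f : X.Arr ι true)
    (hv : X.src x q = X.tgt v) (hf : X.src v () = X.tgt f) (h h') :
    X.comp (X.step x q v) q f h = X.comp x q (X.post (b := true) v f) h' := by
  have h₂ : X.src (X.comp x q v hv) (Sum.inr ()) = X.tgt f := by rw [X.src_comp_inr, hf]
  have h₄ : X.src x q = X.tgt (X.comp v () f hf) := by rw [X.tgt_comp, hv]
  refine (X.comp_congr (step_pos hv) q rfl _ (by rw [← step_pos hv]; exact h)).trans ?_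
  refine Eq.trans ?_ (X.comp_congr rfl q (post_pos hf).symm (by rw [← post_pos hf]; exact h') h')
  rw [X.comp_act_left (plugUnit q) _ (Sum.inr ()) q rfl f h₂, X.assoc x q v () f hv h₂ hf h₄,
    X.act_act, X.comp_act_right unitPlug x q _ h₄]
  refine X.act_congr ?_ rfl
  rintro (x | ⟨_, x⟩ | x)
  exacts [rfl, (x rfl).elim, rfl]

theorem post_one (u : X.Arr Unit true) (A : O) (h : X.src u () = A) :
    X.post (b := true) u (X.one A) = u := by
  rw [post_pos (by rw [X.tgt_one, h]), X.comp_one, X.act_act]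
  exact X.act_self (fun _ => rfl) _

theorem step_one (u : X.Arr Unit true) (A : O) (h : X.tgt u = A) :
    X.step (X.one A) () u = u := by
  rw [step_pos (by rw [X.src_one, h]), X.one_comp, X.act_act]
  exact X.act_self (fun _ => rfl) _

theorem substNe_unit (x : X.Arr Unit b) (u : Unit → X.Arr Unit true) : X.substNe () x u = x := by
  have : (Set.toFinite {p : Unit | p ≠ ()}).toFinset = ∅ := by
    ext p; simp
  unfold substNe
  rw [this, substOn_empty]

theorem substAll_one (u : Unit → X.Arr Unit true) (A : O) (h : X.tgt (u ()) = A) :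
    X.substAll (X.one A) u = u () := by
  rw [substAll_eq_step (), substNe_unit, step_one _ _ h]

variable {Y : CoSub.{u, w} O} (F : X.Hom Y)

theorem Hom.arr_step (x : X.Arr κ b) (p : κ) (u : X.Arr Unit true) :
    F.arr (X.step x p u) = Y.step (F.arr x) p (F.arr u) := by
  by_cases h : X.src x p = X.tgt u
  · rw [step_pos h, F.arr_act, F.arr_comp _ _ _ _ (by rw [F.src_arr, F.tgt_arr, h]), step_pos]
  · rw [step_neg h, step_neg (by rwa [F.src_arr, F.tgt_arr])]

theorem Hom.arr_substOn (S : Finset κ) (x : X.Arr κ b) (u : κ → X.Arr Unit true) :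
    F.arr (X.substOn S x u) = Y.substOn S (F.arr x) (fun p => F.arr (u p)) := by
  induction S using Finset.cons_induction with
  | empty => rfl
  | cons p S hp ih => rw [substOn_cons, substOn_cons, F.arr_step, ih]

theorem Hom.arr_substAll (x : X.Arr κ b) (u : κ → X.Arr Unit true) :
    F.arr (X.substAll x u) = Y.substAll (F.arr x) (fun p => F.arr (u p)) := F.arr_substOn _ _ _

theorem Hom.arr_substNe (q : κ) (x : X.Arr κ b) (u : κ → X.Arr Unit true) :
    F.arr (X.substNe q x u) = Y.substNe q (F.arr x) (fun p => F.arr (u p)) := F.arr_substOn _ _ _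

theorem Hom.arr_post (v : Cod (X.Arr Unit true) b) (f : X.Arr κ b) :
    F.arr (X.post v f) = Y.post (Cod.map F.arr v) (F.arr f) := by
  cases b with
  | false => rfl
  | true =>
    by_cases h : X.src v () = X.tgt f
    · have h' : Y.src (F.arr v) () = Y.tgt (F.arr f) := by rw [F.src_arr, F.tgt_arr, h]
      rw [post_pos h, F.arr_act, F.arr_comp _ _ _ _ h']
      exact (post_pos h').symm
    · rw [post_neg h]
      have h' : ¬ Y.src (F.arr (b := true) v) () = Y.tgt (F.arr f) := by rwa [F.src_arr, F.tgt_arr]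
      exact (post_neg h').symm

end CoSub

/-- A co-subunary 2-polycategory, i.e. a 2-multicategory (`b = true`) with a 2-presheaf
(`b = false`): there are, with the same objects, co-subunary polycategories of 1-cells and of 2-cells,
and the operations of the categories of 1-cells and 2-cells, namely domains, codomains, identities and
vertical composites, are compatible with the polycategorical operations. -/
structure CoSub2 where
  Obj : Type u
  /-- 1-cells -/
  one : CoSub.{u, v} Obj
  /-- 2-cells -/
  two : CoSub.{u, w} Obj
  dom : two.Hom one
  cod : two.Hom one
  /-- Identity 2-cells. -/
  idc : one.Hom two
  /-- The composite of `θ` followed by `η`. -/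
  vcomp : ∀ {ι : Type} [Finite ι] {b : Bool} (θ η : two.Arr ι b), cod.arr θ = dom.arr η → two.Arr ι b
  dom_idc : ∀ {ι : Type} [Finite ι] {b : Bool} (f : one.Arr ι b), dom.arr (idc.arr f) = f
  cod_idc : ∀ {ι : Type} [Finite ι] {b : Bool} (f : one.Arr ι b), cod.arr (idc.arr f) = f
  dom_vcomp : ∀ {ι : Type} [Finite ι] {b : Bool} (θ η : two.Arr ι b) (h : cod.arr θ = dom.arr η),
    dom.arr (vcomp θ η h) = dom.arr θ
  cod_vcomp : ∀ {ι : Type} [Finite ι] {b : Bool} (θ η : two.Arr ι b) (h : cod.arr θ = dom.arr η),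
    cod.arr (vcomp θ η h) = cod.arr η
  id_vcomp : ∀ {ι : Type} [Finite ι] {b : Bool} (f : one.Arr ι b) (θ : two.Arr ι b)
    (h : cod.arr (idc.arr f) = dom.arr θ), vcomp (idc.arr f) θ h = θ
  vcomp_id : ∀ {ι : Type} [Finite ι] {b : Bool} (f : one.Arr ι b) (θ : two.Arr ι b)
    (h : cod.arr θ = dom.arr (idc.arr f)), vcomp θ (idc.arr f) h = θ
  vcomp_assoc : ∀ {ι : Type} [Finite ι] {b : Bool} (θ η ζ : two.Arr ι b)
    (h₁ : cod.arr θ = dom.arr η) (h₂ : cod.arr (vcomp θ η h₁) = dom.arr ζ)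
    (h₃ : cod.arr η = dom.arr ζ) (h₄ : cod.arr θ = dom.arr (vcomp η ζ h₃)),
    vcomp (vcomp θ η h₁) ζ h₂ = vcomp θ (vcomp η ζ h₃) h₄
  act_vcomp : ∀ {ι κ : Type} [Finite ι] [Finite κ] {b : Bool} (σ : ι ≃ κ) (θ η : two.Arr ι b)
    (h : cod.arr θ = dom.arr η) (h' : cod.arr (two.act σ θ) = dom.arr (two.act σ η)),
    two.act σ (vcomp θ η h) = vcomp (two.act σ θ) (two.act σ η) h'
  comp_vcomp : ∀ {ι κ : Type} [Finite ι] [Finite κ] {b : Bool} (θ η : two.Arr κ b) (q : κ)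
    (θ' η' : two.Arr ι true) (h₁ : cod.arr θ = dom.arr η) (h₂ : cod.arr θ' = dom.arr η')
    (h₃ : two.src (vcomp θ η h₁) q = two.tgt (vcomp θ' η' h₂)) (h₄ : two.src θ q = two.tgt θ')
    (h₅ : two.src η q = two.tgt η') (h₆ : cod.arr (two.comp θ q θ' h₄) = dom.arr (two.comp η q η' h₅)),
    two.comp (vcomp θ η h₁) q (vcomp θ' η' h₂) h₃ =
      vcomp (two.comp θ q θ' h₄) (two.comp η q η' h₅) h₆

namespace CoSub2

open CoSub

variable (D : CoSub2.{u, v, w}) {ι κ μ : Type} [Finite ι] [Finite κ] [Finite μ] {b : Bool}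

theorem vcomp_congr {θ θ' η η' : D.two.Arr ι b} (hθ : θ = θ') (hη : η = η') (h h') :
    D.vcomp θ η h = D.vcomp θ' η' h' := by
  subst hθ hη; rfl

theorem map_dom_idc (v : Cod (D.one.Arr Unit true) b) :
    Cod.map D.dom.arr (Cod.map D.idc.arr v) = v := by
  cases b with
  | false => rfl
  | true => exact D.dom_idc v

theorem map_cod_idc (v : Cod (D.one.Arr Unit true) b) :
    Cod.map D.cod.arr (Cod.map D.idc.arr v) = v := by
  cases b with
  | false => rfl
  | true => exact D.cod_idc v

theorem src_vcomp (θ η : D.two.Arr ι b) (h) (i : ι) : D.two.src (D.vcomp θ η h) i = D.two.src θ i := by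
  rw [← D.dom.src_arr, D.dom_vcomp, D.dom.src_arr]

theorem tgt_vcomp (θ η : D.two.Arr ι b) (h) : D.two.tgt (D.vcomp θ η h) = D.two.tgt θ := by
  rw [← D.dom.tgt_arr, D.dom_vcomp, D.dom.tgt_arr]

theorem src_eq_of_cod_eq_dom {θ η : D.two.Arr ι b} (h : D.cod.arr θ = D.dom.arr η) (i : ι) :
    D.two.src θ i = D.two.src η i := by
  rw [← D.cod.src_arr, h, D.dom.src_arr]

theorem tgt_eq_of_cod_eq_dom {θ η : D.two.Arr ι b} (h : D.cod.arr θ = D.dom.arr η) :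
    D.two.tgt θ = D.two.tgt η := by
  rw [← D.cod.tgt_arr, h, D.dom.tgt_arr]

/-- Whiskering at an input. -/
theorem comp_vcomp_left (θ η : D.two.Arr κ b) (q : κ) (f : D.one.Arr ι true) (h₁ h₃ h₄ h₅ h₆) :
    D.two.comp (D.vcomp θ η h₁) q (D.idc.arr f) h₃ =
      D.vcomp (D.two.comp θ q (D.idc.arr f) h₄) (D.two.comp η q (D.idc.arr f) h₅) h₆ := by
  have h₂ : D.cod.arr (D.idc.arr f) = D.dom.arr (D.idc.arr f) := by rw [D.cod_idc, D.dom_idc]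
  rw [← D.comp_vcomp θ η q (D.idc.arr f) (D.idc.arr f) h₁ h₂ (by rw [D.id_vcomp]; exact h₃)]
  exact D.two.comp_congr rfl q (D.id_vcomp _ _ _).symm _ _

theorem comp_vcomp_right (g : D.one.Arr κ b) (q : κ) (θ η : D.two.Arr ι true) (h₁ h₃ h₄ h₅ h₆) :
    D.two.comp (D.idc.arr g) q (D.vcomp θ η h₁) h₃ =
      D.vcomp (D.two.comp (D.idc.arr g) q θ h₄) (D.two.comp (D.idc.arr g) q η h₅) h₆ := by
  have h₂ : D.cod.arr (D.idc.arr g) = D.dom.arr (D.idc.arr g) := by rw [D.cod_idc, D.dom_idc]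
  rw [← D.comp_vcomp (D.idc.arr g) (D.idc.arr g) q θ η h₂ h₁ (by rw [D.id_vcomp]; exact h₃)]
  exact D.two.comp_congr (D.id_vcomp _ _ _).symm q rfl _ _

theorem dom_comp (θ : D.two.Arr κ b) (q : κ) (η : D.two.Arr ι true) (h h') :
    D.dom.arr (D.two.comp θ q η h) = D.one.comp (D.dom.arr θ) q (D.dom.arr η) h' :=
  D.dom.arr_comp _ _ _ _ _

theorem cod_comp (θ : D.two.Arr κ b) (q : κ) (η : D.two.Arr ι true) (h h') :
    D.cod.arr (D.two.comp θ q η h) = D.one.comp (D.cod.arr θ) q (D.cod.arr η) h' :=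
  D.cod.arr_comp _ _ _ _ _

theorem step_vcomp (θ η : D.two.Arr κ b) (p : κ) (f : D.one.Arr Unit true) (h h') :
    D.two.step (D.vcomp θ η h) p (D.idc.arr f) =
      D.vcomp (D.two.step θ p (D.idc.arr f)) (D.two.step η p (D.idc.arr f)) h' := by
  have e := D.src_eq_of_cod_eq_dom h p
  by_cases hp : D.two.src θ p = D.two.tgt (D.idc.arr f)
  · have hp' : D.two.src η p = D.two.tgt (D.idc.arr f) := by rw [← e, hp]
    have h₆ : D.cod.arr (D.two.comp θ p (D.idc.arr f) hp) =
        D.dom.arr (D.two.comp η p (D.idc.arr f) hp') := by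
      rw [D.cod_comp _ _ _ _ (by rw [D.cod.src_arr, D.cod.tgt_arr, hp]),
        D.dom_comp _ _ _ _ (by rw [D.dom.src_arr, D.dom.tgt_arr, hp'])]
      exact D.one.comp_congr h _ (by rw [D.cod_idc, D.dom_idc]) _ _
    rw [step_pos (by rw [D.src_vcomp, hp]), D.comp_vcomp_left _ _ _ _ _ _ hp hp' h₆,
      D.act_vcomp _ _ _ _ (by rw [D.cod.arr_act, D.dom.arr_act, h₆])]
    exact D.vcomp_congr (step_pos hp).symm (step_pos hp').symm _ _
  · rw [step_neg (by rwa [D.src_vcomp])]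
    exact D.vcomp_congr (step_neg hp).symm (step_neg (by rwa [← e])).symm _ _

theorem substOn_vcomp (S : Finset κ) (θ η : D.two.Arr κ b) (f : κ → D.one.Arr Unit true) (h h') :
    D.two.substOn S (D.vcomp θ η h) (fun p => D.idc.arr (f p)) =
      D.vcomp (D.two.substOn S θ fun p => D.idc.arr (f p))
        (D.two.substOn S η fun p => D.idc.arr (f p)) h' := by
  induction S using Finset.cons_induction with
  | empty => rfl
  | cons p S hp ih =>
    have h'' : D.cod.arr (D.two.substOn S θ fun p => D.idc.arr (f p)) =
        D.dom.arr (D.two.substOn S η fun p => D.idc.arr (f p)) := by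
      rw [D.cod.arr_substOn, D.dom.arr_substOn, h]
      simp only [D.dom_idc, D.cod_idc]
    rw [substOn_cons, ih h'', D.step_vcomp _ _ _ _ _ (by
      rw [D.cod.arr_step, D.dom.arr_step, h'', D.cod_idc, D.dom_idc])]
    exact D.vcomp_congr (substOn_cons hp _ _).symm (substOn_cons hp _ _).symm _ _

theorem post_vcomp (v : Cod (D.one.Arr Unit true) b) (θ η : D.two.Arr κ b) (h h') :
    D.two.post (Cod.map D.idc.arr v) (D.vcomp θ η h) =
      D.vcomp (D.two.post (Cod.map D.idc.arr v) θ) (D.two.post (Cod.map D.idc.arr v) η) h' := by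
  cases b with
  | false => rfl
  | true =>
    have e := D.tgt_eq_of_cod_eq_dom h
    by_cases hv : D.two.src (D.idc.arr (b := true) v) () = D.two.tgt θ
    · have hv' : D.two.src (D.idc.arr (b := true) v) () = D.two.tgt η := by rw [← e, hv]
      have h₆ : D.cod.arr (D.two.comp (D.idc.arr v) () θ hv) =
          D.dom.arr (D.two.comp (D.idc.arr v) () η hv') := by
        rw [D.cod_comp _ _ _ _ (by rw [D.cod.src_arr, D.cod.tgt_arr, hv]),
          D.dom_comp _ _ _ _ (by rw [D.dom.src_arr, D.dom.tgt_arr, hv'])]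
        exact D.one.comp_congr (by rw [D.cod_idc, D.dom_idc]) _ h _ _
      refine (post_pos (v := D.idc.arr (b := true) v) (hv.trans (D.tgt_vcomp _ _ h).symm)).trans ?_
      rw [D.comp_vcomp_right v () θ η h _ hv hv' h₆,
        D.act_vcomp _ _ _ _ (by rw [D.cod.arr_act, D.dom.arr_act, h₆])]
      exact D.vcomp_congr (post_pos hv).symm (post_pos hv').symm _ _
    · refine (post_neg (v := D.idc.arr (b := true) v)
        (fun k => hv (k.trans (D.tgt_vcomp _ _ h)))).trans ?_
      exact D.vcomp_congr (post_neg hv).symm (post_neg (by rwa [← e])).symm _ _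

/-- A square, i.e. a 2-cell `k ∘ f ⟹ g ∘ (h₁, …, h_m)` where `f = top`, `g = bot`, `h = left` and
`k = right` (which is absent if `b = false`). -/
@[ext]
structure Square (ι : Type) [Finite ι] (b : Bool) where
  top : D.one.Arr ι b
  bot : D.one.Arr ι b
  left : ι → D.one.Arr Unit true
  right : Cod (D.one.Arr Unit true) b
  src_left : ∀ i, D.one.src (left i) () = D.one.src top i
  tgt_left : ∀ i, D.one.tgt (left i) = D.one.src bot i
  src_right : Cod.map (fun k => D.one.src k ()) right = D.one.tgt top
  tgt_right : Cod.map D.one.tgt right = D.one.tgt bot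
  cell : D.two.Arr ι b
  dom_cell : D.dom.arr cell = D.one.post right top
  cod_cell : D.cod.arr cell = D.one.substAll bot left

variable {D}

namespace Square

theorem src_cell (x : D.Square ι b) (i : ι) : D.two.src x.cell i = D.one.src x.top i := by
  rw [← D.dom.src_arr, x.dom_cell, src_post]

theorem tgt_cell (x : D.Square ι b) : D.two.tgt x.cell = D.one.tgt x.bot := by
  rw [← D.cod.tgt_arr, x.cod_cell, tgt_substAll]

/-- The symmetric action on squares. -/
noncomputable def act (σ : ι ≃ κ) (x : D.Square ι b) : D.Square κ b where
  top := D.one.act σ x.top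
  bot := D.one.act σ x.bot
  left i := x.left (σ.symm i)
  right := x.right
  src_left i := by rw [D.one.src_act', x.src_left]
  tgt_left i := by rw [D.one.src_act', x.tgt_left]
  src_right := by rw [D.one.tgt_act, x.src_right]
  tgt_right := by rw [D.one.tgt_act, x.tgt_right]
  cell := D.two.act σ x.cell
  dom_cell := by rw [D.dom.arr_act, x.dom_cell, post_act]
  cod_cell := by
    rw [D.cod.arr_act, x.cod_cell, ← act_substAll]
    congr 2
    funext i
    simp

/-- The identity square of a vertical arrow. -/
noncomputable def one (u : D.one.Arr Unit true) : D.Square Unit true where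
  top := D.one.one (D.one.src u ())
  bot := D.one.one (D.one.tgt u)
  left _ := u
  right := u
  src_left _ := (D.one.src_one _ _).symm
  tgt_left _ := (D.one.src_one _ _).symm
  src_right := (D.one.tgt_one _).symm
  tgt_right := (D.one.tgt_one _).symm
  cell := D.idc.arr u
  dom_cell := by rw [D.dom_idc, post_one _ _ rfl]
  cod_cell := (D.cod_idc u).trans (substAll_one (fun _ => u) _ rfl).symm

theorem comp_top (x : D.Square κ b) (q : κ) (y : D.Square ι true) (h : x.left q = y.right) :
    D.one.src x.top q = D.one.tgt y.top := by
  rw [← x.src_left, h]; exact y.src_right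

theorem comp_bot (x : D.Square κ b) (q : κ) (y : D.Square ι true) (h : x.left q = y.right) :
    D.one.src x.bot q = D.one.tgt y.bot := by
  rw [← x.tgt_left, h]; exact y.tgt_right

theorem comp_cell₁ (x : D.Square κ b) (q : κ) (y : D.Square ι true) (h : x.left q = y.right) :
    D.two.src x.cell q = D.two.tgt (D.idc.arr y.top) := by
  rw [x.src_cell, D.idc.tgt_arr, comp_top x q y h]

theorem comp_cell₂ (x : D.Square κ b) (q : κ) (y : D.Square ι true) (h : x.left q = y.right) :
    D.two.src (D.idc.arr (D.one.substNe q x.bot x.left)) q = D.two.tgt y.cell := by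
  rw [y.tgt_cell, D.idc.src_arr, src_substNe_self, comp_bot x q y h]

theorem comp_substNe_post (f : D.one.Arr κ b) (l : κ → D.one.Arr Unit true) (q : κ)
    (g : D.one.Arr ι true) (r : D.one.Arr Unit true) (hl : l q = r)
    (hf : D.one.src f q = D.one.tgt (l q)) (hg : D.one.src r () = D.one.tgt g) (h h') :
    D.one.comp (D.one.substNe q f l) q (D.one.post (b := true) r g) h =
      D.one.comp (D.one.substAll f l) q g h' := by
  subst hl
  rw [← D.one.comp_congr (substAll_eq_step q f l).symm q (f := g) rfl
    (by rw [← substAll_eq_step]; exact h') h']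
  rw [comp_step _ _ _ _ _ hg _ h]
  rw [src_substNe_self, hf]

theorem comp_cells (x : D.Square κ b) (q : κ) (y : D.Square ι true) (h : x.left q = y.right) :
    D.cod.arr (D.two.comp x.cell q (D.idc.arr y.top) (comp_cell₁ x q y h)) =
      D.dom.arr (D.two.comp (D.idc.arr (D.one.substNe q x.bot x.left)) q y.cell
        (comp_cell₂ x q y h)) := by
  have h₁ := comp_cell₁ x q y h
  have h₂ := comp_cell₂ x q y h
  have k₁ : D.one.src (D.one.substAll x.bot x.left) q = D.one.tgt y.top := by
    rw [src_substAll _ _ (x.tgt_left q).symm, x.src_left, comp_top x q y h]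
  rw [D.cod_comp _ _ _ _ (by rwa [x.cod_cell, D.cod_idc]),
    D.dom_comp _ _ _ _ (by rwa [D.dom.src_arr, D.dom.tgt_arr])]
  refine (D.one.comp_congr x.cod_cell q (D.cod_idc _) _ k₁).trans ?_
  refine Eq.trans ?_ (D.one.comp_congr (D.dom_idc _).symm q y.dom_cell.symm
    (by rw [src_substNe_self, tgt_post y.src_right, comp_bot x q y h]; exact y.tgt_right.symm) _)
  exact (comp_substNe_post x.bot x.left q y.top y.right h (x.tgt_left q).symm y.src_right _ _).symm

/-- The composite of squares along a common vertical arrow. -/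
noncomputable def comp (x : D.Square κ b) (q : κ) (y : D.Square ι true) (h : x.left q = y.right) :
    D.Square ({p // p ≠ q} ⊕ ι) b where
  top := D.one.comp x.top q y.top (comp_top x q y h)
  bot := D.one.comp x.bot q y.bot (comp_bot x q y h)
  left := Sum.elim (fun p => x.left p.1) y.left
  right := x.right
  src_left := by
    rintro (p | i)
    · rw [D.one.src_comp_inl]; exact x.src_left p.1
    · rw [D.one.src_comp_inr]; exact y.src_left i
  tgt_left := by
    rintro (p | i)
    · rw [D.one.src_comp_inl]; exact x.tgt_left p.1
    · rw [D.one.src_comp_inr]; exact y.tgt_left i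
  src_right := by rw [D.one.tgt_comp, x.src_right]
  tgt_right := by rw [D.one.tgt_comp, x.tgt_right]
  cell := D.vcomp (D.two.comp x.cell q (D.idc.arr y.top) (comp_cell₁ x q y h))
    (D.two.comp (D.idc.arr (D.one.substNe q x.bot x.left)) q y.cell (comp_cell₂ x q y h))
    (comp_cells x q y h)
  dom_cell := by
    have h₁ := comp_top x q y h
    rw [D.dom_vcomp, D.dom_comp _ _ _ _ (by rwa [x.dom_cell, src_post, D.dom_idc]),
      post_comp _ _ _ _ _ (by rwa [src_post])]
    exact D.one.comp_congr x.dom_cell _ (D.dom_idc _) _ _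
  cod_cell := by
    have h₁ := comp_bot x q y h
    have h₂ : D.one.src (D.one.substNe q x.bot x.left) q = D.one.tgt (D.one.substAll y.bot y.left) := by
      rwa [tgt_substAll, src_substNe_self]
    rw [D.cod_vcomp, D.cod_comp _ _ _ _ (by rwa [y.cod_cell, D.cod_idc]),
      substAll_comp _ _ _ _ (Sum.elim (fun p => x.left p.1) y.left) x.left (fun _ => rfl) h₂]
    exact D.one.comp_congr (D.cod_idc _) _ y.cod_cell _ _

theorem ext' {x y : D.Square ι b} (h₁ : x.top = y.top) (h₂ : x.bot = y.bot)
    (h₃ : ∀ i, x.left i = y.left i) (h₄ : x.right = y.right) (h₅ : x.cell = y.cell) : x = y :=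
  Square.ext h₁ h₂ (funext h₃) h₄ h₅

theorem one_comp (u : D.one.Arr Unit true) (y : D.Square ι true) (h : (one u).left () = y.right) :
    comp (one u) () y h = act unitPlug.symm y := by
  have h' : u = y.right := h
  refine ext' ?_ ?_ ?_ h' ?_
  · exact D.one.one_comp (D.one.src u ()) y.top _
  · exact D.one.one_comp (D.one.tgt u) y.bot _
  · rintro (⟨_, x⟩ | i)
    exacts [(x rfl).elim, rfl]
  · have e : D.two.comp (D.two.one (D.one.tgt u)) () y.cell (by
        rw [D.two.src_one, y.tgt_cell, h']; exact y.tgt_right) = D.two.act unitPlug.symm y.cell :=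
      D.two.one_comp _ _ _
    have e₁ : D.one.src u () = D.one.tgt y.top := by rw [h']; exact y.src_right
    have e₂ : D.two.comp (D.idc.arr u) () (D.idc.arr y.top) (by
        rwa [D.idc.src_arr, D.idc.tgt_arr]) = D.idc.arr (D.one.comp u () y.top e₁) :=
      (D.idc.arr_comp _ _ _ _ _).symm
    have e₃ : D.idc.arr (D.one.substNe () (D.one.one (D.one.tgt u)) fun _ => u) =
        D.two.one (D.one.tgt u) := by rw [substNe_unit, D.idc.arr_one]
    have e₄ : D.cod.arr (D.idc.arr (D.one.comp u () y.top e₁)) =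
        D.dom.arr (D.two.act unitPlug.symm y.cell) := by
      rw [D.cod_idc, D.dom.arr_act, y.dom_cell]
      subst h'
      rw [post_pos e₁, D.one.act_act, D.one.act_self]
      exact fun i => unitPlug.symm_apply_apply i
    refine Eq.trans ?_ (D.id_vcomp _ _ e₄)
    exact D.vcomp_congr e₂ ((D.two.comp_congr e₃ () rfl _ _).trans e) _ _

theorem comp_one (x : D.Square κ b) (q : κ) (u : D.one.Arr Unit true) (h : x.left q = (one u).right) :
    comp x q (one u) h = act (plugUnit q).symm x := by
  have h' : x.left q = u := h
  subst h'
  refine ext' ?_ ?_ ?_ rfl ?_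
  · exact D.one.comp_one x.top q (D.one.src (x.left q) ()) _
  · exact D.one.comp_one x.bot q (D.one.tgt (x.left q)) _
  · rintro (i | i) <;> rfl
  · have e₀ : D.two.src x.cell q = D.two.tgt (D.two.one (D.one.src (x.left q) ())) := by
      rw [x.src_cell, D.two.tgt_one, x.src_left]
    have e₁ := D.two.comp_one x.cell q (D.one.src (x.left q) ()) e₀
    have e₂ : D.one.src (D.one.substNe q x.bot x.left) q = D.one.tgt (x.left q) := by
      rw [src_substNe_self, x.tgt_left]
    have e₃ : D.two.comp (D.idc.arr (D.one.substNe q x.bot x.left)) q (D.idc.arr (x.left q))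
        (by rwa [D.idc.src_arr, D.idc.tgt_arr]) = D.idc.arr (D.one.comp _ q _ e₂) :=
      (D.idc.arr_comp _ _ _ _ _).symm
    have e₄ : D.cod.arr (D.two.act (plugUnit q).symm x.cell) =
        D.dom.arr (D.idc.arr (D.one.comp (D.one.substNe q x.bot x.left) q _ e₂)) := by
      rw [D.dom_idc, D.cod.arr_act, x.cod_cell, substAll_eq_step q, step_pos e₂, D.one.act_act,
        D.one.act_self]
      exact fun i => (plugUnit q).symm_apply_apply i
    refine Eq.trans ?_ (D.vcomp_id _ _ e₄)
    exact D.vcomp_congr ((D.two.comp_congr rfl q (D.idc.arr_one _) _ e₀).trans e₁) e₃ _ _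

theorem equivariance {ι' κ' : Type} [Finite ι'] [Finite κ'] (σ : κ ≃ κ') (τ : ι ≃ ι')
    (x : D.Square κ b) (q : κ) (q' : κ') (hq : σ q = q') (y : D.Square ι true)
    (h : x.left q = y.right) (h' : (act σ x).left q' = (act τ y).right) :
    comp (act σ x) q' (act τ y) h' = act ((neEquiv σ hq).sumCongr τ) (comp x q y h) := by
  subst hq
  refine ext' ?_ ?_ ?_ rfl ?_
  · exact D.one.equivariance σ τ _ _ _ rfl _ _ _
  · exact D.one.equivariance σ τ _ _ _ rfl _ _ _
  · rintro (i | i) <;> rfl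
  · have k₁ : D.two.src (D.two.act σ x.cell) (σ q) = D.two.tgt (D.two.act τ (D.idc.arr y.top)) := by
      rw [D.two.src_act, D.two.tgt_act]; exact comp_cell₁ x q y h
    have e₁ := D.two.equivariance σ τ x.cell q _ rfl (D.idc.arr y.top) (comp_cell₁ x q y h) k₁
    have k₂ : D.two.src (D.two.act σ (D.idc.arr (D.one.substNe q x.bot x.left))) (σ q) =
        D.two.tgt (D.two.act τ y.cell) := by
      rw [D.two.src_act, D.two.tgt_act]; exact comp_cell₂ x q y h
    have e₂ := D.two.equivariance σ τ (D.idc.arr (D.one.substNe q x.bot x.left)) q _ rfl y.cell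
      (comp_cell₂ x q y h) k₂
    have e₃ : D.idc.arr (D.one.substNe (σ q) (D.one.act σ x.bot) fun i => x.left (σ.symm i)) =
        D.two.act σ (D.idc.arr (D.one.substNe q x.bot x.left)) := by
      rw [← D.idc.arr_act, ← act_substNe]
      congr 3
      funext i
      simp
    have k₃ := comp_cells x q y h
    refine Eq.trans ?_ (D.act_vcomp _ _ _ k₃ (by rw [D.cod.arr_act, k₃, D.dom.arr_act])).symm
    exact D.vcomp_congr ((D.two.comp_congr rfl _ (D.idc.arr_act _ _) _ k₁).trans e₁)
      ((D.two.comp_congr e₃ _ rfl _ k₂).trans e₂) _ _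

theorem substNe_comp_inr' (x : D.Square μ b) (r : μ) (y : D.Square κ true) (q : κ)
    (h : x.left r = y.right) (h' h'') :
    D.one.substNe (Sum.inr q) (D.one.comp x.bot r y.bot h') (comp x r y h).left =
      D.one.comp (D.one.substNe r x.bot x.left) r (D.one.substNe q y.bot y.left) h'' :=
  substNe_comp_inr x.bot r y.bot _ q _ x.left (fun _ => rfl) _

theorem assoc (x : D.Square μ b) (r : μ) (y : D.Square κ true) (q : κ)
    (z : D.Square ι true) (h₁ : x.left r = y.right) (h₂ : (comp x r y h₁).left (Sum.inr q) = z.right)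
    (h₃ : y.left q = z.right) (h₄ : x.left r = (comp y q z h₃).right) :
    comp (comp x r y h₁) (Sum.inr q) z h₂ =
      act (plugInr (Equiv.refl _)).symm (comp x r (comp y q z h₃) h₄) := by
  have t₁ := comp_top x r y h₁
  have t₂ := comp_top y q z h₃
  have b₁ := comp_bot x r y h₁
  have b₂ := comp_bot y q z h₃
  refine ext' ?_ ?_ ?_ rfl ?_
  · exact D.one.assoc _ _ _ _ _ _ _ _ _
  · exact D.one.assoc _ _ _ _ _ _ _ _ _
  · rintro (⟨i | i, hi⟩ | i) <;> rfl
  · -- all three composable 2-cells, written with composites of two different shapes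
    have s₁ := comp_cell₁ x r y h₁
    have s₂ := comp_cell₂ x r y h₁
    have s₃ := comp_cell₁ y q z h₃
    have s₄ := comp_cell₂ y q z h₃
    have d₁ : D.one.src (D.one.substNe r x.bot x.left) r = D.one.tgt (D.one.substNe q y.bot y.left) := by
      rw [src_substNe_self, tgt_substNe, b₁]
    have i₁ : D.two.src (D.two.comp x.cell r (D.idc.arr y.top) s₁) (Sum.inr q) =
        D.two.tgt (D.idc.arr z.top) := by
      rw [D.two.src_comp_inr, D.idc.src_arr, D.idc.tgt_arr, t₂]
    have i₂ : D.two.src (D.two.comp (D.idc.arr (D.one.substNe r x.bot x.left)) r y.cell s₂)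
        (Sum.inr q) = D.two.tgt (D.idc.arr z.top) := by
      rw [D.two.src_comp_inr, s₃]
    have i₃ : D.two.src (D.two.comp (D.idc.arr (D.one.substNe r x.bot x.left)) r
        (D.idc.arr (D.one.substNe q y.bot y.left)) (by rwa [D.idc.src_arr, D.idc.tgt_arr]))
        (Sum.inr q) = D.two.tgt z.cell := by
      rw [D.two.src_comp_inr, s₄]
    have j₁ : D.two.src x.cell r = D.two.tgt (D.two.comp (D.idc.arr y.top) q (D.idc.arr z.top)
        (by rwa [D.idc.src_arr, D.idc.tgt_arr])) := by
      rw [D.two.tgt_comp, s₁]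
    have j₂ : D.two.src (D.idc.arr (D.one.substNe r x.bot x.left)) r =
        D.two.tgt (D.two.comp y.cell q (D.idc.arr z.top) s₃) := by
      rw [D.two.tgt_comp, s₂]
    have j₃ : D.two.src (D.idc.arr (D.one.substNe r x.bot x.left)) r =
        D.two.tgt (D.two.comp (D.idc.arr (D.one.substNe q y.bot y.left)) q z.cell s₄) := by
      rw [D.two.tgt_comp, D.idc.src_arr, D.idc.tgt_arr, d₁]
    have a₁ := D.two.assoc x.cell r (D.idc.arr y.top) q (D.idc.arr z.top) s₁ i₁
      (by rwa [D.idc.src_arr, D.idc.tgt_arr]) j₁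
    have a₂ := D.two.assoc (D.idc.arr (D.one.substNe r x.bot x.left)) r y.cell q
      (D.idc.arr z.top) s₂ i₂ s₃ j₂
    have a₃ := D.two.assoc (D.idc.arr (D.one.substNe r x.bot x.left)) r
      (D.idc.arr (D.one.substNe q y.bot y.left)) q z.cell
      (by rwa [D.idc.src_arr, D.idc.tgt_arr]) i₃ s₄ j₃
    have c₁ := comp_cells x r y h₁
    have c₂ := comp_cells y q z h₃
    have c₃ := comp_cells (comp x r y h₁) (Sum.inr q) z h₂
    have c₄ := comp_cells x r (comp y q z h₃) h₄
    -- the left side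
    have l₀ : D.cod.arr (D.two.comp (D.two.comp x.cell r (D.idc.arr y.top) s₁) (Sum.inr q)
        (D.idc.arr z.top) i₁) = D.dom.arr (D.two.comp (D.two.comp
          (D.idc.arr (D.one.substNe r x.bot x.left)) r y.cell s₂) (Sum.inr q)
        (D.idc.arr z.top) i₂) := by
      rw [D.cod_comp _ _ _ _ (by rw [D.cod.src_arr, D.cod.tgt_arr, i₁]),
        D.dom_comp _ _ _ _ (by rw [D.dom.src_arr, D.dom.tgt_arr, i₂])]
      exact D.one.comp_congr c₁ _ (by rw [D.cod_idc, D.dom_idc]) _ _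
    have l₁ := D.comp_vcomp_left (D.two.comp x.cell r (D.idc.arr y.top) s₁)
      (D.two.comp (D.idc.arr (D.one.substNe r x.bot x.left)) r y.cell s₂) (Sum.inr q) z.top c₁
      (comp_cell₁ (comp x r y h₁) (Sum.inr q) z h₂) i₁ i₂ l₀
    have l₂ : D.idc.arr (D.one.substNe (Sum.inr q) (comp x r y h₁).bot (comp x r y h₁).left) =
        D.two.comp (D.idc.arr (D.one.substNe r x.bot x.left)) r
        (D.idc.arr (D.one.substNe q y.bot y.left)) (by rwa [D.idc.src_arr, D.idc.tgt_arr]) :=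
      (congrArg D.idc.arr (substNe_comp_inr' x r y q h₁ b₁ d₁)).trans (D.idc.arr_comp _ _ _ _ _)
    have l₃ := D.two.comp_congr l₂ (Sum.inr q) (rfl : z.cell = z.cell)
      (comp_cell₂ (comp x r y h₁) (Sum.inr q) z h₂) i₃
    -- the right side
    have r₀ : D.cod.arr (D.two.comp (D.idc.arr (D.one.substNe r x.bot x.left)) r
        (D.two.comp y.cell q (D.idc.arr z.top) s₃) j₂) = D.dom.arr (D.two.comp
          (D.idc.arr (D.one.substNe r x.bot x.left)) r
        (D.two.comp (D.idc.arr (D.one.substNe q y.bot y.left)) q z.cell s₄) j₃) := by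
      rw [D.cod_comp _ _ _ _ (by rw [D.cod.src_arr, D.cod.tgt_arr, j₂]),
        D.dom_comp _ _ _ _ (by rw [D.dom.src_arr, D.dom.tgt_arr, j₃])]
      exact D.one.comp_congr (by rw [D.cod_idc, D.dom_idc]) _ c₂ _ _
    have r₁ := D.comp_vcomp_right (D.one.substNe r x.bot x.left) r
      (D.two.comp y.cell q (D.idc.arr z.top) s₃)
      (D.two.comp (D.idc.arr (D.one.substNe q y.bot y.left)) q z.cell s₄) c₂
      (comp_cell₂ x r (comp y q z h₃) h₄) j₂ j₃ r₀
    have r₂ : D.two.comp x.cell r (D.idc.arr (comp y q z h₃).top)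
        (comp_cell₁ x r (comp y q z h₃) h₄) =
        D.two.comp x.cell r (D.two.comp (D.idc.arr y.top) q (D.idc.arr z.top)
        (by rwa [D.idc.src_arr, D.idc.tgt_arr])) j₁ :=
      D.two.comp_congr rfl r (D.idc.arr_comp _ _ _ _ _) _ _
    let σ : {p : {p : μ // p ≠ r} ⊕ κ // p ≠ Sum.inr q} ⊕ ι ≃
      {p : μ // p ≠ r} ⊕ ({p : κ // p ≠ q} ⊕ ι) := plugInr (Equiv.refl _)
    have v₁ : D.cod.arr (D.two.act σ.symm (D.two.comp x.cell r (D.two.comp (D.idc.arr y.top) q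
        (D.idc.arr z.top) (by rwa [D.idc.src_arr, D.idc.tgt_arr])) j₁)) =
        D.dom.arr (D.two.act σ.symm (D.two.comp (D.idc.arr (D.one.substNe r x.bot x.left)) r
        (D.two.comp y.cell q (D.idc.arr z.top) s₃) j₂)) := by
      rw [← a₁, ← a₂]; exact l₀
    have v₂ : D.cod.arr (D.two.act σ.symm (D.two.comp (D.idc.arr (D.one.substNe r x.bot x.left)) r
        (D.two.comp y.cell q (D.idc.arr z.top) s₃) j₂)) = D.dom.arr (D.two.act σ.symm (D.two.comp
          (D.idc.arr (D.one.substNe r x.bot x.left)) r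
        (D.two.comp (D.idc.arr (D.one.substNe q y.bot y.left)) q z.cell s₄) j₃)) := by
      rw [D.cod.arr_act, r₀, D.dom.arr_act]
    have lhs : (comp (comp x r y h₁) (Sum.inr q) z h₂).cell =
        D.vcomp (D.vcomp _ _ v₁) (D.two.act σ.symm (D.two.comp
          (D.idc.arr (D.one.substNe r x.bot x.left)) r
        (D.two.comp (D.idc.arr (D.one.substNe q y.bot y.left)) q z.cell s₄) j₃))
        (by rw [D.cod_vcomp]; exact v₂) :=
      D.vcomp_congr (l₁.trans (D.vcomp_congr a₁ a₂ _ _)) (l₃.trans a₃) _ _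
    have v₃ : D.cod.arr (D.two.act σ.symm (D.two.comp x.cell r (D.two.comp (D.idc.arr y.top) q
        (D.idc.arr z.top) (by rwa [D.idc.src_arr, D.idc.tgt_arr])) j₁)) =
        D.dom.arr (D.two.act σ.symm (D.vcomp _ _ r₀)) := by
      rw [D.act_vcomp _ _ _ _ v₂, D.dom_vcomp]; exact v₁
    have rhs : (act σ.symm (comp x r (comp y q z h₃) h₄)).cell =
        D.vcomp _ _ v₃ := by
      refine (D.act_vcomp _ _ _ c₄ (by rw [D.cod.arr_act, c₄, D.dom.arr_act])).trans ?_
      exact D.vcomp_congr (congrArg _ r₂) (congrArg _ r₁) _ _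
    refine lhs.trans (Eq.trans ?_ rhs.symm)
    rw [D.vcomp_assoc _ _ _ v₁ _ v₂ (by rw [D.dom_vcomp]; exact v₁)]
    exact D.vcomp_congr rfl (D.act_vcomp _ _ _ _ _).symm _ _

theorem exchange_aux (x : D.Square μ b) (r s : μ) (hrs : r ≠ s) (y : D.Square κ true)
    (z : D.Square ι true) (h₁ : x.left r = y.right) (h₃ : x.left s = z.right)
    (m₁ : D.two.src (D.idc.arr (D.one.substNe₂ r s x.bot x.left)) r = D.two.tgt y.cell)
    (m₂ : D.two.src (D.two.comp (D.idc.arr (D.one.substNe₂ r s x.bot x.left)) r y.cell m₁)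
      (Sum.inl ⟨s, hrs.symm⟩) = D.two.tgt z.cell)
    (p₂ : D.two.src (D.two.comp (D.idc.arr (D.one.substNe r x.bot x.left)) r y.cell
      (comp_cell₂ x r y h₁)) (Sum.inl ⟨s, hrs.symm⟩) = D.two.tgt (D.idc.arr z.top))
    (p₃ : D.two.src (D.idc.arr (D.one.substNe (Sum.inl ⟨s, hrs.symm⟩) (comp x r y h₁).bot
      (comp x r y h₁).left)) (Sum.inl ⟨s, hrs.symm⟩) = D.two.tgt z.cell) (hp) :
    D.vcomp (D.two.comp (D.two.comp (D.idc.arr (D.one.substNe r x.bot x.left)) r y.cell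
        (comp_cell₂ x r y h₁)) (Sum.inl ⟨s, hrs.symm⟩) (D.idc.arr z.top) p₂)
      (D.two.comp (D.idc.arr (D.one.substNe (Sum.inl ⟨s, hrs.symm⟩) (comp x r y h₁).bot
        (comp x r y h₁).left)) (Sum.inl ⟨s, hrs.symm⟩) z.cell p₃) hp =
      D.two.comp (D.two.comp (D.idc.arr (D.one.substNe₂ r s x.bot x.left)) r y.cell m₁)
        (Sum.inl ⟨s, hrs.symm⟩) z.cell m₂ := by
  have bz := comp_bot x s z h₃
  have b_y := comp_bot x r y h₁
  have sT : ∀ q, q = r ∨ q = s → D.one.src (D.one.substNe₂ r s x.bot x.left) q = D.one.src x.bot q :=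
    fun q hq => src_substOn_of_notMem _ _ _ (by rcases hq with rfl | rfl <;> simp)
  have tz : D.one.tgt (D.dom.arr z.cell) = D.one.tgt z.bot := by rw [D.dom.tgt_arr, z.tgt_cell]
  -- the composites of 1-cells
  have f₁ : D.one.src (D.one.substNe₂ r s x.bot x.left) s = D.one.tgt (D.dom.arr z.cell) := by
    rw [sT _ (Or.inr rfl), bz, tz]
  have f₂ : D.one.src (D.one.substNe r x.bot x.left) s = D.one.tgt z.top := by
    rw [src_substNe_of_ne _ _ _ hrs.symm (x.tgt_left s).symm, x.src_left, comp_top x s z h₃]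
  have f₃ : D.one.comp (D.one.substNe r x.bot x.left) s z.top f₂ =
      D.one.comp (D.one.substNe₂ r s x.bot x.left) s (D.dom.arr z.cell) f₁ := by
    have g₁ : D.one.src (D.one.step (D.one.substNe₂ r s x.bot x.left) s (x.left s)) s =
        D.one.tgt z.top := by rw [← substNe_eq_step hrs]; exact f₂
    have g₂ : D.one.src (D.one.substNe₂ r s x.bot x.left) s =
        D.one.tgt (D.one.post (b := true) (x.left s) z.top) := by
      rw [h₃, ← z.dom_cell]; exact f₁
    refine (D.one.comp_congr (substNe_eq_step hrs _ _) s rfl _ g₁).trans ?_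
    rw [comp_step _ _ _ _ (by rw [sT _ (Or.inr rfl), x.tgt_left]) (by rw [h₃]; exact z.src_right)
      g₁ g₂]
    refine D.one.comp_congr rfl s ?_ _ _
    rw [z.dom_cell, h₃]
  have F₁ : D.two.src (D.idc.arr (D.one.substNe₂ r s x.bot x.left)) s =
      D.two.tgt (D.idc.arr (D.dom.arr z.cell)) := by rwa [D.idc.src_arr, D.idc.tgt_arr]
  have F₂ : D.two.src (D.idc.arr (D.one.substNe r x.bot x.left)) s = D.two.tgt (D.idc.arr z.top) := by
    rwa [D.idc.src_arr, D.idc.tgt_arr]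
  have F₃ : D.two.comp (D.idc.arr (D.one.substNe r x.bot x.left)) s (D.idc.arr z.top) F₂ =
      D.two.comp (D.idc.arr (D.one.substNe₂ r s x.bot x.left)) s (D.idc.arr (D.dom.arr z.cell)) F₁ := by
    rw [← D.idc.arr_comp _ _ _ f₁, ← D.idc.arr_comp _ _ _ f₂, f₃]
  -- the first 2-cell
  have k₁ : D.two.src (D.two.comp (D.idc.arr (D.one.substNe₂ r s x.bot x.left)) r y.cell m₁)
      (Sum.inl ⟨s, hrs.symm⟩) = D.two.tgt (D.idc.arr (D.dom.arr z.cell)) := by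
    rw [D.two.src_comp_inl, F₁]
  have k₂ : D.two.src (D.two.comp (D.idc.arr (D.one.substNe₂ r s x.bot x.left)) s
      (D.idc.arr (D.dom.arr z.cell)) F₁) (Sum.inl ⟨r, hrs⟩) = D.two.tgt y.cell := by
    rw [D.two.src_comp_inl, m₁]
  have k₃ : D.two.src (D.two.comp (D.idc.arr (D.one.substNe r x.bot x.left)) s
      (D.idc.arr z.top) F₂) (Sum.inl ⟨r, hrs⟩) = D.two.tgt y.cell := by
    rw [D.two.src_comp_inl, comp_cell₂ x r y h₁]
  have A : D.two.comp (D.two.comp (D.idc.arr (D.one.substNe r x.bot x.left)) r y.cell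
        (comp_cell₂ x r y h₁)) (Sum.inl ⟨s, hrs.symm⟩) (D.idc.arr z.top) p₂ =
      D.two.comp (D.two.comp (D.idc.arr (D.one.substNe₂ r s x.bot x.left)) r y.cell m₁)
        (Sum.inl ⟨s, hrs.symm⟩) (D.idc.arr (D.dom.arr z.cell)) k₁ := by
    rw [D.two.exchange _ r s hrs y.cell (D.idc.arr (D.dom.arr z.cell)) m₁ k₁ F₁ k₂,
      D.two.exchange _ r s hrs y.cell (D.idc.arr z.top) _ p₂ F₂ k₃]
    exact congrArg _ (D.two.comp_congr F₃ _ rfl _ _)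
  -- the second 2-cell
  have n₁ : D.one.src (D.one.substNe₂ r s x.bot x.left) r = D.one.tgt (D.one.substAll y.bot y.left) := by
    rw [tgt_substAll, sT _ (Or.inl rfl), b_y]
  have n₂ : D.two.src (D.idc.arr (D.one.substNe₂ r s x.bot x.left)) r =
      D.two.tgt (D.idc.arr (D.cod.arr y.cell)) := by
    rw [D.idc.src_arr, D.idc.tgt_arr, y.cod_cell, n₁]
  have n₃ : D.two.src (D.two.comp (D.idc.arr (D.one.substNe₂ r s x.bot x.left)) r
      (D.idc.arr (D.cod.arr y.cell)) n₂) (Sum.inl ⟨s, hrs.symm⟩) = D.two.tgt z.cell := by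
    rw [← m₂, D.two.src_comp_inl, D.two.src_comp_inl]
  have B : D.idc.arr (D.one.substNe (Sum.inl ⟨s, hrs.symm⟩) (comp x r y h₁).bot
      (comp x r y h₁).left) = D.two.comp (D.idc.arr (D.one.substNe₂ r s x.bot x.left)) r
      (D.idc.arr (D.cod.arr y.cell)) n₂ := by
    have e := substNe_comp_inl x.bot r y.bot b_y ⟨s, hrs.symm⟩ (comp x r y h₁).left x.left
      (fun _ => rfl) n₁
    refine (congrArg D.idc.arr e).trans ((D.idc.arr_comp _ _ _ _
      (by rwa [D.idc.src_arr, D.idc.tgt_arr])).trans ?_)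
    refine D.two.comp_congr rfl r (congrArg D.idc.arr y.cod_cell.symm) _ _
  have V : D.cod.arr (D.two.comp (D.idc.arr (D.one.substNe₂ r s x.bot x.left)) r y.cell m₁) =
      D.dom.arr (D.two.comp (D.idc.arr (D.one.substNe₂ r s x.bot x.left)) r
      (D.idc.arr (D.cod.arr y.cell)) n₂) := by
    rw [D.cod_comp _ _ _ _ (by rw [D.cod.src_arr, D.cod.tgt_arr, m₁]),
      D.dom_comp _ _ _ _ (by rw [D.dom.src_arr, D.dom.tgt_arr, n₂])]
    exact D.one.comp_congr (by rw [D.cod_idc, D.dom_idc]) _ (by rw [D.dom_idc]) _ _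
  have V' : D.cod.arr (D.idc.arr (D.dom.arr z.cell)) = D.dom.arr z.cell := by rw [D.cod_idc]
  have v₁ : D.vcomp (D.two.comp (D.idc.arr (D.one.substNe₂ r s x.bot x.left)) r y.cell m₁)
      (D.two.comp (D.idc.arr (D.one.substNe₂ r s x.bot x.left)) r
      (D.idc.arr (D.cod.arr y.cell)) n₂) V =
        D.two.comp (D.idc.arr (D.one.substNe₂ r s x.bot x.left)) r y.cell m₁ := by
    have w₁ : D.cod.arr y.cell = D.dom.arr (D.idc.arr (D.cod.arr y.cell)) := by rw [D.dom_idc]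
    rw [← D.comp_vcomp_right _ r y.cell (D.idc.arr (D.cod.arr y.cell)) w₁
      (by rw [D.vcomp_id]; exact m₁)]
    exact D.two.comp_congr rfl r (D.vcomp_id _ _ _) _ _
  have v₂ : D.vcomp (D.idc.arr (D.dom.arr z.cell)) z.cell V' = z.cell := D.id_vcomp _ _ _
  have hp' : D.cod.arr (D.two.comp (D.two.comp (D.idc.arr (D.one.substNe₂ r s x.bot x.left)) r
        y.cell m₁) (Sum.inl ⟨s, hrs.symm⟩) (D.idc.arr (D.dom.arr z.cell)) k₁) =
      D.dom.arr (D.two.comp (D.two.comp (D.idc.arr (D.one.substNe₂ r s x.bot x.left)) r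
      (D.idc.arr (D.cod.arr y.cell)) n₂) (Sum.inl ⟨s, hrs.symm⟩) z.cell n₃) := by
    rw [D.cod_comp _ _ _ _ (by rw [D.cod.src_arr, D.cod.tgt_arr, k₁]),
      D.dom_comp _ _ _ _ (by rw [D.dom.src_arr, D.dom.tgt_arr, n₃])]
    exact D.one.comp_congr V _ V' _ _
  refine (D.vcomp_congr A (D.two.comp_congr B _ rfl _ n₃) _ hp').trans ?_
  rw [← D.comp_vcomp _ _ _ _ _ V V' (by rw [D.src_vcomp, v₂]; exact m₂)]
  exact D.two.comp_congr v₁ _ v₂ _ _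

theorem exchange (x : D.Square μ b) (r s : μ) (hrs : r ≠ s) (y : D.Square κ true)
    (z : D.Square ι true) (h₁ : x.left r = y.right)
    (h₂ : (comp x r y h₁).left (Sum.inl ⟨s, hrs.symm⟩) = z.right) (h₃ : x.left s = z.right)
    (h₄ : (comp x s z h₃).left (Sum.inl ⟨r, hrs⟩) = y.right) :
    comp (comp x r y h₁) (Sum.inl ⟨s, hrs.symm⟩) z h₂ =
      act (swapSlots hrs).symm (comp (comp x s z h₃) (Sum.inl ⟨r, hrs⟩) y h₄) := by
  have ty := comp_top x r y h₁
  have tz := comp_top x s z h₃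
  have b_y := comp_bot x r y h₁
  have bz := comp_bot x s z h₃
  refine ext' ?_ ?_ ?_ rfl ?_
  · exact D.one.exchange _ _ _ hrs _ _ _ _ _ _
  · exact D.one.exchange _ _ _ hrs _ _ _ _ _ _
  · rintro (⟨i | i, hi⟩ | i) <;> rfl
  · have sT : ∀ q, q = r ∨ q = s →
        D.one.src (D.one.substNe₂ r s x.bot x.left) q = D.one.src x.bot q :=
      fun q hq => src_substOn_of_notMem _ _ _ (by rcases hq with rfl | rfl <;> simp)
    have m₁ : D.two.src (D.idc.arr (D.one.substNe₂ r s x.bot x.left)) r = D.two.tgt y.cell := by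
      rw [D.idc.src_arr, y.tgt_cell, sT _ (Or.inl rfl), b_y]
    have m₁' : D.two.src (D.idc.arr (D.one.substNe₂ r s x.bot x.left)) s = D.two.tgt z.cell := by
      rw [D.idc.src_arr, z.tgt_cell, sT _ (Or.inr rfl), bz]
    have m₂ : D.two.src (D.two.comp (D.idc.arr (D.one.substNe₂ r s x.bot x.left)) r y.cell m₁)
        (Sum.inl ⟨s, hrs.symm⟩) = D.two.tgt z.cell := by rw [D.two.src_comp_inl, m₁']
    have m₂' : D.two.src (D.two.comp (D.idc.arr (D.one.substNe₂ r s x.bot x.left)) s z.cell m₁')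
        (Sum.inl ⟨r, hrs⟩) = D.two.tgt y.cell := by rw [D.two.src_comp_inl, m₁]
    have s₁ := comp_cell₁ x r y h₁
    have s₂ := comp_cell₂ x r y h₁
    have s₃ := comp_cell₁ x s z h₃
    have s₄ := comp_cell₂ x s z h₃
    have p₁ : D.two.src (D.two.comp x.cell r (D.idc.arr y.top) s₁) (Sum.inl ⟨s, hrs.symm⟩) =
        D.two.tgt (D.idc.arr z.top) := by rw [D.two.src_comp_inl, s₃]
    have q₁ : D.two.src (D.two.comp x.cell s (D.idc.arr z.top) s₃) (Sum.inl ⟨r, hrs⟩) =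
        D.two.tgt (D.idc.arr y.top) := by rw [D.two.src_comp_inl, s₁]
    have p₂ : D.two.src (D.two.comp (D.idc.arr (D.one.substNe r x.bot x.left)) r y.cell s₂)
        (Sum.inl ⟨s, hrs.symm⟩) = D.two.tgt (D.idc.arr z.top) := by
      rw [D.two.src_comp_inl, D.idc.src_arr, D.idc.tgt_arr,
        src_substNe_of_ne _ _ _ hrs.symm (x.tgt_left s).symm, x.src_left, tz]
    have q₂ : D.two.src (D.two.comp (D.idc.arr (D.one.substNe s x.bot x.left)) s z.cell s₄)
        (Sum.inl ⟨r, hrs⟩) = D.two.tgt (D.idc.arr y.top) := by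
      rw [D.two.src_comp_inl, D.idc.src_arr, D.idc.tgt_arr,
        src_substNe_of_ne _ _ _ hrs (x.tgt_left r).symm, x.src_left, ty]
    have p₃ := comp_cell₂ (comp x r y h₁) (Sum.inl ⟨s, hrs.symm⟩) z h₂
    have q₃ := comp_cell₂ (comp x s z h₃) (Sum.inl ⟨r, hrs⟩) y h₄
    have c₁ := comp_cells x r y h₁
    have c₂ := comp_cells x s z h₃
    have c₃ := comp_cells (comp x r y h₁) (Sum.inl ⟨s, hrs.symm⟩) z h₂
    have c₄ := comp_cells (comp x s z h₃) (Sum.inl ⟨r, hrs⟩) y h₄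
    have lv : D.cod.arr (D.two.comp (D.two.comp x.cell r (D.idc.arr y.top) s₁)
        (Sum.inl ⟨s, hrs.symm⟩) (D.idc.arr z.top) p₁) =
        D.dom.arr (D.two.comp (D.two.comp (D.idc.arr (D.one.substNe r x.bot x.left)) r y.cell s₂)
        (Sum.inl ⟨s, hrs.symm⟩) (D.idc.arr z.top) p₂) := by
      rw [D.cod_comp _ _ _ _ (by rw [D.cod.src_arr, D.cod.tgt_arr, p₁]),
        D.dom_comp _ _ _ _ (by rw [D.dom.src_arr, D.dom.tgt_arr, p₂])]
      exact D.one.comp_congr c₁ _ (by rw [D.cod_idc, D.dom_idc]) _ _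
    have rv : D.cod.arr (D.two.comp (D.two.comp x.cell s (D.idc.arr z.top) s₃)
        (Sum.inl ⟨r, hrs⟩) (D.idc.arr y.top) q₁) =
        D.dom.arr (D.two.comp (D.two.comp (D.idc.arr (D.one.substNe s x.bot x.left)) s z.cell s₄)
        (Sum.inl ⟨r, hrs⟩) (D.idc.arr y.top) q₂) := by
      rw [D.cod_comp _ _ _ _ (by rw [D.cod.src_arr, D.cod.tgt_arr, q₁]),
        D.dom_comp _ _ _ _ (by rw [D.dom.src_arr, D.dom.tgt_arr, q₂])]
      exact D.one.comp_congr c₂ _ (by rw [D.cod_idc, D.dom_idc]) _ _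
    have l₁ := D.comp_vcomp_left _ _ (Sum.inl ⟨s, hrs.symm⟩ : {p // p ≠ r} ⊕ κ) z.top c₁
      (comp_cell₁ (comp x r y h₁) (Sum.inl ⟨s, hrs.symm⟩) z h₂) p₁ p₂ lv
    have r₁ := D.comp_vcomp_left _ _ (Sum.inl ⟨r, hrs⟩ : {p // p ≠ s} ⊕ ι) y.top c₂
      (comp_cell₁ (comp x s z h₃) (Sum.inl ⟨r, hrs⟩) y h₄) q₁ q₂ rv
    have lc : D.cod.arr (D.two.comp (D.two.comp (D.idc.arr (D.one.substNe r x.bot x.left)) r y.cell s₂)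
        (Sum.inl ⟨s, hrs.symm⟩) (D.idc.arr z.top) p₂) = D.dom.arr (D.two.comp (D.idc.arr (D.one.substNe
          (Sum.inl ⟨s, hrs.symm⟩) (comp x r y h₁).bot (comp x r y h₁).left)) (Sum.inl ⟨s, hrs.symm⟩)
          z.cell p₃) := by
      rw [← c₃]
      refine Eq.trans ?_ (congrArg D.cod.arr l₁).symm
      rw [D.cod_vcomp]
    have rc : D.cod.arr (D.two.comp (D.two.comp (D.idc.arr (D.one.substNe s x.bot x.left)) s z.cell s₄)
        (Sum.inl ⟨r, hrs⟩) (D.idc.arr y.top) q₂) = D.dom.arr (D.two.comp (D.idc.arr (D.one.substNe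
          (Sum.inl ⟨r, hrs⟩) (comp x s z h₃).bot (comp x s z h₃).left)) (Sum.inl ⟨r, hrs⟩)
          y.cell q₃) := by
      rw [← c₄]
      refine Eq.trans ?_ (congrArg D.cod.arr r₁).symm
      rw [D.cod_vcomp]
    have lM := exchange_aux x r s hrs y z h₁ h₃ m₁ m₂ p₂ p₃ lc
    have e := substNe₂_comm r s x.bot x.left
    have m₃ : D.two.src (D.idc.arr (D.one.substNe₂ s r x.bot x.left)) s = D.two.tgt z.cell := by
      rw [← e]; exact m₁'
    have rM := (exchange_aux x s r hrs.symm z y h₃ h₁ m₃ (by rw [D.two.src_comp_inl, ← e, m₁])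
      q₂ q₃ rc).trans (D.two.comp_congr (D.two.comp_congr (congrArg D.idc.arr e.symm) s rfl m₃ m₁')
        (Sum.inl ⟨r, hrs⟩) rfl _ m₂')
    have lhs : (comp (comp x r y h₁) (Sum.inl ⟨s, hrs.symm⟩) z h₂).cell =
        D.vcomp (D.two.comp (D.two.comp x.cell r (D.idc.arr y.top) s₁)
        (Sum.inl ⟨s, hrs.symm⟩) (D.idc.arr z.top) p₁) (D.two.comp (D.two.comp (D.idc.arr
          (D.one.substNe₂ r s x.bot x.left)) r y.cell m₁) (Sum.inl ⟨s, hrs.symm⟩) z.cell m₂)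
          (by rw [← lM, D.dom_vcomp]; exact lv) := by
      refine (D.vcomp_congr l₁ rfl _ (by rw [D.cod_vcomp]; exact lc)).trans ?_
      rw [D.vcomp_assoc _ _ _ lv _ lc (by rw [D.dom_vcomp]; exact lv)]
      exact D.vcomp_congr rfl lM _ _
    have rhs : (comp (comp x s z h₃) (Sum.inl ⟨r, hrs⟩) y h₄).cell =
        D.vcomp (D.two.comp (D.two.comp x.cell s (D.idc.arr z.top) s₃)
        (Sum.inl ⟨r, hrs⟩) (D.idc.arr y.top) q₁) (D.two.comp (D.two.comp (D.idc.arr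
          (D.one.substNe₂ r s x.bot x.left)) s z.cell m₁') (Sum.inl ⟨r, hrs⟩) y.cell m₂')
          (by rw [← rM, D.dom_vcomp]; exact rv) := by
      refine (D.vcomp_congr r₁ rfl _ (by rw [D.cod_vcomp]; exact rc)).trans ?_
      rw [D.vcomp_assoc _ _ _ rv _ rc (by rw [D.dom_vcomp]; exact rv)]
      exact D.vcomp_congr rfl rM _ _
    refine lhs.trans (Eq.trans ?_ (congrArg (D.two.act (swapSlots hrs).symm) rhs).symm)
    have x₁ := D.two.exchange x.cell r s hrs (D.idc.arr y.top) (D.idc.arr z.top) s₁ p₁ s₃ q₁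
    have x₂ := D.two.exchange (D.idc.arr (D.one.substNe₂ r s x.bot x.left)) r s hrs y.cell z.cell m₁ m₂
      m₁' m₂'
    rw [D.act_vcomp _ _ _ _ (by rw [← x₁, ← x₂, ← lM, D.dom_vcomp]; exact lv)]
    exact D.vcomp_congr x₁ x₂ _ _

theorem cyl_left {x : D.Square ι b} {β : D.two.Arr ι b} (hβ : D.dom.arr β = x.bot) :
    D.cod.arr x.cell = D.dom.arr (D.two.substAll β fun i => D.idc.arr (x.left i)) := by
  rw [x.cod_cell, D.dom.arr_substAll, hβ]
  simp only [D.dom_idc]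

theorem cyl_right {x y : D.Square ι b} (hr : x.right = y.right) {α : D.two.Arr ι b}
    (hα : D.cod.arr α = y.top) :
    D.cod.arr (D.two.post (Cod.map D.idc.arr x.right) α) = D.dom.arr y.cell := by
  rw [y.dom_cell, D.cod.arr_post, hα, D.map_cod_idc, hr]

end Square

variable (D) in
/-- A cylinder between two squares with the same vertical arrows, i.e. a 2-cell `up` between their top
arrows and a 2-cell `down` between their bottom arrows that commute with the 2-cells of the squares. -/
@[ext]
structure Cyl (ι : Type) [Finite ι] (b : Bool) where
  fst : D.Square ι b
  snd : D.Square ι b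
  left_eq : fst.left = snd.left
  right_eq : fst.right = snd.right
  up : D.two.Arr ι b
  down : D.two.Arr ι b
  dom_up : D.dom.arr up = fst.top
  cod_up : D.cod.arr up = snd.top
  dom_down : D.dom.arr down = fst.bot
  cod_down : D.cod.arr down = snd.bot
  comm : D.vcomp fst.cell (D.two.substAll down fun i => D.idc.arr (fst.left i))
      (Square.cyl_left dom_down) =
    D.vcomp (D.two.post (Cod.map D.idc.arr fst.right) up) snd.cell
      (Square.cyl_right right_eq cod_up)

namespace Cyl

theorem ext' {x y : D.Cyl ι b} (h₁ : x.fst = y.fst) (h₂ : x.snd = y.snd) (h₃ : x.up = y.up)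
    (h₄ : x.down = y.down) : x = y := Cyl.ext h₁ h₂ h₃ h₄

theorem src_up (x : D.Cyl ι b) (i : ι) : D.two.src x.up i = D.one.src x.fst.top i := by
  rw [← D.dom.src_arr, x.dom_up]

theorem src_down (x : D.Cyl ι b) (i : ι) : D.two.src x.down i = D.one.src x.fst.bot i := by
  rw [← D.dom.src_arr, x.dom_down]

theorem tgt_up (x : D.Cyl ι b) : D.two.tgt x.up = D.one.tgt x.fst.top := by
  rw [← D.dom.tgt_arr, x.dom_up]

theorem tgt_down (x : D.Cyl ι b) : D.two.tgt x.down = D.one.tgt x.fst.bot := by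
  rw [← D.dom.tgt_arr, x.dom_down]

/-- The symmetric action on cylinders. -/
noncomputable def act (σ : ι ≃ κ) (x : D.Cyl ι b) : D.Cyl κ b where
  fst := x.fst.act σ
  snd := x.snd.act σ
  left_eq := by funext i; exact congrFun x.left_eq _
  right_eq := x.right_eq
  up := D.two.act σ x.up
  down := D.two.act σ x.down
  dom_up := by rw [D.dom.arr_act, x.dom_up]; rfl
  cod_up := by rw [D.cod.arr_act, x.cod_up]; rfl
  dom_down := by rw [D.dom.arr_act, x.dom_down]; rfl
  cod_down := by rw [D.cod.arr_act, x.cod_down]; rfl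
  comm := by
    have e₁ : D.two.substAll (D.two.act σ x.down) (fun i => D.idc.arr ((x.fst.act σ).left i)) =
        D.two.act σ (D.two.substAll x.down fun i => D.idc.arr (x.fst.left i)) := by
      rw [← act_substAll]
      congr 2
      funext i
      exact congrArg (fun j => D.idc.arr (x.fst.left j)) (σ.symm_apply_apply i)
    have e₂ : D.two.post (Cod.map D.idc.arr (x.fst.act σ).right) (D.two.act σ x.up) =
        D.two.act σ (D.two.post (Cod.map D.idc.arr x.fst.right) x.up) := post_act _ _ _
    have h₁ := Square.cyl_left x.dom_down
    have h₂ := Square.cyl_right x.right_eq x.cod_up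
    refine (D.vcomp_congr rfl e₁ _ (by rw [D.dom.arr_act, ← h₁, ← D.cod.arr_act]; rfl)).trans ?_
    refine Eq.trans ?_ (D.vcomp_congr e₂ rfl _ (by rw [D.cod.arr_act, h₂, ← D.dom.arr_act]; rfl)).symm
    refine (D.act_vcomp _ _ _ h₁ _).symm.trans (Eq.trans ?_ (D.act_vcomp _ _ _ h₂ _))
    rw [x.comm]

/-- The identity cylinder of a square. -/
noncomputable def id (x : D.Square ι b) : D.Cyl ι b where
  fst := x
  snd := x
  left_eq := rfl
  right_eq := rfl
  up := D.idc.arr x.top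
  down := D.idc.arr x.bot
  dom_up := D.dom_idc _
  cod_up := D.cod_idc _
  dom_down := D.dom_idc _
  cod_down := D.cod_idc _
  comm := by
    have e₁ : D.two.substAll (D.idc.arr x.bot) (fun i => D.idc.arr (x.left i)) =
        D.idc.arr (D.one.substAll x.bot x.left) := (D.idc.arr_substAll _ _).symm
    have e₂ : D.two.post (Cod.map D.idc.arr x.right) (D.idc.arr x.top) =
        D.idc.arr (D.one.post x.right x.top) := (D.idc.arr_post _ _).symm
    refine (D.vcomp_congr rfl e₁ _ (by rw [D.dom_idc, x.cod_cell])).trans ?_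
    refine Eq.trans ?_ (D.vcomp_congr e₂ rfl _ (by rw [D.cod_idc, x.dom_cell])).symm
    rw [D.vcomp_id, D.id_vcomp]

end Cyl

theorem paste_horizontal {f₁ f₂ f₃ s t s' t' : D.two.Arr ι b} (a₁ : D.cod.arr f₁ = D.dom.arr s)
    (c₁ : D.cod.arr s = D.dom.arr t) (a₂ : D.cod.arr s' = D.dom.arr f₂)
    (c₂ : D.cod.arr s' = D.dom.arr t') (g₁ : D.cod.arr f₂ = D.dom.arr t)
    (g₂ : D.cod.arr t' = D.dom.arr f₃) (h : D.vcomp f₁ s a₁ = D.vcomp s' f₂ a₂)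
    (k : D.vcomp f₂ t g₁ = D.vcomp t' f₃ g₂) :
    D.vcomp f₁ (D.vcomp s t c₁) (by rw [D.dom_vcomp, a₁]) =
      D.vcomp (D.vcomp s' t' c₂) f₃ (by rw [D.cod_vcomp, g₂]) := by
  rw [← D.vcomp_assoc f₁ s t a₁ (by rw [D.cod_vcomp, c₁]) c₁,
    D.vcomp_assoc s' t' f₃ c₂ _ g₂ (by rw [D.dom_vcomp, c₂])]
  refine (D.vcomp_congr h rfl _ (by rw [D.cod_vcomp, g₁])).trans ?_
  rw [D.vcomp_assoc s' f₂ t a₂ _ g₁ (by rw [D.dom_vcomp, a₂])]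
  exact D.vcomp_congr rfl k _ _

theorem paste_vertical {x₁ x₂ y₁ y₂ s t m : D.two.Arr ι b} (c : D.cod.arr x₁ = D.dom.arr x₂)
    (c' : D.cod.arr y₁ = D.dom.arr y₂) (u₁ : D.cod.arr x₁ = D.dom.arr m)
    (u₂ : D.cod.arr t = D.dom.arr y₁) (w₁ : D.cod.arr x₂ = D.dom.arr s)
    (w₂ : D.cod.arr m = D.dom.arr y₂) (h : D.vcomp x₁ m u₁ = D.vcomp t y₁ u₂)
    (k : D.vcomp x₂ s w₁ = D.vcomp m y₂ w₂) :
    D.vcomp (D.vcomp x₁ x₂ c) s (by rw [D.cod_vcomp, w₁]) =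
      D.vcomp t (D.vcomp y₁ y₂ c') (by rw [D.dom_vcomp, u₂]) :=
  (D.paste_horizontal u₂ c' u₁ c w₂ w₁ h.symm k.symm).symm

theorem interchange₂ {q : κ} {θ η θ' η' : D.two.Arr κ b} (a₁ : D.cod.arr θ = D.dom.arr η)
    (a₂ : D.cod.arr θ' = D.dom.arr η') (h : D.vcomp θ η a₁ = D.vcomp θ' η' a₂)
    {θ₂ η₂ θ₂' η₂' : D.two.Arr ι true} (b₁ : D.cod.arr θ₂ = D.dom.arr η₂)
    (b₂ : D.cod.arr θ₂' = D.dom.arr η₂') (h₂ : D.vcomp θ₂ η₂ b₁ = D.vcomp θ₂' η₂' b₂)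
    (s₁ : D.two.src θ q = D.two.tgt θ₂) (s₂ : D.two.src η q = D.two.tgt η₂)
    (s₃ : D.two.src θ' q = D.two.tgt θ₂') (s₄ : D.two.src η' q = D.two.tgt η₂') :
    ∃ k₁ k₂, D.vcomp (D.two.comp θ q θ₂ s₁) (D.two.comp η q η₂ s₂) k₁ =
      D.vcomp (D.two.comp θ' q θ₂' s₃) (D.two.comp η' q η₂' s₄) k₂ := by
  have k₁ : D.cod.arr (D.two.comp θ q θ₂ s₁) = D.dom.arr (D.two.comp η q η₂ s₂) := by
    rw [D.cod_comp _ _ _ _ (by rw [D.cod.src_arr, D.cod.tgt_arr, s₁]),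
      D.dom_comp _ _ _ _ (by rw [D.dom.src_arr, D.dom.tgt_arr, s₂])]
    exact D.one.comp_congr a₁ _ b₁ _ _
  have k₂ : D.cod.arr (D.two.comp θ' q θ₂' s₃) = D.dom.arr (D.two.comp η' q η₂' s₄) := by
    rw [D.cod_comp _ _ _ _ (by rw [D.cod.src_arr, D.cod.tgt_arr, s₃]),
      D.dom_comp _ _ _ _ (by rw [D.dom.src_arr, D.dom.tgt_arr, s₄])]
    exact D.one.comp_congr a₂ _ b₂ _ _
  refine ⟨k₁, k₂, ?_⟩
  rw [← D.comp_vcomp θ η q θ₂ η₂ a₁ b₁ (by rw [D.src_vcomp, D.tgt_vcomp, s₁]),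
    ← D.comp_vcomp θ' η' q θ₂' η₂' a₂ b₂ (by rw [D.src_vcomp, D.tgt_vcomp, s₃])]
  exact D.two.comp_congr h q h₂ _ _

namespace Cyl

/-- The vertical composite of cylinders, i.e. composition of 2-cells. -/
noncomputable def vcomp (x y : D.Cyl ι b) (h : x.snd = y.fst) : D.Cyl ι b :=
  have hu : D.cod.arr x.up = D.dom.arr y.up := by rw [x.cod_up, y.dom_up, h]
  have hd : D.cod.arr x.down = D.dom.arr y.down := by rw [x.cod_down, y.dom_down, h]
  { fst := x.fst
    snd := y.snd
    left_eq := by rw [x.left_eq, h, y.left_eq]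
    right_eq := by rw [x.right_eq, h, y.right_eq]
    up := D.vcomp x.up y.up hu
    down := D.vcomp x.down y.down hd
    dom_up := by rw [D.dom_vcomp, x.dom_up]
    cod_up := by rw [D.cod_vcomp, y.cod_up]
    dom_down := by rw [D.dom_vcomp, x.dom_down]
    cod_down := by rw [D.cod_vcomp, y.cod_down]
    comm := by
      have hl : y.fst.left = x.fst.left := by rw [x.left_eq, h]
      have hr : y.fst.right = x.fst.right := by rw [x.right_eq, h]
      have a₁ := Square.cyl_left x.dom_down
      have a₂ := Square.cyl_right x.right_eq x.cod_up
      have b₁ := Square.cyl_left y.dom_down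
      have b₂ := Square.cyl_right y.right_eq y.cod_up
      have c₁ : D.cod.arr (D.two.substAll x.down fun i => D.idc.arr (x.fst.left i)) =
          D.dom.arr (D.two.substAll y.down fun i => D.idc.arr (x.fst.left i)) := by
        rw [D.cod.arr_substAll, D.dom.arr_substAll, hd]
        simp only [D.dom_idc, D.cod_idc]
      have c₂ : D.cod.arr (D.two.post (Cod.map D.idc.arr x.fst.right) x.up) =
          D.dom.arr (D.two.post (Cod.map D.idc.arr x.fst.right) y.up) := by
        rw [D.cod.arr_post, D.dom.arr_post, hu, D.map_dom_idc, D.map_cod_idc]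
      have e₁ := D.substOn_vcomp (Set.finite_univ (α := ι)).toFinset x.down y.down x.fst.left hd c₁
      have e₂ := D.post_vcomp x.fst.right x.up y.up hu c₂
      have g₁ : D.cod.arr x.snd.cell =
          D.dom.arr (D.two.substAll y.down fun i => D.idc.arr (x.fst.left i)) := by
        rw [← hl, h]; exact b₁
      have g₂ : D.cod.arr (D.two.post (Cod.map D.idc.arr x.fst.right) y.up) =
          D.dom.arr y.snd.cell := by rw [← hr]; exact b₂
      have k : D.vcomp x.snd.cell (D.two.substAll y.down fun i => D.idc.arr (x.fst.left i)) g₁ =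
          D.vcomp (D.two.post (Cod.map D.idc.arr x.fst.right) y.up) y.snd.cell g₂ := by
        refine (D.vcomp_congr (by rw [h]) (by rw [hl]) _ b₁).trans (y.comm.trans ?_)
        exact D.vcomp_congr (by rw [hr]) rfl _ _
      have p := D.paste_horizontal a₁ c₁ a₂ c₂ g₁ g₂ x.comm k
      refine (D.vcomp_congr rfl e₁ _ _).trans (p.trans ?_)
      exact D.vcomp_congr e₂.symm rfl _ _ }

theorem comp_up (x : D.Cyl κ b) (q : κ) (y : D.Cyl ι true) (h : x.fst.left q = y.fst.right) :
    D.two.src x.up q = D.two.tgt y.up := by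
  rw [x.src_up, y.tgt_up, Square.comp_top _ _ _ h]

theorem comp_down (x : D.Cyl κ b) (q : κ) (y : D.Cyl ι true) (h : x.fst.left q = y.fst.right) :
    D.two.src x.down q = D.two.tgt y.down := by
  rw [x.src_down, y.tgt_down, Square.comp_bot _ _ _ h]

theorem comp_snd (x : D.Cyl κ b) (q : κ) (y : D.Cyl ι true) (h : x.fst.left q = y.fst.right) :
    x.snd.left q = y.snd.right := by
  rw [← x.left_eq, h]; exact y.right_eq

/-- The composite of cylinders along a common vertical arrow. -/
noncomputable def comp (x : D.Cyl κ b) (q : κ) (y : D.Cyl ι true) (h : x.fst.left q = y.fst.right) :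
    D.Cyl ({p // p ≠ q} ⊕ ι) b where
  fst := x.fst.comp q y.fst h
  snd := x.snd.comp q y.snd (comp_snd x q y h)
  left_eq := by
    funext i
    rcases i with i | i
    · exact congrFun x.left_eq _
    · exact congrFun y.left_eq _
  right_eq := x.right_eq
  up := D.two.comp x.up q y.up (comp_up x q y h)
  down := D.two.comp x.down q y.down (comp_down x q y h)
  dom_up := by
    rw [D.dom_comp _ _ _ _ (by rw [D.dom.src_arr, D.dom.tgt_arr, comp_up x q y h])]
    exact D.one.comp_congr x.dom_up _ y.dom_up _ _
  cod_up := by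
    rw [D.cod_comp _ _ _ _ (by rw [D.cod.src_arr, D.cod.tgt_arr, comp_up x q y h])]
    exact D.one.comp_congr x.cod_up _ y.cod_up _ _
  dom_down := by
    rw [D.dom_comp _ _ _ _ (by rw [D.dom.src_arr, D.dom.tgt_arr, comp_down x q y h])]
    exact D.one.comp_congr x.dom_down _ y.dom_down _ _
  cod_down := by
    rw [D.cod_comp _ _ _ _ (by rw [D.cod.src_arr, D.cod.tgt_arr, comp_down x q y h])]
    exact D.one.comp_congr x.cod_down _ y.cod_down _ _
  comm := by
    have h' := comp_snd x q y h
    have hd := comp_down x q y h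
    have hu := comp_up x q y h
    have s₁ := Square.comp_cell₁ x.fst q y.fst h
    have s₂ := Square.comp_cell₂ x.fst q y.fst h
    have s₃ := Square.comp_cell₁ x.snd q y.snd h'
    have s₄ := Square.comp_cell₂ x.snd q y.snd h'
    have c := Square.comp_cells x.fst q y.fst h
    have c' := Square.comp_cells x.snd q y.snd h'
    have a₁ := Square.cyl_left x.dom_down
    have a₂ := Square.cyl_right x.right_eq x.cod_up
    have b₁ := Square.cyl_left y.dom_down
    have b₂ : D.cod.arr (D.two.post (b := true) (D.idc.arr (b := true) y.fst.right) y.up) =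
      D.dom.arr y.snd.cell := Square.cyl_right y.right_eq y.cod_up
    have kx : D.two.src x.down q = D.two.tgt (D.idc.arr (x.fst.left q)) := by
      rw [x.src_down, D.idc.tgt_arr, x.fst.tgt_left]
    have ky : D.two.src (D.idc.arr (x.fst.left q)) () = D.two.tgt y.up := by
      rw [D.idc.src_arr, y.tgt_up, h]; exact y.fst.src_right
    have kR : D.two.src (D.idc.arr (b := true) y.fst.right) () = D.two.tgt y.up := by
      rw [D.idc.src_arr, y.tgt_up]; exact y.fst.src_right
    have tS : D.two.tgt (D.two.substAll y.down fun i => D.idc.arr (y.fst.left i)) =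
      D.two.tgt y.down := tgt_substAll _ _
    have sN : D.two.src (D.two.substNe q x.down fun i => D.idc.arr (x.fst.left i)) q =
      D.two.src x.down q := src_substNe_self _ _ _
    have d₁ : D.two.src (D.two.substNe q x.down fun i => D.idc.arr (x.fst.left i)) q =
        D.two.tgt (D.two.substAll y.down fun i => D.idc.arr (y.fst.left i)) := by rw [sN, tS, hd]
    have d₂ : D.two.src (D.two.substNe q x.down fun i => D.idc.arr (x.fst.left i)) q =
        D.two.tgt (D.two.post (b := true) (D.idc.arr (b := true) y.fst.right) y.up) := by
      rw [tgt_post kR, sN, kx, h]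
    have d₃ : D.two.src (D.two.substAll x.down fun i => D.idc.arr (x.fst.left i)) q =
        D.two.tgt y.up := by rw [src_substAll _ _ kx, ky]
    have d₄ : D.two.src (D.two.post (Cod.map D.idc.arr x.fst.right) x.up) q = D.two.tgt y.up := by
      rw [src_post, hu]
    have e₁ : D.two.substAll (D.two.comp x.down q y.down hd)
        (fun i => D.idc.arr ((x.fst.comp q y.fst h).left i)) =
        D.two.comp (D.two.substNe q x.down fun i => D.idc.arr (x.fst.left i)) q
          (D.two.substAll y.down fun i => D.idc.arr (y.fst.left i)) d₁ :=
      substAll_comp _ _ _ _ _ (fun i => D.idc.arr (x.fst.left i)) (fun _ => rfl) _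
    have e₂ : D.two.post (Cod.map D.idc.arr x.fst.right) (D.two.comp x.up q y.up hu) =
        D.two.comp (D.two.post (Cod.map D.idc.arr x.fst.right) x.up) q y.up d₄ :=
      post_comp _ _ _ _ _ _
    have e₃ : D.two.comp (D.two.substAll x.down fun i => D.idc.arr (x.fst.left i)) q y.up d₃ =
        D.two.comp (D.two.substNe q x.down fun i => D.idc.arr (x.fst.left i)) q
          (D.two.post (b := true) (D.idc.arr (b := true) y.fst.right) y.up) d₂ := by
      have f₁ := substAll_eq_step q x.down fun i => D.idc.arr (x.fst.left i)
      have f₂ : D.two.src (D.two.step (D.two.substNe q x.down fun i => D.idc.arr (x.fst.left i)) q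
          (D.idc.arr (x.fst.left q))) q = D.two.tgt y.up := by rw [← f₁]; exact d₃
      refine (D.two.comp_congr f₁ q rfl _ f₂).trans ?_
      refine (comp_step _ _ _ _ (by rw [sN, kx]) ky _ (by rw [tgt_post ky, sN, kx])).trans ?_
      refine D.two.comp_congr rfl q ?_ _ _
      rw [h]
    have n₁ : D.dom.arr (D.two.substNe q x.down fun i => D.idc.arr (x.fst.left i)) =
        D.one.substNe q x.fst.bot x.fst.left := by
      rw [D.dom.arr_substNe, x.dom_down]
      simp only [D.dom_idc]
    have n₂ : D.cod.arr (D.two.substNe q x.down fun i => D.idc.arr (x.fst.left i)) =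
        D.one.substNe q x.snd.bot x.snd.left := by
      rw [D.cod.arr_substNe, x.cod_down, ← x.left_eq]
      simp only [D.cod_idc]
    have i₁ := D.interchange₂ (q := q) (θ := x.fst.cell)
      (η := D.two.substAll x.down fun i => D.idc.arr (x.fst.left i)) a₁ a₂ x.comm
      (θ₂ := D.idc.arr y.fst.top) (η₂ := y.up) (θ₂' := y.up) (η₂' := D.idc.arr y.snd.top)
      (by rw [D.cod_idc, y.dom_up]) (by rw [D.dom_idc, y.cod_up])
      (by rw [D.id_vcomp, D.vcomp_id]) s₁ d₃ d₄ s₃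
    have i₂ := D.interchange₂ (q := q)
      (θ := D.idc.arr (D.one.substNe q x.fst.bot x.fst.left))
      (η := D.two.substNe q x.down fun i => D.idc.arr (x.fst.left i))
      (θ' := D.two.substNe q x.down fun i => D.idc.arr (x.fst.left i))
      (η' := D.idc.arr (D.one.substNe q x.snd.bot x.snd.left))
      (by rw [D.cod_idc, n₁]) (by rw [D.dom_idc, n₂]) (by rw [D.id_vcomp, D.vcomp_id]) b₁ b₂ y.comm
      s₂ d₁ d₂ s₄
    obtain ⟨u₁, u₂, i₁⟩ := i₁
    obtain ⟨w₁, w₂, i₂⟩ := i₂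
    have w₂' : D.cod.arr (D.two.comp (D.two.substAll x.down fun i => D.idc.arr (x.fst.left i)) q
        y.up d₃) = D.dom.arr (D.two.comp (D.idc.arr (D.one.substNe q x.snd.bot x.snd.left)) q
          y.snd.cell s₄) := by rw [e₃]; exact w₂
    have i₂' := i₂.trans (D.vcomp_congr e₃.symm rfl w₂ w₂')
    refine (D.vcomp_congr rfl e₁ _ (by rw [← w₁]; exact D.cod_vcomp _ _ c)).trans ?_
    refine Eq.trans ?_ (D.vcomp_congr e₂ rfl _ (by rw [u₂]; exact (D.dom_vcomp _ _ c').symm)).symm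
    exact D.paste_vertical c c' u₁ u₂ w₁ w₂' i₁ i₂'

end Cyl

variable (D) in
/-- The co-subunary polycategory of vertical arrows and squares. -/
noncomputable def squares : CoSub (D.one.Arr Unit true) where
  Arr ι _ b := D.Square ι b
  src x := x.left
  tgt x := x.right
  act := Square.act
  one := Square.one
  comp := Square.comp
  src_act σ x i := congrArg x.left (σ.symm_apply_apply i)
  tgt_act _ _ := rfl
  src_one _ _ := rfl
  tgt_one _ := rfl
  src_comp_inl _ _ _ _ _ := rfl
  src_comp_inr _ _ _ _ _ := rfl
  tgt_comp _ _ _ _ := rfl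
  act_refl _ := Square.ext' (D.one.act_refl _) (D.one.act_refl _) (fun _ => rfl) rfl
    (D.two.act_refl _)
  act_act σ τ _ := Square.ext' (D.one.act_act σ τ _) (D.one.act_act σ τ _) (fun _ => rfl) rfl
    (D.two.act_act σ τ _)
  one_comp := Square.one_comp
  comp_one := Square.comp_one
  assoc := Square.assoc
  exchange := Square.exchange
  equivariance := Square.equivariance

variable (D) in
/-- The co-subunary polycategory of vertical arrows and cylinders. -/
noncomputable def cylinders : CoSub (D.one.Arr Unit true) where
  Arr ι _ b := D.Cyl ι b
  src x := x.fst.left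
  tgt x := x.fst.right
  act := Cyl.act
  one u := Cyl.id (Square.one u)
  comp := Cyl.comp
  src_act σ x i := congrArg x.fst.left (σ.symm_apply_apply i)
  tgt_act _ _ := rfl
  src_one _ _ := rfl
  tgt_one _ := rfl
  src_comp_inl _ _ _ _ _ := rfl
  src_comp_inr _ _ _ _ _ := rfl
  tgt_comp _ _ _ _ := rfl
  act_refl x := Cyl.ext' (D.squares.act_refl _) (D.squares.act_refl _) (D.two.act_refl _)
    (D.two.act_refl _)
  act_act σ τ x := Cyl.ext' (D.squares.act_act σ τ _) (D.squares.act_act σ τ _)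
    (D.two.act_act σ τ _) (D.two.act_act σ τ _)
  one_comp u y h := Cyl.ext' (D.squares.one_comp u y.fst h)
    (D.squares.one_comp u y.snd (h.trans y.right_eq))
    ((D.two.comp_congr (D.idc.arr_one _) _ rfl _ (by rw [← D.idc.arr_one]; exact Cyl.comp_up _ _ _ h)).trans
      (D.two.one_comp _ _ _))
    ((D.two.comp_congr (D.idc.arr_one _) _ rfl _ (by rw [← D.idc.arr_one]; exact Cyl.comp_down _ _ _ h)).trans
      (D.two.one_comp _ _ _))
  comp_one x q u h := Cyl.ext' (D.squares.comp_one x.fst q u h)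
    (D.squares.comp_one x.snd q u (Cyl.comp_snd x q _ h))
    ((D.two.comp_congr rfl _ (D.idc.arr_one _) _ (by rw [← D.idc.arr_one]; exact Cyl.comp_up x q _ h)).trans
      (D.two.comp_one _ _ _ _))
    ((D.two.comp_congr rfl _ (D.idc.arr_one _) _ (by rw [← D.idc.arr_one]; exact Cyl.comp_down x q _ h)).trans
      (D.two.comp_one _ _ _ _))
  assoc x r y q z h₁ h₂ h₃ h₄ := Cyl.ext' (D.squares.assoc _ _ _ _ _ h₁ h₂ h₃ h₄)
    (D.squares.assoc _ _ _ _ _ _ (Cyl.comp_snd (x.comp r y h₁) _ z h₂) (Cyl.comp_snd y q z h₃)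
      (Cyl.comp_snd x r (y.comp q z h₃) h₄))
    (D.two.assoc _ _ _ _ _ _ _ _ _) (D.two.assoc _ _ _ _ _ _ _ _ _)
  exchange x r s hrs y z h₁ h₂ h₃ h₄ := Cyl.ext' (D.squares.exchange _ _ _ hrs _ _ h₁ h₂ h₃ h₄)
    (D.squares.exchange _ _ _ hrs _ _ _ (Cyl.comp_snd (x.comp r y h₁) _ z h₂) (Cyl.comp_snd x s z h₃)
      (Cyl.comp_snd (x.comp s z h₃) _ y h₄))
    (D.two.exchange _ _ _ _ _ _ _ _ _ _) (D.two.exchange _ _ _ _ _ _ _ _ _ _)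
  equivariance σ τ x q q' hq y h h' := Cyl.ext' (D.squares.equivariance σ τ _ _ _ hq _ h h')
    (D.squares.equivariance σ τ _ _ _ hq _ (Cyl.comp_snd x q y h)
      (Cyl.comp_snd (x.act σ) q' (y.act τ) h'))
    (D.two.equivariance σ τ _ _ _ hq _ _ _) (D.two.equivariance σ τ _ _ _ hq _ _ _)

variable (D) in
/-- The co-subunary 2-polycategory of vertical arrows, squares and cylinders, i.e. the
object-of-morphisms of the internal category of quintets in `D` (the object-of-objects of which is `D`
itself). -/
noncomputable def quintets : CoSub2.{v, max v w, max v w} where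
  Obj := D.one.Arr Unit true
  one := D.squares
  two := D.cylinders
  dom :=
    { arr := Cyl.fst
      src_arr := fun _ _ => rfl
      tgt_arr := fun _ => rfl
      arr_act := fun _ _ => rfl
      arr_one := fun _ => rfl
      arr_comp := fun _ _ _ _ _ => rfl }
  cod :=
    { arr := Cyl.snd
      src_arr := fun x i => (congrFun (Cyl.left_eq x) i).symm
      tgt_arr := fun x => (Cyl.right_eq x).symm
      arr_act := fun _ _ => rfl
      arr_one := fun _ => rfl
      arr_comp := fun _ _ _ _ _ => rfl }
  idc :=
    { arr := Cyl.id
      src_arr := fun _ _ => rfl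
      tgt_arr := fun _ => rfl
      arr_act := fun σ x => Cyl.ext' rfl rfl (D.idc.arr_act σ _) (D.idc.arr_act σ _)
      arr_one := fun _ => rfl
      arr_comp := fun g q f h _ => Cyl.ext' rfl rfl (D.idc.arr_comp _ _ _ _ _)
        (D.idc.arr_comp _ _ _ _ _) }
  vcomp := Cyl.vcomp
  dom_idc _ := rfl
  cod_idc _ := rfl
  dom_vcomp _ _ _ := rfl
  cod_vcomp _ _ _ := rfl
  id_vcomp f θ h := by
    have h' : f = θ.fst := h
    subst h'
    exact Cyl.ext' rfl rfl (D.id_vcomp _ _ _) (D.id_vcomp _ _ _)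
  vcomp_id f θ h := by
    have h' : θ.snd = f := h
    subst h'
    exact Cyl.ext' rfl rfl (D.vcomp_id _ _ _) (D.vcomp_id _ _ _)
  vcomp_assoc θ η ζ h₁ h₂ h₃ h₄ := by
    have k₁ : θ.snd = η.fst := h₁
    have k₂ : η.snd = ζ.fst := h₃
    exact Cyl.ext' rfl rfl
      (D.vcomp_assoc _ _ _ _ _ (by rw [η.cod_up, ζ.dom_up, k₂])
        (by rw [D.dom_vcomp, θ.cod_up, η.dom_up, k₁]))
      (D.vcomp_assoc _ _ _ _ _ (by rw [η.cod_down, ζ.dom_down, k₂])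
        (by rw [D.dom_vcomp, θ.cod_down, η.dom_down, k₁]))
  act_vcomp σ θ η h h' := by
    have k : θ.snd = η.fst := h
    have k₁ : D.cod.arr θ.up = D.dom.arr η.up := by rw [θ.cod_up, η.dom_up, k]
    have k₂ : D.cod.arr θ.down = D.dom.arr η.down := by rw [θ.cod_down, η.dom_down, k]
    exact Cyl.ext' rfl rfl (D.act_vcomp _ _ _ _ (by rw [D.cod.arr_act, D.dom.arr_act, k₁]))
      (D.act_vcomp _ _ _ _ (by rw [D.cod.arr_act, D.dom.arr_act, k₂]))
  comp_vcomp θ η q θ' η' h₁ h₂ h₃ h₄ h₅ h₆ := by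
    have k₁ : θ.snd = η.fst := h₁
    have k₂ : θ'.snd = η'.fst := h₂
    have u₁ : D.cod.arr θ.up = D.dom.arr η.up := by rw [θ.cod_up, η.dom_up, k₁]
    have u₂ : D.cod.arr θ'.up = D.dom.arr η'.up := by rw [θ'.cod_up, η'.dom_up, k₂]
    have d₁ : D.cod.arr θ.down = D.dom.arr η.down := by rw [θ.cod_down, η.dom_down, k₁]
    have d₂ : D.cod.arr θ'.down = D.dom.arr η'.down := by rw [θ'.cod_down, η'.dom_down, k₂]
    have e₁ := Cyl.comp_up θ q θ' h₄
    have e₂ := Cyl.comp_up η q η' h₅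
    have e₃ := Cyl.comp_down θ q θ' h₄
    have e₄ := Cyl.comp_down η q η' h₅
    exact Cyl.ext' rfl rfl (D.comp_vcomp _ _ _ _ _ u₁ u₂ _ e₁ e₂ _)
      (D.comp_vcomp _ _ _ _ _ d₁ d₂ _ e₃ e₄ _)

end CoSub2

/-! ## Cliques and the Chu constructions -/

namespace CoSub2

variable (D : CoSub2.{u, v, w})

/-- The elements of a presheaf (the co-nullary arrows) with the list `Γ` of inputs. -/
def Elt {ι : Type} [Finite ι] (Γ : ι → D.Obj) : Type v :=
  {x : D.one.Arr ι false // ∀ i, D.one.src x i = Γ i}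

/-- A clique in the category `Ω(Γ)` of co-nullary arrows with the list `Γ` of inputs: a family of
objects and a compatible family of isomorphisms between any two of them. -/
@[ext]
structure Clique {ι : Type} [Finite ι] (Γ : ι → D.Obj) (E : Type) where
  obj : E → D.Elt Γ
  iso : E → E → D.two.Arr ι false
  dom_iso : ∀ e e', D.dom.arr (iso e e') = (obj e).1
  cod_iso : ∀ e e', D.cod.arr (iso e e') = (obj e').1
  iso_self : ∀ e, iso e e = D.idc.arr (obj e).1
  iso_trans : ∀ e e' e'',
    D.vcomp (iso e e') (iso e' e'') ((cod_iso e e').trans (dom_iso e' e'').symm) = iso e e''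

variable {D}

namespace Clique

variable {ι : Type} [Finite ι] {Γ : ι → D.Obj} {E E' : Type}

/-- Reindexing of cliques. -/
def reindex (g : E' → E) (c : D.Clique Γ E) : D.Clique Γ E' where
  obj e := c.obj (g e)
  iso e e' := c.iso (g e) (g e')
  dom_iso _ _ := c.dom_iso _ _
  cod_iso _ _ := c.cod_iso _ _
  iso_self _ := c.iso_self _
  iso_trans _ _ _ := c.iso_trans _ _ _

/-- The clique consisting of copies of one object and identities. -/
def const (E : Type) (A : D.Elt Γ) : D.Clique Γ E where
  obj _ := A
  iso _ _ := D.idc.arr A.1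
  dom_iso _ _ := D.dom_idc _
  cod_iso _ _ := D.cod_idc _
  iso_self _ := rfl
  iso_trans _ _ _ := D.id_vcomp _ _ _

theorem vcomp_cancel {a b c d f : D.two.Arr ι false} (h₁ : D.cod.arr a = D.dom.arr b)
    (h₂ : D.cod.arr c = D.dom.arr d) (h₃ : D.cod.arr b = D.dom.arr c) (x : D.one.Arr ι false)
    (h₄ : D.vcomp b c h₃ = D.idc.arr x) (h₅ : D.cod.arr a = D.dom.arr d)
    (h₆ : D.vcomp a d h₅ = f) (h) : D.vcomp (D.vcomp a b h₁) (D.vcomp c d h₂) h = f := by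
  rw [D.vcomp_assoc a b _ h₁ _ (by rw [D.dom_vcomp, h₃]) (by rw [D.dom_vcomp, h₁]), ← h₆]
  refine D.vcomp_congr rfl ?_ _ _
  rw [← D.vcomp_assoc b c d h₃ (by rw [D.cod_vcomp, h₂])]
  have h₇ : D.cod.arr (D.idc.arr x) = D.dom.arr d := by rw [← h₄, D.cod_vcomp, h₂]
  exact (D.vcomp_congr h₄ rfl _ h₇).trans (D.id_vcomp _ _ _)

/-- Two cliques with an object `c.obj a = d.obj b` in common form one clique, where the isomorphisms
between objects of different cliques are those through the common object. (So are, equivalently, the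
isomorphisms between objects of the same clique, because of `iso_trans`.) -/
def join (c : D.Clique Γ E) (a : E) (d : D.Clique Γ E') (b : E') (h : c.obj a = d.obj b) :
    D.Clique Γ (E ⊕ E') where
  obj := Sum.elim c.obj d.obj
  iso e e' := D.vcomp (Sum.elim (c.iso · a) (d.iso · b) e) (Sum.elim (c.iso a) (d.iso b) e') (by
    rcases e with e | e <;> rcases e' with e' | e' <;>
      simp only [Sum.elim_inl, Sum.elim_inr, c.cod_iso, c.dom_iso, d.cod_iso, d.dom_iso, h])
  dom_iso e e' := by
    rw [D.dom_vcomp]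
    rcases e with e | e
    exacts [c.dom_iso _ _, d.dom_iso _ _]
  cod_iso e e' := by
    rw [D.cod_vcomp]
    rcases e' with e' | e'
    exacts [c.cod_iso _ _, d.cod_iso _ _]
  iso_self e := by
    rcases e with e | e
    · exact (c.iso_trans _ _ _).trans (c.iso_self _)
    · exact (d.iso_trans _ _ _).trans (d.iso_self _)
  iso_trans e e' e'' := by
    refine vcomp_cancel _ _ ?_ (c.obj a).1 ?_ ?_ rfl _
    · rcases e' with e' | e' <;>
        simp only [Sum.elim_inl, Sum.elim_inr, c.cod_iso, c.dom_iso, d.cod_iso, d.dom_iso]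
    · rcases e' with e' | e'
      · exact (c.iso_trans _ _ _).trans (c.iso_self _)
      · exact (d.iso_trans _ _ _).trans ((d.iso_self _).trans (by rw [h]))

end Clique

variable (D)

/-- The Frobenius pseudo-discrete polycategory of the category `Ω(Γ)`: its polyarrows are the cliques
on all their inputs and outputs. -/
def fpdFib {ι : Type} [Finite ι] (Γ : ι → D.Obj) : PolyData.{v, max v w} where
  Obj := D.Elt Γ
  Arr m n _ _ := D.Clique Γ (m ⊕ n)
  src c i := c.obj (Sum.inl i)
  tgt c j := c.obj (Sum.inr j)
  perm ρ τ c := c.reindex (ρ.sumCongr τ).symm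
  one A := Clique.const _ A
  comp g k f j h := (g.join (Sum.inl k) f (Sum.inr j) h).reindex
    (fun e => Sum.map Subtype.val Subtype.val ((glue k j).symm e))
  src_perm ρ _ c i := congrArg (fun i => c.obj (Sum.inl i)) (ρ.symm_apply_apply i)
  tgt_perm _ τ c j := congrArg (fun j => c.obj (Sum.inr j)) (τ.symm_apply_apply j)
  src_one _ _ := rfl
  tgt_one _ _ := rfl
  src_comp _ _ _ _ _ i := by rcases i with _ | _ <;> rfl
  tgt_comp _ _ _ _ _ i := by rcases i with _ | _ <;> rfl

variable {D}

section

variable {ι κ : Type} [Finite ι] [Finite κ] {Γ : ι → D.Obj} {Δ : κ → D.Obj}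

/-- The action of bijections on elements. -/
def Elt.act (σ : ι ≃ κ) (h : ∀ i, Δ (σ i) = Γ i) (x : D.Elt Γ) : D.Elt Δ :=
  ⟨D.one.act σ x.1, fun i => by
    obtain ⟨i, rfl⟩ := σ.surjective i
    rw [D.one.src_act, x.2, h]⟩

theorem Elt.sub_src (p : ι) (f : D.one.Arr κ true) (h : D.one.tgt f = Γ p) (x : D.Elt Γ) :
    D.one.src x.1 p = D.one.tgt f := (x.2 p).trans h.symm

/-- The action of arrows on elements. -/
def Elt.sub (p : ι) (f : D.one.Arr κ true) (h : D.one.tgt f = Γ p) (x : D.Elt Γ) :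
    D.Elt (D.one.multicat.subCtx Γ p f) :=
  ⟨D.one.comp x.1 p f (Elt.sub_src p f h x), by
    rintro (i | i)
    · exact (D.one.src_comp_inl _ _ _ _ _).trans (x.2 _)
    · exact D.one.src_comp_inr _ _ _ _ _⟩

/-- The action of bijections on cliques. -/
def Clique.act {E : Type} (σ : ι ≃ κ) (h : ∀ i, Δ (σ i) = Γ i) (c : D.Clique Γ E) :
    D.Clique Δ E where
  obj e := (c.obj e).act σ h
  iso e e' := D.two.act σ (c.iso e e')
  dom_iso _ _ := by rw [D.dom.arr_act, c.dom_iso]; rfl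
  cod_iso _ _ := by rw [D.cod.arr_act, c.cod_iso]; rfl
  iso_self _ := by rw [c.iso_self, ← D.idc.arr_act]; rfl
  iso_trans e e' e'' := by
    rw [← D.act_vcomp _ _ _ ((c.cod_iso e e').trans (c.dom_iso e' e'').symm), c.iso_trans]

theorem Clique.sub_src {E : Type} (p : ι) (f : D.one.Arr κ true) (h : D.one.tgt f = Γ p)
    (c : D.Clique Γ E) (e e' : E) : D.two.src (c.iso e e') p = D.two.tgt (D.idc.arr f) := by
  rw [← D.dom.src_arr, c.dom_iso, D.idc.tgt_arr, h, (c.obj e).2]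

/-- The action of arrows on cliques. -/
def Clique.sub {E : Type} (p : ι) (f : D.one.Arr κ true) (h : D.one.tgt f = Γ p)
    (c : D.Clique Γ E) : D.Clique (D.one.multicat.subCtx Γ p f) E where
  obj e := (c.obj e).sub p f h
  iso e e' := D.two.comp (c.iso e e') p (D.idc.arr f) (c.sub_src p f h e e')
  dom_iso e e' := by
    have k := c.sub_src p f h e e'
    rw [D.dom_comp _ _ _ _ (by rw [D.dom.src_arr, D.dom.tgt_arr, k])]
    exact D.one.comp_congr (c.dom_iso _ _) _ (D.dom_idc _) _ _
  cod_iso e e' := by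
    have k := c.sub_src p f h e e'
    rw [D.cod_comp _ _ _ _ (by rw [D.cod.src_arr, D.cod.tgt_arr, k])]
    exact D.one.comp_congr (c.cod_iso _ _) _ (D.cod_idc _) _ _
  iso_self e := by
    have k := c.sub_src p f h e e
    rw [c.iso_self] at k
    exact (D.two.comp_congr (c.iso_self e) _ rfl _ k).trans (D.idc.arr_comp _ _ _ _ _).symm
  iso_trans e e' e'' := by
    have k := (c.cod_iso e e').trans (c.dom_iso e' e'').symm
    rw [← D.comp_vcomp_left _ _ _ _ k (by rw [c.iso_trans]; exact c.sub_src p f h e e'')]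
    exact D.two.comp_congr (c.iso_trans e e' e'') _ rfl _ _

end

variable (D)

/-- The presheaf `Ω_fpd` of (`∗`-)polycategories associated to the presheaf of categories `Ω` (the
co-nullary part of `D`). Every object is its own dual. -/
def fpd : StarPshData.{u, v, v, max v w} D.one.multicat where
  fib Γ := D.fpdFib Γ
  act σ h :=
    { obj := fun x => Elt.act σ h x
      arr := fun c => Clique.act σ h c
      src_arr := fun _ _ => rfl
      tgt_arr := fun _ _ => rfl }
  sub p f h :=
    { obj := fun x => Elt.sub p f h x
      arr := fun c => Clique.sub p f h c
      src_arr := fun _ _ => rfl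
      tgt_arr := fun _ _ => rfl }
  dual x := x
  sact σ c := Clique.reindex σ.symm c
  dual_dual _ := rfl
  entry_sact := by
    intro ι _ Γ m n m' n' _ _ _ _ σ c e
    obtain ⟨e, rfl⟩ := σ.symm.surjective e
    rw [σ.apply_symm_apply]
    have k : ∀ {m n : Type} (c : D.Clique Γ (m ⊕ n)) (e : m ⊕ n),
        Sum.elim (fun i => c.obj (Sum.inl i)) (fun j => c.obj (Sum.inr j)) e = c.obj e := by
      rintro m n c (_ | _) <;> rfl
    exact (k (Clique.reindex σ.symm c) e).trans (k (show D.Clique Γ (m ⊕ n) from c) _).symm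
  act_dual _ _ _ := rfl
  sub_dual _ _ _ _ := rfl

theorem fpd_objs_isPsh : D.fpd.objs.IsPsh where
  act_refl _ _ := Subtype.ext (D.one.act_refl _)
  act_act _ _ _ _ _ _ := Subtype.ext (D.one.act_act _ _ _)
  sub_one _ _ _ _ _ := Subtype.ext (D.one.comp_one _ _ _ _)
  sub_comm _ _ _ _ _ _ _ _ _ _ _ := Subtype.ext (D.one.exchange _ _ _ _ _ _ _ _ _ _)
  sub_comp p g q f hgf h₁ h₂ h₃ _ x := Subtype.ext (by
    have k₁ := Elt.sub_src p g h₂ x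
    have k₃ := Elt.sub_src (Sum.inr q) f h₃ (Elt.sub p g h₂ x)
    have k₂ := Elt.sub_src p (D.one.comp g q f hgf) h₁ x
    refine Eq.trans ?_ (congrArg (D.one.act _) (D.one.assoc x.1 p g q f k₁ k₃ hgf k₂)).symm
    rw [D.one.act_act]
    exact (D.one.act_self (fun i => (plugInr (Equiv.refl _)).apply_symm_apply i) _).symm)
  sub_act p f ρ h₁ h₂ _ x := Subtype.ext (D.one.comp_act_right ρ x.1 p f _ _)
  act_sub τ p p' hp f _ _ _ _ x := Subtype.ext (D.one.comp_act_left τ x.1 p p' hp f _ _)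

/-- `Chu₀(C, Ω) = Adj(Ω_fpd)()`. -/
noncomputable def chu₀ : StarPolyData.{max u v, max u v w} :=
  (D.fpd.adj D.fpd_objs_isPsh).starFib (PEmpty.elim : PEmpty.{1} → D.Obj)

end CoSub2

/-! ## Internal categories in `∗`-polycategories -/

/-- The pullback of two functors of `∗`-polycategories. -/
def StarPolyData.pullback {P : StarPolyData.{u, v}} {Q : StarPolyData.{u₁, v₁}}
    {R : StarPolyData.{u, v}} (F : PolyMap P.toPolyData Q.toPolyData)
    (G : PolyMap R.toPolyData Q.toPolyData) (hF : IsStarFunctor P Q F) (hG : IsStarFunctor R Q G) :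
    StarPolyData.{u, v} where
  Obj := {x : P.Obj × R.Obj // F.obj x.1 = G.obj x.2}
  Arr m n _ _ := {f : P.Arr m n × R.Arr m n // F.arr f.1 = G.arr f.2}
  src f i := ⟨(P.src f.1.1 i, R.src f.1.2 i), by
    have h := congrArg (fun a => Q.src a i) f.2
    simpa only [F.src_arr, G.src_arr] using h⟩
  tgt f j := ⟨(P.tgt f.1.1 j, R.tgt f.1.2 j), by
    have h := congrArg (fun a => Q.tgt a j) f.2
    simpa only [F.tgt_arr, G.tgt_arr] using h⟩
  perm ρ τ f := ⟨(P.perm ρ τ f.1.1, R.perm ρ τ f.1.2), by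
    rw [hF.isFunctor.perm, hG.isFunctor.perm, f.2]⟩
  one x := ⟨(P.one x.1.1, R.one x.1.2), by rw [hF.isFunctor.one, hG.isFunctor.one, x.2]⟩
  comp g k f j h :=
    have h₁ : P.src g.1.1 k = P.tgt f.1.1 j := congrArg (fun x => x.1.1) h
    have h₂ : R.src g.1.2 k = R.tgt f.1.2 j := congrArg (fun x => x.1.2) h
    ⟨(P.comp g.1.1 k f.1.1 j h₁, R.comp g.1.2 k f.1.2 j h₂), by
      rw [hF.isFunctor.comp _ _ _ _ h₁ (by rw [F.src_arr, F.tgt_arr, h₁]),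
        hG.isFunctor.comp _ _ _ _ h₂ (by rw [G.src_arr, G.tgt_arr, h₂])]
      congr 1
      exacts [g.2, f.2]⟩
  src_perm ρ τ f i := Subtype.ext (Prod.ext (P.src_perm ρ τ _ i) (R.src_perm ρ τ _ i))
  tgt_perm ρ τ f j := Subtype.ext (Prod.ext (P.tgt_perm ρ τ _ j) (R.tgt_perm ρ τ _ j))
  src_one x i := Subtype.ext (Prod.ext (P.src_one _ i) (R.src_one _ i))
  tgt_one x i := Subtype.ext (Prod.ext (P.tgt_one _ i) (R.tgt_one _ i))
  src_comp g k f j h i := by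
    refine Subtype.ext (Prod.ext ((P.src_comp _ _ _ _ _ i).trans ?_)
      ((R.src_comp _ _ _ _ _ i).trans ?_)) <;> rcases i with _ | _ <;> rfl
  tgt_comp g k f j h i := by
    refine Subtype.ext (Prod.ext ((P.tgt_comp _ _ _ _ _ i).trans ?_)
      ((R.tgt_comp _ _ _ _ _ i).trans ?_)) <;> rcases i with _ | _ <;> rfl
  dual x := ⟨(P.dual x.1.1, R.dual x.1.2), by rw [hF.dual, hG.dual, x.2]⟩
  dual_dual x := Subtype.ext (Prod.ext (P.dual_dual _) (R.dual_dual _))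
  sact σ f := ⟨(P.sact σ f.1.1, R.sact σ f.1.2), by rw [hF.sact, hG.sact, f.2]⟩
  entry_sact σ f e := by
    refine Subtype.ext (Prod.ext (Eq.trans ?_ ((P.entry_sact σ f.1.1 e).trans ?_))
      (Eq.trans ?_ ((R.entry_sact σ f.1.2 e).trans ?_)))
    · rcases σ e with _ | _ <;> rfl
    · rcases e with _ | _ <;> rfl
    · rcases σ e with _ | _ <;> rfl
    · rcases e with _ | _ <;> rfl

/-- An internal category in the category of `∗`-polycategories, with object-of-objects `P₀` and
object-of-morphisms `P₁`. -/
structure StarInternalCat (P₀ : StarPolyData.{u, v}) (P₁ : StarPolyData.{u₁, v₁}) where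
  isStarPoly₀ : P₀.IsStarPoly
  isStarPoly₁ : P₁.IsStarPoly
  /-- Source. -/
  s : PolyMap P₁.toPolyData P₀.toPolyData
  /-- Target. -/
  t : PolyMap P₁.toPolyData P₀.toPolyData
  /-- Identities. -/
  i : PolyMap P₀.toPolyData P₁.toPolyData
  s_isStar : IsStarFunctor P₁ P₀ s
  t_isStar : IsStarFunctor P₁ P₀ t
  i_isStar : IsStarFunctor P₀ P₁ i
  /-- Composition of the pairs `(x, y)` with `t x = s y`. -/
  c : PolyMap (StarPolyData.pullback t s t_isStar s_isStar).toPolyData P₁.toPolyData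
  c_isStar : IsStarFunctor (StarPolyData.pullback t s t_isStar s_isStar) P₁ c
  s_i : ∀ A, s.obj (i.obj A) = A
  s_i_arr : ∀ {m n : Type} [Finite m] [Finite n] (f : P₀.Arr m n), s.arr (i.arr f) = f
  t_i : ∀ A, t.obj (i.obj A) = A
  t_i_arr : ∀ {m n : Type} [Finite m] [Finite n] (f : P₀.Arr m n), t.arr (i.arr f) = f
  s_c : ∀ x y h, s.obj (c.obj ⟨(x, y), h⟩) = s.obj x
  s_c_arr : ∀ {m n : Type} [Finite m] [Finite n] (f g : P₁.Arr m n) (h : t.arr f = s.arr g),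
    s.arr (c.arr ⟨(f, g), h⟩) = s.arr f
  t_c : ∀ x y h, t.obj (c.obj ⟨(x, y), h⟩) = t.obj y
  t_c_arr : ∀ {m n : Type} [Finite m] [Finite n] (f g : P₁.Arr m n) (h : t.arr f = s.arr g),
    t.arr (c.arr ⟨(f, g), h⟩) = t.arr g
  id_c : ∀ y, c.obj ⟨(i.obj (s.obj y), y), t_i _⟩ = y
  id_c_arr : ∀ {m n : Type} [Finite m] [Finite n] (g : P₁.Arr m n),
    c.arr ⟨(i.arr (s.arr g), g), t_i_arr _⟩ = g
  c_id : ∀ x, c.obj ⟨(x, i.obj (t.obj x)), (s_i _).symm⟩ = x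
  c_id_arr : ∀ {m n : Type} [Finite m] [Finite n] (f : P₁.Arr m n),
    c.arr ⟨(f, i.arr (t.arr f)), (s_i_arr _).symm⟩ = f
  c_assoc : ∀ x y z (h : t.obj x = s.obj y) (h' : t.obj y = s.obj z),
    c.obj ⟨(c.obj ⟨(x, y), h⟩, z), (t_c x y h).trans h'⟩ =
      c.obj ⟨(x, c.obj ⟨(y, z), h'⟩), h.trans (s_c y z h').symm⟩
  c_assoc_arr : ∀ {m n : Type} [Finite m] [Finite n] (f g k : P₁.Arr m n)
    (h : t.arr f = s.arr g) (h' : t.arr g = s.arr k),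
    c.arr ⟨(c.arr ⟨(f, g), h⟩, k), (t_c_arr f g h).trans h'⟩ =
      c.arr ⟨(f, c.arr ⟨(g, k), h'⟩), h.trans (s_c_arr g k h').symm⟩

/-! ## The double Chu construction -/

namespace CoSub2

section Components

variable {D : CoSub2.{u, v, w}} {m n : Type} [Finite m] [Finite n]

/-- The component `A⁺` of `(A⁺, A⁻, A̲)`. -/
def chuPlus (A : D.chu₀.Obj) : D.Obj :=
  AdjObj.plus (Ω := D.fpd.toPolyPshData) (Γ := PEmpty.elim) A

/-- The component `A⁻` of `(A⁺, A⁻, A̲)`. -/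
def chuMinus (A : D.chu₀.Obj) : D.Obj :=
  AdjObj.minus (Ω := D.fpd.toPolyPshData) (Γ := PEmpty.elim) A

/-- The component `A̲` of `(A⁺, A⁻, A̲)`. -/
def chuForm (A : D.chu₀.Obj) : D.one.Arr (PEmpty.{1} ⊕ Bool) false :=
  (AdjObj.form (Ω := D.fpd.toPolyPshData) (Γ := PEmpty.elim) A).1

/-- The primary components of a polyarrow. -/
def chuPrim (f : D.chu₀.Arr m n) (e : m ⊕ n) : D.one.Arr {x // x ≠ e} true :=
  AdjArr.prim (Ω := D.fpd.toPolyPshData) (Γ := PEmpty.elim) f e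

/-- The isomorphisms of the clique of a polyarrow. -/
def chuIso (f : D.chu₀.Arr m n) (e e' : m ⊕ n) : D.two.Arr (PEmpty.{1} ⊕ (m ⊕ n)) false :=
  Clique.iso (AdjArr.sec (Ω := D.fpd.toPolyPshData) (Γ := PEmpty.elim) f) e e'

end Components

variable {D : CoSub2.{u, v, w}} {ι : Type} [Finite ι] {b : Bool}

/-- `z` is the vertical composite of the square `x` and the square `y` below it. -/
def Square.IsComp (x y z : D.Square ι b) : Prop :=
  z.top = x.top ∧ z.bot = y.bot ∧ ∃ h, z.cell =
    D.vcomp (D.two.post (Cod.map D.idc.arr y.right) x.cell)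
      (D.two.substAll y.cell fun i => D.idc.arr (x.left i)) h

/-- `z` is the vertical identity square of `f`. -/
def Square.IsId (f : D.one.Arr ι b) (z : D.Square ι b) : Prop :=
  z.top = f ∧ z.bot = f ∧ z.cell = D.idc.arr f

variable (D)

/-- The data of the double Chu construction: an internal category, with object-of-objects
`Chu₀(D)` and object-of-morphisms `Chu₀` of the vertical arrows, squares and cylinders in `D`, the
structure maps of which are induced by those of the internal category of quintets in `D`. The
objects of `Chu₀(D.quintets)` are thus the vertical arrows `u = (u⁺, u⁻, u̲)`, with `u⁺ = chuPlus u`,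
`u⁻ = chuMinus u`, and `u̲` the 2-cell of the square `chuForm u`; its polyarrows are the 2-cells `μ`,
with components the 2-cells of the squares `chuPrim μ e`. -/
structure DoubleChu extends StarInternalCat D.chu₀ D.quintets.chu₀ where
  s_plus : ∀ x, chuPlus (s.obj x) = D.one.src (chuPlus x) ()
  s_minus : ∀ x, chuMinus (s.obj x) = D.one.src (chuMinus x) ()
  s_form : ∀ x, chuForm (s.obj x) = Square.top (chuForm x)
  s_prim : ∀ {m n : Type} [Finite m] [Finite n] (f : D.quintets.chu₀.Arr m n) (e : m ⊕ n),
    chuPrim (s.arr f) e = Square.top (chuPrim f e)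
  s_iso : ∀ {m n : Type} [Finite m] [Finite n] (f : D.quintets.chu₀.Arr m n) (e e' : m ⊕ n),
    chuIso (s.arr f) e e' = Cyl.up (chuIso f e e')
  t_plus : ∀ x, chuPlus (t.obj x) = D.one.tgt (b := true) (chuPlus x)
  t_minus : ∀ x, chuMinus (t.obj x) = D.one.tgt (b := true) (chuMinus x)
  t_form : ∀ x, chuForm (t.obj x) = Square.bot (chuForm x)
  t_prim : ∀ {m n : Type} [Finite m] [Finite n] (f : D.quintets.chu₀.Arr m n) (e : m ⊕ n),
    chuPrim (t.arr f) e = Square.bot (chuPrim f e)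
  t_iso : ∀ {m n : Type} [Finite m] [Finite n] (f : D.quintets.chu₀.Arr m n) (e e' : m ⊕ n),
    chuIso (t.arr f) e e' = Cyl.down (chuIso f e e')
  i_plus : ∀ A, chuPlus (i.obj A) = D.one.one (chuPlus A)
  i_minus : ∀ A, chuMinus (i.obj A) = D.one.one (chuMinus A)
  i_form : ∀ A, Square.IsId (chuForm A) (chuForm (i.obj A))
  i_prim : ∀ {m n : Type} [Finite m] [Finite n] (f : D.chu₀.Arr m n) (e : m ⊕ n),
    Square.IsId (chuPrim f e) (chuPrim (i.arr f) e)
  i_iso_up : ∀ {m n : Type} [Finite m] [Finite n] (f : D.chu₀.Arr m n) (e e' : m ⊕ n),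
    Cyl.up (chuIso (i.arr f) e e') = chuIso f e e'
  i_iso_down : ∀ {m n : Type} [Finite m] [Finite n] (f : D.chu₀.Arr m n) (e e' : m ⊕ n),
    Cyl.down (chuIso (i.arr f) e e') = chuIso f e e'
  c_plus : ∀ x y h, chuPlus (c.obj ⟨(x, y), h⟩) =
    D.one.post (b := true) (chuPlus y) (chuPlus x)
  c_minus : ∀ x y h, chuMinus (c.obj ⟨(x, y), h⟩) =
    D.one.post (b := true) (chuMinus y) (chuMinus x)
  c_form : ∀ x y h, Square.IsComp (chuForm x) (chuForm y) (chuForm (c.obj ⟨(x, y), h⟩))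
  c_prim : ∀ {m n : Type} [Finite m] [Finite n] (f g : D.quintets.chu₀.Arr m n)
    (h : t.arr f = s.arr g) (e : m ⊕ n),
    Square.IsComp (chuPrim f e) (chuPrim g e) (chuPrim (c.arr ⟨(f, g), h⟩) e)
  c_iso_up : ∀ {m n : Type} [Finite m] [Finite n] (f g : D.quintets.chu₀.Arr m n)
    (h : t.arr f = s.arr g) (e e' : m ⊕ n),
    Cyl.up (chuIso (c.arr ⟨(f, g), h⟩) e e') = Cyl.up (chuIso f e e')
  c_iso_down : ∀ {m n : Type} [Finite m] [Finite n] (f g : D.quintets.chu₀.Arr m n)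
    (h : t.arr f = s.arr g) (e e' : m ⊕ n),
    Cyl.down (chuIso (c.arr ⟨(f, g), h⟩) e e') = Cyl.down (chuIso g e e')

end CoSub2

end ChuDialectica

universe u₂ v₂ u₃ v₃ w₂

set_option linter.unusedVariables false
set_option linter.unusedSectionVars false

namespace ChuDialectica

/-! ## Composition in a multicategory up to reindexing -/

namespace Multicat

variable (C : Multicat.{u, v})

theorem act_congr {ι κ : Type} [Finite ι] [Finite κ] {σ τ : ι ≃ κ} (h : ∀ i, σ i = τ i)
    {f g : C.Arr ι} (hf : f = g) : C.act σ f = C.act τ g := by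
  rw [Equiv.ext h, hf]

theorem act_self {ι : Type} [Finite ι] {σ : ι ≃ ι} (h : ∀ i, σ i = i) (f : C.Arr ι) :
    C.act σ f = f := by
  rw [Equiv.ext (g := Equiv.refl ι) h, C.act_refl]

/-- The composite `g ∘ f` at the input `q` of `g`, with its inputs relabelled along `w`. -/
def plug {κ ι Z : Type} [Finite κ] [Finite ι] [Finite Z] {q : κ} (w : {x : κ // x ≠ q} ⊕ ι ≃ Z)
    (g : C.Arr κ) (f : C.Arr ι) (h : C.src g q = C.tgt f) : C.Arr Z :=
  C.act w (C.comp g q f h)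

variable {C}
variable {ι ι' κ κ' μ Z Z' Z₁ Z₂ : Type} [Finite ι] [Finite ι'] [Finite κ] [Finite κ'] [Finite μ]
  [Finite Z] [Finite Z'] [Finite Z₁] [Finite Z₂]

theorem act_plug (τ : Z ≃ Z') {q : κ} (w : {x : κ // x ≠ q} ⊕ ι ≃ Z) (g : C.Arr κ) (f : C.Arr ι)
    (h : C.src g q = C.tgt f) : C.act τ (C.plug w g f h) = C.plug (w.trans τ) g f h :=
  C.act_act _ _ _

theorem src_plug_inl {q : κ} (w : {x : κ // x ≠ q} ⊕ ι ≃ Z) (g : C.Arr κ) (f : C.Arr ι)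
    (h : C.src g q = C.tgt f) (x) : C.src (C.plug w g f h) (w (Sum.inl x)) = C.src g x.1 :=
  (C.src_act _ _ _).trans (C.src_comp_inl _ _ _ _ _)

theorem src_plug_inr {q : κ} (w : {x : κ // x ≠ q} ⊕ ι ≃ Z) (g : C.Arr κ) (f : C.Arr ι)
    (h : C.src g q = C.tgt f) (x) : C.src (C.plug w g f h) (w (Sum.inr x)) = C.src f x :=
  (C.src_act _ _ _).trans (C.src_comp_inr _ _ _ _ _)

theorem tgt_plug {q : κ} (w : {x : κ // x ≠ q} ⊕ ι ≃ Z) (g : C.Arr κ) (f : C.Arr ι)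
    (h : C.src g q = C.tgt f) : C.tgt (C.plug w g f h) = C.tgt g :=
  (C.tgt_act _ _).trans (C.tgt_comp _ _ _ _)

theorem plug_congr {q : κ} {w w' : {x : κ // x ≠ q} ⊕ ι ≃ Z} (hw : ∀ i, w i = w' i)
    {g g' : C.Arr κ} {f f' : C.Arr ι} (hg : g = g') (hf : f = f') (h h') :
    C.plug w g f h = C.plug w' g' f' h' := by
  subst hg hf; rw [Equiv.ext hw]

theorem plug_act {σ : κ ≃ κ'} {τ : ι ≃ ι'} {q : κ} {q' : κ'} (hq : σ q = q')
    {w' : {x : κ' // x ≠ q'} ⊕ ι' ≃ Z} {w : {x : κ // x ≠ q} ⊕ ι ≃ Z}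
    (hl : ∀ x, w (Sum.inl x) = w' (Sum.inl (neEquiv σ hq x)))
    (hr : ∀ x, w (Sum.inr x) = w' (Sum.inr (τ x))) (g : C.Arr κ) (f : C.Arr ι) (h h') :
    C.plug w' (C.act σ g) (C.act τ f) h' = C.plug w g f h := by
  unfold plug
  rw [C.equivariance σ τ g q q' hq f h, C.act_act]
  refine C.act_congr ?_ rfl
  rintro (x | x)
  · exact (hl x).symm
  · exact (hr x).symm

theorem plug_act_left {σ : κ ≃ κ'} {q : κ} {q' : κ'} (hq : σ q = q')
    {w' : {x : κ' // x ≠ q'} ⊕ ι ≃ Z} {w : {x : κ // x ≠ q} ⊕ ι ≃ Z}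
    (hl : ∀ x, w (Sum.inl x) = w' (Sum.inl (neEquiv σ hq x)))
    (hr : ∀ x, w (Sum.inr x) = w' (Sum.inr x)) (g : C.Arr κ) (f : C.Arr ι) (h h') :
    C.plug w' (C.act σ g) f h' = C.plug w g f h := by
  have := plug_act (τ := Equiv.refl ι) hq hl hr g f h (by rw [C.act_refl]; exact h')
  rw [← this]
  exact plug_congr (fun _ => rfl) rfl (C.act_refl f).symm _ _

theorem plug_act_right {τ : ι ≃ ι'} {q : κ}
    {w' : {x : κ // x ≠ q} ⊕ ι' ≃ Z} {w : {x : κ // x ≠ q} ⊕ ι ≃ Z}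
    (hl : ∀ x, w (Sum.inl x) = w' (Sum.inl x))
    (hr : ∀ x, w (Sum.inr x) = w' (Sum.inr (τ x))) (g : C.Arr κ) (f : C.Arr ι) (h h') :
    C.plug w' g (C.act τ f) h' = C.plug w g f h := by
  have := plug_act (σ := Equiv.refl κ) (q := q) rfl (w' := w') hl hr g f h
    (by rw [C.act_refl]; exact h')
  rw [← this]
  exact plug_congr (fun _ => rfl) (C.act_refl g).symm rfl _ _

theorem plug_assoc {r : μ} {q : κ} {z : Z₁} (w₁ : {x : μ // x ≠ r} ⊕ κ ≃ Z₁)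
    (hz : w₁ (Sum.inr q) = z) (w₂ : {x : Z₁ // x ≠ z} ⊕ ι ≃ Z) (w₃ : {x : κ // x ≠ q} ⊕ ι ≃ Z₂)
    (w₄ : {x : μ // x ≠ r} ⊕ Z₂ ≃ Z) (k : C.Arr μ) (g : C.Arr κ) (f : C.Arr ι) (h₁ h₂ h₃ h₄)
    (hk : ∀ x hx, w₂ (Sum.inl ⟨w₁ (Sum.inl x), hx⟩) = w₄ (Sum.inl x))
    (hg : ∀ x hx, w₂ (Sum.inl ⟨w₁ (Sum.inr x.1), hx⟩) = w₄ (Sum.inr (w₃ (Sum.inl x))))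
    (hf : ∀ x, w₂ (Sum.inr x) = w₄ (Sum.inr (w₃ (Sum.inr x)))) :
    C.plug w₂ (C.plug w₁ k g h₁) f h₂ = C.plug w₄ k (C.plug w₃ g f h₃) h₄ := by
  have h₅ : C.src (C.comp k r g h₁) (Sum.inr q) = C.tgt f := by rw [C.src_comp_inr, h₃]
  refine (plug_act_left (σ := w₁) hz (w := (((neEquiv w₁ hz).sumCongr (Equiv.refl ι))).trans w₂)
    (fun _ => rfl) (fun _ => rfl) _ _ h₅ h₂).trans ?_
  have h₆ : C.src k r = C.tgt (C.comp g q f h₃) := by rw [C.tgt_comp, h₁]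
  refine Eq.trans ?_ (plug_act_right (τ := w₃)
    (w := ((Equiv.refl _).sumCongr w₃).trans w₄) (fun _ => rfl) (fun _ => rfl) _ _ h₆ h₄).symm
  unfold plug
  rw [C.assoc k r g q f h₁ h₅ h₃ h₆, C.act_act]
  refine C.act_congr (fun x => ?_) rfl
  obtain ⟨x, rfl⟩ := (plugInr (Equiv.refl _)).surjective x
  rw [Equiv.trans_apply, Equiv.symm_apply_apply]
  rcases x with ⟨x | x, hx⟩ | x
  · exact hk _ _
  · exact hg ⟨x, _⟩ _
  · exact hf _

theorem plug_exchange {r s : μ} (hrs : r ≠ s) {z₁ : Z₁} {z₂ : Z₂}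
    (w₁ : {x : μ // x ≠ r} ⊕ κ ≃ Z₁) (hz₁ : w₁ (Sum.inl ⟨s, hrs.symm⟩) = z₁)
    (w₂ : {x : Z₁ // x ≠ z₁} ⊕ ι ≃ Z)
    (w₃ : {x : μ // x ≠ s} ⊕ ι ≃ Z₂) (hz₂ : w₃ (Sum.inl ⟨r, hrs⟩) = z₂)
    (w₄ : {x : Z₂ // x ≠ z₂} ⊕ κ ≃ Z) (k : C.Arr μ) (g : C.Arr κ) (f : C.Arr ι) (h₁ h₂ h₃ h₄)
    (hk : ∀ x hx hy h₁ h₂, w₂ (Sum.inl ⟨w₁ (Sum.inl ⟨x, hx⟩), h₁⟩) =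
      w₄ (Sum.inl ⟨w₃ (Sum.inl ⟨x, hy⟩), h₂⟩))
    (hg : ∀ x h₁, w₂ (Sum.inl ⟨w₁ (Sum.inr x), h₁⟩) = w₄ (Sum.inr x))
    (hf : ∀ x h₂, w₂ (Sum.inr x) = w₄ (Sum.inl ⟨w₃ (Sum.inr x), h₂⟩)) :
    C.plug w₂ (C.plug w₁ k g h₁) f h₂ = C.plug w₄ (C.plug w₃ k f h₃) g h₄ := by
  have h₅ : C.src (C.comp k r g h₁) (Sum.inl ⟨s, hrs.symm⟩) = C.tgt f := by rw [C.src_comp_inl, h₃]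
  have h₆ : C.src (C.comp k s f h₃) (Sum.inl ⟨r, hrs⟩) = C.tgt g := by rw [C.src_comp_inl, h₁]
  refine (plug_act_left (σ := w₁) hz₁ (w := (((neEquiv w₁ hz₁).sumCongr (Equiv.refl ι))).trans w₂)
    (fun _ => rfl) (fun _ => rfl) _ _ h₅ h₂).trans ?_
  refine Eq.trans ?_ (plug_act_left (σ := w₃) hz₂
    (w := (((neEquiv w₃ hz₂).sumCongr (Equiv.refl κ))).trans w₄)
    (fun _ => rfl) (fun _ => rfl) _ _ h₆ h₄).symm
  unfold plug
  rw [C.exchange k r s hrs g f h₁ h₅ h₃ h₆, C.act_act]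
  refine C.act_congr (fun x => ?_) rfl
  obtain ⟨x, rfl⟩ := (swapSlots hrs).surjective x
  rw [Equiv.trans_apply, Equiv.symm_apply_apply]
  rcases x with ⟨x | x, hx⟩ | x
  · exact hk _ _ _ _ _
  · exact hg x _
  · exact hf _ _

theorem one_plug (w : {x : Unit // x ≠ ()} ⊕ ι ≃ Z) (ε : ι ≃ Z) (hε : ∀ i, w (Sum.inr i) = ε i)
    (A : C.Obj) (f : C.Arr ι) (h) : C.plug w (C.one A) f h = C.act ε f := by
  unfold plug
  rw [C.one_comp, C.act_act]
  exact C.act_congr hε rfl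

theorem plug_one {q : κ} (w : {x : κ // x ≠ q} ⊕ Unit ≃ Z) (ε : κ ≃ Z)
    (hl : ∀ x, w (Sum.inl x) = ε x.1) (hr : w (Sum.inr ()) = ε q) (A : C.Obj) (g : C.Arr κ) (h) :
    C.plug w g (C.one A) h = C.act ε g := by
  unfold plug
  rw [C.comp_one, C.act_act]
  refine C.act_congr (fun i => ?_) rfl
  obtain ⟨i, rfl⟩ := (plugUnit q).surjective i
  rw [Equiv.trans_apply, Equiv.symm_apply_apply]
  rcases i with i | i
  exacts [hl i, hr]

end Multicat

/-! ## The action of arrows on presheaves up to reindexing -/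

namespace SetPshData

variable {C : Multicat.{u, v}} (M : SetPshData.{u, v, w} C)

/-- The action of `r` at the entry `a` of a list, with the entries of the result relabelled
along `w`. -/
def plug {E F Z : Type} [Finite E] [Finite F] [Finite Z] {Φ : E → C.Obj} {Ψ : Z → C.Obj} {a : E}
    (w : {x : E // x ≠ a} ⊕ F ≃ Z) (r : C.Arr F) (h : C.tgt r = Φ a)
    (hw : ∀ i, Ψ (w i) = C.subCtx Φ a r i) (x : M.El Φ) : M.El Ψ :=
  M.act w hw (M.sub a r h x)

variable {M} (hM : M.IsPsh)
variable {E E' F F' G Z Z' Z₁ Z₂ : Type} [Finite E] [Finite E'] [Finite F] [Finite F'] [Finite G]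
  [Finite Z] [Finite Z'] [Finite Z₁] [Finite Z₂]
  {Φ : E → C.Obj} {Φ' : E' → C.Obj} {Ψ : Z → C.Obj} {Ψ' : Z' → C.Obj} {Ψ₁ : Z₁ → C.Obj}
  {Ψ₂ : Z₂ → C.Obj}

theorem plug_congr {a : E} {w w' : {x : E // x ≠ a} ⊕ F ≃ Z} (hw : ∀ i, w i = w' i)
    {r r' : C.Arr F} (hr : r = r') {x y : M.El Φ} (hx : x = y) (h h')
    (h₁ : ∀ i, Ψ (w i) = C.subCtx Φ a r i) (h₂ : ∀ i, Ψ (w' i) = C.subCtx Φ a r' i) :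
    M.plug w r h h₁ x = M.plug w' r' h' h₂ y := by
  obtain rfl := Equiv.ext hw
  subst hr hx
  rfl

include hM

theorem IsPsh.act_self {σ : E ≃ E} (h : ∀ i, σ i = i) (h₁ : ∀ i, Φ (σ i) = Φ i) (x : M.El Φ) :
    M.act σ h₁ x = x := by
  obtain rfl : σ = Equiv.refl E := Equiv.ext h
  exact hM.act_refl _ _

theorem IsPsh.act_act' (σ : E ≃ E') (τ : E' ≃ Z) (υ : E ≃ Z) (h : ∀ i, τ (σ i) = υ i)
    (h₁ : ∀ i, Φ' (σ i) = Φ i) (h₂ : ∀ i, Ψ (τ i) = Φ' i) (h₃ : ∀ i, Ψ (υ i) = Φ i) (x : M.El Φ) :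
    M.act τ h₂ (M.act σ h₁ x) = M.act υ h₃ x := by
  obtain rfl : σ.trans τ = υ := Equiv.ext h
  exact hM.act_act _ _ _ _ _ _

theorem IsPsh.act_plug {a : E} (w : {x : E // x ≠ a} ⊕ F ≃ Z) (τ : Z ≃ Z')
    (w' : {x : E // x ≠ a} ⊕ F ≃ Z') (hw : ∀ i, τ (w i) = w' i) (r : C.Arr F)
    (h : C.tgt r = Φ a) (h₁ : ∀ i, Ψ (w i) = C.subCtx Φ a r i) (h₂ : ∀ i, Ψ' (τ i) = Ψ i)
    (h₃ : ∀ i, Ψ' (w' i) = C.subCtx Φ a r i) (x : M.El Φ) :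
    M.act τ h₂ (M.plug w r h h₁ x) = M.plug w' r h h₃ x :=
  hM.act_act' _ _ _ hw _ _ _ _

theorem IsPsh.plug_act {σ : E ≃ E'} {a : E} {a' : E'} (ha : σ a = a')
    {w' : {x : E' // x ≠ a'} ⊕ F ≃ Z} {w : {x : E // x ≠ a} ⊕ F ≃ Z}
    (hl : ∀ x, w (Sum.inl x) = w' (Sum.inl (neEquiv σ ha x)))
    (hr : ∀ x, w (Sum.inr x) = w' (Sum.inr x)) (r : C.Arr F) (h : C.tgt r = Φ a)
    (h' : C.tgt r = Φ' a') (h₁ : ∀ i, Φ' (σ i) = Φ i) (h₂ : ∀ i, Ψ (w' i) = C.subCtx Φ' a' r i)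
    (h₃ : ∀ i, Ψ (w i) = C.subCtx Φ a r i) (x : M.El Φ) :
    M.plug w' r h' h₂ (M.act σ h₁ x) = M.plug w r h h₃ x := by
  unfold plug
  have h₄ : ∀ i, C.subCtx Φ' a' r ((neEquiv σ ha).sumCongr (Equiv.refl F) i) =
      C.subCtx Φ a r i := by
    rintro (x | x)
    · exact h₁ _
    · rfl
  rw [hM.act_sub σ a a' ha r h₁ h' h h₄ x]
  refine hM.act_act' _ _ _ ?_ _ _ _ _
  rintro (x | x)
  exacts [(hl x).symm, (hr x).symm]

theorem IsPsh.plug_act_right {τ : F ≃ F'} {a : E}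
    {w' : {x : E // x ≠ a} ⊕ F' ≃ Z} {w : {x : E // x ≠ a} ⊕ F ≃ Z}
    (hl : ∀ x, w (Sum.inl x) = w' (Sum.inl x))
    (hr : ∀ x, w (Sum.inr x) = w' (Sum.inr (τ x))) (r : C.Arr F) (h : C.tgt r = Φ a)
    (h' : C.tgt (C.act τ r) = Φ a) (h₂ : ∀ i, Ψ (w' i) = C.subCtx Φ a (C.act τ r) i)
    (h₃ : ∀ i, Ψ (w i) = C.subCtx Φ a r i) (x : M.El Φ) :
    M.plug w' (C.act τ r) h' h₂ x = M.plug w r h h₃ x := by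
  unfold plug
  have h₄ : ∀ i, C.subCtx Φ a (C.act τ r) ((Equiv.refl _).sumCongr τ i) = C.subCtx Φ a r i := by
    rintro (x | x)
    · rfl
    · exact C.src_act _ _ _
  rw [hM.sub_act a r τ h' h h₄ x]
  refine hM.act_act' _ _ _ ?_ _ _ _ _
  rintro (x | x)
  exacts [(hl x).symm, (hr x).symm]

/-- Acting by a composite arrow. -/
theorem IsPsh.plug_plug {a : E} {q : F} {z : Z₁} (w₁ : {x : E // x ≠ a} ⊕ F ≃ Z₁)
    (hz : w₁ (Sum.inr q) = z) (w₂ : {x : Z₁ // x ≠ z} ⊕ G ≃ Z) (w₃ : {x : F // x ≠ q} ⊕ G ≃ Z₂)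
    (w₄ : {x : E // x ≠ a} ⊕ Z₂ ≃ Z) (g : C.Arr F) (f : C.Arr G) (h₁ h₂ h₃ h₄)
    (c₁ : ∀ i, Ψ₁ (w₁ i) = C.subCtx Φ a g i) (c₂ : ∀ i, Ψ (w₂ i) = C.subCtx Ψ₁ z f i)
    (c₄ : ∀ i, Ψ (w₄ i) = C.subCtx Φ a (C.plug w₃ g f h₃) i)
    (hk : ∀ x hx, w₂ (Sum.inl ⟨w₁ (Sum.inl x), hx⟩) = w₄ (Sum.inl x))
    (hg : ∀ x hx, w₂ (Sum.inl ⟨w₁ (Sum.inr x.1), hx⟩) = w₄ (Sum.inr (w₃ (Sum.inl x))))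
    (hf : ∀ x, w₂ (Sum.inr x) = w₄ (Sum.inr (w₃ (Sum.inr x)))) (x : M.El Φ) :
    M.plug w₂ f h₂ c₂ (M.plug w₁ g h₁ c₁ x) = M.plug w₄ (C.plug w₃ g f h₃) h₄ c₄ x := by
  have h₅ : C.tgt f = C.subCtx Φ a g (Sum.inr q) := h₃.symm
  have c₅ : ∀ i, Ψ ((((neEquiv w₁ hz).sumCongr (Equiv.refl G)).trans w₂) i) =
      C.subCtx (C.subCtx Φ a g) (Sum.inr q) f i := by
    rintro (i | i)
    · exact (c₂ _).trans (c₁ _)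
    · exact c₂ _
  refine (hM.plug_act (σ := w₁) hz (w := ((neEquiv w₁ hz).sumCongr (Equiv.refl G)).trans w₂)
    (fun _ => rfl) (fun _ => rfl) f h₅ h₂ c₁ c₂ c₅ _).trans ?_
  have h₆ : C.tgt (C.comp g q f h₃) = Φ a := (C.tgt_comp _ _ _ _).trans h₁
  have c₆ : ∀ i, Ψ ((((Equiv.refl _).sumCongr w₃).trans w₄) i) =
      C.subCtx Φ a (C.comp g q f h₃) i := by
    rintro (i | i)
    · exact c₄ _
    · exact (c₄ _).trans (C.src_act _ _ _)
  refine Eq.trans ?_ (hM.plug_act_right (τ := w₃) (w := ((Equiv.refl _).sumCongr w₃).trans w₄)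
    (fun _ => rfl) (fun _ => rfl) (C.comp g q f h₃) h₆ h₄ c₄ c₆ x).symm
  unfold plug
  have c₇ : ∀ i, C.subCtx Φ a (C.comp g q f h₃) (plugInr (Equiv.refl _) i) =
      C.subCtx (C.subCtx Φ a g) (Sum.inr q) f i := by
    rintro (⟨i | i, hi⟩ | i)
    · rfl
    · exact C.src_comp_inl _ _ _ _ _
    · exact C.src_comp_inr _ _ _ _ _
  rw [hM.sub_comp a g q f h₃ h₆ h₁ h₅ c₇ x]
  refine (hM.act_act' _ _ _ ?_ _ _ _ _).symm
  rintro (⟨x | x, hx⟩ | x)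
  · exact (hk _ _).symm
  · exact (hg ⟨x, _⟩ _).symm
  · exact (hf _).symm

/-- Acting at two different entries. -/
theorem IsPsh.plug_comm {a b : E} (hab : a ≠ b) {z₁ : Z₁} {z₂ : Z₂}
    (w₁ : {x : E // x ≠ a} ⊕ F ≃ Z₁) (hz₁ : w₁ (Sum.inl ⟨b, hab.symm⟩) = z₁)
    (w₂ : {x : Z₁ // x ≠ z₁} ⊕ G ≃ Z)
    (w₃ : {x : E // x ≠ b} ⊕ G ≃ Z₂) (hz₂ : w₃ (Sum.inl ⟨a, hab⟩) = z₂)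
    (w₄ : {x : Z₂ // x ≠ z₂} ⊕ F ≃ Z) (g : C.Arr F) (f : C.Arr G) (h₁ h₂ h₃ h₄)
    (c₁ : ∀ i, Ψ₁ (w₁ i) = C.subCtx Φ a g i) (c₂ : ∀ i, Ψ (w₂ i) = C.subCtx Ψ₁ z₁ f i)
    (c₃ : ∀ i, Ψ₂ (w₃ i) = C.subCtx Φ b f i) (c₄ : ∀ i, Ψ (w₄ i) = C.subCtx Ψ₂ z₂ g i)
    (hk : ∀ x hx hy h₁ h₂, w₂ (Sum.inl ⟨w₁ (Sum.inl ⟨x, hx⟩), h₁⟩) =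
      w₄ (Sum.inl ⟨w₃ (Sum.inl ⟨x, hy⟩), h₂⟩))
    (hg : ∀ x h₁, w₂ (Sum.inl ⟨w₁ (Sum.inr x), h₁⟩) = w₄ (Sum.inr x))
    (hf : ∀ x h₂, w₂ (Sum.inr x) = w₄ (Sum.inl ⟨w₃ (Sum.inr x), h₂⟩)) (x : M.El Φ) :
    M.plug w₂ f h₂ c₂ (M.plug w₁ g h₁ c₁ x) = M.plug w₄ g h₄ c₄ (M.plug w₃ f h₃ c₃ x) := by
  have h₅ : C.tgt f = C.subCtx Φ a g (Sum.inl ⟨b, hab.symm⟩) := h₃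
  have h₆ : C.tgt g = C.subCtx Φ b f (Sum.inl ⟨a, hab⟩) := h₁
  have c₅ : ∀ i, Ψ ((((neEquiv w₁ hz₁).sumCongr (Equiv.refl G)).trans w₂) i) =
      C.subCtx (C.subCtx Φ a g) (Sum.inl ⟨b, hab.symm⟩) f i := by
    rintro (i | i)
    · exact (c₂ _).trans (c₁ _)
    · exact c₂ _
  have c₆ : ∀ i, Ψ ((((neEquiv w₃ hz₂).sumCongr (Equiv.refl F)).trans w₄) i) =
      C.subCtx (C.subCtx Φ b f) (Sum.inl ⟨a, hab⟩) g i := by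
    rintro (i | i)
    · exact (c₄ _).trans (c₃ _)
    · exact c₄ _
  refine (hM.plug_act (σ := w₁) hz₁ (w := ((neEquiv w₁ hz₁).sumCongr (Equiv.refl G)).trans w₂)
    (fun _ => rfl) (fun _ => rfl) f h₅ h₂ c₁ c₂ c₅ _).trans ?_
  refine Eq.trans ?_ (hM.plug_act (σ := w₃) hz₂
    (w := ((neEquiv w₃ hz₂).sumCongr (Equiv.refl F)).trans w₄)
    (fun _ => rfl) (fun _ => rfl) g h₆ h₄ c₃ c₄ c₆ _).symm
  unfold plug
  have c₇ : ∀ i, C.subCtx (C.subCtx Φ a g) (Sum.inl ⟨b, hab.symm⟩) f ((swapSlots hab).symm i) =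
      C.subCtx (C.subCtx Φ b f) (Sum.inl ⟨a, hab⟩) g i := by
    rintro (⟨i | i, hi⟩ | i) <;> rfl
  rw [hM.sub_comm a b hab g f h₁ h₅ h₃ h₆ c₇ x]
  refine hM.act_act' _ _ _ ?_ _ _ _ _
  rintro (⟨x | x, hx⟩ | x)
  · exact hk _ _ _ _ _
  · exact hf _ _
  · exact hg x _

theorem IsPsh.plug_one {a : E} (w : {x : E // x ≠ a} ⊕ Unit ≃ Z) (ε : E ≃ Z)
    (hl : ∀ x, w (Sum.inl x) = ε x.1) (hr : w (Sum.inr ()) = ε a) (A : C.Obj) (h)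
    (h₁ : ∀ i, Ψ (w i) = C.subCtx Φ a (C.one A) i) (h₂ : ∀ i, Ψ (ε i) = Φ i) (x : M.El Φ) :
    M.plug w (C.one A) h h₁ x = M.act ε h₂ x := by
  unfold plug
  have h₃ : ∀ i, C.subCtx Φ a (C.one A) ((plugUnit a).symm i) = Φ i := by
    intro i
    obtain ⟨i, rfl⟩ := (plugUnit a).surjective i
    rw [Equiv.symm_apply_apply]
    rcases i with i | i
    · rfl
    · exact (C.src_one _ _).trans ((C.tgt_one A).symm.trans h)
  rw [hM.sub_one a A h h₃ x]
  refine hM.act_act' _ _ _ ?_ _ _ _ _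
  intro i
  obtain ⟨i, rfl⟩ := (plugUnit a).surjective i
  rw [Equiv.symm_apply_apply]
  rcases i with i | i
  exacts [hl i, hr]

end SetPshData

/-! ## Acting on the second part of a list -/

namespace SetPshData

variable {C : Multicat.{u, v}} (M : SetPshData.{u, v, w} C) {ι : Type} [Finite ι] (Γ : ι → C.Obj)
variable {E E' F F' G Z Z' Z₁ Z₂ : Type} [Finite E] [Finite E'] [Finite F] [Finite F'] [Finite G]
  [Finite Z] [Finite Z'] [Finite Z₁] [Finite Z₂]

/-- The action of a bijection on the second part of a list. -/
def actR (σ : E ≃ Z) (Φ : E → C.Obj) (Ψ : Z → C.Obj) (hσ : ∀ e, Ψ (σ e) = Φ e)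
    (x : M.El (Sum.elim Γ Φ)) : M.El (Sum.elim Γ Ψ) :=
  M.act ((Equiv.refl ι).sumCongr σ) (by rintro (i | i); exacts [rfl, hσ i]) x

/-- The action of an arrow into an entry of the second part of a list. -/
def plugR {a : E} (w : {x : E // x ≠ a} ⊕ F ≃ Z) (r : C.Arr F) (Φ : E → C.Obj) (Ψ : Z → C.Obj)
    (h : C.tgt r = Φ a) (hl : ∀ x, Ψ (w (Sum.inl x)) = Φ x.1)
    (hr : ∀ x, Ψ (w (Sum.inr x)) = C.src r x) (x : M.El (Sum.elim Γ Φ)) : M.El (Sum.elim Γ Ψ) :=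
  M.plug (Φ := Sum.elim Γ Φ) (plugInr w) r h (by
    rintro (⟨_ | x, hx⟩ | x)
    exacts [rfl, hl _, hr _]) x

variable {M Γ}
variable {Φ : E → C.Obj} {Φ' : E' → C.Obj} {Ψ : Z → C.Obj} {Ψ' : Z' → C.Obj} {Ψ₁ : Z₁ → C.Obj}
  {Ψ₂ : Z₂ → C.Obj}

theorem plugR_congr {a : E} {w w' : {x : E // x ≠ a} ⊕ F ≃ Z} (hw : ∀ i, w i = w' i)
    {r r' : C.Arr F} (hr : r = r') {x y : M.El (Sum.elim Γ Φ)} (hx : x = y) (h₁ h₂ h₃ h₁' h₂' h₃') :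
    M.plugR Γ w r Φ Ψ h₁ h₂ h₃ x = M.plugR Γ w' r' Φ Ψ h₁' h₂' h₃' y := by
  obtain rfl := Equiv.ext hw
  subst hr hx
  rfl

variable (hM : M.IsPsh)
include hM

theorem IsPsh.actR_refl (h) (x : M.El (Sum.elim Γ Φ)) : M.actR Γ (Equiv.refl E) Φ Φ h x = x :=
  hM.act_self (by rintro (_ | _) <;> rfl) _ _

theorem IsPsh.actR_actR (σ : E ≃ E') (τ : E' ≃ Z) (υ : E ≃ Z) (h : ∀ i, τ (σ i) = υ i) (h₁ h₂ h₃)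
    (x : M.El (Sum.elim Γ Φ)) :
    M.actR Γ τ Φ' Ψ h₂ (M.actR Γ σ Φ Φ' h₁ x) = M.actR Γ υ Φ Ψ h₃ x :=
  hM.act_act' _ _ _ (by rintro (i | i); exacts [rfl, congrArg Sum.inr (h i)]) _ _ _ _

theorem IsPsh.actR_plugR {a : E} (w : {x : E // x ≠ a} ⊕ F ≃ Z) (τ : Z ≃ Z')
    (w' : {x : E // x ≠ a} ⊕ F ≃ Z') (hw : ∀ i, τ (w i) = w' i) (r : C.Arr F)
    (h : C.tgt r = Φ a) (h₁ : ∀ x, Ψ (w (Sum.inl x)) = Φ x.1)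
    (h₂ : ∀ x, Ψ (w (Sum.inr x)) = C.src r x) (h₃ : ∀ e, Ψ' (τ e) = Ψ e)
    (x : M.El (Sum.elim Γ Φ)) :
    M.actR Γ τ Ψ Ψ' h₃ (M.plugR Γ w r Φ Ψ h h₁ h₂ x) =
      M.plugR Γ w' r Φ Ψ' h (fun i => ((congrArg Ψ' (hw _)).symm.trans (h₃ _)).trans (h₁ i))
        (fun i => ((congrArg Ψ' (hw _)).symm.trans (h₃ _)).trans (h₂ i)) x :=
  hM.act_plug (Φ := Sum.elim Γ Φ) _ _ _ (by
    rintro (⟨i | i, hi⟩ | i)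
    exacts [rfl, congrArg Sum.inr (hw _), congrArg Sum.inr (hw _)]) _ _ _ _ _ _

theorem IsPsh.plugR_actR {σ : E ≃ E'} {a : E} {a' : E'} (ha : σ a = a')
    {w' : {x : E' // x ≠ a'} ⊕ F ≃ Z} (w : {x : E // x ≠ a} ⊕ F ≃ Z)
    (hl : ∀ x hx, w (Sum.inl x) = w' (Sum.inl ⟨σ x.1, hx⟩))
    (hr : ∀ x, w (Sum.inr x) = w' (Sum.inr x)) (r : C.Arr F) (h₀ h₁ h₂ h₃ h₄ h₅ h₆)
    (x : M.El (Sum.elim Γ Φ)) :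
    M.plugR Γ w' r Φ' Ψ h₁ h₂ h₃ (M.actR Γ σ Φ Φ' h₀ x) = M.plugR Γ w r Φ Ψ h₄ h₅ h₆ x :=
  hM.plug_act (Φ := Sum.elim Γ Φ) (Φ' := Sum.elim Γ Φ') (congrArg Sum.inr ha) (by
    rintro ⟨i | i, hi⟩
    exacts [rfl, congrArg Sum.inr (hl _ _)]) (fun i => congrArg Sum.inr (hr i)) _ _ _ _ _ _ _

theorem IsPsh.plugR_act_right {τ : F ≃ F'} {a : E}
    {w' : {x : E // x ≠ a} ⊕ F' ≃ Z} (w : {x : E // x ≠ a} ⊕ F ≃ Z)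
    (hl : ∀ x, w (Sum.inl x) = w' (Sum.inl x))
    (hr : ∀ x, w (Sum.inr x) = w' (Sum.inr (τ x))) (r : C.Arr F) (h₁ h₂ h₃ h₄ h₅ h₆)
    (x : M.El (Sum.elim Γ Φ)) :
    M.plugR Γ w' (C.act τ r) Φ Ψ h₁ h₂ h₃ x = M.plugR Γ w r Φ Ψ h₄ h₅ h₆ x :=
  hM.plug_act_right (Φ := Sum.elim Γ Φ) (by
    rintro ⟨i | i, hi⟩
    exacts [rfl, congrArg Sum.inr (hl _)]) (fun i => congrArg Sum.inr (hr i)) _ _ _ _ _ _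

theorem IsPsh.plugR_plugR {a : E} {q : F} {z : Z₁} (w₁ : {x : E // x ≠ a} ⊕ F ≃ Z₁)
    (hz : w₁ (Sum.inr q) = z) (w₂ : {x : Z₁ // x ≠ z} ⊕ G ≃ Z) (w₃ : {x : F // x ≠ q} ⊕ G ≃ Z₂)
    (w₄ : {x : E // x ≠ a} ⊕ Z₂ ≃ Z) (g : C.Arr F) (f : C.Arr G) (h h₁ h₂ h₃ h₄ h₅ h₆ h₇ h₈ h₉)
    (hk : ∀ x hx, w₂ (Sum.inl ⟨w₁ (Sum.inl x), hx⟩) = w₄ (Sum.inl x))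
    (hg : ∀ x hx, w₂ (Sum.inl ⟨w₁ (Sum.inr x.1), hx⟩) = w₄ (Sum.inr (w₃ (Sum.inl x))))
    (hf : ∀ x, w₂ (Sum.inr x) = w₄ (Sum.inr (w₃ (Sum.inr x)))) (x : M.El (Sum.elim Γ Φ)) :
    M.plugR Γ w₂ f Ψ₁ Ψ h₁ h₂ h₃ (M.plugR Γ w₁ g Φ Ψ₁ h₄ h₅ h₆ x) =
      M.plugR Γ w₄ (C.plug w₃ g f h) Φ Ψ h₇ h₈ h₉ x :=
  hM.plug_plug (Φ := Sum.elim Γ Φ) (Ψ₁ := Sum.elim Γ Ψ₁) (plugInr w₁) (congrArg Sum.inr hz)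
    (plugInr w₂) w₃ (plugInr w₄) g f _ _ h _ _ _ _ (by
      rintro ⟨i | i, hi⟩ hx
      exacts [rfl, congrArg Sum.inr (hk ⟨i, _⟩ _)]) (fun x hx => congrArg Sum.inr (hg x _))
    (fun x => congrArg Sum.inr (hf x)) x

theorem IsPsh.plugR_comm {a b : E} (hab : a ≠ b) {z₁ : Z₁} {z₂ : Z₂}
    (w₁ : {x : E // x ≠ a} ⊕ F ≃ Z₁) (hz₁ : w₁ (Sum.inl ⟨b, hab.symm⟩) = z₁)
    (w₂ : {x : Z₁ // x ≠ z₁} ⊕ G ≃ Z)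
    (w₃ : {x : E // x ≠ b} ⊕ G ≃ Z₂) (hz₂ : w₃ (Sum.inl ⟨a, hab⟩) = z₂)
    (w₄ : {x : Z₂ // x ≠ z₂} ⊕ F ≃ Z) (g : C.Arr F) (f : C.Arr G)
    (h₁ h₂ h₃ h₄ h₅ h₆ h₁' h₂' h₃' h₄' h₅' h₆')
    (hk : ∀ x hx hy h₁ h₂, w₂ (Sum.inl ⟨w₁ (Sum.inl ⟨x, hx⟩), h₁⟩) =
      w₄ (Sum.inl ⟨w₃ (Sum.inl ⟨x, hy⟩), h₂⟩))
    (hg : ∀ x h₁, w₂ (Sum.inl ⟨w₁ (Sum.inr x), h₁⟩) = w₄ (Sum.inr x))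
    (hf : ∀ x h₂, w₂ (Sum.inr x) = w₄ (Sum.inl ⟨w₃ (Sum.inr x), h₂⟩)) (x : M.El (Sum.elim Γ Φ)) :
    M.plugR Γ w₂ f Ψ₁ Ψ h₁ h₂ h₃ (M.plugR Γ w₁ g Φ Ψ₁ h₄ h₅ h₆ x) =
      M.plugR Γ w₄ g Ψ₂ Ψ h₁' h₂' h₃' (M.plugR Γ w₃ f Φ Ψ₂ h₄' h₅' h₆' x) :=
  hM.plug_comm (Φ := Sum.elim Γ Φ) (Ψ₁ := Sum.elim Γ Ψ₁) (Ψ₂ := Sum.elim Γ Ψ₂)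
    (fun k => hab (Sum.inr.inj k)) (plugInr w₁)
    (congrArg Sum.inr hz₁) (plugInr w₂) (plugInr w₃) (congrArg Sum.inr hz₂) (plugInr w₄) g f _ _ _ _
    _ _ _ _ (by
      rintro (i | i) hx hy h₁ h₂
      exacts [rfl, congrArg Sum.inr (hk _ _ _ _ _)]) (fun x h => congrArg Sum.inr (hg x _))
    (fun x h => congrArg Sum.inr (hf x _)) x

theorem IsPsh.plugR_one {a : E} (w : {x : E // x ≠ a} ⊕ Unit ≃ Z) (ε : E ≃ Z)
    (hl : ∀ x, w (Sum.inl x) = ε x.1) (hr : w (Sum.inr ()) = ε a) (A : C.Obj) (h₁ h₂ h₃ h₄)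
    (x : M.El (Sum.elim Γ Φ)) :
    M.plugR Γ w (C.one A) Φ Ψ h₁ h₂ h₃ x = M.actR Γ ε Φ Ψ h₄ x :=
  hM.plug_one (Φ := Sum.elim Γ Φ) _ _ (by
    rintro ⟨i | i, hi⟩
    exacts [rfl, congrArg Sum.inr (hl _)]) (congrArg Sum.inr hr) _ _ _ _ _

omit hM in
variable (M Γ) in
/-- `y` arises from `x` by the action of `r` at the entry `a` of the second part of a list. -/
def PlugsTo {a : E} (w : {x : E // x ≠ a} ⊕ F ≃ Z) (r : C.Arr F) (Φ : E → C.Obj) (Ψ : Z → C.Obj)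
    (x : M.El (Sum.elim Γ Φ)) (y : M.El (Sum.elim Γ Ψ)) : Prop :=
  ∃ h hl hr, M.plugR Γ w r Φ Ψ h hl hr x = y

omit hM in
theorem PlugsTo.unique {a : E} {w w' : {x : E // x ≠ a} ⊕ F ≃ Z} {r r' : C.Arr F}
    {x : M.El (Sum.elim Γ Φ)} {y y' : M.El (Sum.elim Γ Ψ)} (h : M.PlugsTo Γ w r Φ Ψ x y)
    (h' : M.PlugsTo Γ w' r' Φ Ψ x y') (hw : ∀ i, w i = w' i) (hr : r = r') : y = y' := by
  obtain ⟨_, _, _, rfl⟩ := h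
  obtain ⟨_, _, _, rfl⟩ := h'
  exact plugR_congr hw hr rfl _ _ _ _ _ _

theorem IsPsh.plugsTo_actR {a : E} {w : {x : E // x ≠ a} ⊕ F ≃ Z} {r : C.Arr F}
    {x : M.El (Sum.elim Γ Φ)} {y : M.El (Sum.elim Γ Ψ)} (h : M.PlugsTo Γ w r Φ Ψ x y) (τ : Z ≃ Z')
    (w' : {x : E // x ≠ a} ⊕ F ≃ Z') (hw : ∀ i, τ (w i) = w' i) (h₃ : ∀ e, Ψ' (τ e) = Ψ e) :
    M.PlugsTo Γ w' r Φ Ψ' x (M.actR Γ τ Ψ Ψ' h₃ y) := by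
  obtain ⟨_, _, _, rfl⟩ := h
  exact ⟨_, _, _, (hM.actR_plugR _ _ _ hw _ _ _ _ _ _).symm⟩

end SetPshData

/-! ## Functors of polycategories -/

theorem PolyData.comp_congr (P : PolyData.{u, v}) {m n p q : Type} [Finite m] [Finite n] [Finite p]
    [Finite q] {g g' : P.Arr p q} (hg : g = g') (k : p) {f f' : P.Arr m n} (hf : f = f') (j : n)
    (h h') : P.comp g k f j h = P.comp g' k f' j h' := by
  subst hg hf; rfl

theorem PolyMap.src_eq_tgt {P : PolyData.{u, v}} {Q : PolyData.{u₁, v₁}} (F : PolyMap P Q)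
    {m n p q : Type} [Finite m] [Finite n] [Finite p] [Finite q] {g : P.Arr p q} {k : p}
    {f : P.Arr m n} {j : n} (h : P.src g k = P.tgt f j) {g' : Q.Arr p q} {f' : Q.Arr m n}
    (hg : F.arr g = g') (hf : F.arr f = f') : Q.src g' k = Q.tgt f' j := by
  rw [← hg, ← hf, F.src_arr, F.tgt_arr, h]

theorem PolyMap.IsFunctor.arr_comp {P : PolyData.{u, v}} {Q : PolyData.{u₁, v₁}} {F : PolyMap P Q}
    (hF : F.IsFunctor) {m n p q : Type} [Finite m] [Finite n] [Finite p] [Finite q] {g : P.Arr p q}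
    {k : p} {f : P.Arr m n} {j : n} (h : P.src g k = P.tgt f j) {g' : Q.Arr p q} {f' : Q.Arr m n}
    (hg : F.arr g = g') (hf : F.arr f = f') :
    F.arr (P.comp g k f j h) = Q.comp g' k f' j (F.src_eq_tgt h hg hf) := by
  subst hg hf
  exact hF.comp _ _ _ _ _ _

theorem PolyMap.IsFunctor.trans {P : PolyData.{u, v}} {Q R : PolyData.{u₁, v₁}} {F : PolyMap P Q}
    {G : PolyMap Q R} (hF : F.IsFunctor) (hG : G.IsFunctor) : (F.trans G).IsFunctor where
  perm ρ τ f := (congrArg G.arr (hF.perm ρ τ f)).trans (hG.perm _ _ _)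
  one A := (congrArg G.arr (hF.one A)).trans (hG.one _)
  comp g k f j h h' := (congrArg G.arr (hF.comp g k f j h (F.src_eq_tgt h rfl rfl))).trans
    (hG.comp _ _ _ _ _ _)

theorem IsStarFunctor.trans {P : StarPolyData.{u, v}} {Q R : StarPolyData.{u₁, v₁}}
    {F : PolyMap P.toPolyData Q.toPolyData} {G : PolyMap Q.toPolyData R.toPolyData}
    (hF : IsStarFunctor P Q F) (hG : IsStarFunctor Q R G) : IsStarFunctor P R (F.trans G) where
  isFunctor := hF.isFunctor.trans hG.isFunctor
  dual A := (congrArg G.obj (hF.dual A)).trans (hG.dual _)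
  sact σ f := (congrArg G.arr (hF.sact σ f)).trans (hG.sact _ _)

section

variable {C : Multicat.{u, v}} {Ω : PolyPshData.{u, v, u₁, v₁} C} {ι : Type} [Finite ι]
  {Γ : ι → C.Obj}

variable (Ω Γ) in
/-- The action of a bijection on the second part of a list. -/
def actMap {E Z : Type} [Finite E] [Finite Z] (σ : E ≃ Z) (Φ : E → C.Obj) (Ψ : Z → C.Obj)
    (hσ : ∀ e, Ψ (σ e) = Φ e) : PolyMap (Ω.fib (Sum.elim Γ Φ)) (Ω.fib (Sum.elim Γ Ψ)) :=
  Ω.act ((Equiv.refl ι).sumCongr σ) (by rintro (i | i); exacts [rfl, hσ i])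

theorem plugMap_isFunctor (hΩ : Ω.IsPolyPsh) {E F Z : Type} [Finite E] [Finite F] [Finite Z] {a : E}
    (w : {x : E // x ≠ a} ⊕ F ≃ Z) (r : C.Arr F) (Φ : E → C.Obj) (Ψ : Z → C.Obj) (h hl hr) :
    (plugMap Ω Γ w r Φ Ψ h hl hr).IsFunctor :=
  (hΩ.sub_isFunctor _ _ _).trans (hΩ.act_isFunctor _ _)

theorem actMap_isFunctor (hΩ : Ω.IsPolyPsh) {E Z : Type} [Finite E] [Finite Z] (σ : E ≃ Z)
    (Φ : E → C.Obj) (Ψ : Z → C.Obj) (h) : (actMap Ω Γ σ Φ Ψ h).IsFunctor :=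
  hΩ.act_isFunctor _ _

theorem AdjArr.ext' {m n : Type} [Finite m] [Finite n] (hΩ : (Ω.arrs m n).IsPsh)
    {f g : AdjArr Ω Γ m n} (hs : f.src = g.src) (ht : f.tgt = g.tgt)
    (hp : ∀ e, f.prim e = g.prim e)
    (hsec : ∀ h, (actMap Ω Γ (Equiv.refl _) (posCtx f.src f.tgt) (posCtx g.src g.tgt) h).arr f.sec =
      g.sec) : f = g := by
  rcases f with ⟨s, t, p, h₁, h₂, x, h₃, h₄⟩
  rcases g with ⟨s', t', p', h₁', h₂', x', h₃', h₄'⟩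
  dsimp only at hs ht
  subst hs ht
  obtain rfl : p = p' := funext hp
  have : x = x' := (hΩ.actR_refl (M := Ω.arrs m n) (fun _ => rfl) x).symm.trans (hsec fun _ => rfl)
  subst this
  rfl

/-! ### Primary components of composites -/

/-- `cp` are the primary components of a composite: `Z` is the set of entries of the two factors other
than the entries `a`, `b` along which one composes, and `ap`, `bp` are the primary components of the
factors. -/
structure IsCompPrim {A B Z : Type} [Finite A] [Finite B] [Finite Z] {a : A} {b : B}
    (W : {x : A // x ≠ a} ⊕ {y : B // y ≠ b} ≃ Z) (ap : ∀ e : A, C.Arr {x // x ≠ e})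
    (bp : ∀ e : B, C.Arr {x // x ≠ e}) (cp : ∀ z : Z, C.Arr {x // x ≠ z}) : Prop where
  left : ∀ (e : A) (he : a ≠ e) (z : Z) (hz : W (Sum.inl ⟨e, he.symm⟩) = z),
    ∃ h, cp z = C.plug (plugNe W he hz) (ap e) (bp b) h
  right : ∀ (e : B) (he : b ≠ e) (z : Z) (hz : W (Sum.inr ⟨e, he.symm⟩) = z),
    ∃ h, cp z = C.plug (plugNe ((Equiv.sumComm _ _).trans W) he hz) (bp e) (ap a) h

namespace IsCompPrim

section

variable {A B Z : Type} [Finite A] [Finite B] [Finite Z] {a : A} {b : B}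
  {W : {x : A // x ≠ a} ⊕ {y : B // y ≠ b} ≃ Z} {ap : ∀ e : A, C.Arr {x // x ≠ e}}
  {bp : ∀ e : B, C.Arr {x // x ≠ e}} {cp : ∀ z : Z, C.Arr {x // x ≠ z}}

theorem symm (h : IsCompPrim W ap bp cp) : IsCompPrim ((Equiv.sumComm _ _).trans W) bp ap cp where
  left := h.right
  right e he z hz := by
    obtain ⟨k, hk⟩ := h.left e he z hz
    refine ⟨k, hk.trans (Multicat.plug_congr (fun i => ?_) rfl rfl _ _)⟩
    rcases i with i | i <;> rfl

theorem act {Z' : Type} [Finite Z'] (h : IsCompPrim W ap bp cp) (σ : Z ≃ Z')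
    {cp' : ∀ z : Z', C.Arr {x // x ≠ z}}
    (hcp : ∀ z z' (hz : σ z = z'), cp' z' = C.act (neEquiv σ hz) (cp z)) :
    IsCompPrim (W.trans σ) ap bp cp' where
  left e he z hz := by
    obtain ⟨k, hk⟩ := h.left e he _ rfl
    refine ⟨k, (hcp _ _ hz).trans ((congrArg _ hk).trans ((Multicat.act_plug _ _ _ _ _).trans
      (Multicat.plug_congr (fun i => ?_) rfl rfl _ _)))⟩
    rcases i with i | i <;> rfl
  right e he z hz := by
    obtain ⟨k, hk⟩ := h.right e he _ rfl
    refine ⟨k, (hcp _ _ hz).trans ((congrArg _ hk).trans ((Multicat.act_plug _ _ _ _ _).trans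
      (Multicat.plug_congr (fun i => ?_) rfl rfl _ _)))⟩
    rcases i with i | i <;> rfl

theorem unique {W' : {x : A // x ≠ a} ⊕ {y : B // y ≠ b} ≃ Z} {cp' : ∀ z : Z, C.Arr {x // x ≠ z}}
    (hW : ∀ i, W i = W' i) (h : IsCompPrim W ap bp cp) (h' : IsCompPrim W' ap bp cp') (z : Z) :
    cp z = cp' z := by
  obtain rfl := Equiv.ext hW
  obtain ⟨z, rfl⟩ := W.surjective z
  rcases z with z | z
  · obtain ⟨_, k⟩ := h.left z.1 z.2.symm _ rfl
    obtain ⟨_, k'⟩ := h'.left z.1 z.2.symm _ rfl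
    exact k.trans k'.symm
  · obtain ⟨_, k⟩ := h.right z.1 z.2.symm _ rfl
    obtain ⟨_, k'⟩ := h'.right z.1 z.2.symm _ rfl
    exact k.trans k'.symm

/-- Compatibility with bijections of the entries of the factors. -/
theorem of_act {A' B' : Type} [Finite A'] [Finite B'] {a' : A'} {b' : B'} {ρ : A ≃ A'} {σ : B ≃ B'}
    (ha : ρ a = a') (hb : σ b = b') {W' : {x : A' // x ≠ a'} ⊕ {y : B' // y ≠ b'} ≃ Z}
    {ap' : ∀ e : A', C.Arr {x // x ≠ e}} {bp' : ∀ e : B', C.Arr {x // x ≠ e}}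
    (hap : ∀ e e' (he : ρ e = e'), ap' e' = C.act (neEquiv ρ he) (ap e))
    (hbp : ∀ e e' (he : σ e = e'), bp' e' = C.act (neEquiv σ he) (bp e))
    (hl : ∀ x, W (Sum.inl x) = W' (Sum.inl (neEquiv ρ ha x)))
    (hr : ∀ x, W (Sum.inr x) = W' (Sum.inr (neEquiv σ hb x)))
    (h : IsCompPrim W' ap' bp' cp) : IsCompPrim W ap bp cp where
  left e he z hz := by
    have he' : a' ≠ ρ e := fun k => he (ρ.injective (ha.trans k))
    obtain ⟨k, hk⟩ := h.left (ρ e) he' z ((hl ⟨e, he.symm⟩).symm.trans hz)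
    have k' : C.src (ap e) ⟨a, he⟩ = C.tgt (bp b) := by
      rw [hbp b b' hb, C.tgt_act, hap e _ rfl] at k
      subst ha
      exact (C.src_act (neEquiv ρ rfl) (ap e) ⟨a, he⟩).symm.trans k
    refine ⟨k', hk.trans ((Multicat.plug_congr (fun _ => rfl) (hap e _ rfl) (hbp b b' hb) _
      (by rw [← hap e _ rfl, ← hbp b b' hb]; exact k)).trans
      (Multicat.plug_act (Subtype.ext ha) ?_ ?_ _ _ _ _))⟩
    · rintro ⟨⟨x, hx⟩, hx'⟩
      exact Subtype.ext (hl _)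
    · rintro ⟨x, hx⟩
      exact Subtype.ext (hr _)
  right e he z hz := by
    have he' : b' ≠ σ e := fun k => he (σ.injective (hb.trans k))
    obtain ⟨k, hk⟩ := h.right (σ e) he' z ((hr ⟨e, he.symm⟩).symm.trans hz)
    have k' : C.src (bp e) ⟨b, he⟩ = C.tgt (ap a) := by
      rw [hap a a' ha, C.tgt_act, hbp e _ rfl] at k
      subst hb
      exact (C.src_act (neEquiv σ rfl) (bp e) ⟨b, he⟩).symm.trans k
    refine ⟨k', hk.trans ((Multicat.plug_congr (fun _ => rfl) (hbp e _ rfl) (hap a a' ha) _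
      (by rw [← hbp e _ rfl, ← hap a a' ha]; exact k)).trans
      (Multicat.plug_act (Subtype.ext hb) ?_ ?_ _ _ _ _))⟩
    · rintro ⟨⟨x, hx⟩, hx'⟩
      exact Subtype.ext (hr _)
    · rintro ⟨x, hx⟩
      exact Subtype.ext (hl _)

end

end IsCompPrim

/-- The two ways of composing three factors, with the sets of entries `X`, `Y`, `V`, along the entries
`c ∈ X`, `d ∈ Y` and `k ∈ Y`, `j ∈ V`, agree on entries. -/
structure Ternary {X Y V Z₁ Z₂ Z : Type} {c : X} {d k : Y} {j : V} (hdk : d ≠ k) {z₁ : Z₁} {z₂ : Z₂}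
    (W₁ : {x : X // x ≠ c} ⊕ {y : Y // y ≠ d} ≃ Z₁) (W₂ : {x : Z₁ // x ≠ z₁} ⊕ {y : V // y ≠ j} ≃ Z)
    (W₃ : {x : Y // x ≠ k} ⊕ {y : V // y ≠ j} ≃ Z₂) (W₄ : {x : X // x ≠ c} ⊕ {y : Z₂ // y ≠ z₂} ≃ Z) :
    Prop where
  eq₁ : W₁ (Sum.inr ⟨k, hdk.symm⟩) = z₁
  eq₂ : W₃ (Sum.inl ⟨d, hdk⟩) = z₂
  left : ∀ x hx, W₂ (Sum.inl ⟨W₁ (Sum.inl x), hx⟩) = W₄ (Sum.inl x)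
  middle : ∀ x hd hk hx hx', W₂ (Sum.inl ⟨W₁ (Sum.inr ⟨x, hd⟩), hx⟩) =
    W₄ (Sum.inr ⟨W₃ (Sum.inl ⟨x, hk⟩), hx'⟩)
  right : ∀ x hx', W₂ (Sum.inr x) = W₄ (Sum.inr ⟨W₃ (Sum.inr x), hx'⟩)

namespace Ternary

variable {X Y V Z₁ Z₂ Z : Type} {c : X} {d k : Y} {j : V} {hdk : d ≠ k} {z₁ : Z₁} {z₂ : Z₂}
  {W₁ : {x : X // x ≠ c} ⊕ {y : Y // y ≠ d} ≃ Z₁} {W₂ : {x : Z₁ // x ≠ z₁} ⊕ {y : V // y ≠ j} ≃ Z}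
  {W₃ : {x : Y // x ≠ k} ⊕ {y : V // y ≠ j} ≃ Z₂} {W₄ : {x : X // x ≠ c} ⊕ {y : Z₂ // y ≠ z₂} ≃ Z}
  (T : Ternary hdk W₁ W₂ W₃ W₄)
include T

theorem symm : Ternary hdk.symm ((Equiv.sumComm _ _).trans W₃) ((Equiv.sumComm _ _).trans W₄)
    ((Equiv.sumComm _ _).trans W₁) ((Equiv.sumComm _ _).trans W₂) where
  eq₁ := T.eq₂
  eq₂ := T.eq₁
  left x hx := (T.right x hx).symm
  middle x hd hk hx hx' := (T.middle x hk hd hx' hx).symm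
  right x hx := (T.left x hx).symm

variable [Finite X] [Finite Y] [Finite V] [Finite Z₁] [Finite Z₂] [Finite Z]
  {xp : ∀ e : X, C.Arr {x // x ≠ e}} {yp : ∀ e : Y, C.Arr {x // x ≠ e}}
  {vp : ∀ e : V, C.Arr {x // x ≠ e}} {zp₁ : ∀ e : Z₁, C.Arr {x // x ≠ e}}
  {zp₂ : ∀ e : Z₂, C.Arr {x // x ≠ e}} {L R : ∀ e : Z, C.Arr {x // x ≠ e}}

theorem prim_left (h₁ : IsCompPrim W₁ xp yp zp₁) (h₂ : IsCompPrim W₂ zp₁ vp L)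
    (h₃ : IsCompPrim W₃ yp vp zp₂) (h₄ : IsCompPrim W₄ xp zp₂ R) (x : {x : X // x ≠ c}) :
    L (W₄ (Sum.inl x)) = R (W₄ (Sum.inl x)) := by
  have hx : W₁ (Sum.inl x) ≠ z₁ := fun h => by
    have := W₁.injective (h.trans T.eq₁.symm)
    simp at this
  obtain ⟨a₁, e₁⟩ := h₁.left x.1 x.2.symm _ rfl
  obtain ⟨a₂, e₂⟩ := h₂.left (W₁ (Sum.inl x)) hx.symm _ (T.left x hx)
  obtain ⟨a₃, e₃⟩ := h₃.left d hdk.symm z₂ T.eq₂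
  obtain ⟨a₄, e₄⟩ := h₄.left x.1 x.2.symm _ rfl
  refine e₂.trans (Eq.trans ?_ e₄.symm)
  refine (Multicat.plug_congr (fun _ => rfl) e₁ rfl _ (by rw [← e₁]; exact a₂)).trans ?_
  refine Eq.trans ?_ (Multicat.plug_congr (fun _ => rfl) rfl e₃ _ (by rw [← e₃]; exact a₄)).symm
  refine Multicat.plug_assoc _ (Subtype.ext T.eq₁) _ _ _ _ _ _ _ _ _ _ ?_ ?_ ?_
  · rintro ⟨⟨y, hy⟩, hy'⟩ h
    exact Subtype.ext (T.left _ _)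
  · rintro ⟨⟨y, hy⟩, hy'⟩ h
    exact Subtype.ext (T.middle _ _ _ _ _)
  · rintro ⟨y, hy⟩
    exact Subtype.ext (T.right _ _)

theorem prim_middle (h₁ : IsCompPrim W₁ xp yp zp₁) (h₂ : IsCompPrim W₂ zp₁ vp L)
    (h₃ : IsCompPrim W₃ yp vp zp₂) (h₄ : IsCompPrim W₄ xp zp₂ R) (y : Y) (hd : d ≠ y) (hk : k ≠ y)
    (z : Z) (hy) (hz : W₂ (Sum.inl ⟨W₁ (Sum.inr ⟨y, hd.symm⟩), hy⟩) = z) : L z = R z := by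
  have hy' : W₃ (Sum.inl ⟨y, hk.symm⟩) ≠ z₂ := fun h => by
    have := W₃.injective (h.trans T.eq₂.symm)
    exact hd (congrArg Subtype.val (Sum.inl.inj this)).symm
  obtain ⟨a₁, e₁⟩ := h₁.right y hd _ rfl
  obtain ⟨a₂, e₂⟩ := h₂.left (W₁ (Sum.inr ⟨y, hd.symm⟩)) hy.symm _ hz
  obtain ⟨a₃, e₃⟩ := h₃.left y hk _ rfl
  obtain ⟨a₄, e₄⟩ := h₄.right (W₃ (Sum.inl ⟨y, hk.symm⟩)) hy'.symm z
    ((T.middle y hd.symm hk.symm hy hy').symm.trans hz)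
  refine e₂.trans (Eq.trans ?_ e₄.symm)
  refine (Multicat.plug_congr (fun _ => rfl) e₁ rfl _ (by rw [← e₁]; exact a₂)).trans ?_
  refine Eq.trans ?_ (Multicat.plug_congr (fun _ => rfl) e₃ rfl _ (by rw [← e₃]; exact a₄)).symm
  refine Multicat.plug_exchange (μ := {x : Y // x ≠ y}) (r := ⟨d, hd⟩) (s := ⟨k, hk⟩)
    (fun h => hdk (congrArg Subtype.val h)) _ (Subtype.ext T.eq₁) _ _
    (Subtype.ext T.eq₂) _ _ _ _ _ _ _ _ ?_ ?_ ?_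
  · rintro ⟨x, hx⟩ h₁ h₂ h₃ h₄
    exact Subtype.ext (T.middle _ _ _ _ _)
  · rintro ⟨y, hy⟩ h
    exact Subtype.ext (T.left _ _)
  · rintro ⟨y, hy⟩ h
    exact Subtype.ext (T.right _ _)

theorem prim_eq (h₁ : IsCompPrim W₁ xp yp zp₁) (h₂ : IsCompPrim W₂ zp₁ vp L)
    (h₃ : IsCompPrim W₃ yp vp zp₂) (h₄ : IsCompPrim W₄ xp zp₂ R) (z : Z) : L z = R z := by
  obtain ⟨z, rfl⟩ := W₄.surjective z
  rcases z with x | ⟨z, hz⟩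
  · exact T.prim_left h₁ h₂ h₃ h₄ x
  · obtain ⟨z, rfl⟩ := W₃.surjective z
    rcases z with ⟨y, hk⟩ | v
    · have hd : d ≠ y := by
        rintro rfl
        exact hz T.eq₂
      have hy : W₁ (Sum.inr ⟨y, hd.symm⟩) ≠ z₁ := fun h => by
        have := W₁.injective (h.trans T.eq₁.symm)
        exact hk (congrArg Subtype.val (Sum.inr.inj this))
      exact T.prim_middle h₁ h₂ h₃ h₄ y hd hk.symm _ hy (T.middle _ _ _ _ _)
    · have := T.symm.prim_left h₃.symm h₄.symm h₁.symm h₂.symm v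
      have e := T.right v hz
      rw [← e]
      exact this.symm

variable {M : SetPshData.{u, v, w} C} (hM : M.IsPsh) {ΦX : X → C.Obj} {ΦY : Y → C.Obj}
  {ΦV : V → C.Obj} {Ψ₁ : Z₁ → C.Obj} {Ψ₂ : Z₂ → C.Obj} {Ψ : Z → C.Obj}
include hM

theorem sec_left (h₃ : IsCompPrim W₃ yp vp zp₂) {x : M.El (Sum.elim Γ ΦX)}
    {y : M.El (Sum.elim Γ Ψ₁)} {z : M.El (Sum.elim Γ Ψ)}
    (h : M.PlugsTo Γ W₁ (yp d) ΦX Ψ₁ x y) (h' : M.PlugsTo Γ W₂ (vp j) Ψ₁ Ψ y z) :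
    M.PlugsTo Γ W₄ (zp₂ z₂) ΦX Ψ x z := by
  obtain ⟨a₁, a₂, a₃, rfl⟩ := h
  obtain ⟨b₁, b₂, b₃, rfl⟩ := h'
  obtain ⟨b, e⟩ := h₃.left d hdk.symm z₂ T.eq₂
  have hr : ∀ y h, W₂ (Sum.inl ⟨W₁ (Sum.inr y), h⟩) = W₄ (Sum.inr (plugNe W₃ hdk.symm T.eq₂
      (Sum.inl ⟨y, fun k => h ((congrArg (fun y => W₁ (Sum.inr y)) k).trans T.eq₁)⟩))) := by
    rintro ⟨y, hy⟩ h
    exact T.middle _ _ _ _ _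
  have hr₄ : ∀ i, Ψ (W₄ (Sum.inr i)) = C.src (zp₂ z₂) i := by
    intro i
    rw [e]
    obtain ⟨i, rfl⟩ := (plugNe W₃ hdk.symm T.eq₂).surjective i
    rcases i with ⟨i, hi⟩ | i
    · have hW : W₁ (Sum.inr i) ≠ z₁ := fun k =>
        hi (Sum.inr.inj (W₁.injective (k.trans T.eq₁.symm)))
      rw [Multicat.src_plug_inl, ← a₃, ← b₂ ⟨W₁ (Sum.inr i), hW⟩, hr]
    · rw [Multicat.src_plug_inr, ← b₃]
      exact congrArg Ψ (T.right _ _).symm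
  have hl₄ : ∀ i, Ψ (W₄ (Sum.inl i)) = ΦX i.1 := by
    intro i
    have hW : W₁ (Sum.inl i) ≠ z₁ := fun k => by
      have := W₁.injective (k.trans T.eq₁.symm)
      simp at this
    rw [← T.left i hW, b₂, a₂]
  have ht : C.tgt (zp₂ z₂) = ΦX c := by rw [e, Multicat.tgt_plug, a₁]
  refine ⟨ht, hl₄, hr₄, Eq.symm ?_⟩
  refine Eq.trans ?_ (SetPshData.plugR_congr (fun _ => rfl) e.symm rfl
    (by rw [← e]; exact ht) hl₄ (by rw [← e]; exact hr₄) _ _ _)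
  refine hM.plugR_plugR W₁ T.eq₁ _ _ _ _ _ _ _ _ _ _ _ _ _ _ _ ?_ ?_ ?_ x
  · intro y h
    exact T.left _ _
  · rintro ⟨⟨y, hy⟩, hy'⟩ h
    exact T.middle _ _ _ _ _
  · rintro ⟨y, hy⟩
    exact T.right _ _

theorem sec_middle {y : M.El (Sum.elim Γ ΦY)} {y₁ : M.El (Sum.elim Γ Ψ₁)}
    {y₂ : M.El (Sum.elim Γ Ψ₂)} {z z' : M.El (Sum.elim Γ Ψ)} {f : C.Arr _} {g : C.Arr _}
    (h₁ : M.PlugsTo Γ ((Equiv.sumComm _ _).trans W₁) f ΦY Ψ₁ y y₁)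
    (h₂ : M.PlugsTo Γ W₂ g Ψ₁ Ψ y₁ z) (h₃ : M.PlugsTo Γ W₃ g ΦY Ψ₂ y y₂)
    (h₄ : M.PlugsTo Γ ((Equiv.sumComm _ _).trans W₄) f Ψ₂ Ψ y₂ z') : z = z' := by
  obtain ⟨_, _, _, rfl⟩ := h₁
  obtain ⟨_, _, _, rfl⟩ := h₂
  obtain ⟨_, _, _, rfl⟩ := h₃
  obtain ⟨_, _, _, rfl⟩ := h₄
  refine hM.plugR_comm hdk _ T.eq₁ _ _ T.eq₂ _ _ _ _ _ _ _ _ _ _ _ _ _ _ _ ?_ ?_ ?_ y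
  · intro x h₁ h₂ h₃ h₄
    exact T.middle _ _ _ _ _
  · intro y h
    exact T.left _ _
  · intro y h
    exact T.right _ _

theorem sec_right (h₁ : IsCompPrim W₁ xp yp zp₁) {x : M.El (Sum.elim Γ ΦV)}
    {y : M.El (Sum.elim Γ Ψ₂)} {z : M.El (Sum.elim Γ Ψ)}
    (h : M.PlugsTo Γ ((Equiv.sumComm _ _).trans W₃) (yp k) ΦV Ψ₂ x y)
    (h' : M.PlugsTo Γ ((Equiv.sumComm _ _).trans W₄) (xp c) Ψ₂ Ψ y z) :
    M.PlugsTo Γ ((Equiv.sumComm _ _).trans W₂) (zp₁ z₁) ΦV Ψ x z :=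
  T.symm.sec_left hM h₁.symm h h'

end Ternary

end

section

variable {C : Multicat.{u, v}} {Ω : PolyPshData.{u, v, u₁, v₁} C} {ι : Type} [Finite ι]
  {Γ : ι → C.Obj}

variable {m n p q r s : Type} [Finite m] [Finite n] [Finite p] [Finite q] [Finite r] [Finite s]

theorem adjComp_isCompPrim (hΩ : Ω.objs.IsPsh) (g : AdjArr Ω Γ p q) (k : p) (f : AdjArr Ω Γ m n)
    (j : n) (h : g.src k = f.tgt j) :
    IsCompPrim (glue k j) g.prim f.prim (adjComp hΩ g k f j h).prim where
  left := by
    rintro (e | e) he z rfl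
    exacts [⟨_, rfl⟩, ⟨_, rfl⟩]
  right := by
    rintro (e | e) he z rfl
    exacts [⟨_, rfl⟩, ⟨_, rfl⟩]

theorem adjPerm_prim (hΩ : Ω.objs.IsPsh) {m' n' : Type} [Finite m'] [Finite n'] (ρ : m ≃ m')
    (τ : n ≃ n') (f : AdjArr Ω Γ m n) (z : m ⊕ n) (z' : m' ⊕ n') (hz : ρ.sumCongr τ z = z') :
    (adjPerm hΩ ρ τ f).prim z' = C.act (neEquiv (ρ.sumCongr τ) hz) (f.prim z) := by
  obtain rfl : z = (ρ.sumCongr τ).symm z' := by rw [← hz, Equiv.symm_apply_apply]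
  rfl

theorem adjPerm_sec (hΩ : Ω.objs.IsPsh) {m' n' : Type} [Finite m'] [Finite n'] (ρ : m ≃ m')
    (τ : n ≃ n') (f : AdjArr Ω Γ m n) : ∃ h, (adjPerm hΩ ρ τ f).sec = (Ω.fib _).perm ρ τ
      ((actMap Ω Γ (ρ.sumCongr τ) _ (posCtx (adjPerm hΩ ρ τ f).src (adjPerm hΩ ρ τ f).tgt) h).arr
        f.sec) :=
  ⟨by rintro (_ | _) <;> simp [adjPerm, posCtx], rfl⟩

theorem adjComp_sec (hΩ : Ω.objs.IsPsh) (g : AdjArr Ω Γ p q) (k : p) (f : AdjArr Ω Γ m n)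
    (j : n) (h : g.src k = f.tgt j) : ∃ G F e,
      (Ω.arrs p q).PlugsTo Γ (glue k j) (f.prim (Sum.inr j)) _ _ g.sec G ∧
      (Ω.arrs m n).PlugsTo Γ ((Equiv.sumComm _ _).trans (glue k j)) (g.prim (Sum.inl k)) _ _ f.sec F ∧
      (adjComp hΩ g k f j h).sec = (Ω.fib _).comp G k F j e := by
  have hg : ∀ x, posCtx (adjComp hΩ g k f j h).src (adjComp hΩ g k f j h).tgt
      (glue k j (Sum.inl x)) = posCtx g.src g.tgt x.1 := by
    rintro ⟨_ | _, _⟩ <;> rfl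
  have hf : ∀ x, posCtx (adjComp hΩ g k f j h).src (adjComp hΩ g k f j h).tgt
      (glue k j (Sum.inr x)) = posCtx f.src f.tgt x.1 := by
    rintro ⟨_ | _, _⟩ <;> rfl
  exact ⟨_, _, _, ⟨_, hg, fun x => (hf x).trans (f.src_prim _ _).symm, rfl⟩,
    ⟨_, hf, fun x => (hg x).trans (g.src_prim _ _).symm, rfl⟩, rfl⟩

/-- The secondary component of a composite, after a bijection of the entries. -/
theorem map_adjComp_sec (hΩ : Ω.IsPolyPsh) (g : AdjArr Ω Γ p q) (k : p) (f : AdjArr Ω Γ m n)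
    (j : n) (h : g.src k = f.tgt j) {Z : Type} [Finite Z] (τ : _ ≃ Z) (Ψ : Z → C.Obj) (hτ) :
    ∃ G F e, (Ω.arrs p q).PlugsTo Γ ((glue k j).trans τ) (f.prim (Sum.inr j)) _ Ψ g.sec G ∧
      (Ω.arrs m n).PlugsTo Γ ((Equiv.sumComm _ _).trans ((glue k j).trans τ)) (g.prim (Sum.inl k))
        _ Ψ f.sec F ∧
      (actMap Ω Γ τ _ Ψ hτ).arr (adjComp hΩ.objs_isPsh g k f j h).sec = (Ω.fib _).comp G k F j e := by
  obtain ⟨G, F, e, hG, hF, hs⟩ := adjComp_sec hΩ.objs_isPsh g k f j h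
  exact ⟨_, _, _, (hΩ.arrs_isPsh _ _).plugsTo_actR hG τ _ (fun _ => rfl) hτ,
    (hΩ.arrs_isPsh _ _).plugsTo_actR hF τ _ (fun _ => rfl) hτ,
    (congrArg _ hs).trans ((actMap_isFunctor hΩ _ _ _ hτ).arr_comp e rfl rfl)⟩

theorem plugsTo_comp (hΩ : Ω.IsPolyPsh) {E F Z : Type} [Finite E] [Finite F] [Finite Z] {a : E}
    {w : {x : E // x ≠ a} ⊕ F ≃ Z} {R : C.Arr F} {Φ : E → C.Obj} {Ψ : Z → C.Obj}
    {g : (Ω.fib (Sum.elim Γ Φ)).Arr p q} {k : p} {f : (Ω.fib (Sum.elim Γ Φ)).Arr m n} {j : n} {e}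
    {y : (Ω.fib (Sum.elim Γ Ψ)).Arr _ _}
    (h : (Ω.arrs _ _).PlugsTo Γ w R Φ Ψ ((Ω.fib _).comp g k f j e) y) :
    ∃ g' f' e', (Ω.arrs p q).PlugsTo Γ w R Φ Ψ g g' ∧ (Ω.arrs m n).PlugsTo Γ w R Φ Ψ f f' ∧
      y = (Ω.fib _).comp g' k f' j e' := by
  obtain ⟨a₁, a₂, a₃, rfl⟩ := h
  exact ⟨_, _, _, ⟨a₁, a₂, a₃, rfl⟩, ⟨a₁, a₂, a₃, rfl⟩,
    (plugMap_isFunctor hΩ w R Φ Ψ a₁ a₂ a₃).arr_comp e rfl rfl⟩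

theorem ternary_assoc (c : r) (d : q) (k : p) (j : n) :
    Ternary (X := r ⊕ s) (Y := p ⊕ q) (V := m ⊕ n) (c := Sum.inl c) (d := Sum.inr d)
      (k := Sum.inl k) (j := Sum.inr j) (Z := (({x : {x // x ≠ c} ⊕ p // x ≠ Sum.inr k} ⊕ m) ⊕
        ({y // y ≠ j} ⊕ ({y // y ≠ d} ⊕ s)))) Sum.inr_ne_inl
      (glue c d) (glue (Sum.inr k) j) (glue k j) ((glue c (Sum.inr d)).trans
        ((plugInr (Equiv.refl _)).symm.sumCongr (plugInr (Equiv.refl _)))) where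
  eq₁ := rfl
  eq₂ := rfl
  left := by rintro ⟨x | x, hx⟩ hx' <;> rfl
  middle := by rintro (x | x) hx₁ hx₂ hx₃ hx₄ <;> rfl
  right := by rintro ⟨x | x, hx⟩ hx' <;> rfl

theorem adj_assoc (hΩ : Ω.IsPolyPsh) (h : AdjArr Ω Γ r s) (c : r) (g : AdjArr Ω Γ p q)
    (k : p) (d : q) (f : AdjArr Ω Γ m n) (j : n)
    (h₁ : h.src c = g.tgt d) (h₂ : (adjComp hΩ.objs_isPsh h c g d h₁).src (Sum.inr k) = f.tgt j)
    (h₃ : g.src k = f.tgt j) (h₄ : h.src c = (adjComp hΩ.objs_isPsh g k f j h₃).tgt (Sum.inr d)) :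
    adjComp hΩ.objs_isPsh (adjComp hΩ.objs_isPsh h c g d h₁) (Sum.inr k) f j h₂ =
      adjPerm hΩ.objs_isPsh (plugInr (Equiv.refl _)).symm (plugInr (Equiv.refl _))
        (adjComp hΩ.objs_isPsh h c (adjComp hΩ.objs_isPsh g k f j h₃) (Sum.inr d) h₄) := by
  have T := ternary_assoc (m := m) (s := s) c d k j
  have w₁ := adjComp_isCompPrim hΩ.objs_isPsh h c g d h₁
  have w₃ := adjComp_isCompPrim hΩ.objs_isPsh g k f j h₃
  refine AdjArr.ext' (hΩ.arrs_isPsh _ _) ?_ ?_ ?_ ?_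
  · funext x
    rcases x with ⟨x | x, hx⟩ | x <;> rfl
  · funext x
    rcases x with x | x | x <;> rfl
  · exact T.prim_eq w₁ (adjComp_isCompPrim _ _ _ _ _ _) w₃
      ((adjComp_isCompPrim _ _ _ _ _ _).act _ (adjPerm_prim _ _ _ _))
  · intro hc
    obtain ⟨G₁, F₁, _, hG₁, hF₁, e₁⟩ := adjComp_sec hΩ.objs_isPsh h c g d h₁
    obtain ⟨G₂, F₂, _, hG₂, hF₂, e₂⟩ := map_adjComp_sec hΩ _ _ f j h₂ _ _ hc
    obtain ⟨G₃, F₃, _, hG₃, hF₃, e₃⟩ := adjComp_sec hΩ.objs_isPsh g k f j h₃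
    obtain ⟨hp, ep⟩ := adjPerm_sec hΩ.objs_isPsh (plugInr (Equiv.refl _)).symm
      (plugInr (Equiv.refl _)) (adjComp hΩ.objs_isPsh h c _ (Sum.inr d) h₄)
    obtain ⟨G₄, F₄, _, hG₄, hF₄, e₄⟩ := map_adjComp_sec hΩ h c _ (Sum.inr d) h₄ _ _ hp
    refine e₂.trans (Eq.trans ?_ (ep.trans (congrArg _ e₄)).symm)
    rw [e₁] at hG₂
    rw [e₃] at hF₄
    obtain ⟨X, Y, _, hX, hY, rfl⟩ := plugsTo_comp hΩ hG₂
    obtain ⟨Y', V, _, hY', hV, rfl⟩ := plugsTo_comp hΩ hF₄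
    obtain rfl := (T.sec_left (hΩ.arrs_isPsh _ _) w₃ hG₁ hX).unique hG₄ (fun _ => rfl) rfl
    obtain rfl := T.sec_middle (hΩ.arrs_isPsh _ _) hF₁ hY hG₃ hY'
    obtain rfl := (T.sec_right (hΩ.arrs_isPsh _ _) w₁ hF₃ hV).unique hF₂ (fun _ => rfl) rfl
    exact (hΩ.isPoly _).assoc _ _ _ _ _ _ _ _ _ _ _

theorem plugsTo_congr_ctx {E F Z : Type} [Finite E] [Finite F] [Finite Z] {M : SetPshData.{u, v, w} C}
    {a : E} {w w' : {x : E // x ≠ a} ⊕ F ≃ Z} {R : C.Arr F} {Φ : E → C.Obj} {Ψ : Z → C.Obj}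
    {x : M.El (Sum.elim Γ Φ)} {y : M.El (Sum.elim Γ Ψ)} (h : M.PlugsTo Γ w R Φ Ψ x y)
    (hw : ∀ i, w i = w' i) : M.PlugsTo Γ w' R Φ Ψ x y := by
  obtain rfl := Equiv.ext hw
  exact h

theorem ternary_exchange_inputs {c c' : r} (hc : c ≠ c') (d : q) (j : n) :
    Ternary (X := p ⊕ q) (Y := r ⊕ s) (V := m ⊕ n) (c := Sum.inr d) (d := Sum.inl c)
      (k := Sum.inl c') (j := Sum.inr j) (fun h => hc (Sum.inl.inj h))
      ((Equiv.sumComm _ _).trans (glue c d))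
      (glue (Sum.inl (⟨c', hc.symm⟩ : {x // x ≠ c})) j) (glue c' j)
      ((Equiv.sumComm _ _).trans ((glue (Sum.inl (⟨c, hc⟩ : {x // x ≠ c'})) d).trans
        ((swapSlots hc).symm.sumCongr leftSwap))) where
  eq₁ := rfl
  eq₂ := rfl
  left := by rintro ⟨x | x, hx⟩ hx' <;> rfl
  middle := by rintro (x | x) hx₁ hx₂ hx₃ hx₄ <;> rfl
  right := by rintro ⟨x | x, hx⟩ hx' <;> rfl

theorem adj_exchange_inputs (hΩ : Ω.IsPolyPsh) (h : AdjArr Ω Γ r s) (c c' : r) (hc : c ≠ c')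
    (g : AdjArr Ω Γ p q) (d : q) (f : AdjArr Ω Γ m n) (j : n)
    (h₁ : h.src c = g.tgt d)
    (h₂ : (adjComp hΩ.objs_isPsh h c g d h₁).src (Sum.inl ⟨c', hc.symm⟩) = f.tgt j)
    (h₃ : h.src c' = f.tgt j)
    (h₄ : (adjComp hΩ.objs_isPsh h c' f j h₃).src (Sum.inl ⟨c, hc⟩) = g.tgt d) :
    adjComp hΩ.objs_isPsh (adjComp hΩ.objs_isPsh h c g d h₁) (Sum.inl ⟨c', hc.symm⟩) f j h₂ =
      adjPerm hΩ.objs_isPsh (swapSlots hc).symm leftSwap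
        (adjComp hΩ.objs_isPsh (adjComp hΩ.objs_isPsh h c' f j h₃) (Sum.inl ⟨c, hc⟩) g d h₄) := by
  have T := ternary_exchange_inputs (m := m) (p := p) (s := s) hc d j
  have w₁ := (adjComp_isCompPrim hΩ.objs_isPsh h c g d h₁).symm
  have w₃ := adjComp_isCompPrim hΩ.objs_isPsh h c' f j h₃
  refine AdjArr.ext' (hΩ.arrs_isPsh _ _) ?_ ?_ ?_ ?_
  · funext x
    rcases x with ⟨x | x, hx⟩ | x <;> rfl
  · funext x
    rcases x with x | x | x <;> rfl
  · exact T.prim_eq w₁ (adjComp_isCompPrim _ _ _ _ _ _) w₃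
      ((adjComp_isCompPrim _ _ _ _ _ _).act _ (adjPerm_prim _ _ _ _)).symm
  · intro hc'
    obtain ⟨G₁, F₁, _, hG₁, hF₁, e₁⟩ := adjComp_sec hΩ.objs_isPsh h c g d h₁
    obtain ⟨G₂, F₂, _, hG₂, hF₂, e₂⟩ := map_adjComp_sec hΩ _ _ f j h₂ _ _ hc'
    obtain ⟨G₃, F₃, _, hG₃, hF₃, e₃⟩ := adjComp_sec hΩ.objs_isPsh h c' f j h₃
    obtain ⟨hp, ep⟩ := adjPerm_sec hΩ.objs_isPsh (swapSlots hc).symm leftSwap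
      (adjComp hΩ.objs_isPsh _ (Sum.inl (⟨c, hc⟩ : {x // x ≠ c'})) g d h₄)
    obtain ⟨G₄, F₄, _, hG₄, hF₄, e₄⟩ := map_adjComp_sec hΩ _ (Sum.inl (⟨c, hc⟩ : {x // x ≠ c'})) g d h₄ _ _ hp
    refine e₂.trans (Eq.trans ?_ (ep.trans (congrArg _ e₄)).symm)
    rw [e₁] at hG₂
    rw [e₃] at hG₄
    obtain ⟨H, G, _, hH, hG, rfl⟩ := plugsTo_comp hΩ hG₂
    obtain ⟨H', F, _, hH', hF, rfl⟩ := plugsTo_comp hΩ hG₄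
    obtain rfl := (T.sec_left (hΩ.arrs_isPsh _ _) w₃ hF₁ hG).unique hF₄ (fun _ => rfl) rfl
    obtain rfl := T.sec_middle (hΩ.arrs_isPsh _ _) (plugsTo_congr_ctx hG₁ (by rintro (_ | _) <;> rfl)) hH
      hG₃ (plugsTo_congr_ctx hH' (by rintro (_ | _) <;> rfl))
    obtain rfl := (T.sec_right (hΩ.arrs_isPsh _ _) w₁ hF₃ (plugsTo_congr_ctx hF
      (by rintro (_ | _) <;> rfl))).unique hF₂ (fun _ => rfl) rfl
    exact (hΩ.isPoly _).exchange_inputs _ _ _ _ _ _ _ _ _ _ _ _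

theorem ternary_exchange_outputs (c : r) (k : p) {j j' : n} (hj : j ≠ j') :
    Ternary (X := p ⊕ q) (Y := m ⊕ n) (V := r ⊕ s) (c := Sum.inl k) (d := Sum.inr j)
      (k := Sum.inr j') (j := Sum.inl c) (fun h => hj (Sum.inr.inj h))
      (glue k j) ((Equiv.sumComm _ _).trans (glue c (Sum.inl (⟨j', hj.symm⟩ : {x // x ≠ j}))))
      ((Equiv.sumComm _ _).trans (glue c j'))
      ((glue k (Sum.inl (⟨j, hj⟩ : {x // x ≠ j'}))).trans (leftSwap.sumCongr (swapSlots hj).symm)) where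
  eq₁ := rfl
  eq₂ := rfl
  left := by rintro ⟨x | x, hx⟩ hx' <;> rfl
  middle := by rintro (x | x) hx₁ hx₂ hx₃ hx₄ <;> rfl
  right := by rintro ⟨x | x, hx⟩ hx' <;> rfl

theorem adj_exchange_outputs (hΩ : Ω.IsPolyPsh) (h : AdjArr Ω Γ r s) (c : r) (g : AdjArr Ω Γ p q)
    (k : p) (f : AdjArr Ω Γ m n) (j j' : n) (hj : j ≠ j')
    (h₁ : g.src k = f.tgt j)
    (h₂ : h.src c = (adjComp hΩ.objs_isPsh g k f j h₁).tgt (Sum.inl ⟨j', hj.symm⟩))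
    (h₃ : h.src c = f.tgt j')
    (h₄ : g.src k = (adjComp hΩ.objs_isPsh h c f j' h₃).tgt (Sum.inl ⟨j, hj⟩)) :
    adjComp hΩ.objs_isPsh h c (adjComp hΩ.objs_isPsh g k f j h₁) (Sum.inl ⟨j', hj.symm⟩) h₂ =
      adjPerm hΩ.objs_isPsh leftSwap (swapSlots hj).symm
        (adjComp hΩ.objs_isPsh g k (adjComp hΩ.objs_isPsh h c f j' h₃) (Sum.inl ⟨j, hj⟩) h₄) := by
  have T := ternary_exchange_outputs (m := m) (q := q) (s := s) c k hj
  have w₁ := adjComp_isCompPrim hΩ.objs_isPsh g k f j h₁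
  have w₃ := (adjComp_isCompPrim hΩ.objs_isPsh h c f j' h₃).symm
  refine AdjArr.ext' (hΩ.arrs_isPsh _ _) ?_ ?_ ?_ ?_
  · funext x
    rcases x with x | x | x <;> rfl
  · funext x
    rcases x with ⟨x | x, hx⟩ | x <;> rfl
  · exact T.prim_eq w₁ (adjComp_isCompPrim _ _ _ _ _ _).symm w₃
      ((adjComp_isCompPrim _ _ _ _ _ _).act _ (adjPerm_prim _ _ _ _))
  · intro hc'
    obtain ⟨G₁, F₁, _, hG₁, hF₁, e₁⟩ := adjComp_sec hΩ.objs_isPsh g k f j h₁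
    obtain ⟨H₂, F₂, _, hH₂, hF₂, e₂⟩ := map_adjComp_sec hΩ h c _ _ h₂ _ _ hc'
    obtain ⟨H₃, F₃, _, hH₃, hF₃, e₃⟩ := adjComp_sec hΩ.objs_isPsh h c f j' h₃
    obtain ⟨hp, ep⟩ := adjPerm_sec hΩ.objs_isPsh leftSwap (swapSlots hj).symm
      (adjComp hΩ.objs_isPsh g k _ (Sum.inl (⟨j, hj⟩ : {x // x ≠ j'})) h₄)
    obtain ⟨G₄, F₄, _, hG₄, hF₄, e₄⟩ := map_adjComp_sec hΩ g k _ (Sum.inl (⟨j, hj⟩ : {x // x ≠ j'})) h₄ _ _ hp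
    refine e₂.trans (Eq.trans ?_ (ep.trans (congrArg _ e₄)).symm)
    rw [e₁] at hF₂
    rw [e₃] at hF₄
    obtain ⟨G, F, _, hG, hF, rfl⟩ := plugsTo_comp hΩ hF₂
    obtain ⟨H, F', _, hH, hF', rfl⟩ := plugsTo_comp hΩ hF₄
    obtain rfl := (T.sec_left (hΩ.arrs_isPsh _ _) w₃ hG₁ hG).unique hG₄ (fun _ => rfl) rfl
    obtain rfl := T.sec_middle (hΩ.arrs_isPsh _ _) hF₁ hF hF₃ hF'
    obtain rfl := (T.sec_right (hΩ.arrs_isPsh _ _) w₁ (plugsTo_congr_ctx hH₃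
      (by rintro (_ | _) <;> rfl)) hH).unique hH₂ (by rintro (_ | _) <;> rfl) rfl
    exact (hΩ.isPoly _).exchange_outputs _ _ _ _ _ _ _ _ _ _ _ _

end

section

variable {C : Multicat.{u, v}} {Ω : PolyPshData.{u, v, u₁, v₁} C} {ι : Type} [Finite ι]
  {Γ : ι → C.Obj}

theorem IsCompPrim.unit {A B Z : Type} [Finite A] [Finite B] [Finite Z] {a a' : A} {b : B}
    {W : {x : A // x ≠ a} ⊕ {y : B // y ≠ b} ≃ Z} {ap : ∀ e : A, C.Arr {x // x ≠ e}}
    {bp : ∀ e : B, C.Arr {x // x ≠ e}} {cp : ∀ z : Z, C.Arr {x // x ≠ z}}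
    (h : IsCompPrim W ap bp cp) (ha : a ≠ a') {ε : Unit ≃ {x // x ≠ a}} {ε' : Unit ≃ {x // x ≠ a'}}
    {X X' : C.Obj} (h₁ : ap a = C.act ε (C.one X)) (h₂ : ap a' = C.act ε' (C.one X')) (υ : B ≃ Z)
    (hυ : ∀ y, υ y.1 = W (Sum.inr y)) (hb : υ b = W (Sum.inl ⟨a', ha.symm⟩)) (e : B) (z : Z)
    (hz : υ e = z) : cp z = C.act (neEquiv υ hz) (bp e) := by
  have hε' : ε' () = ⟨a, ha⟩ := by
    obtain ⟨⟨⟩, h⟩ := ε'.surjective ⟨a, ha⟩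
    exact h
  by_cases hbe : b = e
  · subst hbe
    obtain ⟨k, hk⟩ := h.left a' ha z (hb.symm.trans hz)
    have k' : C.src (C.one X') () = C.tgt (bp b) := by
      rw [h₂] at k
      rw [← k, ← hε', C.src_act]
    refine hk.trans ((Multicat.plug_congr (fun _ => rfl) h₂ rfl k (by rw [← h₂]; exact k)).trans
      ((Multicat.plug_act_left (w := ((neEquiv ε' hε').sumCongr (Equiv.refl _)).trans (plugNe W ha
        (hb.symm.trans hz))) hε' (fun _ => rfl) (fun _ => rfl) _ _ k' _).trans
        (Multicat.one_plug _ _ (fun i => ?_) _ _ _)))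
    exact Subtype.ext (hυ i).symm
  · obtain ⟨k, hk⟩ := h.right e hbe z ((hυ ⟨e, Ne.symm hbe⟩).symm.trans hz)
    have k' : C.src (bp e) ⟨b, hbe⟩ = C.tgt (C.one X) := by
      rw [k, h₁, C.tgt_act]
    have hε : ε () = ⟨a', ha.symm⟩ := by
      have : ∀ x : {x // x ≠ a'}, x = ⟨a, ha⟩ := fun x => by
        obtain ⟨⟨⟩, h⟩ := ε'.surjective x
        exact h.symm.trans hε'
      refine Subtype.ext ?_
      by_contra hne
      exact (ε ()).2 (congrArg Subtype.val (this ⟨_, hne⟩))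
    refine hk.trans ((Multicat.plug_congr (fun _ => rfl) rfl h₁ k (by rw [← h₁]; exact k)).trans
      ((Multicat.plug_act_right (τ := ε) (w := ((Equiv.refl _).sumCongr ε).trans
        (plugNe ((Equiv.sumComm _ _).trans W) hbe ((hυ ⟨e, Ne.symm hbe⟩).symm.trans hz))) (fun _ => rfl) (fun _ => rfl) _ _ k' _).trans
        (Multicat.plug_one _ _ (fun i => ?_) ?_ _ _ _)))
    · exact Subtype.ext (hυ ⟨i.1.1, _⟩).symm
    · refine Subtype.ext (Eq.trans ?_ hb.symm)
      exact congrArg (fun x => W (Sum.inl x)) hε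

theorem plugsTo_one (hΩ : Ω.IsPolyPsh) {E F Z : Type} [Finite E] [Finite F] [Finite Z] {a : E}
    {w : {x : E // x ≠ a} ⊕ F ≃ Z} {R : C.Arr F} {Φ : E → C.Obj} {Ψ : Z → C.Obj}
    {X : (Ω.fib (Sum.elim Γ Φ)).Obj} {y : (Ω.fib (Sum.elim Γ Ψ)).Arr Unit Unit}
    (h : (Ω.arrs _ _).PlugsTo Γ w R Φ Ψ ((Ω.fib _).one X) y) : ∃ Y, y = (Ω.fib _).one Y := by
  obtain ⟨a₁, a₂, a₃, rfl⟩ := h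
  exact ⟨_, (plugMap_isFunctor hΩ w R Φ Ψ a₁ a₂ a₃).one X⟩

theorem SetPshData.PlugsTo.unit {M : SetPshData.{u, v, w} C} (hM : M.IsPsh) {E F Z : Type} [Finite E]
    [Finite F] [Finite Z] {a : E} {w : {x : E // x ≠ a} ⊕ F ≃ Z} {Φ : E → C.Obj} {Ψ : Z → C.Obj}
    {ε : Unit ≃ F} {X : C.Obj} {x : M.El (Sum.elim Γ Φ)} {y : M.El (Sum.elim Γ Ψ)}
    (h : M.PlugsTo Γ w (C.act ε (C.one X)) Φ Ψ x y) (υ : E ≃ Z) (hυ : ∀ x, w (Sum.inl x) = υ x.1)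
    (ha : w (Sum.inr (ε ())) = υ a) (hΨ) : y = M.actR Γ υ Φ Ψ hΨ x := by
  obtain ⟨a₁, a₂, a₃, rfl⟩ := h
  have h₁ : C.tgt (C.one X) = Φ a := (C.tgt_act _ _).symm.trans a₁
  refine (hM.plugR_act_right (τ := ε) (((Equiv.refl _).sumCongr ε).trans w) (fun _ => rfl) (fun _ => rfl) _ _ _
    _ h₁ a₂ ?_ x).trans (hM.plugR_one _ _ hυ ha _ _ _ _ _ _)
  rintro ⟨⟩
  exact (a₃ _).trans (C.src_act _ _ _)

variable {m n p q : Type} [Finite m] [Finite n] [Finite p] [Finite q]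

theorem adj_one_comp (hΩ : Ω.IsPolyPsh) (A : AdjObj Ω Γ) (f : AdjArr Ω Γ m n) (j : n)
    (h : A = f.tgt j) :
    adjComp hΩ.objs_isPsh (adjOne hΩ.objs_isPsh A) () f j h =
      adjPerm hΩ.objs_isPsh unitPlug.symm (plugUnit j).symm f := by
  have hυ : ∀ y : {y : m ⊕ n // y ≠ Sum.inr j}, unitPlug.symm.sumCongr (plugUnit j).symm y.1 =
      glue () j (Sum.inr y) := by
    rintro ⟨y | y, hy⟩
    · rfl
    · exact congrArg Sum.inr ((Equiv.symm_apply_eq _).2 rfl)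
  have hj : unitPlug.symm.sumCongr (plugUnit j).symm (Sum.inr j : m ⊕ n) = Sum.inr (Sum.inr ()) :=
    congrArg Sum.inr ((Equiv.symm_apply_eq _).2 rfl)
  refine AdjArr.ext' (hΩ.arrs_isPsh _ _) ?_ ?_ ?_ ?_
  · funext x
    rcases x with ⟨x, hx⟩ | x
    exacts [(hx rfl).elim, rfl]
  · funext x
    rcases x with x | x
    exacts [rfl, h]
  · intro z
    exact (adjComp_isCompPrim hΩ.objs_isPsh (adjOne hΩ.objs_isPsh A) () f j h).unit (a' := Sum.inr ())
      Sum.inl_ne_inr rfl rfl (unitPlug.symm.sumCongr (plugUnit j).symm) hυ hj _ z _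
  · intro hc
    obtain ⟨G, F, _, hG, hF, e⟩ := map_adjComp_sec hΩ (adjOne hΩ.objs_isPsh A) () f j h _ _ hc
    obtain ⟨hp, ep⟩ := adjPerm_sec hΩ.objs_isPsh unitPlug.symm (plugUnit j).symm f
    refine e.trans (Eq.trans ?_ ep.symm)
    obtain ⟨X, rfl⟩ := plugsTo_one hΩ hG
    obtain rfl := hF.unit (hΩ.arrs_isPsh _ _) _ (fun y => (hυ y).symm) hj.symm hp
    exact (hΩ.isPoly _).one_comp _ _ _ _

theorem adj_comp_one (hΩ : Ω.IsPolyPsh) (g : AdjArr Ω Γ p q) (k : p) (A : AdjObj Ω Γ)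
    (h : g.src k = A) :
    adjComp hΩ.objs_isPsh g k (adjOne hΩ.objs_isPsh A) () h =
      adjPerm hΩ.objs_isPsh (plugUnit k).symm unitPlug.symm g := by
  have hυ : ∀ y : {y : p ⊕ q // y ≠ Sum.inl k}, (plugUnit k).symm.sumCongr unitPlug.symm y.1 =
      glue k () (Sum.inl y) := by
    rintro ⟨y | y, hy⟩
    · exact congrArg Sum.inl ((Equiv.symm_apply_eq _).2 rfl)
    · rfl
  have hj : (plugUnit k).symm.sumCongr unitPlug.symm (Sum.inl k : p ⊕ q) = Sum.inl (Sum.inr ()) :=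
    congrArg Sum.inl ((Equiv.symm_apply_eq _).2 rfl)
  refine AdjArr.ext' (hΩ.arrs_isPsh _ _) ?_ ?_ ?_ ?_
  · funext x
    rcases x with x | x
    · rfl
    · exact h.symm
  · funext x
    rcases x with ⟨x, hx⟩ | x
    exacts [(hx rfl).elim, rfl]
  · intro z
    exact (adjComp_isCompPrim hΩ.objs_isPsh g k (adjOne hΩ.objs_isPsh A) () h).symm.unit
      (a' := Sum.inl ()) Sum.inr_ne_inl rfl rfl ((plugUnit k).symm.sumCongr unitPlug.symm) hυ hj _ z _
  · intro hc
    obtain ⟨G, F, _, hG, hF, e⟩ := map_adjComp_sec hΩ g k (adjOne hΩ.objs_isPsh A) () h _ _ hc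
    obtain ⟨hp, ep⟩ := adjPerm_sec hΩ.objs_isPsh (plugUnit k).symm unitPlug.symm g
    refine e.trans (Eq.trans ?_ ep.symm)
    obtain ⟨X, rfl⟩ := plugsTo_one hΩ hF
    obtain rfl := hG.unit (hΩ.arrs_isPsh _ _) _ (fun y => (hυ y).symm) hj.symm hp
    exact (hΩ.isPoly _).comp_one _ _ _ _

theorem adj_perm_refl (hΩ : Ω.IsPolyPsh) (f : AdjArr Ω Γ m n) :
    adjPerm hΩ.objs_isPsh (Equiv.refl m) (Equiv.refl n) f = f := by
  have hr : (Equiv.refl m).sumCongr (Equiv.refl n) = Equiv.refl (m ⊕ n) := by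
    ext (x | x) <;> rfl
  refine AdjArr.ext' (hΩ.arrs_isPsh _ _) rfl rfl ?_ ?_
  · intro z
    rcases z with z | z
    · refine C.act_self (fun x => Subtype.ext ?_) _
      exact congrArg (fun σ : _ ≃ _ => σ x.1) hr
    · refine C.act_self (fun x => Subtype.ext ?_) _
      exact congrArg (fun σ : _ ≃ _ => σ x.1) hr
  · intro hc
    obtain ⟨hp, ep⟩ := adjPerm_sec hΩ.objs_isPsh (Equiv.refl m) (Equiv.refl n) f
    refine (congrArg _ (ep.trans ((hΩ.isPoly _).perm_refl _))).trans ?_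
    refine ((hΩ.arrs_isPsh m n).actR_actR _ _ (Equiv.refl _) (fun x => ?_) hp hc (fun _ => rfl) _).trans
      ((hΩ.arrs_isPsh m n).actR_refl _ _)
    exact congrArg (fun σ : _ ≃ _ => σ x) hr

end

section

variable {C : Multicat.{u, v}} {ι : Type} [Finite ι] {Γ : ι → C.Obj}

theorem SetPshData.PlugsTo.of_act {M : SetPshData.{u, v, w} C} (hM : M.IsPsh)
    {E E' F F' Z : Type} [Finite E] [Finite E'] [Finite F] [Finite F'] [Finite Z] {σ : E ≃ E'}
    {τ : F ≃ F'} {a : E} {a' : E'} (ha : σ a = a') {w' : {x : E' // x ≠ a'} ⊕ F' ≃ Z}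
    {R : C.Arr F} {R' : C.Arr F'} {Φ : E → C.Obj} {Φ' : E' → C.Obj} {Ψ : Z → C.Obj}
    {x : M.El (Sum.elim Γ Φ)} {y : M.El (Sum.elim Γ Ψ)} {hσ}
    (h : M.PlugsTo Γ w' R' Φ' Ψ (M.actR Γ σ Φ Φ' hσ x) y) (hR : R' = C.act τ R)
    (w : {x : E // x ≠ a} ⊕ F ≃ Z)
    (hl : ∀ x, w (Sum.inl x) = w' (Sum.inl (neEquiv σ ha x)))
    (hr : ∀ x, w (Sum.inr x) = w' (Sum.inr (τ x))) : M.PlugsTo Γ w R Φ Ψ x y := by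
  subst hR
  obtain ⟨a₁, a₂, a₃, rfl⟩ := h
  have b₁ : C.tgt R = Φ' a' := (C.tgt_act _ _).symm.trans a₁
  have b₁' : C.tgt R = Φ a := b₁.trans (by rw [← ha, hσ])
  have b₂ : ∀ x, Ψ (w (Sum.inl x)) = Φ x.1 := fun x => by
    rw [hl, a₂]
    exact hσ _
  have b₃ : ∀ x, Ψ (w (Sum.inr x)) = C.src R x := fun x => by
    rw [hr, a₃, C.src_act]
  refine ⟨b₁', b₂, b₃, Eq.symm ?_⟩
  refine (hM.plugR_act_right (τ := τ) (((Equiv.refl _).sumCongr τ).trans w') (fun _ => rfl)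
    (fun _ => rfl) _ _ _ _ b₁ a₂ (fun x => ?_) _).trans
    (hM.plugR_actR ha w (fun i hi => hl i) hr _ _ _ _ _ _ _ _ _)
  exact (congrArg Ψ (hr x)).symm.trans (b₃ x)

end

section

variable {C : Multicat.{u, v}} {Ω : StarPshData.{u, v, u₁, v₁} C} {ι : Type} [Finite ι]
  {Γ : ι → C.Obj} {m n p q m' n' p' q' : Type} [Finite m] [Finite n] [Finite p] [Finite q]
  [Finite m'] [Finite n'] [Finite p'] [Finite q']

theorem plugsTo_sact (hΩ : Ω.IsStarPsh) {E F Z : Type} [Finite E] [Finite F] [Finite Z] {a : E}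
    {w : {x : E // x ≠ a} ⊕ F ≃ Z} {R : C.Arr F} {Φ : E → C.Obj} {Ψ : Z → C.Obj} {σ : m ⊕ n ≃ p ⊕ q}
    {x : (Ω.fib (Sum.elim Γ Φ)).Arr m n} {y : (Ω.fib (Sum.elim Γ Ψ)).Arr p q}
    (h : (Ω.arrs p q).PlugsTo Γ w R Φ Ψ (Ω.sact σ x) y) :
    ∃ y', (Ω.arrs m n).PlugsTo Γ w R Φ Ψ x y' ∧ y = Ω.sact σ y' := by
  obtain ⟨a₁, a₂, a₃, rfl⟩ := h
  exact ⟨_, ⟨a₁, a₂, a₃, rfl⟩, ((hΩ.sub_isStarFunctor _ _ _).trans (hΩ.act_isStarFunctor _ _)).sact σ x⟩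

theorem adjSact_prim (hΩ : Ω.objs.IsPsh) (σ : m ⊕ n ≃ m' ⊕ n')
    (f : AdjArr Ω.toPolyPshData Γ m n) (z : m ⊕ n) (z' : m' ⊕ n') (hz : σ z = z') :
    (adjSact hΩ σ f).prim z' = C.act (neEquiv σ hz) (f.prim z) := by
  obtain rfl : z = σ.symm z' := by rw [← hz, Equiv.symm_apply_apply]
  rfl

theorem adjSact_sec (hΩ : Ω.objs.IsPsh) (σ : m ⊕ n ≃ m' ⊕ n') (f : AdjArr Ω.toPolyPshData Γ m n) :
    ∃ h, (adjSact hΩ σ f).sec = Ω.sact σ ((actMap Ω.toPolyPshData Γ σ _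
      (posCtx (adjSact hΩ σ f).src (adjSact hΩ σ f).tgt) h).arr f.sec) :=
  ⟨fun e => by
    refine (posCtx_eq (adjSact hΩ σ f) (σ e)).trans (Eq.trans ?_ (posCtx_eq f e).symm)
    exact congrArg AdjObj.plus (((Ω.adj hΩ).starFib Γ).entry_sact σ f e), rfl⟩

theorem adjEntry_sact (hΩ : Ω.objs.IsPsh) (σ : m ⊕ n ≃ m' ⊕ n')
    (f : AdjArr Ω.toPolyPshData Γ m n) (e : m ⊕ n) :
    adjEntry (adjSact hΩ σ f) (σ e) = adjEntry f e :=
  ((Ω.adj hΩ).starFib Γ).entry_sact σ f e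

theorem adjEntry_comp (hΩ : Ω.objs.IsPsh) (g : AdjArr Ω.toPolyPshData Γ p q) (k : p)
    (f : AdjArr Ω.toPolyPshData Γ m n) (j : n) (h : g.src k = f.tgt j) (e) :
    adjEntry (adjComp hΩ g k f j h) (glue k j e) =
      Sum.elim (fun x => adjEntry g x.1) (fun x => adjEntry f x.1) e := by
  rcases e with ⟨_ | _, _⟩ | ⟨_ | _, _⟩ <;> rfl

theorem AdjArr.ext_entry (hΩ : Ω.IsPolyPsh) {f g : AdjArr Ω.toPolyPshData Γ m n}
    (he : ∀ e, adjEntry f e = adjEntry g e) (hp : ∀ e, f.prim e = g.prim e)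
    (hsec : ∀ h, (actMap Ω.toPolyPshData Γ (Equiv.refl _) (posCtx f.src f.tgt)
      (posCtx g.src g.tgt) h).arr f.sec = g.sec) : f = g :=
  AdjArr.ext' (hΩ.arrs_isPsh m n) (funext fun i => he (Sum.inl i))
    (funext fun j => (adjDual_adjDual hΩ.objs_isPsh _).symm.trans ((congrArg (adjDual Ω)
      (he (Sum.inr j))).trans (adjDual_adjDual hΩ.objs_isPsh _))) hp hsec

theorem map_adjSact_sec (hΩ : Ω.IsStarPsh) (σ : m ⊕ n ≃ m' ⊕ n')
    (f : AdjArr Ω.toPolyPshData Γ m n) {Z : Type} [Finite Z] (τ : m' ⊕ n' ≃ Z) (Ψ : Z → C.Obj) (hτ) :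
    ∃ h, (actMap Ω.toPolyPshData Γ τ _ Ψ hτ).arr (adjSact hΩ.isPolyPsh.objs_isPsh σ f).sec =
      Ω.sact σ ((actMap Ω.toPolyPshData Γ (σ.trans τ) _ Ψ h).arr f.sec) := by
  obtain ⟨h, e⟩ := adjSact_sec hΩ.isPolyPsh.objs_isPsh σ f
  refine ⟨fun x => (hτ _).trans (h x), (congrArg _ e).trans
    (((hΩ.act_isStarFunctor _ _).sact σ _).trans (congrArg _ ?_))⟩
  exact (hΩ.isPolyPsh.arrs_isPsh m n).actR_actR _ _ _ (fun _ => rfl) h hτ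
    (fun x => (hτ _).trans (h x)) _

theorem adj_sact_sumCongr (hΩ : Ω.IsStarPsh) (ρ : m ≃ m') (τ : n ≃ n')
    (f : AdjArr Ω.toPolyPshData Γ m n) : adjSact hΩ.isPolyPsh.objs_isPsh (ρ.sumCongr τ) f =
      adjPerm hΩ.isPolyPsh.objs_isPsh ρ τ f := by
  refine AdjArr.ext_entry hΩ.isPolyPsh ?_ (fun _ => rfl) ?_
  · intro e
    obtain ⟨e, rfl⟩ := (ρ.sumCongr τ).surjective e
    rw [adjEntry_sact]
    rcases e with e | e
    · exact (congrArg f.src (ρ.symm_apply_apply e)).symm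
    · exact (congrArg (fun e => adjDual Ω (f.tgt e)) (τ.symm_apply_apply e)).symm
  · intro h
    obtain ⟨h₁, e₁⟩ := map_adjSact_sec hΩ (ρ.sumCongr τ) f _ _ h
    obtain ⟨h₂, e₂⟩ := adjPerm_sec hΩ.isPolyPsh.objs_isPsh ρ τ f
    exact e₁.trans (((hΩ.isStarPoly _).sact_sumCongr ρ τ _).trans e₂.symm)

theorem adj_sact_sact (hΩ : Ω.IsStarPsh) (σ : m ⊕ n ≃ m' ⊕ n') (τ : m' ⊕ n' ≃ p ⊕ q)
    (f : AdjArr Ω.toPolyPshData Γ m n) :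
    adjSact hΩ.isPolyPsh.objs_isPsh τ (adjSact hΩ.isPolyPsh.objs_isPsh σ f) =
      adjSact hΩ.isPolyPsh.objs_isPsh (σ.trans τ) f := by
  refine AdjArr.ext_entry hΩ.isPolyPsh ?_ ?_ ?_
  · intro e
    obtain ⟨e, rfl⟩ := (σ.trans τ).surjective e
    exact (adjEntry_sact _ _ _ _).trans ((adjEntry_sact _ _ _ _).trans (adjEntry_sact _ _ _ _).symm)
  · intro e
    obtain ⟨e, rfl⟩ := (σ.trans τ).surjective e
    refine (adjSact_prim _ τ _ (σ e) _ rfl).trans ((congrArg _ (adjSact_prim _ σ _ e _ rfl)).trans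
      ((C.act_act _ _ _).trans (adjSact_prim _ (σ.trans τ) _ e _ rfl).symm))
  · intro h
    obtain ⟨h₁, e₁⟩ := map_adjSact_sec hΩ τ (adjSact hΩ.isPolyPsh.objs_isPsh σ f) _ _ h
    obtain ⟨h₂, e₂⟩ := map_adjSact_sec hΩ σ f _ _ h₁
    obtain ⟨h₃, e₃⟩ := adjSact_sec hΩ.isPolyPsh.objs_isPsh (σ.trans τ) f
    exact e₁.trans ((congrArg _ e₂).trans (((hΩ.isStarPoly _).sact_sact σ τ _).trans e₃.symm))

/-- The composites of `f ^ σ` and `g ^ ρ` in either order, and the bijection of a composite. -/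
theorem adj_equivariance (hΩ : Ω.IsStarPsh) (ρ : p ⊕ q ≃ p' ⊕ q') (σ : m ⊕ n ≃ m' ⊕ n')
    (g : AdjArr Ω.toPolyPshData Γ p q) (k : p) (k' : p') (hk : ρ (Sum.inl k) = Sum.inl k')
    (f : AdjArr Ω.toPolyPshData Γ m n) (j : n) (j' : n') (hj : σ (Sum.inr j) = Sum.inr j')
    (h : g.src k = f.tgt j)
    (h' : (adjSact hΩ.isPolyPsh.objs_isPsh ρ g).src k' =
      (adjSact hΩ.isPolyPsh.objs_isPsh σ f).tgt j') :
    adjComp hΩ.isPolyPsh.objs_isPsh (adjSact hΩ.isPolyPsh.objs_isPsh ρ g) k'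
      (adjSact hΩ.isPolyPsh.objs_isPsh σ f) j' h' =
      adjSact hΩ.isPolyPsh.objs_isPsh
        ((glue k j).symm.trans (((neEquiv ρ hk).sumCongr (neEquiv σ hj)).trans (glue k' j')))
        (adjComp hΩ.isPolyPsh.objs_isPsh g k f j h) := by
  have hW : ∀ i, ((glue k j).symm.trans (((neEquiv ρ hk).sumCongr (neEquiv σ hj)).trans
      (glue k' j'))) (glue k j i) = glue k' j' ((neEquiv ρ hk).sumCongr (neEquiv σ hj) i) := by
    intro i
    simp only [Equiv.trans_apply, Equiv.symm_apply_apply]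
  refine AdjArr.ext_entry hΩ.isPolyPsh ?_ ?_ ?_
  · intro e
    obtain ⟨e, rfl⟩ := (((neEquiv ρ hk).sumCongr (neEquiv σ hj)).trans (glue k' j')).surjective e
    refine (adjEntry_comp _ _ _ _ _ _ _).trans (Eq.trans ?_ (congrArg _ (hW e)))
    rw [adjEntry_sact, adjEntry_comp]
    rcases e with e | e
    exacts [adjEntry_sact _ _ _ _, adjEntry_sact _ _ _ _]
  · intro e
    refine IsCompPrim.unique (fun i => (hW i).symm) ((adjComp_isCompPrim _ _ _ _ _ _).of_act
      (W := ((neEquiv ρ hk).sumCongr (neEquiv σ hj)).trans (glue k' j')) (W' := glue k' j') hk hj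
      (adjSact_prim _ _ _) (adjSact_prim _ _ _) (by intro _; rfl) (by intro _; rfl))
      ((adjComp_isCompPrim _ _ _ _ _ _).act _ (adjSact_prim _ _ _)) e
  · intro hc
    obtain ⟨G, F, _, hG, hF, e₁⟩ := map_adjComp_sec hΩ.isPolyPsh _ k' _ j' h' _ _ hc
    obtain ⟨hs, e₂⟩ := adjSact_sec hΩ.isPolyPsh.objs_isPsh ((glue k j).symm.trans
      (((neEquiv ρ hk).sumCongr (neEquiv σ hj)).trans (glue k' j')))
      (adjComp hΩ.isPolyPsh.objs_isPsh g k f j h)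
    obtain ⟨G', F', _, hG', hF', e₃⟩ := map_adjComp_sec hΩ.isPolyPsh g k f j h _ _ hs
    refine e₁.trans (Eq.trans ?_ (e₂.trans (congrArg _ e₃)).symm)
    obtain ⟨hρ, eg⟩ := adjSact_sec hΩ.isPolyPsh.objs_isPsh ρ g
    obtain ⟨hσ, ef⟩ := adjSact_sec hΩ.isPolyPsh.objs_isPsh σ f
    rw [eg] at hG
    rw [ef] at hF
    obtain ⟨G, hG₁, rfl⟩ := plugsTo_sact hΩ hG
    obtain ⟨F, hF₁, rfl⟩ := plugsTo_sact hΩ hF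
    obtain rfl := (hG₁.of_act (hσ := hρ) (w' := (glue k' j').trans (Equiv.refl _))
      (hΩ.isPolyPsh.arrs_isPsh _ _) hk (adjSact_prim _ _ _ _ _ hj)
      (((neEquiv ρ hk).sumCongr (neEquiv σ hj)).trans (glue k' j')) (by intro _; rfl)
      (by intro _; rfl)).unique hG' (fun i => (hW i).symm) rfl
    obtain rfl := (hF₁.of_act (hσ := hσ) (w' := (Equiv.sumComm _ _).trans ((glue k' j').trans (Equiv.refl _)))
      (hΩ.isPolyPsh.arrs_isPsh _ _) hj (adjSact_prim _ _ _ _ _ hk)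
      ((Equiv.sumComm _ _).trans (((neEquiv ρ hk).sumCongr (neEquiv σ hj)).trans (glue k' j')))
      (by intro _; rfl) (by intro _; rfl)).unique hF' (fun i => (hW _).symm) rfl
    exact (hΩ.isStarPoly _).equivariance ρ σ _ k k' hk _ j j' hj _ _

theorem adj_equivariance_dual (hΩ : Ω.IsStarPsh) (ρ : p ⊕ q ≃ p' ⊕ q') (σ : m ⊕ n ≃ m' ⊕ n')
    (g : AdjArr Ω.toPolyPshData Γ p q) (k : p) (k' : q') (hk : ρ (Sum.inl k) = Sum.inr k')
    (f : AdjArr Ω.toPolyPshData Γ m n) (j : n) (j' : m') (hj : σ (Sum.inr j) = Sum.inl j')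
    (h : g.src k = f.tgt j)
    (h' : (adjSact hΩ.isPolyPsh.objs_isPsh σ f).src j' =
      (adjSact hΩ.isPolyPsh.objs_isPsh ρ g).tgt k') :
    adjComp hΩ.isPolyPsh.objs_isPsh (adjSact hΩ.isPolyPsh.objs_isPsh σ f) j'
      (adjSact hΩ.isPolyPsh.objs_isPsh ρ g) k' h' =
      adjSact hΩ.isPolyPsh.objs_isPsh ((glue k j).symm.trans
        (((Equiv.sumComm _ _).trans ((neEquiv σ hj).sumCongr (neEquiv ρ hk))).trans (glue j' k')))
        (adjComp hΩ.isPolyPsh.objs_isPsh g k f j h) := by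
  have hW : ∀ i, ((glue k j).symm.trans (((Equiv.sumComm _ _).trans ((neEquiv σ hj).sumCongr
      (neEquiv ρ hk))).trans (glue j' k'))) (glue k j (Equiv.sumComm _ _ i)) =
        glue j' k' ((neEquiv σ hj).sumCongr (neEquiv ρ hk) i) := by
    intro i
    simp only [Equiv.trans_apply, Equiv.symm_apply_apply]
    rcases i with i | i <;> rfl
  refine AdjArr.ext_entry hΩ.isPolyPsh ?_ ?_ ?_
  · intro e
    obtain ⟨e, rfl⟩ := (((neEquiv σ hj).sumCongr (neEquiv ρ hk)).trans (glue j' k')).surjective e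
    refine (adjEntry_comp _ _ _ _ _ _ _).trans (Eq.trans ?_ (congrArg _ (hW e)))
    rw [adjEntry_sact, adjEntry_comp]
    rcases e with e | e
    exacts [adjEntry_sact _ _ _ _, adjEntry_sact _ _ _ _]
  · intro e
    refine IsCompPrim.unique (fun i => (hW i).symm) ((adjComp_isCompPrim _ _ _ _ _ _).of_act
      (W := ((neEquiv σ hj).sumCongr (neEquiv ρ hk)).trans (glue j' k')) (W' := glue j' k') hj hk
      (adjSact_prim _ _ _) (adjSact_prim _ _ _) (by intro _; rfl) (by intro _; rfl))
      ((adjComp_isCompPrim _ _ _ _ _ _).act _ (adjSact_prim _ _ _)).symm e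
  · intro hc
    obtain ⟨F, G, _, hF, hG, e₁⟩ := map_adjComp_sec hΩ.isPolyPsh _ j' _ k' h' _ _ hc
    obtain ⟨hs, e₂⟩ := adjSact_sec hΩ.isPolyPsh.objs_isPsh ((glue k j).symm.trans
      (((Equiv.sumComm _ _).trans ((neEquiv σ hj).sumCongr (neEquiv ρ hk))).trans (glue j' k')))
      (adjComp hΩ.isPolyPsh.objs_isPsh g k f j h)
    obtain ⟨G', F', _, hG', hF', e₃⟩ := map_adjComp_sec hΩ.isPolyPsh g k f j h _ _ hs
    refine e₁.trans (Eq.trans ?_ (e₂.trans (congrArg _ e₃)).symm)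
    obtain ⟨hρ, eg⟩ := adjSact_sec hΩ.isPolyPsh.objs_isPsh ρ g
    obtain ⟨hσ, ef⟩ := adjSact_sec hΩ.isPolyPsh.objs_isPsh σ f
    rw [eg] at hG
    rw [ef] at hF
    obtain ⟨G, hG₁, rfl⟩ := plugsTo_sact hΩ hG
    obtain ⟨F, hF₁, rfl⟩ := plugsTo_sact hΩ hF
    obtain rfl := (hG₁.of_act (hσ := hρ) (w' := (Equiv.sumComm _ _).trans ((glue j' k').trans (Equiv.refl _)))
      (hΩ.isPolyPsh.arrs_isPsh _ _) hk (adjSact_prim _ _ _ _ _ hj)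
      ((Equiv.sumComm _ _).trans (((neEquiv σ hj).sumCongr (neEquiv ρ hk)).trans (glue j' k')))
      (by intro _; rfl) (by intro _; rfl)).unique hG' (fun i => (hW _).symm.trans (by
        rcases i with i | i <;> rfl)) rfl
    obtain rfl := (hF₁.of_act (hσ := hσ) (w' := (glue j' k').trans (Equiv.refl _))
      (hΩ.isPolyPsh.arrs_isPsh _ _) hj (adjSact_prim _ _ _ _ _ hk)
      (((neEquiv σ hj).sumCongr (neEquiv ρ hk)).trans (glue j' k')) (by intro _; rfl)
      (by intro _; rfl)).unique hF' (fun i => (hW i).symm) rfl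
    exact (hΩ.isStarPoly _).equivariance_dual ρ σ _ k k' hk _ j j' hj _ _

end

/-- A functor of multicategories. -/
structure Multicat.Hom (C : Multicat.{u, v}) (C' : Multicat.{u₂, v₂}) where
  obj : C.Obj → C'.Obj
  arr : ∀ {ι : Type} [Finite ι], C.Arr ι → C'.Arr ι
  src_arr : ∀ {ι : Type} [Finite ι] (f : C.Arr ι) (i : ι), C'.src (arr f) i = obj (C.src f i)
  tgt_arr : ∀ {ι : Type} [Finite ι] (f : C.Arr ι), C'.tgt (arr f) = obj (C.tgt f)
  arr_act : ∀ {ι κ : Type} [Finite ι] [Finite κ] (σ : ι ≃ κ) (f : C.Arr ι),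
    arr (C.act σ f) = C'.act σ (arr f)
  arr_one : ∀ A : C.Obj, arr (C.one A) = C'.one (obj A)
  arr_comp : ∀ {ι κ : Type} [Finite ι] [Finite κ] (g : C.Arr κ) (q : κ) (f : C.Arr ι) (h h'),
    arr (C.comp g q f h) = C'.comp (arr g) q (arr f) h'

def Multicat.Hom.id (C : Multicat.{u, v}) : C.Hom C where
  obj A := A
  arr f := f
  src_arr _ _ := rfl
  tgt_arr _ := rfl
  arr_act _ _ := rfl
  arr_one _ := rfl
  arr_comp _ _ _ _ _ := rfl

theorem Multicat.Hom.arr_plug {C : Multicat.{u, v}} {C' : Multicat.{u₂, v₂}} (H : C.Hom C')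
    {κ ι Z : Type} [Finite κ] [Finite ι] [Finite Z] {q : κ} (w : {x : κ // x ≠ q} ⊕ ι ≃ Z)
    (g : C.Arr κ) (f : C.Arr ι) (h) :
    ∃ h', H.arr (C.plug w g f h) = C'.plug w (H.arr g) (H.arr f) h' := by
  have h' : C'.src (H.arr g) q = C'.tgt (H.arr f) := by rw [H.src_arr, H.tgt_arr, h]
  refine ⟨h', (H.arr_act _ _).trans (congrArg _ (H.arr_comp _ _ _ h h'))⟩

theorem IsCompPrim.map {C : Multicat.{u, v}} {C' : Multicat.{u₂, v₂}} (H : C.Hom C')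
    {A B Z : Type} [Finite A] [Finite B] [Finite Z] {a : A} {b : B}
    {W : {x : A // x ≠ a} ⊕ {y : B // y ≠ b} ≃ Z} {ap : ∀ e : A, C.Arr {x // x ≠ e}}
    {bp : ∀ e : B, C.Arr {x // x ≠ e}} {cp : ∀ z : Z, C.Arr {x // x ≠ z}}
    (h : IsCompPrim W ap bp cp) :
    IsCompPrim W (fun e => H.arr (ap e)) (fun e => H.arr (bp e)) (fun e => H.arr (cp e)) where
  left e he z hz := by
    obtain ⟨k, hk⟩ := h.left e he z hz
    obtain ⟨k', hk'⟩ := H.arr_plug (plugNe W he hz) (ap e) (bp b) k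
    exact ⟨k', (congrArg H.arr hk).trans hk'⟩
  right e he z hz := by
    obtain ⟨k, hk⟩ := h.right e he z hz
    obtain ⟨k', hk'⟩ := H.arr_plug (plugNe ((Equiv.sumComm _ _).trans W) he hz) (bp e) (ap a) k
    exact ⟨k', (congrArg H.arr hk).trans hk'⟩

/-- The values of a presheaf of polycategories at the lists `Γ, Φ` are mapped to those of another one
at the lists `Γ', Φ'`, compatibly with the actions on `Φ`. -/
structure CtxMap {C : Multicat.{u, v}} {C' : Multicat.{u₂, v₂}} (H : C.Hom C')
    (Ω : PolyPshData.{u, v, u₁, v₁} C) (Ω' : PolyPshData.{u₂, v₂, u₃, v₃} C') {ι κ : Type} [Finite ι]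
    [Finite κ] (Γ : ι → C.Obj) (Γ' : κ → C'.Obj) where
  map : ∀ {E : Type} [Finite E] (Φ : E → C.Obj) (Ψ : E → C'.Obj), (∀ e, Ψ e = H.obj (Φ e)) →
    PolyMap (Ω.fib (Sum.elim Γ Φ)) (Ω'.fib (Sum.elim Γ' Ψ))
  map_act_obj : ∀ {E Z : Type} [Finite E] [Finite Z] (σ : E ≃ Z) (Φ : E → C.Obj) (Φ' : Z → C.Obj)
    (Ψ : E → C'.Obj) (Ψ' : Z → C'.Obj) (h h' hσ hσ') (x),
    (map Φ' Ψ' h').obj ((actMap Ω Γ σ Φ Φ' hσ).obj x) =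
      (actMap Ω' Γ' σ Ψ Ψ' hσ').obj ((map Φ Ψ h).obj x)
  map_act_arr : ∀ {E Z m n : Type} [Finite E] [Finite Z] [Finite m] [Finite n] (σ : E ≃ Z)
    (Φ : E → C.Obj) (Φ' : Z → C.Obj) (Ψ : E → C'.Obj) (Ψ' : Z → C'.Obj) (h h' hσ hσ')
    (x : (Ω.fib _).Arr m n), (map Φ' Ψ' h').arr ((actMap Ω Γ σ Φ Φ' hσ).arr x) =
      (actMap Ω' Γ' σ Ψ Ψ' hσ').arr ((map Φ Ψ h).arr x)
  map_plug_obj : ∀ {E F Z : Type} [Finite E] [Finite F] [Finite Z] {a : E}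
    (w : {x : E // x ≠ a} ⊕ F ≃ Z) (r : C.Arr F) (Φ : E → C.Obj) (Φ' : Z → C.Obj) (Ψ : E → C'.Obj)
    (Ψ' : Z → C'.Obj) (h h' h₁ h₂ h₃ h₁' h₂' h₃') (x),
    (map Φ' Ψ' h').obj ((plugMap Ω Γ w r Φ Φ' h₁ h₂ h₃).obj x) =
      (plugMap Ω' Γ' w (H.arr r) Ψ Ψ' h₁' h₂' h₃').obj ((map Φ Ψ h).obj x)
  map_plug_arr : ∀ {E F Z m n : Type} [Finite E] [Finite F] [Finite Z] [Finite m] [Finite n] {a : E}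
    (w : {x : E // x ≠ a} ⊕ F ≃ Z) (r : C.Arr F) (Φ : E → C.Obj) (Φ' : Z → C.Obj) (Ψ : E → C'.Obj)
    (Ψ' : Z → C'.Obj) (h h' h₁ h₂ h₃ h₁' h₂' h₃') (x : (Ω.fib _).Arr m n),
    (map Φ' Ψ' h').arr ((plugMap Ω Γ w r Φ Φ' h₁ h₂ h₃).arr x) =
      (plugMap Ω' Γ' w (H.arr r) Ψ Ψ' h₁' h₂' h₃').arr ((map Φ Ψ h).arr x)

namespace CtxMap

variable {C : Multicat.{u, v}} {C' : Multicat.{u₂, v₂}} {H : C.Hom C'} {ι κ : Type} [Finite ι]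
  [Finite κ] {Γ : ι → C.Obj} {Γ' : κ → C'.Obj}

section

variable {Ω : PolyPshData.{u, v, u₁, v₁} C} {Ω' : PolyPshData.{u₂, v₂, u₃, v₃} C'}
  (T : CtxMap H Ω Ω' Γ Γ')

theorem map_pull {E : Type} [Finite E] (φ : AdjObj Ω Γ) (φ' : AdjObj Ω' Γ')
    (h₁ : φ'.plus = H.obj φ.plus) (h₂ : φ'.minus = H.obj φ.minus)
    (h₃ : ∀ h, φ'.form = (T.map (fun s => cond s φ.plus φ.minus) (fun s => cond s φ'.plus φ'.minus)
      h).obj φ.form) (s : Bool) (Φ : E → C.Obj) (Ψ : E → C'.Obj) (h)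
    (e : E) (g : C.Arr {x // x ≠ e}) (k₁ k₂ k₃ k₁' k₂' k₃') :
    (T.map Φ Ψ h).obj (pull Ω φ s Φ e g k₁ k₂ k₃) = pull Ω' φ' s Ψ e (H.arr g) k₁' k₂' k₃' := by
  rcases φ' with ⟨p, q, x⟩
  dsimp only at h₁ h₂ h₃
  subst h₁ h₂
  have hh : ∀ s, cond s (H.obj φ.plus) (H.obj φ.minus) = H.obj (cond s φ.plus φ.minus) := by
    rintro (_ | _) <;> rfl
  obtain rfl := h₃ hh
  refine T.map_plug_obj (a := s) (pullIndex s e) g (fun s => cond s φ.plus φ.minus) Φ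
    (fun s => cond s (H.obj φ.plus) (H.obj φ.minus)) Ψ hh h k₂ ?_ (fun x => (k₁ x).symm) k₂' ?_
    (fun x => (k₁' x).symm) φ.form
  · rintro ⟨y, hy⟩
    cases s <;> cases y <;> first | exact (hy rfl).elim | exact k₃
  · rintro ⟨y, hy⟩
    cases s <;> cases y <;> first | exact (hy rfl).elim | exact k₃'

/-- The map of objects of the Chu–Dialectica construction. -/
def adjObj (φ : AdjObj Ω Γ) : AdjObj Ω' Γ' where
  plus := H.obj φ.plus
  minus := H.obj φ.minus
  form := (T.map (fun s => cond s φ.plus φ.minus) (fun s => cond s (H.obj φ.plus) (H.obj φ.minus))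
    (by rintro (_ | _) <;> rfl)).obj φ.form

theorem posCtx_adjObj {m n : Type} (φ : m → AdjObj Ω Γ) (ψ : n → AdjObj Ω Γ) (e : m ⊕ n) :
    posCtx (fun i => T.adjObj (φ i)) (fun j => T.adjObj (ψ j)) e = H.obj (posCtx φ ψ e) := by
  rcases e with _ | _ <;> rfl

/-- The induced map of Chu–Dialectica constructions. -/
def adj (hΩ : Ω.objs.IsPsh) (hΩ' : Ω'.objs.IsPsh) : PolyMap (adjFib hΩ Γ) (adjFib hΩ' Γ') where
  obj := T.adjObj
  arr {m n _ _} f :=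
    { src := fun i => T.adjObj (f.src i)
      tgt := fun j => T.adjObj (f.tgt j)
      prim := fun e => H.arr (f.prim e)
      src_prim := fun e x => (H.src_arr _ _).trans ((congrArg H.obj (f.src_prim e x)).trans
        (T.posCtx_adjObj _ _ _).symm)
      tgt_prim := fun e => (H.tgt_arr _).trans ((congrArg H.obj (f.tgt_prim e)).trans
        (by rcases e with _ | _ <;> rfl))
      sec := (T.map _ _ (T.posCtx_adjObj _ _)).arr f.sec
      src_sec := fun i => ((T.map _ _ _).src_arr _ _).trans ((congrArg _ (f.src_sec i)).trans
        (T.map_pull _ (T.adjObj (f.src i)) rfl rfl (fun _ => rfl) false _ _ _ _ _ _ _ _ _ _ _))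
      tgt_sec := fun j => ((T.map _ _ _).tgt_arr _ _).trans ((congrArg _ (f.tgt_sec j)).trans
        (T.map_pull _ (T.adjObj (f.tgt j)) rfl rfl (fun _ => rfl) true _ _ _ _ _ _ _ _ _ _ _)) }
  src_arr _ _ := rfl
  tgt_arr _ _ := rfl

theorem map_plugsTo {m n E F Z : Type} [Finite m] [Finite n] [Finite E] [Finite F] [Finite Z] {a : E}
    {w : {x : E // x ≠ a} ⊕ F ≃ Z} {r : C.Arr F} {Φ : E → C.Obj} {Φ' : Z → C.Obj} {Ψ : E → C'.Obj}
    {Ψ' : Z → C'.Obj} {x : (Ω.arrs m n).El (Sum.elim Γ Φ)} {y : (Ω.arrs m n).El (Sum.elim Γ Φ')}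
    (hxy : (Ω.arrs m n).PlugsTo Γ w r Φ Φ' x y) (h h') :
    (Ω'.arrs m n).PlugsTo Γ' w (H.arr r) Ψ Ψ' ((T.map Φ Ψ h).arr x) ((T.map Φ' Ψ' h').arr y) := by
  obtain ⟨h₁, h₂, h₃, rfl⟩ := hxy
  have h₁' : C'.tgt (H.arr r) = Ψ a := by rw [H.tgt_arr, h₁, h]
  have h₂' : ∀ x, Ψ' (w (Sum.inl x)) = Ψ x.1 := fun x => by rw [h', h₂, h]
  have h₃' : ∀ x, Ψ' (w (Sum.inr x)) = C'.src (H.arr r) x := fun x => by rw [h', h₃, H.src_arr]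
  exact ⟨h₁', h₂', h₃', (T.map_plug_arr w r Φ Φ' Ψ Ψ' h h' h₁ h₂ h₃ h₁' h₂' h₃' x).symm⟩

theorem adj_one (hΩ : Ω.objs.IsPsh) (hΩ' : Ω'.IsPolyPsh)
    (hT : ∀ {E : Type} [Finite E] (Φ : E → C.Obj) (Ψ h), (T.map Φ Ψ h).IsFunctor) (φ : AdjObj Ω Γ) :
    (T.adj hΩ hΩ'.objs_isPsh).arr (adjOne hΩ φ) = adjOne hΩ'.objs_isPsh (T.adjObj φ) := by
  refine AdjArr.ext' (hΩ'.arrs_isPsh _ _) rfl rfl ?_ ?_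
  · rintro (e | e)
    exacts [(H.arr_act _ _).trans (congrArg _ (H.arr_one _)),
      (H.arr_act _ _).trans (congrArg _ (H.arr_one _))]
  · intro hc
    refine ((hΩ'.arrs_isPsh _ _).actR_refl hc _).trans (((hT _ _ _).one _).trans
      (congrArg (Ω'.fib _).one ?_))
    exact T.map_act_obj (E := Bool) _ (fun s => cond s φ.plus φ.minus) _
      (fun s => cond s (H.obj φ.plus) (H.obj φ.minus)) _ _ _ (by rintro (_ | _) <;> rfl)
      (by rintro (_ | _) <;> rfl) _

theorem adj_comp (hΩ : Ω.objs.IsPsh) (hΩ' : Ω'.IsPolyPsh)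
    (hT : ∀ {E : Type} [Finite E] (Φ : E → C.Obj) (Ψ h), (T.map Φ Ψ h).IsFunctor)
    {m n p q : Type} [Finite m] [Finite n] [Finite p] [Finite q] (g : AdjArr Ω Γ p q) (k : p)
    (f : AdjArr Ω Γ m n) (j : n) (h : g.src k = f.tgt j) (h') :
    (T.adj hΩ hΩ'.objs_isPsh).arr (adjComp hΩ g k f j h) = adjComp hΩ'.objs_isPsh
      ((T.adj hΩ hΩ'.objs_isPsh).arr g) k ((T.adj hΩ hΩ'.objs_isPsh).arr f) j h' := by
  refine AdjArr.ext' (hΩ'.arrs_isPsh _ _) ?_ ?_ ?_ ?_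
  · funext x
    rcases x with x | x <;> rfl
  · funext x
    rcases x with x | x <;> rfl
  · exact ((adjComp_isCompPrim hΩ g k f j h).map H).unique (fun _ => rfl)
      (adjComp_isCompPrim hΩ'.objs_isPsh _ k _ j h')
  · intro hc
    have hp := T.posCtx_adjObj (adjComp hΩ g k f j h).src (adjComp hΩ g k f j h).tgt
    obtain ⟨G, F, e, hG, hF, e₁⟩ := adjComp_sec hΩ g k f j h
    obtain ⟨G', F', _, hG', hF', e₂⟩ := map_adjComp_sec hΩ'
      ((T.adj hΩ hΩ'.objs_isPsh).arr g) k ((T.adj hΩ hΩ'.objs_isPsh).arr f) j h' (Equiv.refl _) _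
        (fun x => (hc x).symm)
    have e₃ : ((T.adj hΩ hΩ'.objs_isPsh).arr (adjComp hΩ g k f j h)).sec = (Ω'.fib _).comp G' k F' j
        _ := ((congrArg _ e₁).trans ((hT _ _ hp).arr_comp e
      ((T.map_plugsTo hG _ hp).unique hG' (fun _ => rfl) rfl)
      ((T.map_plugsTo hF _ hp).unique hF' (fun _ => rfl) rfl)))
    refine (congrArg _ (e₃.trans e₂.symm)).trans ?_
    exact ((hΩ'.arrs_isPsh _ _).actR_actR _ _ (Equiv.refl _) (fun _ => rfl) (fun x => (hc x).symm) hc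
      (fun _ => rfl) _).trans ((hΩ'.arrs_isPsh _ _).actR_refl (fun _ => rfl) _)

end

section

variable {Ω : StarPshData.{u, v, u₁, v₁} C} {Ω' : StarPshData.{u₂, v₂, u₃, v₃} C'}
  (T : CtxMap H Ω.toPolyPshData Ω'.toPolyPshData Γ Γ')

theorem adjObj_dual (hT : ∀ {E : Type} [Finite E] (Φ : E → C.Obj) (Ψ h) (x : (Ω.fib _).Obj),
      (T.map Φ Ψ h).obj (Ω.dual x) = Ω'.dual ((T.map Φ Ψ h).obj x)) (φ : AdjObj Ω.toPolyPshData Γ) :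
    T.adjObj (adjDual Ω φ) = adjDual Ω' (T.adjObj φ) := by
  refine AdjObj.ext' rfl rfl (heq_of_eq ?_)
  refine (hT _ _ _ _).trans (congrArg Ω'.dual ?_)
  exact T.map_act_obj (E := Bool) Equiv.boolNot (fun s => cond s φ.plus φ.minus) _
      (fun s => cond s (H.obj φ.plus) (H.obj φ.minus)) _ _ _ (by rintro (_ | _) <;> rfl)
      (by rintro (_ | _) <;> rfl) _

theorem adj_isStarFunctor (hΩ : Ω.IsStarPsh) (hΩ' : Ω'.IsStarPsh)
    (hT : ∀ {E : Type} [Finite E] (Φ : E → C.Obj) (Ψ h),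
      IsStarFunctor (Ω.starFib _) (Ω'.starFib _) (T.map Φ Ψ h)) :
    IsStarFunctor ((Ω.adj hΩ.isPolyPsh.objs_isPsh).starFib Γ)
      ((Ω'.adj hΩ'.isPolyPsh.objs_isPsh).starFib Γ')
      (T.adj hΩ.isPolyPsh.objs_isPsh hΩ'.isPolyPsh.objs_isPsh) := by
  have hd := T.adjObj_dual (fun Φ Ψ h => (hT Φ Ψ h).dual)
  have hs : ∀ {m n m' n' : Type} [Finite m] [Finite n] [Finite m'] [Finite n']
      (σ : m ⊕ n ≃ m' ⊕ n') (f : AdjArr Ω.toPolyPshData Γ m n),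
      (T.adj hΩ.isPolyPsh.objs_isPsh hΩ'.isPolyPsh.objs_isPsh).arr
        (adjSact hΩ.isPolyPsh.objs_isPsh σ f) = adjSact hΩ'.isPolyPsh.objs_isPsh σ
        ((T.adj hΩ.isPolyPsh.objs_isPsh hΩ'.isPolyPsh.objs_isPsh).arr f) := by
    intro m n m' n' _ _ _ _ σ f
    have he : ∀ {m n : Type} [Finite m] [Finite n] (f : AdjArr Ω.toPolyPshData Γ m n) (e : m ⊕ n),
        adjEntry ((T.adj hΩ.isPolyPsh.objs_isPsh hΩ'.isPolyPsh.objs_isPsh).arr f) e =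
          T.adjObj (adjEntry f e) := by
      intro m n _ _ f e
      rcases e with e | e
      exacts [rfl, (hd _).symm]
    refine AdjArr.ext_entry hΩ'.isPolyPsh ?_ ?_ ?_
    · intro e
      obtain ⟨e, rfl⟩ := σ.surjective e
      exact (he _ _).trans ((congrArg T.adjObj (adjEntry_sact _ σ f e)).trans
        ((he f e).symm.trans (adjEntry_sact _ σ _ e).symm))
    · intro e
      exact H.arr_act _ _
    · intro hc
      obtain ⟨h₁, e₁⟩ := adjSact_sec hΩ.isPolyPsh.objs_isPsh σ f
      obtain ⟨h₂, e₂⟩ := adjSact_sec hΩ'.isPolyPsh.objs_isPsh σ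
        ((T.adj hΩ.isPolyPsh.objs_isPsh hΩ'.isPolyPsh.objs_isPsh).arr f)
      refine Eq.trans ?_ e₂.symm
      have hp := T.posCtx_adjObj (adjSact hΩ.isPolyPsh.objs_isPsh σ f).src
        (adjSact hΩ.isPolyPsh.objs_isPsh σ f).tgt
      refine (congrArg _ ((congrArg (T.map _ _ hp).arr e₁).trans ((hT _ _ hp).sact σ _))).trans ?_
      refine ((hΩ'.act_isStarFunctor _ _).sact σ _).trans (congrArg (Ω'.sact σ) ?_)
      refine (congrArg _ (T.map_act_arr _ _ _ _ _ (T.posCtx_adjObj _ _) hp _ (fun x => (hc _).symm.trans (h₂ x))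
        f.sec)).trans ?_
      exact (hΩ'.isPolyPsh.arrs_isPsh _ _).actR_actR _ _ _ (fun _ => rfl)
        (fun x => (hc _).symm.trans (h₂ x)) hc h₂ _
  refine ⟨⟨?_, ?_, ?_⟩, hd, hs⟩
  · intro m n m' n' _ _ _ _ ρ τ f
    refine (congrArg _ (adj_sact_sumCongr hΩ ρ τ f).symm).trans ((hs _ f).trans ?_)
    exact adj_sact_sumCongr hΩ' ρ τ _
  · intro φ
    exact T.adj_one _ hΩ'.isPolyPsh (fun Φ Ψ h => (hT Φ Ψ h).isFunctor) φ
  · intro m n p q _ _ _ _ g k f j h h'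
    exact T.adj_comp _ hΩ'.isPolyPsh (fun Φ Ψ h => (hT Φ Ψ h).isFunctor) g k f j h h'

end

end CtxMap

namespace SetPshData

variable {C : Multicat.{u, v}} (M : SetPshData.{u, v, w} C) {E : Type} [Finite E] (Φ : E → C.Obj)

/-- The presheaf `Γ ↦ M(Γ, Φ)`. -/
def extend : SetPshData.{u, v, w} C where
  El Γ := M.El (Sum.elim Γ Φ)
  act {ι κ _ _ Γ Δ} σ h := M.act (σ.sumCongr (Equiv.refl E)) (by rintro (x | x); exacts [h x, rfl])
  sub {ι κ _ _ Γ} p f h x := M.act (plugInl p κ E) (by rintro (⟨x | x, h⟩ | x) <;> rfl)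
    (M.sub (Γ := Sum.elim Γ Φ) (Sum.inl p) f h x)

variable {M}

theorem IsPsh.extend (hM : M.IsPsh) : (M.extend Φ).IsPsh where
  act_refl h x := hM.act_self (by rintro (_ | _) <;> rfl) _ _
  act_act σ τ h₁ h₂ h₃ x := hM.act_act' _ _ _ (by rintro (_ | _) <;> rfl) _ _ _ _
  sub_one {ι _ Γ} p A h₁ h₂ x := hM.plug_one (Φ := Sum.elim Γ Φ) _ _ (by
    rintro ⟨x | x, hx⟩
    · exact congrArg Sum.inl ((Equiv.symm_apply_eq _).2 rfl).symm
    · rfl) (congrArg Sum.inl ((Equiv.symm_apply_eq _).2 rfl).symm) _ _ _ _ _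
  sub_comm {ι κ μ _ _ _ Γ} p q hpq f g h₁ h₂ h₃ h₄ h₅ x := by
    refine Eq.trans ?_ (hM.act_plug _ _ ((plugInl (Sum.inl ⟨p, hpq⟩ : {x // x ≠ q} ⊕ μ) κ E).trans
      ((swapSlots hpq).symm.sumCongr (Equiv.refl E))) (fun _ => rfl) _ _ _ _ (by
        rintro (⟨x | x, hx⟩ | x)
        · exact h₅ (Sum.inl ⟨x, fun k => hx (congrArg Sum.inl k)⟩)
        · rfl
        · exact h₅ (Sum.inr x)) _).symm
    refine hM.plug_comm (Φ := Sum.elim Γ Φ) (a := Sum.inl p) (b := Sum.inl q)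
      (fun h => hpq (Sum.inl.inj h)) (plugInl p κ E) rfl _ (plugInl q μ E) rfl _ f g _ _ _ _ _ _ _ _
      ?_ ?_ ?_ x
    · rintro (x | x) hx hy h₁ h₂ <;> rfl
    · intro x h₁
      rfl
    · intro x h₂
      rfl
  sub_comp {ι κ μ _ _ _ Γ} p g q f hgf h₁ h₂ h₃ h₄ x := by
    refine Eq.trans ?_ (hM.act_plug _ _ ((plugInl (Sum.inr q : {x // x ≠ p} ⊕ κ) μ E).trans
      ((plugInr (Equiv.refl _)).sumCongr (Equiv.refl E))) (fun _ => rfl) _ _ _ _ (by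
        rintro (⟨(x | x) | x, hx⟩ | x)
        · exact h₄ (Sum.inl ⟨Sum.inl x, fun k => hx (congrArg Sum.inl k)⟩)
        · exact h₄ (Sum.inl ⟨Sum.inr x, fun k => hx (congrArg Sum.inl k)⟩)
        · rfl
        · exact h₄ (Sum.inr x)) _).symm
    refine Eq.trans ?_ (hM.plug_plug (Φ := Sum.elim Γ Φ) (a := Sum.inl p) (plugInl p κ E) rfl _
      (Equiv.refl _) (plugInl p _ E) g f _ _ hgf ?_ _ _ ?_ ?_ ?_ ?_ x).symm
    · exact plug_congr (fun _ => rfl) (C.act_refl _).symm rfl _ _ _ _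
    · exact (C.tgt_act _ _).trans h₁
    · rintro (⟨x | x, hx⟩ | x)
      · rfl
      · rfl
      · exact congrFun (congrArg C.src (C.act_refl _).symm) x
    · rintro ⟨x | x, hx⟩ hx' <;> rfl
    · intro x hx
      rfl
    · intro x
      rfl
  sub_act {ι κ κ' _ _ _ Γ} p f ρ h₁ h₂ h₃ x := by
    refine Eq.trans ?_ (hM.act_plug _ _ ((plugInl p κ E).trans
      (((Equiv.refl _).sumCongr ρ).sumCongr (Equiv.refl E))) (fun _ => rfl) _ _ _ _ (by
        rintro (⟨x | x, hx⟩ | x)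
        · rfl
        · rfl
        · exact h₃ (Sum.inr x)) _).symm
    refine hM.plug_act_right (Φ := Sum.elim Γ Φ) (a := Sum.inl p) (τ := ρ) ?_ ?_ _ _ _ _ _ x
    · rintro ⟨x | x, hx⟩ <;> rfl
    · intro x
      rfl
  act_sub {ι ι' κ _ _ _ Γ Δ} τ p p' hp f h₁ h₂ h₃ h₄ x := by
    refine Eq.trans ?_ (hM.act_plug _ _ ((plugInl p κ E).trans
      (((neEquiv τ hp).sumCongr (Equiv.refl _)).sumCongr (Equiv.refl E))) (fun _ => rfl) _ _ _ _ (by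
        rintro (⟨x | x, hx⟩ | x)
        · exact h₁ x
        · rfl
        · rfl) _).symm
    refine hM.plug_act (Φ := Sum.elim Γ Φ) (Φ' := Sum.elim Δ Φ) (a := Sum.inl p)
      (congrArg Sum.inl hp) ?_ ?_ f _ _ _ _ _ x
    · rintro ⟨x | x, hx⟩ <;> rfl
    · intro x
      rfl

end SetPshData

section

variable {C : Multicat.{u, v}} {Ω : PolyPshData.{u, v, u₁, v₁} C}

/-- The action of a bijection on the first part of a list. -/
def actCtx (hΩ : Ω.IsPolyPsh) {ι κ : Type} [Finite ι] [Finite κ] {Γ : ι → C.Obj} {Δ : κ → C.Obj}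
    (σ : ι ≃ κ) (hσ : ∀ i, Δ (σ i) = Γ i) : CtxMap (Multicat.Hom.id C) Ω Ω Γ Δ where
  map {E _} Φ Ψ h := Ω.act (σ.sumCongr (Equiv.refl E)) (by rintro (x | x); exacts [hσ x, h x])
  map_act_obj {E Z _ _} τ Φ Φ' Ψ Ψ' h h' hτ hτ' x := by
    have hc : ∀ i, Sum.elim Δ Ψ' (σ.sumCongr τ i) = Sum.elim Γ Φ i := by
      rintro (i | i)
      exacts [hσ i, (h' _).trans (hτ i)]
    exact (hΩ.objs_isPsh.act_act' _ _ (σ.sumCongr τ) (by rintro (_ | _) <;> rfl) _ _ hc x).trans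
      (hΩ.objs_isPsh.act_act' _ _ (σ.sumCongr τ) (by rintro (_ | _) <;> rfl) _ _ hc x).symm
  map_act_arr {E Z m n _ _ _ _} τ Φ Φ' Ψ Ψ' h h' hτ hτ' x := by
    have hc : ∀ i, Sum.elim Δ Ψ' (σ.sumCongr τ i) = Sum.elim Γ Φ i := by
      rintro (i | i)
      exacts [hσ i, (h' _).trans (hτ i)]
    have hM := hΩ.arrs_isPsh m n
    exact (hM.act_act' _ _ (σ.sumCongr τ) (by rintro (_ | _) <;> rfl) _ _ hc x).trans
      (hM.act_act' _ _ (σ.sumCongr τ) (by rintro (_ | _) <;> rfl) _ _ hc x).symm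
  map_plug_obj {E F Z _ _ _ a} w r Φ Φ' Ψ Ψ' h h' h₁ h₂ h₃ h₁' h₂' h₃' x := by
    have hM := hΩ.objs_isPsh
    have hc : ∀ i, Sum.elim Δ Ψ' (((plugInr w).trans (σ.sumCongr (Equiv.refl Z))) i) =
        C.subCtx (Sum.elim Γ Φ) (Sum.inr a) r i := by
      rintro (⟨i | i, hi⟩ | i)
      exacts [hσ i, (h' _).trans (h₂ _), (h' _).trans (h₃ _)]
    refine (hM.act_plug _ _ ((plugInr w).trans (σ.sumCongr (Equiv.refl Z))) (fun _ => rfl) r h₁ _ _ hc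
      x).trans (hM.plug_act (σ := σ.sumCongr (Equiv.refl E)) (Φ := Sum.elim Γ Φ)
        (Φ' := Sum.elim Δ Ψ) (a := Sum.inr a) (a' := Sum.inr a) rfl (w' := plugInr w)
        (w := (plugInr w).trans (σ.sumCongr (Equiv.refl Z))) ?_ ?_ r _ _ _ _ _ x).symm
    · rintro ⟨x | x, hx⟩ <;> rfl
    · intro x
      rfl
  map_plug_arr {E F Z m n _ _ _ _ _ a} w r Φ Φ' Ψ Ψ' h h' h₁ h₂ h₃ h₁' h₂' h₃' x := by
    have hM := hΩ.arrs_isPsh m n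
    have hc : ∀ i, Sum.elim Δ Ψ' (((plugInr w).trans (σ.sumCongr (Equiv.refl Z))) i) =
        C.subCtx (Sum.elim Γ Φ) (Sum.inr a) r i := by
      rintro (⟨i | i, hi⟩ | i)
      exacts [hσ i, (h' _).trans (h₂ _), (h' _).trans (h₃ _)]
    refine (hM.act_plug _ _ ((plugInr w).trans (σ.sumCongr (Equiv.refl Z))) (fun _ => rfl) r h₁ _ _ hc
      x).trans (hM.plug_act (σ := σ.sumCongr (Equiv.refl E)) (Φ := Sum.elim Γ Φ)
        (Φ' := Sum.elim Δ Ψ) (a := Sum.inr a) (a' := Sum.inr a) rfl (w' := plugInr w)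
        (w := (plugInr w).trans (σ.sumCongr (Equiv.refl Z))) ?_ ?_ r _ _ _ _ _ x).symm
    · rintro ⟨x | x, hx⟩ <;> rfl
    · intro x
      rfl

/-- The action of an arrow into an entry of the first part of a list. -/
def subCtxMap (hΩ : Ω.IsPolyPsh) {ι κ : Type} [Finite ι] [Finite κ] {Γ : ι → C.Obj} (p : ι)
    (f : C.Arr κ) (hf : C.tgt f = Γ p) : CtxMap (Multicat.Hom.id C) Ω Ω Γ (C.subCtx Γ p f) where
  map {E _} Φ Ψ h := (Ω.sub (Γ := Sum.elim Γ Φ) (Sum.inl p) f hf).trans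
    (Ω.act (plugInl p κ E) (by rintro (⟨x | x, hx⟩ | x); exacts [rfl, h x, rfl]))
  map_act_obj {E Z _ _} τ Φ Φ' Ψ Ψ' h h' hτ hτ' x := by
    have hM := hΩ.objs_isPsh
    have hc : ∀ i, Sum.elim (C.subCtx Γ p f) Ψ' (((plugInl p κ E).trans
        ((Equiv.refl _).sumCongr τ)) i) = C.subCtx (Sum.elim Γ Φ) (Sum.inl p) f i := by
      rintro (⟨i | i, hi⟩ | i)
      exacts [rfl, (h' _).trans (hτ i), rfl]
    refine Eq.trans ?_ (hM.act_plug _ _ ((plugInl p κ E).trans ((Equiv.refl _).sumCongr τ))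
      (fun _ => rfl) f hf _ _ hc x).symm
    refine hM.plug_act (σ := (Equiv.refl _).sumCongr τ) (Φ := Sum.elim Γ Φ) (Φ' := Sum.elim Γ Φ')
      (a := Sum.inl p) (a' := Sum.inl p) rfl (w' := plugInl p κ Z)
      (w := (plugInl p κ E).trans ((Equiv.refl _).sumCongr τ)) ?_ ?_ f _ _ _ _ _ x
    · rintro ⟨x | x, hx⟩ <;> rfl
    · intro x
      rfl
  map_act_arr {E Z m n _ _ _ _} τ Φ Φ' Ψ Ψ' h h' hτ hτ' x := by
    have hM := hΩ.arrs_isPsh m n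
    have hc : ∀ i, Sum.elim (C.subCtx Γ p f) Ψ' (((plugInl p κ E).trans
        ((Equiv.refl _).sumCongr τ)) i) = C.subCtx (Sum.elim Γ Φ) (Sum.inl p) f i := by
      rintro (⟨i | i, hi⟩ | i)
      exacts [rfl, (h' _).trans (hτ i), rfl]
    refine Eq.trans ?_ (hM.act_plug _ _ ((plugInl p κ E).trans ((Equiv.refl _).sumCongr τ))
      (fun _ => rfl) f hf _ _ hc x).symm
    refine hM.plug_act (σ := (Equiv.refl _).sumCongr τ) (Φ := Sum.elim Γ Φ) (Φ' := Sum.elim Γ Φ')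
      (a := Sum.inl p) (a' := Sum.inl p) rfl (w' := plugInl p κ Z)
      (w := (plugInl p κ E).trans ((Equiv.refl _).sumCongr τ)) ?_ ?_ f _ _ _ _ _ x
    · rintro ⟨x | x, hx⟩ <;> rfl
    · intro x
      rfl
  map_plug_obj {E F Z _ _ _ a} w r Φ Φ' Ψ Ψ' h h' h₁ h₂ h₃ h₁' h₂' h₃' x := by
    refine hΩ.objs_isPsh.plug_comm (Φ := Sum.elim Γ Φ) (a := Sum.inr a) (b := Sum.inl p) Sum.inr_ne_inl
      (plugInr w) rfl (plugInl p κ Z) (plugInl p κ E) rfl (plugInr w) r f _ _ _ _ _ _ _ _ ?_ ?_ ?_ x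
    · rintro (x | x) hx hy h₁ h₂ <;> rfl
    · intro x h₁
      rfl
    · intro x h₂
      rfl
  map_plug_arr {E F Z m n _ _ _ _ _ a} w r Φ Φ' Ψ Ψ' h h' h₁ h₂ h₃ h₁' h₂' h₃' x := by
    refine (hΩ.arrs_isPsh m n).plug_comm (Φ := Sum.elim Γ Φ) (a := Sum.inr a) (b := Sum.inl p)
      Sum.inr_ne_inl
      (plugInr w) rfl (plugInl p κ Z) (plugInl p κ E) rfl (plugInr w) r f _ _ _ _ _ _ _ _ ?_ ?_ ?_ x
    · rintro (x | x) hx hy h₁ h₂ <;> rfl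
    · intro x h₁
      rfl
    · intro x h₂
      rfl

theorem adj_objs_isPsh (hΩ : Ω.IsPolyPsh) : (Ω.adj hΩ.objs_isPsh).objs.IsPsh where
  act_refl h φ := AdjObj.ext' rfl rfl (heq_of_eq
    ((hΩ.objs_isPsh.extend (fun s => cond s φ.plus φ.minus)).act_refl h φ.form))
  act_act σ τ h₁ h₂ h₃ φ := AdjObj.ext' rfl rfl (heq_of_eq
    ((hΩ.objs_isPsh.extend (fun s => cond s φ.plus φ.minus)).act_act σ τ h₁ h₂ h₃ _))
  sub_one p A h₁ h₂ φ := AdjObj.ext' rfl rfl (heq_of_eq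
    ((hΩ.objs_isPsh.extend (fun s => cond s φ.plus φ.minus)).sub_one p A h₁ h₂ _))
  sub_comm p q hpq f g h₁ h₂ h₃ h₄ h₅ φ := AdjObj.ext' rfl rfl (heq_of_eq
    ((hΩ.objs_isPsh.extend (fun s => cond s φ.plus φ.minus)).sub_comm p q hpq f g h₁ h₂ h₃ h₄ h₅ _))
  sub_comp p g q f hgf h₁ h₂ h₃ h₄ φ := AdjObj.ext' rfl rfl (heq_of_eq
    ((hΩ.objs_isPsh.extend (fun s => cond s φ.plus φ.minus)).sub_comp p g q f hgf h₁ h₂ h₃ h₄ _))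
  sub_act p f ρ h₁ h₂ h₃ φ := AdjObj.ext' rfl rfl (heq_of_eq
    ((hΩ.objs_isPsh.extend (fun s => cond s φ.plus φ.minus)).sub_act p f ρ h₁ h₂ h₃ _))
  act_sub τ p p' hp f h₁ h₂ h₃ h₄ φ := AdjObj.ext' rfl rfl (heq_of_eq
    ((hΩ.objs_isPsh.extend (fun s => cond s φ.plus φ.minus)).act_sub τ p p' hp f h₁ h₂ h₃ h₄ _))

/-- Polyarrows of `Adj(Ω)` agree if their objects do and the remaining components are equal up to an
identification of lists. -/
theorem AdjArr.ext_sec (hΩ : Ω.IsPolyPsh) {ι : Type} [Finite ι] {Γ : ι → C.Obj} {m n : Type}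
    [Finite m] [Finite n] {f g : AdjArr Ω Γ m n} (hs : ∀ i, f.src i = g.src i)
    (ht : ∀ j, f.tgt j = g.tgt j) (hp : f.prim = g.prim) (h : posCtx g.src g.tgt = posCtx f.src f.tgt)
    (hsec : HEq f.sec g.sec) : f = g := by
  rcases f with ⟨s, t, p, h₁, h₂, x, h₃, h₄⟩
  rcases g with ⟨s', t', p', h₁', h₂', x', h₃', h₄'⟩
  dsimp only at hs ht hp hsec
  obtain rfl := funext hs
  obtain rfl := funext ht
  subst hp
  cases hsec
  rfl

theorem adj_arrs_isPsh (hΩ : Ω.IsPolyPsh) (m n : Type) [Finite m] [Finite n] :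
    ((Ω.adj hΩ.objs_isPsh).arrs m n).IsPsh := by
  have ho := adj_objs_isPsh hΩ
  have hM : ∀ {ι : Type} [Finite ι] {Γ : ι → C.Obj} (f : AdjArr Ω Γ m n), _ :=
    fun f => (hΩ.arrs_isPsh m n).extend (posCtx f.src f.tgt)
  constructor
  · intro ι _ Γ h f
    exact AdjArr.ext_sec hΩ (fun _ => ho.act_refl h _) (fun _ => ho.act_refl h _) rfl rfl
      (heq_of_eq ((hM f).act_refl h f.sec))
  · intro ι κ μ _ _ _ Γ Δ Θ σ τ h₁ h₂ h₃ f
    exact AdjArr.ext_sec hΩ (fun _ => ho.act_act σ τ h₁ h₂ h₃ _) (fun _ => ho.act_act σ τ h₁ h₂ h₃ _)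
      rfl rfl (heq_of_eq ((hM f).act_act σ τ h₁ h₂ h₃ f.sec))
  · intro ι _ Γ p A h₁ h₂ f
    exact AdjArr.ext_sec hΩ (fun _ => ho.sub_one p A h₁ h₂ _) (fun _ => ho.sub_one p A h₁ h₂ _)
      rfl rfl (heq_of_eq ((hM f).sub_one p A h₁ h₂ f.sec))
  · intro ι κ μ _ _ _ Γ p q hpq a b h₁ h₂ h₃ h₄ h₅ f
    exact AdjArr.ext_sec hΩ (fun _ => ho.sub_comm p q hpq a b h₁ h₂ h₃ h₄ h₅ _)
      (fun _ => ho.sub_comm p q hpq a b h₁ h₂ h₃ h₄ h₅ _)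
      rfl rfl (heq_of_eq ((hM f).sub_comm p q hpq a b h₁ h₂ h₃ h₄ h₅ f.sec))
  · intro ι κ μ _ _ _ Γ p a q b hgf h₁ h₂ h₃ h₄ f
    exact AdjArr.ext_sec hΩ (fun _ => ho.sub_comp p a q b hgf h₁ h₂ h₃ h₄ _)
      (fun _ => ho.sub_comp p a q b hgf h₁ h₂ h₃ h₄ _)
      rfl rfl (heq_of_eq ((hM f).sub_comp p a q b hgf h₁ h₂ h₃ h₄ f.sec))
  · intro ι κ κ' _ _ _ Γ p a ρ h₁ h₂ h₃ f
    exact AdjArr.ext_sec hΩ (fun _ => ho.sub_act p a ρ h₁ h₂ h₃ _)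
      (fun _ => ho.sub_act p a ρ h₁ h₂ h₃ _)
      rfl rfl (heq_of_eq ((hM f).sub_act p a ρ h₁ h₂ h₃ f.sec))
  · intro ι ι' κ _ _ _ Γ Δ τ p p' hp a h₁ h₂ h₃ h₄ f
    exact AdjArr.ext_sec hΩ (fun _ => ho.act_sub τ p p' hp a h₁ h₂ h₃ h₄ _)
      (fun _ => ho.act_sub τ p p' hp a h₁ h₂ h₃ h₄ _)
      rfl rfl (heq_of_eq ((hM f).act_sub τ p p' hp a h₁ h₂ h₃ h₄ f.sec))

end

section

variable {C : Multicat.{u, v}} {Ω : StarPshData.{u, v, u₁, v₁} C}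

theorem adj_isStarPoly (hΩ : Ω.IsStarPsh) {ι : Type} [Finite ι] (Γ : ι → C.Obj) :
    ((Ω.adj hΩ.isPolyPsh.objs_isPsh).starFib Γ).IsStarPoly where
  isPoly :=
    { perm_refl := adj_perm_refl hΩ.isPolyPsh
      perm_perm := by
        intro m n m' n' m'' n'' _ _ _ _ _ _ ρ τ ρ' τ' f
        refine (congrArg (adjPerm _ ρ' τ') (adj_sact_sumCongr hΩ ρ τ f).symm).trans
          ((adj_sact_sumCongr hΩ ρ' τ' _).symm.trans ((adj_sact_sact hΩ _ _ f).trans ?_))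
        rw [Equiv.sumCongr_trans]
        exact adj_sact_sumCongr hΩ _ _ f
      one_comp := fun A f j h => adj_one_comp hΩ.isPolyPsh A f j h
      comp_one := fun g k A h => adj_comp_one hΩ.isPolyPsh g k A h
      assoc := adj_assoc hΩ.isPolyPsh
      exchange_inputs := adj_exchange_inputs hΩ.isPolyPsh
      exchange_outputs := adj_exchange_outputs hΩ.isPolyPsh
      equivariance := by
        intro m n p q m' n' p' q' _ _ _ _ _ _ _ _ ρ τ ρ' τ' g k k' hk f j j' hj h h'
        have h'' : (adjSact hΩ.isPolyPsh.objs_isPsh (ρ.sumCongr τ) g).src k' =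
            (adjSact hΩ.isPolyPsh.objs_isPsh (ρ'.sumCongr τ') f).tgt j' :=
          (congrArg (fun a => a.src k') (adj_sact_sumCongr hΩ ρ τ g)).trans (h'.trans
            (congrArg (fun a => a.tgt j') (adj_sact_sumCongr hΩ ρ' τ' f)).symm)
        have e := adj_equivariance hΩ (ρ.sumCongr τ) (ρ'.sumCongr τ') g k k' (congrArg Sum.inl hk) f
          j j' (congrArg Sum.inr hj) h h''
        refine Eq.trans ?_ (e.trans ?_)
        · exact PolyData.comp_congr (adjFib hΩ.isPolyPsh.objs_isPsh Γ) (adj_sact_sumCongr hΩ ρ τ g).symm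
            k' (adj_sact_sumCongr hΩ ρ' τ' f).symm j' h' h''
        · refine Eq.trans ?_ (adj_sact_sumCongr hΩ _ _ _)
          congr 1
          refine Equiv.ext ?_
          rintro ((x | x) | (x | x)) <;> rfl }
  sact_sumCongr := adj_sact_sumCongr hΩ
  sact_sact := adj_sact_sact hΩ
  equivariance := adj_equivariance hΩ
  equivariance_dual := adj_equivariance_dual hΩ

/-- The Chu–Dialectica construction of a presheaf of `∗`-polycategories is again one. -/
theorem adj_isStarPsh (hΩ : Ω.IsStarPsh) : (Ω.adj hΩ.isPolyPsh.objs_isPsh).IsStarPsh := by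
  have ha : ∀ {ι κ : Type} [Finite ι] [Finite κ] {Γ : ι → C.Obj} {Δ : κ → C.Obj}
      (σ : ι ≃ κ) (h : ∀ i, Δ (σ i) = Γ i), IsStarFunctor
        ((Ω.adj hΩ.isPolyPsh.objs_isPsh).starFib Γ) ((Ω.adj hΩ.isPolyPsh.objs_isPsh).starFib Δ)
        ((Ω.adj hΩ.isPolyPsh.objs_isPsh).act σ h) := fun σ h =>
    (actCtx hΩ.isPolyPsh σ h).adj_isStarFunctor hΩ hΩ (fun _ _ _ => hΩ.act_isStarFunctor _ _)
  have hs : ∀ {ι κ : Type} [Finite ι] [Finite κ] {Γ : ι → C.Obj} (p : ι) (f : C.Arr κ)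
      (h : C.tgt f = Γ p), IsStarFunctor ((Ω.adj hΩ.isPolyPsh.objs_isPsh).starFib Γ)
        ((Ω.adj hΩ.isPolyPsh.objs_isPsh).starFib (C.subCtx Γ p f))
        ((Ω.adj hΩ.isPolyPsh.objs_isPsh).sub p f h) := fun p f h =>
    (subCtxMap hΩ.isPolyPsh p f h).adj_isStarFunctor hΩ hΩ (fun _ _ _ =>
      (hΩ.sub_isStarFunctor _ _ _).trans (hΩ.act_isStarFunctor _ _))
  exact
    { isPolyPsh :=
        { isPoly := fun Γ => (adj_isStarPoly hΩ Γ).isPoly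
          act_isFunctor := fun σ h => (ha σ h).isFunctor
          sub_isFunctor := fun p f h => (hs p f h).isFunctor
          objs_isPsh := adj_objs_isPsh hΩ.isPolyPsh
          arrs_isPsh := adj_arrs_isPsh hΩ.isPolyPsh }
      isStarPoly := adj_isStarPoly hΩ
      act_isStarFunctor := ha
      sub_isStarFunctor := hs }

end

namespace CoSub2

variable {D : CoSub2.{u, v, w}}

namespace Clique

variable {ι : Type} [Finite ι] {Γ : ι → D.Obj} {E E' E'' : Type}

/-- The isomorphisms on which two cliques with the same objects agree form an equivalence relation. -/
theorem iso_equivalence {c d : D.Clique Γ E} (h : c.obj = d.obj) :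
    Equivalence fun e e' => c.iso e e' = d.iso e e' where
  refl e := by rw [c.iso_self, d.iso_self, h]
  symm {e e'} k := by
    have h₁ : D.cod.arr (c.iso e' e) = D.dom.arr (d.iso e e') := by rw [← k, c.cod_iso, c.dom_iso]
    have h₂ : D.cod.arr (d.iso e e') = D.dom.arr (d.iso e' e) := by rw [d.cod_iso, d.dom_iso]
    have h₃ : D.cod.arr (D.vcomp (c.iso e' e) (d.iso e e') h₁) = D.dom.arr (d.iso e' e) := by
      rw [D.cod_vcomp, h₂]
    have h₄ : D.vcomp (c.iso e' e) (d.iso e e') h₁ = D.idc.arr (d.obj e').1 := by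
      rw [← h, ← c.iso_self, ← c.iso_trans e' e e']
      exact D.vcomp_congr rfl k.symm _ _
    have h₅ : D.vcomp (d.iso e e') (d.iso e' e) h₂ = D.idc.arr (c.obj e).1 := by
      rw [h, ← d.iso_self, ← d.iso_trans e e' e]
    have h₆ := D.vcomp_assoc (c.iso e' e) (d.iso e e') (d.iso e' e) h₁ h₃ h₂
      (by rw [h₁, D.dom_vcomp])
    refine Eq.trans ?_ (h₆.symm.trans ?_)
    · exact ((D.vcomp_congr rfl h₅ _ (by rw [D.dom_idc, c.cod_iso])).trans (D.vcomp_id _ _ _)).symm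
    · exact (D.vcomp_congr h₄ rfl _ (by rw [D.cod_idc, d.dom_iso])).trans (D.id_vcomp _ _ _)
  trans {e e' e''} k k' := by
    rw [← c.iso_trans e e' e'', ← d.iso_trans e e' e'']
    exact D.vcomp_congr k k' _ _

theorem ext_of_forall {c d : D.Clique Γ E} (h : ∀ e, c.obj e = d.obj e)
    (k : ∀ e e', c.iso e e' = d.iso e e') : c = d :=
  Clique.ext (funext h) (funext fun e => funext fun e' => k e e')

/-- Cliques with the same objects are equal if they agree on the isomorphisms to one object. -/
theorem ext_of_iso_to {c d : D.Clique Γ E} (h : ∀ e, c.obj e = d.obj e) (e₀ : E)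
    (k : ∀ e, c.iso e e₀ = d.iso e e₀) : c = d :=
  have R := iso_equivalence (funext h)
  ext_of_forall h fun e e' => R.trans (k e) (R.symm (k e'))

theorem reindex_congr {u u' : E' → E} (h : ∀ e, u e = u' e) {c d : D.Clique Γ E} (k : c = d) :
    c.reindex u = d.reindex u' := by
  obtain rfl := funext h
  rw [k]

theorem reindex_reindex (u : E' → E) (u' : E'' → E') (c : D.Clique Γ E) :
    (c.reindex u).reindex u' = c.reindex (fun e => u (u' e)) := rfl

theorem reindex_self {u : E → E} (h : ∀ e, u e = e) (c : D.Clique Γ E) : c.reindex u = c := by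
  obtain rfl : u = fun e => e := funext h
  rfl

section join

variable (c : D.Clique Γ E) (a : E) (d : D.Clique Γ E') (b : E') (h : c.obj a = d.obj b)

theorem join_iso_inl (e e' : E) : (c.join a d b h).iso (Sum.inl e) (Sum.inl e') = c.iso e e' :=
  c.iso_trans _ _ _

theorem join_iso_inr (e e' : E') : (c.join a d b h).iso (Sum.inr e) (Sum.inr e') = d.iso e e' :=
  d.iso_trans _ _ _

theorem join_iso_inr_inl : (c.join a d b h).iso (Sum.inr b) (Sum.inl a) = D.idc.arr (c.obj a).1 := by
  refine (D.vcomp_congr (d.iso_self b) (c.iso_self a) _ (by rw [D.cod_idc, D.dom_idc, h])).trans ?_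
  rw [D.vcomp_id]
  exact congrArg (fun x => D.idc.arr x.1) h.symm

/-- The universal property of `join`. -/
theorem eq_join {z : D.Clique Γ (E ⊕ E')} (hc : z.reindex Sum.inl = c) (hd : z.reindex Sum.inr = d)
    (hz : z.iso (Sum.inr b) (Sum.inl a) = D.idc.arr (c.obj a).1) : z = c.join a d b h := by
  have ho : ∀ e, z.obj e = (c.join a d b h).obj e := by
    subst hc hd
    rintro (e | e) <;> rfl
  have R := iso_equivalence (funext ho)
  refine ext_of_iso_to ho (Sum.inl a) ?_
  have hl : ∀ e e', z.iso (Sum.inl e) (Sum.inl e') = c.iso e e' := fun e e' =>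
    congrArg (fun c => iso c e e') hc
  have hr : ∀ e e', z.iso (Sum.inr e) (Sum.inr e') = d.iso e e' := fun e e' =>
    congrArg (fun c => iso c e e') hd
  rintro (e | e)
  · exact (hl _ _).trans (join_iso_inl c a d b h _ _).symm
  · exact R.trans ((hr e b).trans (join_iso_inr c a d b h _ _).symm)
      (hz.trans (join_iso_inr_inl c a d b h).symm)

theorem join_reindex {F F' : Type} (u : F → E) (u' : F' → E') (x : F) (y : F') (hx : u x = a)
    (hy : u' y = b) (h') : (c.reindex u).join x (d.reindex u') y h' =
      (c.join a d b h).reindex (Sum.map u u') := by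
  subst hx hy
  refine (eq_join _ _ _ _ _ ?_ ?_ ?_).symm
  · exact ext_of_forall (by intro _; rfl) (by intro _ _; apply join_iso_inl; assumption)
  · exact ext_of_forall (by intro _; rfl) (by intro _ _; apply join_iso_inr; assumption)
  · exact join_iso_inr_inl _ _ _ _ h

theorem exists_join_left {F G : Type} {z₁ : D.Clique Γ F} {v : F → E} (h₁ : z₁ = c.reindex v)
    {x : F} (hx : v x = a) {u : G → F ⊕ E'} {z : D.Clique Γ G} (k)
    (hz : z = (z₁.join x d b k).reindex u) :
    ∃ h, z = (c.join a d b h).reindex (fun e => Sum.map v id (u e)) := by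
  subst h₁ hx
  exact ⟨k, hz.trans (reindex_congr (fun _ => rfl) (join_reindex c _ d b k v id x b rfl rfl k))⟩

theorem exists_join_right {F G : Type} {z₁ : D.Clique Γ F} {v : F → E'} (h₁ : z₁ = d.reindex v)
    {x : F} (hx : v x = b) {u : G → E ⊕ F} {z : D.Clique Γ G} (k)
    (hz : z = (c.join a z₁ x k).reindex u) :
    ∃ h, z = (c.join a d b h).reindex (fun e => Sum.map id v (u e)) := by
  subst h₁ hx
  exact ⟨k, hz.trans (reindex_congr (fun _ => rfl) (join_reindex c a d _ k id v a x rfl rfl k))⟩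

theorem eq_reindex {F F' : Type} {X : D.Clique Γ E} {Y : D.Clique Γ E'} {w : E → E'}
    (hXY : X = Y.reindex w) {z : D.Clique Γ F} {z' : D.Clique Γ F'} {u : F → E} {u' : F' → E'}
    (hz : z = X.reindex u) (hz' : z' = Y.reindex u') (s : F → F') (h : ∀ e, w (u e) = u' (s e)) :
    z = z'.reindex s := by
  subst hXY hz hz'
  exact reindex_congr h rfl

theorem join_comm : c.join a d b h = (d.join b c a h.symm).reindex Sum.swap := by
  refine (eq_join _ _ _ _ _ ?_ ?_ ?_).symm
  · exact ext_of_forall (by intro _; rfl) (by intro _ _; apply join_iso_inr; exact h.symm)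
  · exact ext_of_forall (by intro _; rfl) (by intro _ _; apply join_iso_inl; exact h.symm)
  · refine (iso_equivalence (c := (d.join b c a h.symm).reindex Sum.swap) (d := c.join a d b h)
      (funext ?_)).symm ?_ |>.trans (join_iso_inr_inl _ _ _ _ _)
    · rintro (e | e) <;> rfl
    · refine (join_iso_inr_inl d b c a h.symm).trans ?_
      refine ((D.vcomp_congr (c.iso_self a) (d.iso_self b) _
        (by rw [D.cod_idc, D.dom_idc, h])).trans ?_).symm
      rw [D.id_vcomp]

end join

theorem join_assoc {F : Type} (c : D.Clique Γ E) (a : E) (d : D.Clique Γ E') (b b' : E')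
    (f : D.Clique Γ F) (x : F) (h : c.obj a = d.obj b) (k : d.obj b' = f.obj x) :
    (c.join a d b h).join (Sum.inr b') f x k =
      (c.join a (d.join b' f x k) (Sum.inl b) h).reindex (Equiv.sumAssoc _ _ _) := by
  refine (eq_join _ _ _ _ _ ?_ ?_ ?_).symm
  · refine eq_join _ _ _ _ _ ?_ ?_ ?_
    · exact ext_of_forall (by intro _; rfl) (by intro _ _; apply join_iso_inl; assumption)
    · exact ext_of_forall (by intro _; rfl) (by
        intro _ _
        refine (join_iso_inr _ _ _ _ ?_ _ _).trans (join_iso_inl _ _ _ _ ?_ _ _) <;> assumption)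
    · exact join_iso_inr_inl c a (d.join b' f x k) (Sum.inl b) h
  · exact ext_of_forall (by intro _; rfl) (by
      intro _ _
      refine (join_iso_inr _ _ _ _ ?_ _ _).trans (join_iso_inr _ _ _ _ ?_ _ _) <;> assumption)
  · exact (join_iso_inr c a (d.join b' f x k) (Sum.inl b) h _ _).trans (join_iso_inr_inl _ _ _ _ _)

theorem join_const (A : D.Elt Γ) (a : E') (d : D.Clique Γ E) (b : E) (h : A = d.obj b) :
    (const E' A).join a d b h = d.reindex (Sum.elim (fun _ => b) id) := by
  subst h
  refine (eq_join _ _ _ _ _ ?_ ?_ ?_).symm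
  · exact ext_of_forall (fun _ => rfl) (fun _ _ => d.iso_self b)
  · exact ext_of_forall (fun _ => rfl) (fun _ _ => rfl)
  · exact d.iso_self b

/-- Joining two cliques to a third one. -/
theorem join_exchange {F : Type} (c : D.Clique Γ E) (a a' : E) (d : D.Clique Γ E') (b : E')
    (f : D.Clique Γ F) (x : F) (h : c.obj a = d.obj b) (k : c.obj a' = f.obj x) :
    (c.join a d b h).join (Sum.inl a') f x k = ((c.join a' f x k).join (Sum.inl a) d b h).reindex
      (Sum.elim (Sum.elim (fun e => Sum.inl (Sum.inl e)) Sum.inr) (fun e => Sum.inl (Sum.inr e))) := by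
  refine (eq_join _ _ _ _ _ ?_ ?_ ?_).symm
  · refine eq_join _ _ _ _ _ ?_ ?_ ?_
    · exact ext_of_forall (by intro _; rfl) (by
        intro _ _
        refine (join_iso_inl _ _ _ _ ?_ _ _).trans (join_iso_inl _ _ _ _ ?_ _ _) <;> assumption)
    · exact ext_of_forall (by intro _; rfl) (by intro _ _; apply join_iso_inr; assumption)
    · exact join_iso_inr_inl (c.join a' f x k) (Sum.inl a) d b h
  · exact ext_of_forall (by intro _; rfl) (by
      intro _ _
      refine (join_iso_inl _ _ _ _ ?_ _ _).trans (join_iso_inr _ _ _ _ ?_ _ _) <;> assumption)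
  · exact (join_iso_inl (c.join a' f x k) (Sum.inl a) d b h _ _).trans (join_iso_inr_inl _ _ _ _ _)

end Clique

/-- The entries of two cliques which are entries of their composite. -/
def glueMap {m n p q : Type} (k : p) (j : n) :
    ({x // x ≠ k} ⊕ m) ⊕ ({y // y ≠ j} ⊕ q) → (p ⊕ q) ⊕ (m ⊕ n)
  | Sum.inl (Sum.inl x) => Sum.inl (Sum.inl x.1)
  | Sum.inr (Sum.inr y) => Sum.inl (Sum.inr y)
  | Sum.inl (Sum.inr x) => Sum.inr (Sum.inl x)
  | Sum.inr (Sum.inl y) => Sum.inr (Sum.inr y.1)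

theorem glueMap_glue {m n p q : Type} (k : p) (j : n)
    (e : {e : p ⊕ q // e ≠ Sum.inl k} ⊕ {e : m ⊕ n // e ≠ Sum.inr j}) :
    glueMap k j (glue k j e) = Sum.map Subtype.val Subtype.val e := by
  rcases e with ⟨_ | _, _⟩ | ⟨_ | _, _⟩ <;> rfl

theorem fpdFib_comp {ι : Type} [Finite ι] {Γ : ι → D.Obj} {m n p q : Type} [Finite m] [Finite n]
    [Finite p] [Finite q] (g : D.Clique Γ (p ⊕ q)) (k : p) (f : D.Clique Γ (m ⊕ n)) (j : n) (h) :
    (D.fpdFib Γ).comp g k f j h = (g.join (Sum.inl k) f (Sum.inr j) h).reindex (glueMap k j) :=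
  Clique.reindex_congr (by rintro ((_ | _) | (_ | _)) <;> rfl) rfl

theorem fpdFib_comp' {ι : Type} [Finite ι] {Γ : ι → D.Obj} {m n p q : Type} [Finite m] [Finite n]
    [Finite p] [Finite q] (g : D.Clique Γ (p ⊕ q)) (k : p) (f : D.Clique Γ (m ⊕ n)) (j : n) (h) :
    (D.fpdFib Γ).comp g k f j h =
      (f.join (Sum.inr j) g (Sum.inl k) (Eq.symm h)).reindex (fun e => Sum.swap (glueMap k j e)) :=
  (fpdFib_comp g k f j h).trans (Clique.reindex_congr (fun _ => rfl) (Clique.join_comm _ _ _ _ _))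

theorem fpd_equivariance {ι : Type} [Finite ι] {Γ : ι → D.Obj} {m n p q m' n' p' q' : Type} [Finite m]
    [Finite n] [Finite p] [Finite q] [Finite m'] [Finite n'] [Finite p'] [Finite q']
    (ρ : p ⊕ q ≃ p' ⊕ q') (σ : m ⊕ n ≃ m' ⊕ n')
    (g : D.Clique Γ (p ⊕ q)) (k : p) (k' : p') (hk : ρ (Sum.inl k) = Sum.inl k')
    (f : D.Clique Γ (m ⊕ n)) (j : n)
    (j' : n') (hj : σ (Sum.inr j) = Sum.inr j') (h) (h') :
    (D.fpdFib Γ).comp (g.reindex ρ.symm) k' (f.reindex σ.symm) j' h' =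
      ((D.fpdFib Γ).comp g k f j h).reindex ((glue k j).symm.trans
        (((neEquiv ρ hk).sumCongr (neEquiv σ hj)).trans (glue k' j'))).symm := by
  refine Clique.eq_reindex (Clique.join_reindex g (Sum.inl k) f (Sum.inr j) h ρ.symm
    σ.symm _ _ (by rw [← hk, ρ.symm_apply_apply]) (by rw [← hj, σ.symm_apply_apply]) h')
    (fpdFib_comp _ _ _ _ h') (fpdFib_comp g k f j h) _ ?_
  intro e
  obtain ⟨e, rfl⟩ := (glue k' j').surjective e
  simp only [Equiv.symm_apply_apply, Equiv.symm_trans_apply, Equiv.symm_symm, glueMap_glue]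
  rcases e with e | e <;> rfl

theorem fpd_equivariance_dual {ι : Type} [Finite ι] {Γ : ι → D.Obj} {m n p q m' n' p' q' : Type}
    [Finite m] [Finite n] [Finite p] [Finite q] [Finite m'] [Finite n'] [Finite p'] [Finite q']
    (ρ : p ⊕ q ≃ p' ⊕ q') (σ : m ⊕ n ≃ m' ⊕ n')
    (g : D.Clique Γ (p ⊕ q)) (k : p) (k' : q') (hk : ρ (Sum.inl k) = Sum.inr k')
    (f : D.Clique Γ (m ⊕ n)) (j : n)
    (j' : m') (hj : σ (Sum.inr j) = Sum.inl j') (h) (h') :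
    (D.fpdFib Γ).comp (f.reindex σ.symm) j' (g.reindex ρ.symm) k' h' =
      ((D.fpdFib Γ).comp g k f j h).reindex ((glue k j).symm.trans
        (((Equiv.sumComm _ _).trans ((neEquiv σ hj).sumCongr (neEquiv ρ hk))).trans
          (glue j' k'))).symm := by
  refine Clique.eq_reindex (Clique.join_reindex f (Sum.inr j) g (Sum.inl k) (Eq.symm h)
    σ.symm ρ.symm _ _ (by rw [← hj, σ.symm_apply_apply]) (by rw [← hk, ρ.symm_apply_apply]) h')
    (fpdFib_comp _ _ _ _ h') (fpdFib_comp' g k f j h) _ ?_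
  intro e
  obtain ⟨e, rfl⟩ := (glue j' k').surjective e
  simp only [Equiv.symm_apply_apply, Equiv.symm_trans_apply, Equiv.symm_symm, glueMap_glue]
  rcases e with e | e <;> rfl

variable (D) in
theorem fpdFib_isPoly {ι : Type} [Finite ι] (Γ : ι → D.Obj) : (D.fpdFib Γ).IsPoly where
  perm_refl f := Clique.reindex_self (by rintro (_ | _) <;> rfl) f
  perm_perm ρ τ ρ' τ' f := by
    refine (Clique.reindex_reindex _ _ _).trans (Clique.reindex_congr ?_ rfl)
    rintro (_ | _) <;> rfl
  one_comp A f j h := by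
    refine Clique.eq_reindex (Clique.join_const A (Sum.inl ()) f (Sum.inr j) h) (fpdFib_comp _ _ _ _ h)
      (z' := f) (u' := id) rfl _ ?_
    rintro ((⟨_, x⟩ | _) | (_ | _))
    exacts [(x rfl).elim, rfl, rfl, rfl]
  comp_one g k A h := by
    refine Clique.eq_reindex (Clique.join_const A (Sum.inr ()) g (Sum.inl k) (Eq.symm h))
      (fpdFib_comp' _ _ _ _ h) (z' := g) (u' := id) rfl _ ?_
    rintro ((_ | _) | (⟨_, x⟩ | _))
    exacts [rfl, rfl, (x rfl).elim, rfl]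
  assoc h c g k d f j h₁ h₂ h₃ h₄ := by
    obtain ⟨_, e₁⟩ := Clique.exists_join_left _ (Sum.inr (Sum.inl k)) _ _ (fpdFib_comp h c g d h₁) rfl _
      (fpdFib_comp _ (Sum.inr k) f j h₂)
    obtain ⟨_, e₂⟩ := Clique.exists_join_right _ _ _ (Sum.inl (Sum.inr d)) (fpdFib_comp g k f j h₃) rfl _
      (fpdFib_comp h c _ (Sum.inr d) h₄)
    refine Clique.eq_reindex (Clique.join_assoc h (Sum.inl c) g (Sum.inr d) (Sum.inl k) f (Sum.inr j)
      h₁ h₃) e₁ e₂ _ ?_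
    rintro ((⟨(_ | _), _⟩ | _) | (_ | (_ | _))) <;> rfl
  exchange_inputs h c c' hc g d f j h₁ h₂ h₃ h₄ := by
    obtain ⟨_, e₁⟩ := Clique.exists_join_left _ (Sum.inl (Sum.inl c')) _ _ (fpdFib_comp h c g d h₁) rfl _
      (fpdFib_comp _ (Sum.inl ⟨c', hc.symm⟩) f j h₂)
    obtain ⟨_, e₂⟩ := Clique.exists_join_left _ (Sum.inl (Sum.inl c)) _ _ (fpdFib_comp h c' f j h₃) rfl _
      (fpdFib_comp _ (Sum.inl ⟨c, hc⟩) g d h₄)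
    refine Clique.eq_reindex (Clique.join_exchange h (Sum.inl c) (Sum.inl c') g (Sum.inr d) f (Sum.inr j)
      h₁ h₃) e₁ e₂ _ ?_
    rintro ((⟨(_ | _), _⟩ | _) | (_ | (_ | _))) <;> rfl
  exchange_outputs h c g k f j j' hj h₁ h₂ h₃ h₄ := by
    obtain ⟨_, e₁⟩ := Clique.exists_join_left _ (Sum.inl (Sum.inr j')) _ _ (fpdFib_comp' g k f j h₁) rfl _
      (fpdFib_comp' h c _ (Sum.inl ⟨j', hj.symm⟩) h₂)
    obtain ⟨_, e₂⟩ := Clique.exists_join_left _ (Sum.inl (Sum.inr j)) _ _ (fpdFib_comp' h c f j' h₃) rfl _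
      (fpdFib_comp' g k _ (Sum.inl ⟨j, hj⟩) h₄)
    refine Clique.eq_reindex (Clique.join_exchange f (Sum.inr j) (Sum.inr j') g (Sum.inl k) h (Sum.inl c)
      (Eq.symm h₁) (Eq.symm h₃)) e₁ e₂ _ ?_
    rintro ((_ | (_ | _)) | (⟨(_ | _), _⟩ | _)) <;> rfl
  equivariance ρ τ ρ' τ' g k k' hk f j j' hj h h' := by
    refine (fpd_equivariance (ρ.sumCongr τ) (ρ'.sumCongr τ') g k k' (congrArg Sum.inl hk) f j j'
      (congrArg Sum.inr hj) h h').trans (Clique.reindex_congr ?_ rfl)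
    rintro ((_ | _) | (_ | _)) <;> rfl

variable (D) in
theorem fpd_isStarPoly {ι : Type} [Finite ι] (Γ : ι → D.Obj) : (D.fpd.starFib Γ).IsStarPoly where
  isPoly := D.fpdFib_isPoly Γ
  sact_sumCongr ρ τ f := rfl
  sact_sact σ τ f := rfl
  equivariance := fpd_equivariance
  equivariance_dual := fpd_equivariance_dual

section

variable {ι κ : Type} [Finite ι] [Finite κ] {Γ : ι → D.Obj} {Δ : κ → D.Obj} {E E' : Type}

theorem Clique.act_join (σ : ι ≃ κ) (hσ : ∀ i, Δ (σ i) = Γ i) (c : D.Clique Γ E) (a : E)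
    (d : D.Clique Γ E') (b : E') (h h') :
    (c.join a d b h).act σ hσ = (c.act σ hσ).join a (d.act σ hσ) b h' := by
  refine eq_join _ _ _ _ _ ?_ ?_ ?_
  · exact ext_of_forall (by intro _; rfl) (by
      intro _ _; exact congrArg (D.two.act σ) (join_iso_inl c a d b h _ _))
  · exact ext_of_forall (by intro _; rfl) (by
      intro _ _; exact congrArg (D.two.act σ) (join_iso_inr c a d b h _ _))
  · exact (congrArg (D.two.act σ) (join_iso_inr_inl c a d b h)).trans (D.idc.arr_act _ _).symm

theorem Clique.sub_join (p : ι) (r : D.one.Arr κ true) (hr : D.one.tgt r = Γ p) (c : D.Clique Γ E)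
    (a : E) (d : D.Clique Γ E') (b : E') (h h') :
    (c.join a d b h).sub p r hr = (c.sub p r hr).join a (d.sub p r hr) b h' := by
  have k : ∀ {E : Type} (c : D.Clique Γ E) (a : E), D.two.src (D.idc.arr (c.obj a).1) p =
      D.two.tgt (D.idc.arr r) := fun c a => by rw [← c.iso_self]; exact c.sub_src p r hr a a
  refine eq_join _ _ _ _ _ ?_ ?_ ?_
  · exact ext_of_forall (by intro _; rfl) (by
      intro _ _; exact D.two.comp_congr (join_iso_inl c a d b h _ _) _ rfl _ _)
  · exact ext_of_forall (by intro _; rfl) (by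
      intro _ _; exact D.two.comp_congr (join_iso_inr c a d b h _ _) _ rfl _ _)
  · exact (D.two.comp_congr (join_iso_inr_inl c a d b h) _ rfl _ (k c a)).trans
      (D.idc.arr_comp _ _ _ _ _).symm

variable (D) in
theorem fpd_act_isStarFunctor (σ : ι ≃ κ) (h : ∀ i, Δ (σ i) = Γ i) :
    IsStarFunctor (D.fpd.starFib Γ) (D.fpd.starFib Δ) (D.fpd.act σ h) where
  isFunctor :=
    { perm := fun _ _ _ => rfl
      one := fun A => Clique.ext_of_forall (fun _ => rfl) (fun _ _ => (D.idc.arr_act _ _).symm)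
      comp := fun g k f j h' h'' =>
        Clique.reindex_congr (fun _ => rfl) (Clique.act_join σ h _ _ _ _ h' h'') }
  dual _ := rfl
  sact _ _ := rfl

variable (D) in
theorem fpd_sub_isStarFunctor (p : ι) (r : D.one.Arr κ true) (h : D.one.tgt r = Γ p) :
    IsStarFunctor (D.fpd.starFib Γ) (D.fpd.starFib (D.one.multicat.subCtx Γ p r))
      (D.fpd.sub p r h) where
  isFunctor :=
    { perm := fun _ _ _ => rfl
      one := fun A => Clique.ext_of_forall (fun _ => rfl) (fun _ _ => (D.idc.arr_comp _ _ _ _ _).symm)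
      comp := fun g k f j h' h'' =>
        Clique.reindex_congr (fun _ => rfl) (Clique.sub_join p r h _ _ _ _ h' h'') }
  dual _ := rfl
  sact _ _ := rfl

end

variable (D) in
theorem fpd_arrs_isPsh (m n : Type) [Finite m] [Finite n] : (D.fpd.arrs m n).IsPsh where
  act_refl h c := Clique.ext_of_forall (fun _ => D.fpd_objs_isPsh.act_refl h _)
    (fun _ _ => D.two.act_refl _)
  act_act σ τ h₁ h₂ h₃ c := Clique.ext_of_forall
    (fun _ => D.fpd_objs_isPsh.act_act σ τ h₁ h₂ h₃ _) (fun _ _ => D.two.act_act _ _ _)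
  sub_one p A h₁ h₂ c := Clique.ext_of_forall (fun _ => D.fpd_objs_isPsh.sub_one p A h₁ h₂ _)
    (fun e e' => (D.two.comp_congr rfl _ (D.idc.arr_one A) _
      ((Clique.sub_src p _ h₁ c e e').trans (congrArg D.two.tgt (D.idc.arr_one A)))).trans (D.two.comp_one _ _ _ _))
  sub_comm p q hpq f g h₁ h₂ h₃ h₄ h₅ c := Clique.ext_of_forall
    (fun _ => D.fpd_objs_isPsh.sub_comm p q hpq f g h₁ h₂ h₃ h₄ h₅ _)
    (fun _ _ => D.two.exchange _ _ _ _ _ _ _ _ _ _)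
  sub_comp p g q f hgf h₁ h₂ h₃ h₄ c := Clique.ext_of_forall
    (fun _ => D.fpd_objs_isPsh.sub_comp p g q f hgf h₁ h₂ h₃ h₄ _) (fun e e' => by
      have k₁ := Clique.sub_src p g h₂ c e e'
      have k₃ := Clique.sub_src (Sum.inr q) f h₃ (Clique.sub p g h₂ c) e e'
      have k₂ := Clique.sub_src p (D.one.comp g q f hgf) h₁ c e e'
      have k₄ : D.two.src (D.idc.arr g) q = D.two.tgt (D.idc.arr f) :=
        (D.idc.src_arr g q).trans (hgf.trans (D.idc.tgt_arr f).symm)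
      have k₅ := D.idc.arr_comp g q f hgf k₄
      have k₆ := k₂.trans (congrArg D.two.tgt k₅)
      refine (D.two.comp_congr rfl _ k₅ k₂ k₆).trans ?_
      refine Eq.trans ?_ (congrArg (D.two.act _) (D.two.assoc (Clique.iso c e e') p (D.idc.arr g) q
        (D.idc.arr f) k₁ k₃ k₄ k₆)).symm
      rw [D.two.act_act]
      exact (D.two.act_self (fun i => (plugInr (Equiv.refl _)).apply_symm_apply i) _).symm)
  sub_act p f ρ h₁ h₂ h₃ c := Clique.ext_of_forall
    (fun _ => D.fpd_objs_isPsh.sub_act p f ρ h₁ h₂ h₃ _) (fun e e' => by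
      have k := Clique.sub_src p _ h₁ c e e'
      have k' := k.trans (congrArg D.two.tgt (D.idc.arr_act ρ f))
      exact (D.two.comp_congr rfl _ (D.idc.arr_act ρ f) k k').trans
        (D.two.comp_act_right ρ _ p _ _ _))
  act_sub τ p p' hp f h₁ h₂ h₃ h₄ c := Clique.ext_of_forall
    (fun _ => D.fpd_objs_isPsh.act_sub τ p p' hp f h₁ h₂ h₃ h₄ _)
    (fun _ _ => D.two.comp_act_left τ _ p p' hp _ _ _)

variable (D) in
/-- The presheaf `Ω_fpd` is a presheaf of `∗`-polycategories. -/
theorem fpd_isStarPsh : D.fpd.IsStarPsh where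
  isPolyPsh :=
    { isPoly := fun Γ => D.fpdFib_isPoly Γ
      act_isFunctor := fun σ h => (D.fpd_act_isStarFunctor σ h).isFunctor
      sub_isFunctor := fun p f h => (D.fpd_sub_isStarFunctor p f h).isFunctor
      objs_isPsh := D.fpd_objs_isPsh
      arrs_isPsh := D.fpd_arrs_isPsh }
  isStarPoly := D.fpd_isStarPoly
  act_isStarFunctor := D.fpd_act_isStarFunctor
  sub_isStarFunctor := D.fpd_sub_isStarFunctor

variable (D) in
theorem chu₀_isStarPoly : D.chu₀.IsStarPoly := adj_isStarPoly D.fpd_isStarPsh _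

end CoSub2

/-- A functor of co-subunary polycategories with the given map of objects. -/
structure CoSub.Fun {O : Type u} {O' : Type u₂} (obj : O → O') (X : CoSub.{u, v} O)
    (Y : CoSub.{u₂, v₂} O') where
  arr : ∀ {ι : Type} [Finite ι] {b : Bool}, X.Arr ι b → Y.Arr ι b
  src_arr : ∀ {ι : Type} [Finite ι] {b : Bool} (f : X.Arr ι b) (i : ι),
    Y.src (arr f) i = obj (X.src f i)
  tgt_arr : ∀ {ι : Type} [Finite ι] {b : Bool} (f : X.Arr ι b),
    Y.tgt (arr f) = Cod.map obj (X.tgt f)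
  arr_act : ∀ {ι κ : Type} [Finite ι] [Finite κ] {b : Bool} (σ : ι ≃ κ) (f : X.Arr ι b),
    arr (X.act σ f) = Y.act σ (arr f)
  arr_one : ∀ A : O, arr (X.one A) = Y.one (obj A)
  arr_comp : ∀ {ι κ : Type} [Finite ι] [Finite κ] {b : Bool} (g : X.Arr κ b) (q : κ)
    (f : X.Arr ι true) (h : X.src g q = X.tgt f) (h' : Y.src (arr g) q = Y.tgt (arr f)),
    arr (X.comp g q f h) = Y.comp (arr g) q (arr f) h'

/-- The underlying functor of multicategories. -/
def CoSub.Fun.multicat {O : Type u} {O' : Type u₂} {obj : O → O'} {X : CoSub.{u, v} O}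
    {Y : CoSub.{u₂, v₂} O'} (F : CoSub.Fun obj X Y) : X.multicat.Hom Y.multicat where
  obj := obj
  arr f := F.arr f
  src_arr f i := F.src_arr f i
  tgt_arr f := F.tgt_arr f
  arr_act σ f := F.arr_act σ f
  arr_one A := F.arr_one A
  arr_comp g q f h h' := F.arr_comp g q f h h'

/-- A functor of co-subunary 2-polycategories. -/
structure CoSub2.Functor (D : CoSub2.{u, v, w}) (D' : CoSub2.{u₂, v₂, w₂}) where
  obj : D.Obj → D'.Obj
  one : CoSub.Fun obj D.one D'.one
  two : CoSub.Fun obj D.two D'.two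
  dom_two : ∀ {ι : Type} [Finite ι] {b : Bool} (θ : D.two.Arr ι b),
    D'.dom.arr (two.arr θ) = one.arr (D.dom.arr θ)
  cod_two : ∀ {ι : Type} [Finite ι] {b : Bool} (θ : D.two.Arr ι b),
    D'.cod.arr (two.arr θ) = one.arr (D.cod.arr θ)
  two_idc : ∀ {ι : Type} [Finite ι] {b : Bool} (f : D.one.Arr ι b),
    two.arr (D.idc.arr f) = D'.idc.arr (one.arr f)
  two_vcomp : ∀ {ι : Type} [Finite ι] {b : Bool} (θ η : D.two.Arr ι b) (h h'),
    two.arr (D.vcomp θ η h) = D'.vcomp (two.arr θ) (two.arr η) h'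

namespace CoSub2.Functor

variable {D : CoSub2.{u, v, w}} {D' : CoSub2.{u₂, v₂, w₂}} (F : D.Functor D')

section

variable {ι : Type} [Finite ι] {Γ : ι → D.Obj} {Δ : ι → D'.Obj} {E E' : Type}

/-- The map of elements. -/
def mapElt (h : ∀ i, Δ i = F.obj (Γ i)) (x : D.Elt Γ) : D'.Elt Δ :=
  ⟨F.one.arr x.1, fun i => by rw [F.one.src_arr, x.2, h]⟩

/-- The map of cliques. -/
def mapClique (h : ∀ i, Δ i = F.obj (Γ i)) (c : D.Clique Γ E) : D'.Clique Δ E where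
  obj e := F.mapElt h (c.obj e)
  iso e e' := F.two.arr (c.iso e e')
  dom_iso e e' := (F.dom_two _).trans (congrArg F.one.arr (c.dom_iso e e'))
  cod_iso e e' := (F.cod_two _).trans (congrArg F.one.arr (c.cod_iso e e'))
  iso_self e := (congrArg F.two.arr (c.iso_self e)).trans (F.two_idc _)
  iso_trans e e' e'' := (F.two_vcomp _ _ _ _).symm.trans (congrArg F.two.arr (c.iso_trans e e' e''))

theorem mapClique_join (h : ∀ i, Δ i = F.obj (Γ i)) (c : D.Clique Γ E) (a : E) (d : D.Clique Γ E')
    (b : E') (k k') :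
    F.mapClique h (c.join a d b k) = (F.mapClique h c).join a (F.mapClique h d) b k' := by
  refine Clique.eq_join _ _ _ _ _ ?_ ?_ ?_
  · exact Clique.ext_of_forall (by intro _; rfl) (by
      intro _ _; exact congrArg F.two.arr (Clique.join_iso_inl c a d b k _ _))
  · exact Clique.ext_of_forall (by intro _; rfl) (by
      intro _ _; exact congrArg F.two.arr (Clique.join_iso_inr c a d b k _ _))
  · exact (congrArg F.two.arr (Clique.join_iso_inr_inl c a d b k)).trans (F.two_idc _)

/-- The map of fibres of `Ω_fpd`. -/
def mapFib (h : ∀ i, Δ i = F.obj (Γ i)) : PolyMap (D.fpdFib Γ) (D'.fpdFib Δ) where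
  obj x := F.mapElt h x
  arr c := F.mapClique h c
  src_arr _ _ := rfl
  tgt_arr _ _ := rfl

theorem mapFib_isStarFunctor (h : ∀ i, Δ i = F.obj (Γ i)) :
    IsStarFunctor (D.fpd.starFib Γ) (D'.fpd.starFib Δ) (F.mapFib h) where
  isFunctor :=
    { perm := fun _ _ _ => rfl
      one := fun A => Clique.ext_of_forall (fun _ => rfl) (fun _ _ => F.two_idc _)
      comp := fun g k f j h' h'' =>
        Clique.reindex_congr (fun _ => rfl) (F.mapClique_join h _ _ _ _ h' h'') }
  dual _ := rfl
  sact _ _ := rfl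

end

section

variable {ι κ : Type} [Finite ι] [Finite κ] {Γ : ι → D.Obj} {Δ : ι → D'.Obj} {Γ' : κ → D.Obj}
  {Δ' : κ → D'.Obj} {E : Type} (h : ∀ i, Δ i = F.obj (Γ i)) (h' : ∀ i, Δ' i = F.obj (Γ' i))

theorem mapElt_act (σ : ι ≃ κ) (k k') (x : D.Elt Γ) :
    F.mapElt h' (x.act σ k) = (F.mapElt h x).act σ k' :=
  Subtype.ext (F.one.arr_act _ _)

theorem mapClique_act (σ : ι ≃ κ) (k k') (x : D.Clique Γ E) :
    F.mapClique h' (x.act σ k) = (F.mapClique h x).act σ k' :=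
  Clique.ext_of_forall (fun _ => F.mapElt_act h h' σ k k' _) (fun _ _ => F.two.arr_act _ _)

theorem mapElt_sub (p : ι) (r : D.one.Arr κ true) (k k') (h'') (x : D.Elt Γ) :
    F.mapElt h'' (x.sub p r k) = (F.mapElt h x).sub p (F.one.arr r) k' :=
  Subtype.ext (F.one.arr_comp _ _ _ _ _)

theorem mapClique_sub (p : ι) (r : D.one.Arr κ true) (k k') (h'') (x : D.Clique Γ E) :
    F.mapClique h'' (x.sub p r k) = (F.mapClique h x).sub p (F.one.arr r) k' :=
  Clique.ext_of_forall (fun _ => F.mapElt_sub h p r k k' h'' _) (fun e e' => by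
    have k₁ := Clique.sub_src p r k x e e'
    have k₂ := Clique.sub_src p (F.one.arr r) k' (F.mapClique h x) e e'
    refine (F.two.arr_comp _ _ _ k₁ ?_).trans (D'.two.comp_congr rfl _ (F.two_idc r) _ k₂)
    rw [F.two_idc]
    exact k₂)

end

/-- The induced maps of values of `Ω_fpd`. -/
def ctxMap : CtxMap F.one.multicat D.fpd.toPolyPshData D'.fpd.toPolyPshData
    (PEmpty.elim : PEmpty.{1} → D.Obj) (PEmpty.elim : PEmpty.{1} → D'.Obj) where
  map Φ Ψ h := F.mapFib (Γ := Sum.elim PEmpty.elim Φ) (Δ := Sum.elim PEmpty.elim Ψ)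
    (by rintro (i | i); exacts [i.elim, h i])
  map_act_obj σ Φ Φ' Ψ Ψ' h h' hσ hσ' x := F.mapElt_act (Γ := Sum.elim PEmpty.elim Φ)
    (Δ := Sum.elim PEmpty.elim Ψ) (Γ' := Sum.elim PEmpty.elim Φ') (Δ' := Sum.elim PEmpty.elim Ψ')
    (by rintro (i | i); exacts [i.elim, h i]) (by rintro (i | i); exacts [i.elim, h' i]) _
    (by rintro (i | i); exacts [i.elim, hσ i]) (by rintro (i | i); exacts [i.elim, hσ' i]) x
  map_act_arr σ Φ Φ' Ψ Ψ' h h' hσ hσ' x := F.mapClique_act (Γ := Sum.elim PEmpty.elim Φ)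
    (Δ := Sum.elim PEmpty.elim Ψ) (Γ' := Sum.elim PEmpty.elim Φ') (Δ' := Sum.elim PEmpty.elim Ψ')
    (by rintro (i | i); exacts [i.elim, h i]) (by rintro (i | i); exacts [i.elim, h' i]) _
    (by rintro (i | i); exacts [i.elim, hσ i]) (by rintro (i | i); exacts [i.elim, hσ' i]) x
  map_plug_obj {E Z₁ Z _ _ _ a} w r Φ Φ' Ψ Ψ' h h' h₁ h₂ h₃ h₁' h₂' h₃' x := by
    have k : ∀ i, D'.one.multicat.subCtx (Sum.elim PEmpty.elim Ψ) (Sum.inr a) (F.one.arr r) i =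
        F.obj (D.one.multicat.subCtx (Sum.elim PEmpty.elim Φ) (Sum.inr a) r i) := by
      rintro (⟨i | i, hi⟩ | i)
      exacts [i.elim, h i, F.one.src_arr r i]
    have kh : ∀ i, Sum.elim PEmpty.elim Ψ i = F.obj (Sum.elim PEmpty.elim Φ i) := by
      rintro (i | i)
      exacts [i.elim, h i]
    refine (F.mapElt_act (Γ := D.one.multicat.subCtx (Sum.elim PEmpty.elim Φ) (Sum.inr a) r)
      (Γ' := Sum.elim PEmpty.elim Φ') k (by rintro (i | i); exacts [i.elim, h' i]) (plugInr w) (by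
        rintro (⟨i | i, hi⟩ | i)
        exacts [i.elim, h₂ _, h₃ _]) (by
      rintro (⟨i | i, hi⟩ | i)
      exacts [i.elim, h₂' _, h₃' _]) _).trans ?_
    exact congrArg (Elt.act (plugInr w) _) (F.mapElt_sub (Γ := Sum.elim PEmpty.elim Φ) kh (Sum.inr a) r h₁ h₁' k x)
  map_plug_arr {E Z₁ Z m n _ _ _ _ _ a} w r Φ Φ' Ψ Ψ' h h' h₁ h₂ h₃ h₁' h₂' h₃' x := by
    have k : ∀ i, D'.one.multicat.subCtx (Sum.elim PEmpty.elim Ψ) (Sum.inr a) (F.one.arr r) i =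
        F.obj (D.one.multicat.subCtx (Sum.elim PEmpty.elim Φ) (Sum.inr a) r i) := by
      rintro (⟨i | i, hi⟩ | i)
      exacts [i.elim, h i, F.one.src_arr r i]
    have kh : ∀ i, Sum.elim PEmpty.elim Ψ i = F.obj (Sum.elim PEmpty.elim Φ i) := by
      rintro (i | i)
      exacts [i.elim, h i]
    refine (F.mapClique_act (Γ := D.one.multicat.subCtx (Sum.elim PEmpty.elim Φ) (Sum.inr a) r)
      (Γ' := Sum.elim PEmpty.elim Φ') k (by rintro (i | i); exacts [i.elim, h' i]) (plugInr w) (by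
        rintro (⟨i | i, hi⟩ | i)
        exacts [i.elim, h₂ _, h₃ _]) (by
      rintro (⟨i | i, hi⟩ | i)
      exacts [i.elim, h₂' _, h₃' _]) _).trans ?_
    exact congrArg (Clique.act (plugInr w) _) (F.mapClique_sub
      (Γ := Sum.elim PEmpty.elim Φ) kh (Sum.inr a) r h₁ h₁' k x)

/-- The induced functor `Chu₀(D) ⟶ Chu₀(D')`. -/
noncomputable def chu : PolyMap D.chu₀.toPolyData D'.chu₀.toPolyData :=
  F.ctxMap.adj D.fpd_objs_isPsh D'.fpd_objs_isPsh

theorem chu_isStarFunctor : IsStarFunctor D.chu₀ D'.chu₀ F.chu :=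
  F.ctxMap.adj_isStarFunctor D.fpd_isStarPsh D'.fpd_isStarPsh (fun Φ Ψ h =>
    F.mapFib_isStarFunctor (Γ := Sum.elim PEmpty.elim Φ) (Δ := Sum.elim PEmpty.elim Ψ)
      (by rintro (i | i); exacts [i.elim, h i]))

end CoSub2.Functor

namespace CoSub

variable {O : Type u} {X : CoSub.{u, v} O} {ι κ : Type} [Finite ι] [Finite κ] {b : Bool}

theorem step_id (x : X.Arr κ b) (p : κ) (u : X.Arr Unit true) (hu : u = X.one (X.src x p)) :
    X.step x p u = x := by
  subst hu
  rw [step_pos (by rw [X.tgt_one]), X.comp_one, X.act_act]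
  exact X.act_self (fun i => (plugUnit p).apply_symm_apply i) _

theorem substOn_id (S : Finset κ) (x : X.Arr κ b) (u : κ → X.Arr Unit true)
    (hu : ∀ p, u p = X.one (X.src x p)) : X.substOn S x u = x := by
  induction S using Finset.cons_induction with
  | empty => rfl
  | cons p S hp ih => rw [substOn_cons, ih, step_id _ _ _ (hu p)]

theorem post_id (v : Cod (X.Arr Unit true) b) (f : X.Arr κ b) (hv : v = Cod.map X.one (X.tgt f)) :
    X.post v f = f := by
  subst hv
  cases b with
  | false => rfl
  | true =>
    have h : X.src (X.one (X.tgt f)) () = X.tgt f := X.src_one _ _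
    refine (post_pos (v := X.one (X.tgt f)) h).trans ?_
    rw [X.one_comp, X.act_act]
    exact X.act_self (fun i => unitPlug.apply_symm_apply i) _

end CoSub

namespace CoSub2

open CoSub

variable {D : CoSub2.{u, v, w}} {ι κ : Type} [Finite ι] [Finite κ] {b : Bool}

/-- The vertical identity square of an arrow. -/
noncomputable def Square.vone (f : D.one.Arr ι b) : D.Square ι b where
  top := f
  bot := f
  left i := D.one.one (D.one.src f i)
  right := Cod.map D.one.one (D.one.tgt f)
  src_left _ := D.one.src_one _ _
  tgt_left _ := D.one.tgt_one _
  src_right := by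
    cases b
    exacts [rfl, D.one.src_one _ _]
  tgt_right := by
    cases b
    exacts [rfl, D.one.tgt_one _]
  cell := D.idc.arr f
  dom_cell := by rw [D.dom_idc, post_id _ _ rfl]
  cod_cell := by rw [D.cod_idc]; exact (substOn_id _ _ _ fun _ => rfl).symm

theorem idc_comp_idc (g : D.one.Arr κ b) (q : κ) (f : D.one.Arr ι true) (h h') :
    D.two.comp (D.idc.arr g) q (D.idc.arr f) h = D.idc.arr (D.one.comp g q f h') :=
  (D.idc.arr_comp _ _ _ _ _).symm

theorem Square.vone_comp (g : D.one.Arr κ b) (q : κ) (f : D.one.Arr ι true) (h h') :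
    vone (D.one.comp g q f h) = (vone g).comp q (vone f) h' := by
  refine ext' rfl rfl ?_ ?_ ?_
  · rintro (i | i)
    · exact congrArg D.one.one (D.one.src_comp_inl _ _ _ _ _)
    · exact congrArg D.one.one (D.one.src_comp_inr _ _ _ _ _)
  · exact congrArg (Cod.map D.one.one) (D.one.tgt_comp _ _ _ _)
  · have e : D.one.substNe q g (fun i => D.one.one (D.one.src g i)) = g :=
      substOn_id _ _ _ fun _ => rfl
    have hgf : D.two.src (D.idc.arr g) q = D.two.tgt (D.idc.arr f) := by
      rw [D.idc.src_arr, D.idc.tgt_arr, h]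
    have k : D.cod.arr (D.idc.arr (D.one.comp g q f h)) =
        D.dom.arr (D.idc.arr (D.one.comp g q f h)) := by rw [D.cod_idc, D.dom_idc]
    refine (D.id_vcomp _ _ k).symm.trans (D.vcomp_congr (idc_comp_idc g q f hgf h).symm ?_ _ _)
    exact (idc_comp_idc g q f hgf h).symm.trans
      (D.two.comp_congr (congrArg D.idc.arr e.symm) q rfl _ _)

/-- The vertical identity cylinder of a 2-cell. -/
noncomputable def Cyl.vone (θ : D.two.Arr ι b) : D.Cyl ι b where
  fst := Square.vone (D.dom.arr θ)
  snd := Square.vone (D.cod.arr θ)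
  left_eq := by
    funext i
    exact congrArg D.one.one ((D.dom.src_arr θ i).trans (D.cod.src_arr θ i).symm)
  right_eq := congrArg (Cod.map D.one.one) ((D.dom.tgt_arr θ).trans (D.cod.tgt_arr θ).symm)
  up := θ
  down := θ
  dom_up := rfl
  cod_up := rfl
  dom_down := rfl
  cod_down := rfl
  comm := by
    have e₁ : D.two.substAll θ (fun i => D.idc.arr (D.one.one (D.one.src (D.dom.arr θ) i))) = θ :=
      substOn_id _ _ _ fun i => by rw [D.idc.arr_one, D.dom.src_arr]
    have e₂ : D.two.post (Cod.map D.idc.arr (Cod.map D.one.one (D.one.tgt (D.dom.arr θ)))) θ = θ :=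
      post_id _ _ (by
        rw [D.dom.tgt_arr]
        cases b
        exacts [rfl, D.idc.arr_one _])
    refine (D.vcomp_congr rfl e₁ _ (D.cod_idc _)).trans (.trans ?_
      (D.vcomp_congr e₂ rfl _ (D.dom_idc _).symm).symm)
    exact (D.id_vcomp _ _ _).trans (D.vcomp_id _ _ _).symm

variable (D)

/-- The functor of sources of the internal category of quintets. -/
noncomputable def quintetsSource : D.quintets.Functor D where
  obj u := D.one.src u ()
  one :=
    { arr := Square.top
      src_arr := fun x i => (Square.src_left x i).symm
      tgt_arr := fun x => (Square.src_right x).symm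
      arr_act := fun _ _ => rfl
      arr_one := fun _ => rfl
      arr_comp := fun _ _ _ _ _ => rfl }
  two :=
    { arr := Cyl.up
      src_arr := fun x i => (Cyl.src_up x i).trans (Square.src_left _ i).symm
      tgt_arr := fun x => (Cyl.tgt_up x).trans (Square.src_right _).symm
      arr_act := fun _ _ => rfl
      arr_one := fun u => D.idc.arr_one _
      arr_comp := fun _ _ _ _ _ => rfl }
  dom_two := Cyl.dom_up
  cod_two := Cyl.cod_up
  two_idc _ := rfl
  two_vcomp _ _ _ _ := rfl

/-- The functor of targets of the internal category of quintets. -/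
noncomputable def quintetsTarget : D.quintets.Functor D where
  obj u := D.one.tgt (b := true) u
  one :=
    { arr := Square.bot
      src_arr := fun x i => (Square.tgt_left x i).symm
      tgt_arr := fun x => (Square.tgt_right x).symm
      arr_act := fun _ _ => rfl
      arr_one := fun _ => rfl
      arr_comp := fun _ _ _ _ _ => rfl }
  two :=
    { arr := Cyl.down
      src_arr := fun x i => (Cyl.src_down x i).trans (Square.tgt_left _ i).symm
      tgt_arr := fun x => (Cyl.tgt_down x).trans (Square.tgt_right _).symm
      arr_act := fun _ _ => rfl
      arr_one := fun u => D.idc.arr_one _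
      arr_comp := fun _ _ _ _ _ => rfl }
  dom_two := Cyl.dom_down
  cod_two := Cyl.cod_down
  two_idc _ := rfl
  two_vcomp _ _ _ _ := rfl

theorem Square.vone_act (σ : ι ≃ κ) (f : D.one.Arr ι b) :
    vone (D.one.act σ f) = (vone f).act σ :=
  ext' rfl rfl (fun i => congrArg D.one.one (D.one.src_act' σ f i))
    (congrArg (Cod.map D.one.one) (D.one.tgt_act σ f)) (D.idc.arr_act σ f)

theorem Square.vone_one (A : D.Obj) : vone (D.one.one A) = Square.one (D.one.one A) :=
  ext' (congrArg D.one.one (D.one.src_one A ()).symm) (congrArg D.one.one (D.one.tgt_one A).symm)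
    (fun i => congrArg D.one.one (D.one.src_one A _)) (congrArg D.one.one (D.one.tgt_one A)) rfl

theorem Cyl.vone_comp (θ : D.two.Arr κ b) (q : κ) (η : D.two.Arr ι true) (h)
    (h' : (vone θ).fst.left q = (vone η).fst.right) :
    vone (D.two.comp θ q η h) = (vone θ).comp q (vone η) h' := by
  have h₁ : D.one.src (D.dom.arr θ) q = D.one.tgt (D.dom.arr η) := by
    rw [D.dom.src_arr, D.dom.tgt_arr, h]
  have h₂ : D.one.src (D.cod.arr θ) q = D.one.tgt (D.cod.arr η) := by
    rw [D.cod.src_arr, D.cod.tgt_arr, h]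
  exact Cyl.ext' ((congrArg Square.vone (D.dom_comp θ q η h h₁)).trans
      (Square.vone_comp _ q _ h₁ h'))
    ((congrArg Square.vone (D.cod_comp θ q η h h₂)).trans
      (Square.vone_comp _ q _ h₂ (Cyl.comp_snd (vone θ) q (vone η) h'))) rfl rfl

theorem Cyl.vone_vcomp (θ η : D.two.Arr ι b) (h) (h' : (vone θ).snd = (vone η).fst) :
    vone (D.vcomp θ η h) = (vone θ).vcomp (vone η) h' :=
  Cyl.ext' (congrArg Square.vone (D.dom_vcomp θ η h))
    (congrArg Square.vone (D.cod_vcomp θ η h)) rfl rfl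

/-- The functor of identities of the internal category of quintets. -/
noncomputable def quintetsId : D.Functor D.quintets where
  obj A := D.one.one A
  one :=
    { arr := Square.vone
      src_arr := fun _ _ => rfl
      tgt_arr := fun _ => rfl
      arr_act := fun σ f => Square.vone_act D σ f
      arr_one := fun A => Square.vone_one D A
      arr_comp := fun g q f h h' => Square.vone_comp g q f h h' }
  two :=
    { arr := Cyl.vone
      src_arr := fun θ i => congrArg D.one.one (D.dom.src_arr θ i)
      tgt_arr := fun θ => congrArg (Cod.map D.one.one) (D.dom.tgt_arr θ)
      arr_act := fun σ θ => Cyl.ext'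
        ((congrArg Square.vone (D.dom.arr_act σ θ)).trans (Square.vone_act D σ _))
        ((congrArg Square.vone (D.cod.arr_act σ θ)).trans (Square.vone_act D σ _)) rfl rfl
      arr_one := fun A => Cyl.ext'
        ((congrArg Square.vone (D.dom.arr_one A)).trans (Square.vone_one D A))
        ((congrArg Square.vone (D.cod.arr_one A)).trans (Square.vone_one D A))
        ((D.idc.arr_one A).symm.trans (congrArg (fun B => D.idc.arr (D.one.one B)) (D.one.src_one A ()).symm))
        ((D.idc.arr_one A).symm.trans (congrArg (fun B => D.idc.arr (D.one.one B)) (D.one.tgt_one A).symm))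
      arr_comp := fun θ q η h h' => Cyl.vone_comp D θ q η h h' }
  dom_two _ := rfl
  cod_two _ := rfl
  two_idc f := Cyl.ext' (congrArg Square.vone (D.dom_idc f)) (congrArg Square.vone (D.cod_idc f)) rfl rfl
  two_vcomp θ η h h' := Cyl.vone_vcomp D θ η h h'

end CoSub2

namespace CoSub

variable {O : Type u} {X : CoSub.{u, v} O} {ι κ : Type} [Finite ι] [Finite κ] {b : Bool}

/-- The composite of vertical arrows, or of absent vertical arrows. -/
noncomputable def postCod (X : CoSub.{u, v} O) : {b : Bool} → Cod (X.Arr Unit true) b →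
    Cod (X.Arr Unit true) b → Cod (X.Arr Unit true) b
  | true, v, u => X.post (b := true) v u
  | false, _, _ => PUnit.unit

theorem post_step (v : Cod (X.Arr Unit true) b) (x : X.Arr κ b) (p : κ) (u : X.Arr Unit true) :
    X.post v (X.step x p u) = X.step (X.post v x) p u := by
  by_cases h : X.src x p = X.tgt u
  · have h' : X.src (X.post v x) p = X.tgt u := by rw [src_post, h]
    rw [step_pos h, step_pos h', post_act, post_comp _ _ _ _ _ h']
  · rw [step_neg h, step_neg (by rwa [src_post])]

theorem post_substOn (v : Cod (X.Arr Unit true) b) (S : Finset κ) (x : X.Arr κ b)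
    (u : κ → X.Arr Unit true) : X.post v (X.substOn S x u) = X.substOn S (X.post v x) u := by
  induction S using Finset.cons_induction with
  | empty => rfl
  | cons p S hp ih => rw [substOn_cons, substOn_cons, post_step, ih]

theorem post_substAll (v : Cod (X.Arr Unit true) b) (x : X.Arr κ b) (u : κ → X.Arr Unit true) :
    X.post v (X.substAll x u) = X.substAll (X.post v x) u := post_substOn _ _ _ _

theorem post_substNe (v : Cod (X.Arr Unit true) b) (q : κ) (x : X.Arr κ b)
    (u : κ → X.Arr Unit true) : X.post v (X.substNe q x u) = X.substNe q (X.post v x) u :=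
  post_substOn _ _ _ _

theorem post_post (v u : Cod (X.Arr Unit true) b) (f : X.Arr κ b)
    (hv : Cod.map (fun k => X.src k ()) v = Cod.map X.tgt u)
    (hu : Cod.map (fun k => X.src k ()) u = X.tgt f) :
    X.post v (X.post u f) = X.post (X.postCod v u) f := by
  cases b with
  | false => rfl
  | true =>
    have hv' : X.src v () = X.tgt (b := true) u := hv
    have hu' : X.src u () = X.tgt f := hu
    have h : X.src (X.post (b := true) v u) () = X.tgt f := by rw [src_post, hu']
    rw [post_pos hu', post_act, post_comp _ _ _ _ _ h]
    exact (post_pos h).symm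

theorem step_step (x : X.Arr κ b) (p : κ) (u v : X.Arr Unit true) (hu : X.src x p = X.tgt u)
    (hv : X.src u () = X.tgt v) :
    X.step (X.step x p u) p v = X.step x p (X.post (b := true) u v) := by
  have h₁ : X.src (X.step x p u) p = X.tgt v := by rw [src_step_self hu, hv]
  have h₂ : X.src x p = X.tgt (X.post (b := true) u v) := by rw [tgt_post hv, hu]
  rw [step_pos h₁, step_pos h₂, comp_step _ _ _ _ hu hv h₁ h₂]

theorem substOn_step (S : Finset κ) (x : X.Arr κ b) (u : κ → X.Arr Unit true) {p : κ} (hp : p ∉ S)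
    (v : X.Arr Unit true) : X.substOn S (X.step x p v) u = X.step (X.substOn S x u) p v := by
  induction S using Finset.cons_induction with
  | empty => rfl
  | cons q S hq ih =>
    rw [Finset.mem_cons, not_or] at hp
    rw [substOn_cons, substOn_cons, ih hp.2]
    exact step_comm _ hp.1 _ _

theorem substOn_substOn (S : Finset κ) (x : X.Arr κ b) (u v : κ → X.Arr Unit true)
    (hu : ∀ p, X.src x p = X.tgt (u p)) (hv : ∀ p, X.src (u p) () = X.tgt (v p)) :
    X.substOn S (X.substOn S x u) v = X.substOn S x fun p => X.post (b := true) (u p) (v p) := by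
  induction S using Finset.cons_induction with
  | empty => rfl
  | cons p S hp ih =>
    rw [substOn_cons hp x u, substOn_cons hp, substOn_step _ _ _ hp, ih, substOn_cons hp]
    refine step_step _ _ _ _ ?_ (hv p)
    rw [src_substOn_of_notMem _ _ _ hp, hu p]

theorem substAll_substAll (x : X.Arr κ b) (u v : κ → X.Arr Unit true)
    (hu : ∀ p, X.src x p = X.tgt (u p)) (hv : ∀ p, X.src (u p) () = X.tgt (v p)) :
    X.substAll (X.substAll x u) v = X.substAll x fun p => X.post (b := true) (u p) (v p) :=
  substOn_substOn _ _ _ _ hu hv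

theorem substNe_substNe (q : κ) (x : X.Arr κ b) (u v : κ → X.Arr Unit true)
    (hu : ∀ p, X.src x p = X.tgt (u p)) (hv : ∀ p, X.src (u p) () = X.tgt (v p)) :
    X.substNe q (X.substNe q x u) v = X.substNe q x fun p => X.post (b := true) (u p) (v p) :=
  substOn_substOn _ _ _ _ hu hv

theorem substNe_substAll (q : κ) (x : X.Arr κ b) (u v : κ → X.Arr Unit true)
    (hu : ∀ p, X.src x p = X.tgt (u p)) (hv : ∀ p, X.src (u p) () = X.tgt (v p)) :
    X.substNe q (X.substAll x u) v =
      X.step (X.substNe q x fun p => X.post (b := true) (u p) (v p)) q (u q) := by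
  rw [substAll_eq_step q]
  refine (substOn_step _ _ _ (by simp) _).trans ?_
  rw [← substNe_substNe q x u v hu hv]
  rfl

theorem substAll_unit (v : X.Arr Unit true) (u : Unit → X.Arr Unit true) (h : X.src v () = X.tgt (u ())) :
    X.substAll v u = X.post (b := true) v (u ()) := by
  rw [substAll_eq_step (), substNe_unit, step_pos h, post_pos h]
  refine X.act_congr ?_ rfl
  rintro (⟨_, x⟩ | i)
  exacts [(x rfl).elim, rfl]

theorem Hom.map_postCod {Y : CoSub.{u, w} O} (F : X.Hom Y) (v u : Cod (X.Arr Unit true) b) :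
    Cod.map F.arr (X.postCod v u) = Y.postCod (Cod.map F.arr v) (Cod.map F.arr u) := by
  cases b with
  | false => rfl
  | true => exact F.arr_post (b := true) v u

end CoSub

namespace CoSub2

open CoSub

variable {D : CoSub2.{u, v, w}} {ι κ μ : Type} [Finite ι] [Finite κ] [Finite μ] {b : Bool}

theorem vcomp_middle {a p p' q q' d : D.two.Arr ι b} (h₁ : D.cod.arr a = D.dom.arr p)
    (h₂ : D.cod.arr q = D.dom.arr d) (h₃ : D.cod.arr p = D.dom.arr q)
    (h₁' : D.cod.arr a = D.dom.arr p') (h₂' : D.cod.arr q' = D.dom.arr d)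
    (h₃' : D.cod.arr p' = D.dom.arr q') (e : D.vcomp p q h₃ = D.vcomp p' q' h₃') (k k') :
    D.vcomp (D.vcomp a p h₁) (D.vcomp q d h₂) k = D.vcomp (D.vcomp a p' h₁') (D.vcomp q' d h₂') k' := by
  have aux : ∀ {p q : D.two.Arr ι b} (h₁ : D.cod.arr a = D.dom.arr p)
      (h₂ : D.cod.arr q = D.dom.arr d) (h₃ : D.cod.arr p = D.dom.arr q) (k),
      D.vcomp (D.vcomp a p h₁) (D.vcomp q d h₂) k =
        D.vcomp a (D.vcomp (D.vcomp p q h₃) d (by rw [D.cod_vcomp, h₂]))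
          (by rw [D.dom_vcomp, D.dom_vcomp, h₁]) := by
    intro p q h₁ h₂ h₃ k
    rw [D.vcomp_assoc a p _ h₁ k (by rw [D.dom_vcomp, h₃]) (by rw [D.dom_vcomp, h₁])]
    exact D.vcomp_congr rfl (D.vcomp_assoc p q d h₃ _ h₂ _).symm _ _
  refine (aux h₁ h₂ h₃ k).trans (.trans ?_ (aux h₁' h₂' h₃' k').symm)
  exact D.vcomp_congr rfl (D.vcomp_congr e rfl _ _) _ _

theorem vcomp_whisker_right_left (θ : D.two.Arr κ b) (q : κ) (η : D.two.Arr ι true)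
    (g : D.one.Arr κ b) (f : D.one.Arr ι true) (hg : g = D.dom.arr θ) (hf : f = D.cod.arr η)
    (h h₁ h₂ h₃) : D.vcomp (D.two.comp (D.idc.arr g) q η h₁) (D.two.comp θ q (D.idc.arr f) h₂) h₃ =
      D.two.comp θ q η h := by
  subst hg hf
  have k₁ : D.cod.arr (D.idc.arr (D.dom.arr θ)) = D.dom.arr θ := D.cod_idc _
  have k₂ : D.cod.arr η = D.dom.arr (D.idc.arr (D.cod.arr η)) := (D.dom_idc _).symm
  rw [← D.comp_vcomp _ _ q _ _ k₁ k₂ (by rw [D.src_vcomp, D.tgt_vcomp]; exact h₁)]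
  exact D.two.comp_congr (D.id_vcomp _ _ _) q (D.vcomp_id _ _ _) _ _

theorem vcomp_whisker_left_right (θ : D.two.Arr κ b) (q : κ) (η : D.two.Arr ι true)
    (g : D.one.Arr κ b) (f : D.one.Arr ι true) (hg : g = D.cod.arr θ) (hf : f = D.dom.arr η)
    (h h₁ h₂ h₃) : D.vcomp (D.two.comp θ q (D.idc.arr f) h₂) (D.two.comp (D.idc.arr g) q η h₁) h₃ =
      D.two.comp θ q η h := by
  subst hg hf
  have k₁ : D.cod.arr θ = D.dom.arr (D.idc.arr (D.cod.arr θ)) := (D.dom_idc _).symm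
  have k₂ : D.cod.arr (D.idc.arr (D.dom.arr η)) = D.dom.arr η := D.cod_idc _
  rw [← D.comp_vcomp _ _ q _ _ k₁ k₂ (by rw [D.src_vcomp, D.tgt_vcomp]; exact h₂)]
  exact D.two.comp_congr (D.vcomp_id _ _ _) q (D.id_vcomp _ _ _) _ _

theorem post_idc (v : Cod (D.one.Arr Unit true) b) (f : D.one.Arr κ b) :
    D.two.post (Cod.map D.idc.arr v) (D.idc.arr f) = D.idc.arr (D.one.post v f) :=
  (D.idc.arr_post _ _).symm

theorem substAll_idc (f : D.one.Arr κ b) (u : κ → D.one.Arr Unit true) :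
    D.two.substAll (D.idc.arr f) (fun i => D.idc.arr (u i)) = D.idc.arr (D.one.substAll f u) :=
  (D.idc.arr_substAll _ _).symm

theorem substNe_idc (q : κ) (f : D.one.Arr κ b) (u : κ → D.one.Arr Unit true) :
    D.two.substNe q (D.idc.arr f) (fun i => D.idc.arr (u i)) = D.idc.arr (D.one.substNe q f u) :=
  (D.idc.arr_substNe _ _ _).symm

theorem dom_post (v : Cod (D.one.Arr Unit true) b) (θ : D.two.Arr κ b) :
    D.dom.arr (D.two.post (Cod.map D.idc.arr v) θ) = D.one.post v (D.dom.arr θ) := by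
  rw [D.dom.arr_post, D.map_dom_idc]

theorem cod_post (v : Cod (D.one.Arr Unit true) b) (θ : D.two.Arr κ b) :
    D.cod.arr (D.two.post (Cod.map D.idc.arr v) θ) = D.one.post v (D.cod.arr θ) := by
  rw [D.cod.arr_post, D.map_cod_idc]

theorem dom_substAll (θ : D.two.Arr κ b) (u : κ → D.one.Arr Unit true) :
    D.dom.arr (D.two.substAll θ fun i => D.idc.arr (u i)) = D.one.substAll (D.dom.arr θ) u := by
  rw [D.dom.arr_substAll]; simp only [D.dom_idc]

theorem cod_substAll (θ : D.two.Arr κ b) (u : κ → D.one.Arr Unit true) :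
    D.cod.arr (D.two.substAll θ fun i => D.idc.arr (u i)) = D.one.substAll (D.cod.arr θ) u := by
  rw [D.cod.arr_substAll]; simp only [D.cod_idc]

theorem dom_substNe (q : κ) (θ : D.two.Arr κ b) (u : κ → D.one.Arr Unit true) :
    D.dom.arr (D.two.substNe q θ fun i => D.idc.arr (u i)) = D.one.substNe q (D.dom.arr θ) u := by
  rw [D.dom.arr_substNe]; simp only [D.dom_idc]

theorem cod_substNe (q : κ) (θ : D.two.Arr κ b) (u : κ → D.one.Arr Unit true) :
    D.cod.arr (D.two.substNe q θ fun i => D.idc.arr (u i)) = D.one.substNe q (D.cod.arr θ) u := by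
  rw [D.cod.arr_substNe]; simp only [D.cod_idc]

namespace Square

theorem left_composable {x y : D.Square ι b} (h : x.bot = y.top) (i : ι) :
    D.one.src (y.left i) () = D.one.tgt (x.left i) := by
  rw [y.src_left, x.tgt_left, h]

theorem right_composable {x y : D.Square ι b} (h : x.bot = y.top) :
    Cod.map (fun k => D.one.src k ()) y.right = Cod.map D.one.tgt x.right := by
  rw [y.src_right, x.tgt_right, h]

theorem stack_cells {x y : D.Square ι b} (h : x.bot = y.top) :
    D.cod.arr (D.two.post (Cod.map D.idc.arr y.right) x.cell) =
      D.dom.arr (D.two.substAll y.cell fun i => D.idc.arr (x.left i)) := by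
  rw [D.cod_post, D.dom_substAll, x.cod_cell, y.dom_cell, post_substAll, h]

/-- The vertical composite of the square `x` and the square `y` below it. -/
noncomputable def stack (x y : D.Square ι b) (h : x.bot = y.top) : D.Square ι b where
  top := x.top
  bot := y.bot
  left i := D.one.post (b := true) (y.left i) (x.left i)
  right := D.one.postCod y.right x.right
  src_left i := by rw [src_post, x.src_left]
  tgt_left i := by rw [tgt_post (left_composable h i), y.tgt_left]
  src_right := by
    cases b
    exacts [rfl, (src_post (b := true) ()).trans x.src_right]
  tgt_right := by
    cases b
    exacts [rfl, (tgt_post (right_composable h)).trans y.tgt_right]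
  cell := D.vcomp (D.two.post (Cod.map D.idc.arr y.right) x.cell)
    (D.two.substAll y.cell fun i => D.idc.arr (x.left i)) (stack_cells h)
  dom_cell := by
    rw [D.dom_vcomp, D.dom_post, x.dom_cell, post_post _ _ _ (right_composable h) x.src_right]
  cod_cell := by
    rw [D.cod_vcomp, D.cod_substAll, y.cod_cell,
      substAll_substAll _ _ _ (fun i => (y.tgt_left i).symm) (left_composable h)]

end Square

end CoSub2

namespace CoSub2

open CoSub

variable {D : CoSub2.{u, v, w}} {ι κ μ : Type} [Finite ι] [Finite κ] [Finite μ] {b : Bool}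

namespace Square

theorem stack_congr {x x' y y' : D.Square ι b} (hx : x = x') (hy : y = y') (h h') :
    x.stack y h = x'.stack y' h' := by
  subst hx hy; rfl

theorem stack_act (σ : ι ≃ κ) (x y : D.Square ι b) (h) (h') :
    (x.act σ).stack (y.act σ) h' = (x.stack y h).act σ := by
  refine ext' rfl rfl (fun _ => rfl) rfl ?_
  have e₁ : D.two.post (Cod.map D.idc.arr y.right) (D.two.act σ x.cell) =
      D.two.act σ (D.two.post (Cod.map D.idc.arr y.right) x.cell) := post_act _ _ _
  have e₂ : D.two.substAll (D.two.act σ y.cell) (fun i => D.idc.arr (x.left (σ.symm i))) =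
      D.two.act σ (D.two.substAll y.cell fun i => D.idc.arr (x.left i)) := by
    rw [← act_substAll]
    congr 2
    funext i
    exact congrArg (fun j => D.idc.arr (x.left j)) (σ.symm_apply_apply i)
  have k := stack_cells h
  refine (D.vcomp_congr e₁ e₂ _ (by rw [D.cod.arr_act, k, D.dom.arr_act])).trans ?_
  exact (D.act_vcomp σ _ _ k _).symm

theorem stack_one (u v : D.one.Arr Unit true) (h : D.one.src v () = D.one.tgt u) (h') :
    (one u).stack (one v) h' = one (D.one.post (b := true) v u) := by
  refine ext' ?_ ?_ (fun _ => rfl) rfl ?_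
  · exact congrArg D.one.one (src_post (b := true) ()).symm
  · exact congrArg D.one.one (tgt_post h).symm
  · have e₁ : D.two.post (b := true) (Cod.map D.idc.arr (one v).right) (D.idc.arr u) =
        D.idc.arr (D.one.post (b := true) v u) := D.post_idc (b := true) v u
    have e₂ : D.two.substAll (D.idc.arr v) (fun _ => D.idc.arr u) =
        D.idc.arr (D.one.post (b := true) v u) := by
      rw [← substAll_unit v (fun _ => u) h]
      exact D.substAll_idc v fun _ => u
    refine (D.vcomp_congr e₁ e₂ _ (by rw [D.cod_idc, D.dom_idc])).trans ?_
    exact D.id_vcomp _ _ _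

theorem stack_comp (x y : D.Square κ b) (q : κ) (x' y' : D.Square ι true) (hx : x.left q = x'.right)
    (hy : y.left q = y'.right) (h : x.bot = y.top) (h' : x'.bot = y'.top) (k) (k') :
    (x.comp q x' hx).stack (y.comp q y' hy) k = (x.stack y h).comp q (x'.stack y' h') k' := by
  refine ext' rfl rfl ?_ rfl ?_
  · rintro (i | i) <;> rfl
  have cx := x.comp_cells q x' hx
  have cy := y.comp_cells q y' hy
  have sx₁ := x.comp_cell₁ q x' hx
  have sx₂ := x.comp_cell₂ q x' hx
  have sy₁ := y.comp_cell₁ q y' hy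
  have sy₂ := y.comp_cell₂ q y' hy
  have kl := left_composable h q
  have kr := right_composable h'
  have kr' : D.one.src (b := true) y'.right () = D.one.tgt (b := true) x'.right := kr
  have bq : D.two.src y.cell q = D.one.src x.bot q := by rw [y.src_cell, h]
  have xq : D.one.src x.bot q = D.one.tgt x'.bot := comp_bot x q x' hx
  have yq : D.one.src y.bot q = D.one.tgt y'.bot := comp_bot y q y' hy
  have d₁ : D.two.src (D.two.post (Cod.map D.idc.arr y.right) x.cell) q =
      D.two.tgt (D.idc.arr x'.top) := by rw [src_post, sx₁]
  have d₂ : D.two.src (D.idc.arr (D.one.substNe q (D.one.post y.right y.top) x.left)) q =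
      D.two.tgt x'.cell := by
    rw [D.idc.src_arr, src_substNe_self, src_post, ← h, x'.tgt_cell, xq]
  have d₃ : D.two.src (D.two.substNe q y.cell fun i => D.idc.arr (x.left i)) q =
      D.two.tgt (D.idc.arr (D.one.substAll y'.top x'.left)) := by
    rw [src_substNe_self, D.idc.tgt_arr, tgt_substAll, bq, xq, h']
  have d₄ : D.two.src (D.idc.arr (D.one.substNe q (D.one.substNe q y.bot y.left) x.left)) q =
      D.two.tgt (D.two.substAll y'.cell fun i => D.idc.arr (x'.left i)) := by
    rw [D.idc.src_arr, src_substNe_self, src_substNe_self, tgt_substAll, y'.tgt_cell, yq]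
  have d : D.two.src (D.two.substNe q y.cell fun i => D.idc.arr (x.left i)) q =
      D.two.tgt x'.cell := by
    rw [src_substNe_self, bq, xq, x'.tgt_cell]
  have u₁ : D.two.src y.cell q = D.two.tgt (D.idc.arr (x.left q)) := by
    rw [D.idc.tgt_arr, bq, x.tgt_left]
  have u₂ : D.two.src (D.idc.arr (x.left q)) () = D.two.tgt (D.idc.arr x'.top) := by
    rw [D.idc.src_arr, D.idc.tgt_arr, x.src_left, comp_top x q x' hx]
  have f₂ : D.two.src (D.two.substAll y.cell fun i => D.idc.arr (x.left i)) q =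
      D.two.tgt (D.idc.arr x'.top) := by rw [src_substAll _ _ u₁, u₂]
  have b₂ : D.two.src (D.two.substNe q y.cell fun i => D.idc.arr (x.left i)) q =
      D.two.tgt (D.idc.arr (D.one.post (b := true) x'.right x'.top)) := by
    rw [D.idc.tgt_arr, ← x'.dom_cell, D.dom.tgt_arr, d]
  have N : D.one.substNe q (D.one.substNe q y.bot y.left) x.left =
      D.one.substNe q y.bot fun i => D.one.post (b := true) (y.left i) (x.left i) :=
    substNe_substNe q y.bot y.left x.left (fun i => (y.tgt_left i).symm) (left_composable h)
  have N' : D.cod.arr (D.two.substNe q y.cell fun i => D.idc.arr (x.left i)) =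
      D.one.step (D.one.substNe q y.bot fun i => D.one.post (b := true) (y.left i) (x.left i)) q
        (y.left q) := by
    rw [D.cod_substNe, y.cod_cell,
      substNe_substAll q y.bot y.left x.left (fun i => (y.tgt_left i).symm) (left_composable h)]
  have f₃ : D.two.src (D.idc.arr (D.one.substNe q y.bot fun i =>
      D.one.post (b := true) (y.left i) (x.left i))) q =
      D.two.tgt (D.two.post (b := true) (Cod.map D.idc.arr y'.right) x'.cell) := by
    rw [← D.dom.tgt_arr, D.dom_post, tgt_post, D.idc.src_arr, src_substNe_self, yq, ← y'.tgt_right]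
    · rfl
    · rw [D.dom.tgt_arr, x'.tgt_cell, kr']; exact x'.tgt_right
  have b₃ : D.two.src (D.idc.arr (D.cod.arr
      (D.two.substNe q y.cell fun i => D.idc.arr (x.left i)))) q = D.two.tgt x'.cell := by
    rw [D.idc.src_arr, D.cod.src_arr, d]
  have f₁ : D.two.src (D.vcomp (D.two.post (Cod.map D.idc.arr y.right) x.cell)
      (D.two.substAll y.cell fun i => D.idc.arr (x.left i)) (stack_cells h)) q =
      D.two.tgt (D.idc.arr x'.top) := by rw [D.src_vcomp, d₁]
  have l : ∀ i, (x.comp q x' hx).left i = Sum.elim (fun p : {p // p ≠ q} => x.left p.1) x'.left i :=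
    fun _ => rfl
  have e₁ : D.two.post (Cod.map D.idc.arr y.right) (D.two.comp x.cell q (D.idc.arr x'.top) sx₁) =
      D.two.comp (D.two.post (Cod.map D.idc.arr y.right) x.cell) q (D.idc.arr x'.top) d₁ :=
    post_comp _ _ _ _ _ _
  have e₂ : D.two.post (Cod.map D.idc.arr y.right)
      (D.two.comp (D.idc.arr (D.one.substNe q x.bot x.left)) q x'.cell sx₂) =
      D.two.comp (D.idc.arr (D.one.substNe q (D.one.post y.right y.top) x.left)) q x'.cell d₂ := by
    have e : D.two.post (Cod.map D.idc.arr y.right) (D.idc.arr (D.one.substNe q x.bot x.left)) =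
        D.idc.arr (D.one.substNe q (D.one.post y.right y.top) x.left) := by
      rw [D.post_idc, post_substNe, h]
    exact (post_comp _ _ _ _ _ (by rw [e]; exact d₂)).trans (D.two.comp_congr e q rfl _ _)
  have e₃ : D.two.substAll (D.two.comp y.cell q (D.idc.arr y'.top) sy₁)
      (fun i => D.idc.arr ((x.comp q x' hx).left i)) =
      D.two.comp (D.two.substNe q y.cell fun i => D.idc.arr (x.left i)) q
        (D.idc.arr (D.one.substAll y'.top x'.left)) d₃ :=
    (substAll_comp _ _ _ _ _ (fun i => D.idc.arr (x.left i)) (fun _ => rfl)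
      ((d₃.trans (congrArg D.two.tgt (D.substAll_idc y'.top x'.left).symm)))).trans
      (D.two.comp_congr rfl q (D.substAll_idc y'.top x'.left) _ _)
  have e₄ : D.two.substAll (D.two.comp (D.idc.arr (D.one.substNe q y.bot y.left)) q y'.cell sy₂)
      (fun i => D.idc.arr ((x.comp q x' hx).left i)) =
      D.two.comp (D.idc.arr (D.one.substNe q (D.one.substNe q y.bot y.left) x.left)) q
        (D.two.substAll y'.cell fun i => D.idc.arr (x'.left i)) d₄ := by
    have e := D.substNe_idc q (D.one.substNe q y.bot y.left) x.left
    exact (substAll_comp _ _ _ _ _ (fun i => D.idc.arr (x.left i)) (fun _ => rfl)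
      (by rw [e]; exact d₄)).trans (D.two.comp_congr e q rfl _ _)
  have c₁ : D.cod.arr (D.two.post (Cod.map D.idc.arr y.right)
      (D.two.comp x.cell q (D.idc.arr x'.top) sx₁)) =
      D.dom.arr (D.two.post (Cod.map D.idc.arr y.right)
        (D.two.comp (D.idc.arr (D.one.substNe q x.bot x.left)) q x'.cell sx₂)) := by
    rw [D.cod_post, D.dom_post, cx]
  have c₂ : D.cod.arr (D.two.substAll (D.two.comp y.cell q (D.idc.arr y'.top) sy₁)
      (fun i => D.idc.arr ((x.comp q x' hx).left i))) =
      D.dom.arr (D.two.substAll (D.two.comp (D.idc.arr (D.one.substNe q y.bot y.left)) q y'.cell sy₂)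
        (fun i => D.idc.arr ((x.comp q x' hx).left i))) := by
    rw [D.cod_substAll, D.dom_substAll, cy]
  have c₁' := (congrArg D.cod.arr e₁).symm.trans (c₁.trans (congrArg D.dom.arr e₂))
  have c₂' := (congrArg D.cod.arr e₃).symm.trans (c₂.trans (congrArg D.dom.arr e₄))
  have E₁ := (D.post_vcomp y.right _ _ cx c₁).trans (D.vcomp_congr e₁ e₂ c₁ c₁')
  have E₂ := (D.substOn_vcomp (Set.finite_univ (α := {p // p ≠ q} ⊕ ι)).toFinset _ _
    (x.comp q x' hx).left cy c₂).trans (D.vcomp_congr e₃ e₄ c₂ c₂')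
  have K := (congrArg D.cod.arr E₁).symm.trans ((stack_cells k).trans (congrArg D.dom.arr E₂))
  have g₁ : D.two.comp (D.two.substAll y.cell fun i => D.idc.arr (x.left i)) q
      (D.idc.arr x'.top) f₂ =
      D.two.comp (D.two.substNe q y.cell fun i => D.idc.arr (x.left i)) q
        (D.idc.arr (D.one.post (b := true) x'.right x'.top)) b₂ := by
    have s := substAll_eq_step q y.cell fun i => D.idc.arr (x.left i)
    have t : D.two.post (b := true) (D.idc.arr (x.left q)) (D.idc.arr x'.top) =
        D.idc.arr (D.one.post (b := true) x'.right x'.top) := by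
      rw [hx]; exact D.post_idc (b := true) x'.right x'.top
    refine (D.two.comp_congr s q rfl _ (by rw [← s]; exact f₂)).trans ?_
    refine (comp_step _ _ _ _ (by rw [src_substNe_self, u₁]) u₂ _ (by rw [t]; exact b₂)).trans ?_
    exact D.two.comp_congr rfl q t _ _
  have g₂ : D.two.comp (D.idc.arr (D.one.substNe q y.bot fun i =>
      D.one.post (b := true) (y.left i) (x.left i))) q
      (D.two.post (b := true) (Cod.map D.idc.arr y'.right) x'.cell) f₃ =
      D.two.comp (D.idc.arr (D.cod.arr (D.two.substNe q y.cell fun i => D.idc.arr (x.left i)))) q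
        x'.cell b₃ := by
    have s : D.idc.arr (D.cod.arr (D.two.substNe q y.cell fun i => D.idc.arr (x.left i))) =
        D.two.step (D.idc.arr (D.one.substNe q y.bot fun i =>
          D.one.post (b := true) (y.left i) (x.left i))) q (D.idc.arr (y.left q)) := by
      rw [N', D.idc.arr_step]
    have v₁ : D.two.src (D.idc.arr (D.one.substNe q y.bot fun i =>
        D.one.post (b := true) (y.left i) (x.left i))) q = D.two.tgt (D.idc.arr (y.left q)) := by
      rw [D.idc.src_arr, D.idc.tgt_arr, src_substNe_self, y.tgt_left]
    have v₂ : D.two.src (D.idc.arr (y.left q)) () = D.two.tgt x'.cell := by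
      rw [D.idc.src_arr, kl, x.tgt_left, x'.tgt_cell, xq]
    have t : D.two.post (b := true) (D.idc.arr (y.left q)) x'.cell =
        D.two.post (b := true) (Cod.map D.idc.arr y'.right) x'.cell := by rw [hy]; rfl
    refine Eq.symm ((D.two.comp_congr s q rfl _ (by rw [← s]; exact b₃)).trans ?_)
    refine (comp_step _ _ _ _ v₁ v₂ _ (by rw [t]; exact f₃)).trans ?_
    exact D.two.comp_congr rfl q t _ _
  have F₁ := D.comp_vcomp_left _ _ q x'.top (stack_cells h) f₁ d₁ f₂ (by
    rw [D.cod_comp _ _ _ _ (by rw [D.cod.src_arr, D.cod.tgt_arr, d₁]),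
      D.dom_comp _ _ _ _ (by rw [D.dom.src_arr, D.dom.tgt_arr, f₂])]
    exact D.one.comp_congr (stack_cells h) q (by rw [D.cod_idc, D.dom_idc]) _ _)
  have f₄ : D.two.src (D.idc.arr (D.one.substNe q y.bot fun i =>
      D.one.post (b := true) (y.left i) (x.left i))) q =
      D.two.tgt (D.two.substAll y'.cell fun i => D.idc.arr (x'.left i)) := by rw [← N]; exact d₄
  have f : D.two.src (D.idc.arr (D.one.substNe q y.bot fun i =>
      D.one.post (b := true) (y.left i) (x.left i))) q = D.two.tgt (x'.stack y' h').cell := by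
    rw [f₃]
    exact (D.tgt_vcomp _ _ (stack_cells h')).symm
  have F₂ := D.comp_vcomp_right (D.one.substNe q y.bot fun i =>
      D.one.post (b := true) (y.left i) (x.left i)) q _ _ (stack_cells h') f f₃ f₄ (by
    rw [D.cod_comp _ _ _ _ (by rw [D.cod.src_arr, D.cod.tgt_arr, f₃]),
      D.dom_comp _ _ _ _ (by rw [D.dom.src_arr, D.dom.tgt_arr, f₄])]
    exact D.one.comp_congr (by rw [D.cod_idc, D.dom_idc]) q (stack_cells h') _ _)
  have M₁ : D.cod.arr (D.two.comp (D.two.substAll y.cell fun i => D.idc.arr (x.left i)) q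
      (D.idc.arr x'.top) f₂) = D.dom.arr (D.two.comp (D.idc.arr (D.one.substNe q y.bot fun i =>
        D.one.post (b := true) (y.left i) (x.left i))) q
        (D.two.post (b := true) (Cod.map D.idc.arr y'.right) x'.cell) f₃) :=
    (D.cod_vcomp _ _ _).symm.trans ((congrArg D.cod.arr F₁).symm.trans
      (((x.stack y h).comp_cells q (x'.stack y' h') k').trans
        ((congrArg D.dom.arr F₂).trans (D.dom_vcomp _ _ _))))
  have M₂ : D.cod.arr (D.two.comp (D.idc.arr (D.one.substNe q (D.one.post y.right y.top) x.left)) q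
      x'.cell d₂) = D.dom.arr (D.two.comp (D.two.substNe q y.cell fun i => D.idc.arr (x.left i)) q
        (D.idc.arr (D.one.substAll y'.top x'.left)) d₃) :=
    (D.cod_vcomp _ _ c₁').symm.trans (K.trans (D.dom_vcomp _ _ c₂'))
  have M : D.vcomp _ _ M₂ = D.vcomp _ _ M₁ := by
    refine (D.vcomp_whisker_right_left _ q x'.cell _ _ ?_ ?_ d d₂ d₃ M₂).trans (.trans ?_
      (D.vcomp_congr g₁ g₂ M₁ ((congrArg D.cod.arr g₁).symm.trans
        (M₁.trans (congrArg D.dom.arr g₂)))).symm)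
    · rw [D.dom_substNe, y.dom_cell]
    · rw [x'.cod_cell, h']
    · exact (D.vcomp_whisker_left_right _ q x'.cell _ _ rfl x'.dom_cell.symm d b₃ b₂ _).symm
  refine (D.vcomp_congr E₁ E₂ _ K).trans (.trans ?_ (D.vcomp_congr F₁ F₂ _
    ((congrArg D.cod.arr F₁).symm.trans (((x.stack y h).comp_cells q (x'.stack y' h') k').trans
      (congrArg D.dom.arr F₂)))).symm)
  have e₄' : D.two.comp (D.idc.arr (D.one.substNe q (D.one.substNe q y.bot y.left) x.left)) q
      (D.two.substAll y'.cell fun i => D.idc.arr (x'.left i)) d₄ = D.two.comp (D.idc.arr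
        (D.one.substNe q y.bot fun i => D.one.post (b := true) (y.left i) (x.left i))) q
        (D.two.substAll y'.cell fun i => D.idc.arr (x'.left i)) f₄ :=
    D.two.comp_congr (congrArg D.idc.arr N) q rfl _ _
  have c₂'' := c₂'.trans (congrArg D.dom.arr e₄')
  refine (D.vcomp_congr rfl (D.vcomp_congr rfl e₄' c₂' c₂'') K
    (K.trans ((D.dom_vcomp _ _ c₂').trans (D.dom_vcomp _ _ c₂'').symm))).trans ?_
  exact D.vcomp_middle _ _ M₂ _ _ M₁ M _ _

theorem vone_stack (x : D.Square ι b) (h : (vone x.top).bot = x.top) :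
    (vone x.top).stack x h = x := by
  refine ext' rfl rfl (fun i => ?_) ?_ ?_
  · exact post_one _ _ (x.src_left i)
  · have k := x.src_right
    rcases b with _ | _
    · rfl
    · exact post_one _ _ k
  · have e₁ : D.two.post (Cod.map D.idc.arr x.right) (D.idc.arr x.top) =
        D.idc.arr (D.dom.arr x.cell) := by rw [D.post_idc, x.dom_cell]
    have e₂ : D.two.substAll x.cell (fun i => D.idc.arr (D.one.one (D.one.src x.top i))) = x.cell :=
      substOn_id _ _ _ fun i => by rw [D.idc.arr_one, x.src_cell]
    exact (D.vcomp_congr e₁ e₂ _ (D.cod_idc _)).trans (D.id_vcomp _ _ _)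

theorem stack_vone (x : D.Square ι b) (h : x.bot = (vone x.bot).top) :
    x.stack (vone x.bot) h = x := by
  refine ext' rfl rfl (fun i => ?_) ?_ ?_
  · refine post_id (b := true) _ _ ?_
    exact congrArg D.one.one (x.tgt_left i).symm
  · have k := x.tgt_right
    rcases b with _ | _
    · rfl
    · exact post_id (b := true) _ _ (congrArg D.one.one k.symm)
  · have e₁ : D.two.post (Cod.map D.idc.arr (Cod.map D.one.one (D.one.tgt x.bot))) x.cell =
        x.cell := post_id _ _ (by
      rw [x.tgt_cell]
      cases b
      exacts [rfl, D.idc.arr_one _])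
    have e₂ : D.two.substAll (D.idc.arr x.bot) (fun i => D.idc.arr (x.left i)) =
        D.idc.arr (D.cod.arr x.cell) := by rw [D.substAll_idc, x.cod_cell]
    exact (D.vcomp_congr e₁ e₂ _ (D.dom_idc _).symm).trans (D.vcomp_id _ _ _)

theorem stack_assoc (x y z : D.Square ι b) (h₁ : x.bot = y.top) (h₂ : y.bot = z.top) (h₃) (h₄) :
    (x.stack y h₁).stack z h₃ = x.stack (y.stack z h₂) h₄ := by
  have pl : ∀ i, D.one.post (b := true) (z.left i) (D.one.post (b := true) (y.left i) (x.left i)) =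
      D.one.post (b := true) (D.one.post (b := true) (z.left i) (y.left i)) (x.left i) := fun i =>
    post_post (b := true) (z.left i) (y.left i) (x.left i) (left_composable h₂ i)
      (left_composable h₁ i)
  have kr := right_composable h₁
  have kr' := right_composable h₂
  refine ext' rfl rfl pl ?_ ?_
  · rcases b with _ | _
    · rfl
    · exact post_post (b := true) z.right y.right x.right kr' kr
  · have t : Cod.map (fun k => D.two.src k ()) (Cod.map D.idc.arr z.right) =
        Cod.map D.two.tgt (Cod.map D.idc.arr y.right) := by
      rcases b with _ | _
      · rfl
      · exact (D.idc.src_arr (b := true) z.right ()).trans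
          (Eq.trans kr' (D.idc.tgt_arr (b := true) y.right).symm)
    have t' : Cod.map (fun k => D.two.src k ()) (Cod.map D.idc.arr y.right) = D.two.tgt x.cell := by
      rw [x.tgt_cell]
      rcases b with _ | _
      · rfl
      · exact (D.idc.src_arr (b := true) y.right ()).trans (Eq.trans y.src_right (by rw [h₁]))
    have e₁ : D.two.post (Cod.map D.idc.arr z.right) (D.two.post (Cod.map D.idc.arr y.right) x.cell) =
        D.two.post (Cod.map D.idc.arr (D.one.postCod z.right y.right)) x.cell := by
      rw [post_post _ _ _ t t', D.idc.map_postCod]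
    have e₂ : D.two.post (Cod.map D.idc.arr z.right)
        (D.two.substAll y.cell fun i => D.idc.arr (x.left i)) =
        D.two.substAll (D.two.post (Cod.map D.idc.arr z.right) y.cell)
          fun i => D.idc.arr (x.left i) := post_substAll _ _ _
    have e₃ : D.two.substAll z.cell
        (fun i => D.idc.arr (D.one.post (b := true) (y.left i) (x.left i))) =
        D.two.substAll (D.two.substAll z.cell fun i => D.idc.arr (y.left i))
          fun i => D.idc.arr (x.left i) := by
      rw [substAll_substAll z.cell _ _
        (fun i => by rw [z.src_cell, D.idc.tgt_arr, y.tgt_left, h₂])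
        (fun i => by rw [D.idc.src_arr, D.idc.tgt_arr, left_composable h₁ i])]
      exact congrArg _ (funext fun i => (D.post_idc (b := true) (y.left i) (x.left i)).symm)
    have a₁ := stack_cells h₁
    have a₂ := stack_cells h₂
    have c₁ : D.cod.arr (D.two.post (Cod.map D.idc.arr z.right)
        (D.two.post (Cod.map D.idc.arr y.right) x.cell)) =
        D.dom.arr (D.two.post (Cod.map D.idc.arr z.right)
          (D.two.substAll y.cell fun i => D.idc.arr (x.left i))) := by
      rw [D.cod_post, a₁, ← D.dom_post]
    have c₂ : D.cod.arr (D.two.substAll (D.two.post (Cod.map D.idc.arr z.right) y.cell)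
        fun i => D.idc.arr (x.left i)) =
        D.dom.arr (D.two.substAll (D.two.substAll z.cell fun i => D.idc.arr (y.left i))
          fun i => D.idc.arr (x.left i)) := by
      rw [D.cod_substAll, a₂, ← D.dom_substAll]
    have c₁' := (congrArg D.cod.arr e₁).symm.trans (c₁.trans (congrArg D.dom.arr e₂))
    have E₁ := (D.post_vcomp z.right _ _ a₁ c₁).trans (D.vcomp_congr e₁ e₂ c₁ c₁')
    have E₂ := D.substOn_vcomp (Set.finite_univ (α := ι)).toFinset _ _ x.left a₂ c₂
    refine (D.vcomp_congr E₁ e₃ _ (by rw [D.cod_vcomp]; exact c₂)).trans (.trans ?_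
      (D.vcomp_congr rfl E₂ _ (c₁'.trans (D.dom_vcomp _ _ c₂).symm)).symm)
    exact D.vcomp_assoc _ _ _ c₁' _ c₂ _

end Square

end CoSub2

namespace CoSub2

open CoSub

variable {D : CoSub2.{u, v, w}} {ι κ μ : Type} [Finite ι] [Finite κ] [Finite μ] {b : Bool}

namespace Cyl

theorem stack_fst {x y : D.Cyl ι b} (h : x.down = y.up) : x.fst.bot = y.fst.top := by
  rw [← x.dom_down, h, y.dom_up]

theorem stack_snd {x y : D.Cyl ι b} (h : x.down = y.up) : x.snd.bot = y.snd.top := by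
  rw [← x.cod_down, h, y.cod_up]

/-- The vertical composite of the cylinder `x` and the cylinder `y` below it. -/
noncomputable def stack (x y : D.Cyl ι b) (h : x.down = y.up) : D.Cyl ι b where
  fst := x.fst.stack y.fst (stack_fst h)
  snd := x.snd.stack y.snd (stack_snd h)
  left_eq := by
    funext i
    exact congrArg₂ (D.one.post (b := true)) (congrFun y.left_eq i) (congrFun x.left_eq i)
  right_eq := congrArg₂ D.one.postCod y.right_eq x.right_eq
  up := x.up
  down := y.down
  dom_up := x.dom_up
  cod_up := x.cod_up
  dom_down := y.dom_down
  cod_down := y.cod_down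
  comm := by
    have h₁ := stack_fst h
    have h₂ := stack_snd h
    have ax := Square.cyl_left x.dom_down
    have ax' := Square.cyl_right x.right_eq x.cod_up
    have ay := Square.cyl_left y.dom_down
    have ay' := Square.cyl_right y.right_eq y.cod_up
    have kl := Square.left_composable h₁
    have t : Cod.map (fun k => D.two.src k ()) (Cod.map D.idc.arr y.fst.right) =
        Cod.map D.two.tgt (Cod.map D.idc.arr x.fst.right) := by
      have kr := Square.right_composable h₁
      rcases b with _ | _
      · rfl
      · exact (D.idc.src_arr (b := true) y.fst.right ()).trans
          (Eq.trans kr (D.idc.tgt_arr (b := true) x.fst.right).symm)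
    have t' : Cod.map (fun k => D.two.src k ()) (Cod.map D.idc.arr x.fst.right) = D.two.tgt x.up := by
      rw [x.tgt_up]
      rcases b with _ | _
      · rfl
      · exact (D.idc.src_arr (b := true) x.fst.right ()).trans x.fst.src_right
    have e₁ : D.two.post (Cod.map D.idc.arr y.fst.right)
        (D.two.substAll x.down fun i => D.idc.arr (x.fst.left i)) =
        D.two.substAll (D.two.post (Cod.map D.idc.arr y.fst.right) y.up)
          fun i => D.idc.arr (x.fst.left i) := by rw [post_substAll, h]
    have e₂ : D.two.post (Cod.map D.idc.arr y.fst.right)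
        (D.two.post (Cod.map D.idc.arr x.fst.right) x.up) =
        D.two.post (Cod.map D.idc.arr (D.one.postCod y.fst.right x.fst.right)) x.up := by
      rw [post_post _ _ _ t t', D.idc.map_postCod]
    have e₃ : D.two.substAll (D.two.substAll y.down fun i => D.idc.arr (y.fst.left i))
        (fun i => D.idc.arr (x.fst.left i)) = D.two.substAll y.down
          fun i => D.idc.arr (D.one.post (b := true) (y.fst.left i) (x.fst.left i)) := by
      rw [substAll_substAll y.down _ _
        (fun i => by rw [y.src_down, D.idc.tgt_arr, y.fst.tgt_left])
        (fun i => by rw [D.idc.src_arr, D.idc.tgt_arr, kl i])]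
      exact congrArg _ (funext fun i => D.post_idc (b := true) (y.fst.left i) (x.fst.left i))
    have e₄ : D.two.post (Cod.map D.idc.arr y.fst.right) x.snd.cell =
        D.two.post (Cod.map D.idc.arr y.snd.right) x.snd.cell := by rw [y.right_eq]
    have e₅ : D.two.substAll y.snd.cell (fun i => D.idc.arr (x.fst.left i)) =
        D.two.substAll y.snd.cell fun i => D.idc.arr (x.snd.left i) := by rw [x.left_eq]
    -- the cylinder `x`, followed by the right arrow of `y`
    have p₁ : D.cod.arr (D.two.post (Cod.map D.idc.arr y.fst.right) x.fst.cell) =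
        D.dom.arr (D.two.post (Cod.map D.idc.arr y.fst.right)
          (D.two.substAll x.down fun i => D.idc.arr (x.fst.left i))) := by
      rw [D.cod_post, ax, ← D.dom_post]
    have p₂ : D.cod.arr (D.two.post (Cod.map D.idc.arr y.fst.right)
        (D.two.post (Cod.map D.idc.arr x.fst.right) x.up)) =
        D.dom.arr (D.two.post (Cod.map D.idc.arr y.fst.right) x.snd.cell) := by
      rw [D.cod_post, ax', ← D.dom_post]
    have u₁ := p₁.trans (congrArg D.dom.arr e₁)
    have u₂ := (congrArg D.cod.arr e₂).symm.trans (p₂.trans (congrArg D.dom.arr e₄))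
    have H : D.vcomp _ _ u₁ = D.vcomp _ _ u₂ :=
      (D.vcomp_congr rfl e₁ p₁ u₁).symm.trans ((D.post_vcomp y.fst.right _ _ ax p₁).symm.trans
        ((congrArg (D.two.post (Cod.map D.idc.arr y.fst.right)) x.comm).trans
          ((D.post_vcomp y.fst.right _ _ ax' p₂).trans (D.vcomp_congr e₂ e₄ p₂ u₂))))
    -- the cylinder `y`, preceded by the left arrows of `x`
    have q₁ : D.cod.arr (D.two.substAll y.fst.cell fun i => D.idc.arr (x.fst.left i)) =
        D.dom.arr (D.two.substAll (D.two.substAll y.down fun i => D.idc.arr (y.fst.left i))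
          fun i => D.idc.arr (x.fst.left i)) := by
      rw [D.cod_substAll, ay, ← D.dom_substAll]
    have q₂ : D.cod.arr (D.two.substAll (D.two.post (Cod.map D.idc.arr y.fst.right) y.up)
        fun i => D.idc.arr (x.fst.left i)) =
        D.dom.arr (D.two.substAll y.snd.cell fun i => D.idc.arr (x.fst.left i)) := by
      rw [D.cod_substAll, ay', ← D.dom_substAll]
    have w₁ := q₁.trans (congrArg D.dom.arr e₃)
    have w₂ := q₂.trans (congrArg D.dom.arr e₅)
    have K : D.vcomp _ _ w₁ = D.vcomp _ _ w₂ :=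
      (D.vcomp_congr rfl e₃ q₁ w₁).symm.trans
        ((D.substOn_vcomp (Set.finite_univ (α := ι)).toFinset _ _ x.fst.left ay q₁).symm.trans
        ((congrArg (fun z => D.two.substAll z fun i => D.idc.arr (x.fst.left i)) y.comm).trans
          ((D.substOn_vcomp (Set.finite_univ (α := ι)).toFinset _ _ x.fst.left ay' q₂).trans
            (D.vcomp_congr rfl e₅ q₂ w₂))))
    exact D.paste_vertical (Square.stack_cells h₁) (Square.stack_cells h₂) u₁ u₂ w₁ w₂ H K

theorem stack_act (σ : ι ≃ κ) (x y : D.Cyl ι b) (h) (h') :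
    (x.act σ).stack (y.act σ) h' = (x.stack y h).act σ :=
  ext' (Square.stack_act σ _ _ (stack_fst h) (stack_fst (x := x.act σ) h'))
    (Square.stack_act σ _ _ (stack_snd h) (stack_snd (x := x.act σ) h')) rfl rfl

theorem stack_comp (x y : D.Cyl κ b) (q : κ) (x' y' : D.Cyl ι true)
    (hx : x.fst.left q = x'.fst.right) (hy : y.fst.left q = y'.fst.right) (h : x.down = y.up)
    (h' : x'.down = y'.up) (k) (k') :
    (x.comp q x' hx).stack (y.comp q y' hy) k = (x.stack y h).comp q (x'.stack y' h') k' :=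
  ext' (Square.stack_comp _ _ q _ _ hx hy (stack_fst h) (stack_fst h')
      (stack_fst (x := x.comp q x' hx) k) k')
    (Square.stack_comp _ _ q _ _ (comp_snd x q x' hx) (comp_snd y q y' hy) (stack_snd h)
      (stack_snd h') (stack_snd (x := x.comp q x' hx) k)
      (comp_snd (x.stack y h) q (x'.stack y' h') k')) rfl rfl

theorem vone_stack (x : D.Cyl ι b) (h : (vone x.up).down = x.up) : (vone x.up).stack x h = x :=
  ext' ((Square.stack_congr (congrArg Square.vone x.dom_up) rfl x.dom_up rfl).trans
      (Square.vone_stack x.fst rfl))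
    ((Square.stack_congr (congrArg Square.vone x.cod_up) rfl x.cod_up rfl).trans
      (Square.vone_stack x.snd rfl)) rfl rfl

theorem stack_vone (x : D.Cyl ι b) (h : x.down = (vone x.down).up) : x.stack (vone x.down) h = x :=
  ext' ((Square.stack_congr rfl (congrArg Square.vone x.dom_down) x.dom_down.symm rfl).trans
      (Square.stack_vone x.fst rfl))
    ((Square.stack_congr rfl (congrArg Square.vone x.cod_down) x.cod_down.symm rfl).trans
      (Square.stack_vone x.snd rfl)) rfl rfl

theorem stack_assoc (x y z : D.Cyl ι b) (h₁ : x.down = y.up) (h₂ : y.down = z.up) (h₃) (h₄) :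
    (x.stack y h₁).stack z h₃ = x.stack (y.stack z h₂) h₄ :=
  ext' (Square.stack_assoc _ _ _ (stack_fst h₁) (stack_fst h₂) (stack_fst h₂) (stack_fst h₁))
    (Square.stack_assoc _ _ _ (stack_snd h₁) (stack_snd h₂) (stack_snd h₂) (stack_snd h₁)) rfl rfl

end Cyl

end CoSub2

namespace CoSub

section

variable {O₁ O₂ : Type u} {O : Type u₂} {obj₁ : O₁ → O} {obj₂ : O₂ → O} {X₁ : CoSub.{u, v} O₁}
  {X₂ : CoSub.{u, v} O₂} {Y : CoSub.{u₂, v₂} O} (F : Fun obj₁ X₁ Y) (G : Fun obj₂ X₂ Y)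

/-- The target of an arrow of a pullback. -/
def pullbackTgt {ι : Type} [Finite ι] : {b : Bool} → (f : X₁.Arr ι b) → (g : X₂.Arr ι b) →
    F.arr f = G.arr g → Cod {x : O₁ × O₂ // obj₁ x.1 = obj₂ x.2} b
  | true, f, g, h => ⟨(X₁.tgt f, X₂.tgt g), by
      have k := congrArg Y.tgt h
      rwa [F.tgt_arr, G.tgt_arr] at k⟩
  | false, _, _, _ => PUnit.unit

theorem pullbackTgt_congr {ι κ : Type} [Finite ι] [Finite κ] {b : Bool} {f : X₁.Arr ι b}
    {g : X₂.Arr ι b} {f' : X₁.Arr κ b} {g' : X₂.Arr κ b} (hf : X₁.tgt f = X₁.tgt f')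
    (hg : X₂.tgt g = X₂.tgt g') (h h') : pullbackTgt F G f g h = pullbackTgt F G f' g' h' := by
  cases b with
  | false => rfl
  | true => exact Subtype.ext (Prod.ext hf hg)

/-- The pullback of functors of co-subunary polycategories. -/
def pullback : CoSub.{u, v} {x : O₁ × O₂ // obj₁ x.1 = obj₂ x.2} where
  Arr ι _ b := {f : X₁.Arr ι b × X₂.Arr ι b // F.arr f.1 = G.arr f.2}
  src f i := ⟨(X₁.src f.1.1 i, X₂.src f.1.2 i), by
    have k := congrArg (fun f => Y.src f i) f.2
    rwa [F.src_arr, G.src_arr] at k⟩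
  tgt f := pullbackTgt F G f.1.1 f.1.2 f.2
  act σ f := ⟨(X₁.act σ f.1.1, X₂.act σ f.1.2), by rw [F.arr_act, G.arr_act, f.2]⟩
  one A := ⟨(X₁.one A.1.1, X₂.one A.1.2), by rw [F.arr_one, G.arr_one, A.2]⟩
  comp g q f h :=
    have h₁ : X₁.src g.1.1 q = X₁.tgt f.1.1 := congrArg (fun x => x.1.1) h
    have h₂ : X₂.src g.1.2 q = X₂.tgt f.1.2 := congrArg (fun x => x.1.2) h
    have k₁ : Y.src (F.arr g.1.1) q = Y.tgt (F.arr f.1.1) := by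
      rw [F.src_arr, F.tgt_arr]; exact congrArg obj₁ h₁
    have k₂ : Y.src (G.arr g.1.2) q = Y.tgt (G.arr f.1.2) := by
      rw [G.src_arr, G.tgt_arr]; exact congrArg obj₂ h₂
    ⟨(X₁.comp g.1.1 q f.1.1 h₁, X₂.comp g.1.2 q f.1.2 h₂),
      (F.arr_comp _ _ _ h₁ k₁).trans ((Y.comp_congr g.2 q f.2 k₁ k₂).trans
        (G.arr_comp _ _ _ h₂ k₂).symm)⟩
  src_act σ f i := Subtype.ext (Prod.ext (X₁.src_act _ _ _) (X₂.src_act _ _ _))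
  tgt_act σ f := pullbackTgt_congr F G (X₁.tgt_act _ _) (X₂.tgt_act _ _) _ _
  src_one A i := Subtype.ext (Prod.ext (X₁.src_one _ _) (X₂.src_one _ _))
  tgt_one A := Subtype.ext (Prod.ext (X₁.tgt_one _) (X₂.tgt_one _))
  src_comp_inl _ _ _ _ _ := Subtype.ext (Prod.ext (X₁.src_comp_inl _ _ _ _ _)
    (X₂.src_comp_inl _ _ _ _ _))
  src_comp_inr _ _ _ _ _ := Subtype.ext (Prod.ext (X₁.src_comp_inr _ _ _ _ _)
    (X₂.src_comp_inr _ _ _ _ _))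
  tgt_comp _ _ _ _ := pullbackTgt_congr F G (X₁.tgt_comp _ _ _ _) (X₂.tgt_comp _ _ _ _) _ _
  act_refl _ := Subtype.ext (Prod.ext (X₁.act_refl _) (X₂.act_refl _))
  act_act _ _ _ := Subtype.ext (Prod.ext (X₁.act_act _ _ _) (X₂.act_act _ _ _))
  one_comp _ _ _ := Subtype.ext (Prod.ext (X₁.one_comp _ _ _) (X₂.one_comp _ _ _))
  comp_one _ _ _ _ := Subtype.ext (Prod.ext (X₁.comp_one _ _ _ _) (X₂.comp_one _ _ _ _))
  assoc k r g q f h₁ h₂ h₃ h₄ := Subtype.ext (Prod.ext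
    (X₁.assoc _ _ _ _ _ (congrArg (fun x => x.1.1) h₁) (congrArg (fun x => x.1.1) h₂)
      (congrArg (fun x => x.1.1) h₃) (congrArg (fun x => x.1.1) h₄))
    (X₂.assoc _ _ _ _ _ (congrArg (fun x => x.1.2) h₁) (congrArg (fun x => x.1.2) h₂)
      (congrArg (fun x => x.1.2) h₃) (congrArg (fun x => x.1.2) h₄)))
  exchange k r s hrs g f h₁ h₂ h₃ h₄ := Subtype.ext (Prod.ext
    (X₁.exchange _ _ _ hrs _ _ (congrArg (fun x => x.1.1) h₁) (congrArg (fun x => x.1.1) h₂)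
      (congrArg (fun x => x.1.1) h₃) (congrArg (fun x => x.1.1) h₄))
    (X₂.exchange _ _ _ hrs _ _ (congrArg (fun x => x.1.2) h₁) (congrArg (fun x => x.1.2) h₂)
      (congrArg (fun x => x.1.2) h₃) (congrArg (fun x => x.1.2) h₄)))
  equivariance σ τ g q q' hq f h h' := Subtype.ext (Prod.ext
    (X₁.equivariance σ τ _ _ _ hq _ (congrArg (fun x => x.1.1) h) (congrArg (fun x => x.1.1) h'))
    (X₂.equivariance σ τ _ _ _ hq _ (congrArg (fun x => x.1.2) h) (congrArg (fun x => x.1.2) h')))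

end

end CoSub

namespace CoSub2

variable {D₁ D₂ : CoSub2.{u, v, w}} {E : CoSub2.{u₂, v₂, w₂}} (F : D₁.Functor E) (G : D₂.Functor E)

/-- The pullback of functors of co-subunary 2-polycategories. -/
def pullback : CoSub2.{u, v, w} where
  Obj := {x : D₁.Obj × D₂.Obj // F.obj x.1 = G.obj x.2}
  one := CoSub.pullback F.one G.one
  two := CoSub.pullback F.two G.two
  dom :=
    { arr := fun θ => ⟨(D₁.dom.arr θ.1.1, D₂.dom.arr θ.1.2),
        (F.dom_two _).symm.trans ((congrArg E.dom.arr θ.2).trans (G.dom_two _))⟩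
      src_arr := fun _ _ => Subtype.ext (Prod.ext (D₁.dom.src_arr _ _) (D₂.dom.src_arr _ _))
      tgt_arr := fun {_ _ b} _ => by
        cases b
        exacts [rfl, Subtype.ext (Prod.ext (D₁.dom.tgt_arr _) (D₂.dom.tgt_arr _))]
      arr_act := fun _ _ => Subtype.ext (Prod.ext (D₁.dom.arr_act _ _) (D₂.dom.arr_act _ _))
      arr_one := fun _ => Subtype.ext (Prod.ext (D₁.dom.arr_one _) (D₂.dom.arr_one _))
      arr_comp := fun _ _ _ _ _ => Subtype.ext (Prod.ext (D₁.dom.arr_comp _ _ _ _ _)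
        (D₂.dom.arr_comp _ _ _ _ _)) }
  cod :=
    { arr := fun θ => ⟨(D₁.cod.arr θ.1.1, D₂.cod.arr θ.1.2),
        (F.cod_two _).symm.trans ((congrArg E.cod.arr θ.2).trans (G.cod_two _))⟩
      src_arr := fun _ _ => Subtype.ext (Prod.ext (D₁.cod.src_arr _ _) (D₂.cod.src_arr _ _))
      tgt_arr := fun {_ _ b} _ => by
        cases b
        exacts [rfl, Subtype.ext (Prod.ext (D₁.cod.tgt_arr _) (D₂.cod.tgt_arr _))]
      arr_act := fun _ _ => Subtype.ext (Prod.ext (D₁.cod.arr_act _ _) (D₂.cod.arr_act _ _))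
      arr_one := fun _ => Subtype.ext (Prod.ext (D₁.cod.arr_one _) (D₂.cod.arr_one _))
      arr_comp := fun _ _ _ _ _ => Subtype.ext (Prod.ext (D₁.cod.arr_comp _ _ _ _ _)
        (D₂.cod.arr_comp _ _ _ _ _)) }
  idc :=
    { arr := fun f => ⟨(D₁.idc.arr f.1.1, D₂.idc.arr f.1.2),
        (F.two_idc _).trans ((congrArg E.idc.arr f.2).trans (G.two_idc _).symm)⟩
      src_arr := fun _ _ => Subtype.ext (Prod.ext (D₁.idc.src_arr _ _) (D₂.idc.src_arr _ _))
      tgt_arr := fun {_ _ b} _ => by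
        cases b
        exacts [rfl, Subtype.ext (Prod.ext (D₁.idc.tgt_arr _) (D₂.idc.tgt_arr _))]
      arr_act := fun _ _ => Subtype.ext (Prod.ext (D₁.idc.arr_act _ _) (D₂.idc.arr_act _ _))
      arr_one := fun _ => Subtype.ext (Prod.ext (D₁.idc.arr_one _) (D₂.idc.arr_one _))
      arr_comp := fun _ _ _ _ _ => Subtype.ext (Prod.ext (D₁.idc.arr_comp _ _ _ _ _)
        (D₂.idc.arr_comp _ _ _ _ _)) }
  vcomp θ η h :=
    have h₁ : D₁.cod.arr θ.1.1 = D₁.dom.arr η.1.1 := congrArg (fun x => x.1.1) h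
    have h₂ : D₂.cod.arr θ.1.2 = D₂.dom.arr η.1.2 := congrArg (fun x => x.1.2) h
    have k₁ : E.cod.arr (F.two.arr θ.1.1) = E.dom.arr (F.two.arr η.1.1) := by
      rw [F.cod_two, F.dom_two, h₁]
    have k₂ : E.cod.arr (G.two.arr θ.1.2) = E.dom.arr (G.two.arr η.1.2) := by
      rw [G.cod_two, G.dom_two, h₂]
    ⟨(D₁.vcomp θ.1.1 η.1.1 h₁, D₂.vcomp θ.1.2 η.1.2 h₂),
      (F.two_vcomp _ _ h₁ k₁).trans ((E.vcomp_congr θ.2 η.2 k₁ k₂).trans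
        (G.two_vcomp _ _ h₂ k₂).symm)⟩
  dom_idc _ := Subtype.ext (Prod.ext (D₁.dom_idc _) (D₂.dom_idc _))
  cod_idc _ := Subtype.ext (Prod.ext (D₁.cod_idc _) (D₂.cod_idc _))
  dom_vcomp _ _ _ := Subtype.ext (Prod.ext (D₁.dom_vcomp _ _ _) (D₂.dom_vcomp _ _ _))
  cod_vcomp _ _ _ := Subtype.ext (Prod.ext (D₁.cod_vcomp _ _ _) (D₂.cod_vcomp _ _ _))
  id_vcomp _ _ _ := Subtype.ext (Prod.ext (D₁.id_vcomp _ _ _) (D₂.id_vcomp _ _ _))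
  vcomp_id _ _ _ := Subtype.ext (Prod.ext (D₁.vcomp_id _ _ _) (D₂.vcomp_id _ _ _))
  vcomp_assoc _ _ _ h₁ h₂ h₃ h₄ := Subtype.ext (Prod.ext
    (D₁.vcomp_assoc _ _ _ (congrArg (fun x => x.1.1) h₁) (congrArg (fun x => x.1.1) h₂)
      (congrArg (fun x => x.1.1) h₃) (congrArg (fun x => x.1.1) h₄))
    (D₂.vcomp_assoc _ _ _ (congrArg (fun x => x.1.2) h₁) (congrArg (fun x => x.1.2) h₂)
      (congrArg (fun x => x.1.2) h₃) (congrArg (fun x => x.1.2) h₄)))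
  act_vcomp _ _ _ h h' := Subtype.ext (Prod.ext
    (D₁.act_vcomp _ _ _ (congrArg (fun x => x.1.1) h) (congrArg (fun x => x.1.1) h'))
    (D₂.act_vcomp _ _ _ (congrArg (fun x => x.1.2) h) (congrArg (fun x => x.1.2) h')))
  comp_vcomp _ _ _ _ _ h₁ h₂ h₃ h₄ h₅ h₆ := Subtype.ext (Prod.ext
    (D₁.comp_vcomp _ _ _ _ _ (congrArg (fun x => x.1.1) h₁) (congrArg (fun x => x.1.1) h₂)
      (congrArg (fun x => x.1.1) h₃) (congrArg (fun x => x.1.1) h₄)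
      (congrArg (fun x => x.1.1) h₅) (congrArg (fun x => x.1.1) h₆))
    (D₂.comp_vcomp _ _ _ _ _ (congrArg (fun x => x.1.2) h₁) (congrArg (fun x => x.1.2) h₂)
      (congrArg (fun x => x.1.2) h₃) (congrArg (fun x => x.1.2) h₄)
      (congrArg (fun x => x.1.2) h₅) (congrArg (fun x => x.1.2) h₆)))

/-- The first projection of a pullback. -/
def pullbackFst : (pullback F G).Functor D₁ where
  obj x := x.1.1
  one :=
    { arr := fun f => f.1.1
      src_arr := fun _ _ => rfl
      tgt_arr := fun {_ _ b} _ => by cases b <;> rfl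
      arr_act := fun _ _ => rfl
      arr_one := fun _ => rfl
      arr_comp := fun _ _ _ _ _ => rfl }
  two :=
    { arr := fun f => f.1.1
      src_arr := fun _ _ => rfl
      tgt_arr := fun {_ _ b} _ => by cases b <;> rfl
      arr_act := fun _ _ => rfl
      arr_one := fun _ => rfl
      arr_comp := fun _ _ _ _ _ => rfl }
  dom_two _ := rfl
  cod_two _ := rfl
  two_idc _ := rfl
  two_vcomp _ _ _ _ := rfl

/-- The second projection of a pullback. -/
def pullbackSnd : (pullback F G).Functor D₂ where
  obj x := x.1.2
  one :=
    { arr := fun f => f.1.2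
      src_arr := fun _ _ => rfl
      tgt_arr := fun {_ _ b} _ => by cases b <;> rfl
      arr_act := fun _ _ => rfl
      arr_one := fun _ => rfl
      arr_comp := fun _ _ _ _ _ => rfl }
  two :=
    { arr := fun f => f.1.2
      src_arr := fun _ _ => rfl
      tgt_arr := fun {_ _ b} _ => by cases b <;> rfl
      arr_act := fun _ _ => rfl
      arr_one := fun _ => rfl
      arr_comp := fun _ _ _ _ _ => rfl }
  dom_two _ := rfl
  cod_two _ := rfl
  two_idc _ := rfl
  two_vcomp _ _ _ _ := rfl

section

variable {D : CoSub2.{u, v, w}} {m n : Type} [Finite m] [Finite n]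

theorem chuObj_ext {A B : D.chu₀.Obj} (h₁ : chuPlus A = chuPlus B) (h₂ : chuMinus A = chuMinus B)
    (h₃ : chuForm A = chuForm B) : A = B := by
  refine AdjObj.ext' (Ω := D.fpd.toPolyPshData) (Γ := PEmpty.elim) h₁ h₂ ?_
  obtain ⟨a, b, c⟩ := A
  obtain ⟨a', b', c'⟩ := B
  have k₁ : a = a' := h₁
  have k₂ : b = b' := h₂
  subst k₁ k₂
  exact heq_of_eq (Subtype.ext h₃)

theorem chuArr_ext {f g : D.chu₀.Arr m n} (hs : ∀ i, D.chu₀.src f i = D.chu₀.src g i)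
    (ht : ∀ j, D.chu₀.tgt f j = D.chu₀.tgt g j) (hp : ∀ e, chuPrim f e = chuPrim g e)
    (hi : ∀ e e', chuIso f e e' = chuIso g e e') : f = g := by
  obtain ⟨s, t, p, h₁, h₂, x, h₃, h₄⟩ := f
  obtain ⟨s', t', p', h₁', h₂', x', h₃', h₄'⟩ := g
  have k₁ : s = s' := funext hs
  have k₂ : t = t' := funext ht
  have k₃ : p = p' := funext hp
  subst k₁ k₂ k₃
  have k₄ : x = x' := Clique.ext_of_forall (fun e => Subtype.ext
    ((Clique.dom_iso x e e).symm.trans ((congrArg D.dom.arr (hi e e)).trans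
      (Clique.dom_iso x' e e)))) hi
  subst k₄
  rfl

end

end CoSub2

namespace CoSub2

variable {D₁ D₂ : CoSub2.{u, v, w}} {E : CoSub2.{u₂, v₂, w₂}} (F : D₁.Functor E) (G : D₂.Functor E)

/-- The clique in a pullback with given components. -/
def Clique.pair {ι M : Type} [Finite ι] {Γ : ι → (pullback F G).Obj} {Γ₁ : ι → D₁.Obj}
    {Γ₂ : ι → D₂.Obj} (h₁ : ∀ i, Γ₁ i = (Γ i).1.1) (h₂ : ∀ i, Γ₂ i = (Γ i).1.2)
    (c₁ : D₁.Clique Γ₁ M) (c₂ : D₂.Clique Γ₂ M)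
    (h : ∀ e e', F.two.arr (c₁.iso e e') = G.two.arr (c₂.iso e e')) :
    (pullback F G).Clique Γ M where
  obj e := ⟨⟨((c₁.obj e).1, (c₂.obj e).1), by
      rw [← c₁.dom_iso e e, ← c₂.dom_iso e e, ← F.dom_two, ← G.dom_two, h]⟩,
    fun i => Subtype.ext (Prod.ext (((c₁.obj e).2 i).trans (h₁ i)) (((c₂.obj e).2 i).trans (h₂ i)))⟩
  iso e e' := ⟨(c₁.iso e e', c₂.iso e e'), h e e'⟩
  dom_iso e e' := Subtype.ext (Prod.ext (c₁.dom_iso e e') (c₂.dom_iso e e'))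
  cod_iso e e' := Subtype.ext (Prod.ext (c₁.cod_iso e e') (c₂.cod_iso e e'))
  iso_self e := Subtype.ext (Prod.ext (c₁.iso_self e) (c₂.iso_self e))
  iso_trans e e' e'' := Subtype.ext (Prod.ext (c₁.iso_trans e e' e'') (c₂.iso_trans e e' e''))

/-- The object of `Chu₀` of a pullback with given components. -/
def pairObj (x : D₁.chu₀.Obj) (y : D₂.chu₀.Obj) (h : F.chu.obj x = G.chu.obj y) :
    AdjObj (pullback F G).fpd.toPolyPshData (PEmpty.elim : PEmpty.{1} → (pullback F G).Obj) where
  plus := ⟨(chuPlus x, chuPlus y), congrArg chuPlus h⟩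
  minus := ⟨(chuMinus x, chuMinus y), congrArg chuMinus h⟩
  form := ⟨⟨(chuForm x, chuForm y), congrArg chuForm h⟩, fun i => Subtype.ext (Prod.ext (by
      refine ((AdjObj.form (Ω := D₁.fpd.toPolyPshData) (Γ := PEmpty.elim) x).2 i).trans ?_
      rcases i with i | _ | _
      exacts [i.elim, rfl, rfl]) (by
      refine ((AdjObj.form (Ω := D₂.fpd.toPolyPshData) (Γ := PEmpty.elim) y).2 i).trans ?_
      rcases i with i | _ | _
      exacts [i.elim, rfl, rfl]))⟩

/-- The polyarrow of `Chu₀` of a pullback with given components. -/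
noncomputable def pairArr {m n : Type} [Finite m] [Finite n] (f : D₁.chu₀.Arr m n) (g : D₂.chu₀.Arr m n)
    (h : F.chu.arr f = G.chu.arr g) :
    AdjArr (pullback F G).fpd.toPolyPshData (PEmpty.elim : PEmpty.{1} → (pullback F G).Obj) m n where
  src i := pairObj F G (D₁.chu₀.src f i) (D₂.chu₀.src g i)
    (congrArg (fun k => E.chu₀.src k i) h)
  tgt j := pairObj F G (D₁.chu₀.tgt f j) (D₂.chu₀.tgt g j)
    (congrArg (fun k => E.chu₀.tgt k j) h)
  prim e := ⟨(chuPrim f e, chuPrim g e), congrArg (fun k => chuPrim k e) h⟩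
  src_prim e x := Subtype.ext (Prod.ext
    ((AdjArr.src_prim (Ω := D₁.fpd.toPolyPshData) (Γ := PEmpty.elim) f e x).trans (by
      rcases x with ⟨x | x, _⟩ <;> rfl))
    ((AdjArr.src_prim (Ω := D₂.fpd.toPolyPshData) (Γ := PEmpty.elim) g e x).trans (by
      rcases x with ⟨x | x, _⟩ <;> rfl)))
  tgt_prim e := Subtype.ext (Prod.ext
    ((AdjArr.tgt_prim (Ω := D₁.fpd.toPolyPshData) (Γ := PEmpty.elim) f e).trans (by
      rcases e with e | e <;> rfl))
    ((AdjArr.tgt_prim (Ω := D₂.fpd.toPolyPshData) (Γ := PEmpty.elim) g e).trans (by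
      rcases e with e | e <;> rfl)))
  sec := Clique.pair F G (by
      rintro (i | i | i)
      exacts [i.elim, rfl, rfl]) (by
      rintro (i | i | i)
      exacts [i.elim, rfl, rfl])
    (AdjArr.sec (Ω := D₁.fpd.toPolyPshData) (Γ := PEmpty.elim) f)
    (AdjArr.sec (Ω := D₂.fpd.toPolyPshData) (Γ := PEmpty.elim) g)
    (fun e e' => congrArg (fun k => chuIso k e e') h)
  src_sec i := Subtype.ext (Subtype.ext (Prod.ext
    (congrArg Subtype.val (AdjArr.src_sec (Ω := D₁.fpd.toPolyPshData) (Γ := PEmpty.elim) f i))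
    (congrArg Subtype.val (AdjArr.src_sec (Ω := D₂.fpd.toPolyPshData) (Γ := PEmpty.elim) g i))))
  tgt_sec j := Subtype.ext (Subtype.ext (Prod.ext
    (congrArg Subtype.val (AdjArr.tgt_sec (Ω := D₁.fpd.toPolyPshData) (Γ := PEmpty.elim) f j))
    (congrArg Subtype.val (AdjArr.tgt_sec (Ω := D₂.fpd.toPolyPshData) (Γ := PEmpty.elim) g j))))

theorem chuObj_pullback_ext {x y : (pullback F G).chu₀.Obj}
    (h₁ : (pullbackFst F G).chu.obj x = (pullbackFst F G).chu.obj y)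
    (h₂ : (pullbackSnd F G).chu.obj x = (pullbackSnd F G).chu.obj y) : x = y :=
  chuObj_ext (Subtype.ext (Prod.ext (congrArg chuPlus h₁) (congrArg chuPlus h₂)))
    (Subtype.ext (Prod.ext (congrArg chuMinus h₁) (congrArg chuMinus h₂)))
    (Subtype.ext (Prod.ext (congrArg chuForm h₁) (congrArg chuForm h₂)))

theorem chuArr_pullback_ext {m n : Type} [Finite m] [Finite n] {f g : (pullback F G).chu₀.Arr m n}
    (h₁ : (pullbackFst F G).chu.arr f = (pullbackFst F G).chu.arr g)
    (h₂ : (pullbackSnd F G).chu.arr f = (pullbackSnd F G).chu.arr g) : f = g :=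
  chuArr_ext
    (fun i => chuObj_pullback_ext F G (congrArg (fun k => D₁.chu₀.src k i) h₁)
      (congrArg (fun k => D₂.chu₀.src k i) h₂))
    (fun j => chuObj_pullback_ext F G (congrArg (fun k => D₁.chu₀.tgt k j) h₁)
      (congrArg (fun k => D₂.chu₀.tgt k j) h₂))
    (fun e => Subtype.ext (Prod.ext (congrArg (fun k => chuPrim k e) h₁)
      (congrArg (fun k => chuPrim k e) h₂)))
    (fun e e' => Subtype.ext (Prod.ext (congrArg (fun k => chuIso k e e') h₁)
      (congrArg (fun k => chuIso k e e') h₂)))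

/-- The comparison of the pullback of `Chu₀` with `Chu₀` of the pullback. -/
noncomputable def pairing (hF : IsStarFunctor D₁.chu₀ E.chu₀ F.chu) (hG : IsStarFunctor D₂.chu₀ E.chu₀ G.chu) :
    PolyMap (StarPolyData.pullback F.chu G.chu hF hG).toPolyData (pullback F G).chu₀.toPolyData where
  obj x := pairObj F G x.1.1 x.1.2 x.2
  arr f := pairArr F G f.1.1 f.1.2 f.2
  src_arr _ _ := rfl
  tgt_arr _ _ := rfl

variable {F G} in
theorem fst_pairing {hF : IsStarFunctor D₁.chu₀ E.chu₀ F.chu}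
    {hG : IsStarFunctor D₂.chu₀ E.chu₀ G.chu} {m n : Type} [Finite m] [Finite n]
    (f : (StarPolyData.pullback F.chu G.chu hF hG).Arr m n) :
    (pullbackFst F G).chu.arr ((pairing F G hF hG).arr f) = f.1.1 :=
  chuArr_ext (fun i => chuObj_ext rfl rfl rfl) (fun j => chuObj_ext rfl rfl rfl) (fun _ => rfl)
    (fun _ _ => rfl)

variable {F G} in
theorem snd_pairing {hF : IsStarFunctor D₁.chu₀ E.chu₀ F.chu}
    {hG : IsStarFunctor D₂.chu₀ E.chu₀ G.chu} {m n : Type} [Finite m] [Finite n]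
    (f : (StarPolyData.pullback F.chu G.chu hF hG).Arr m n) :
    (pullbackSnd F G).chu.arr ((pairing F G hF hG).arr f) = f.1.2 :=
  chuArr_ext (fun i => chuObj_ext rfl rfl rfl) (fun j => chuObj_ext rfl rfl rfl) (fun _ => rfl)
    (fun _ _ => rfl)

theorem pairing_isStarFunctor (hF : IsStarFunctor D₁.chu₀ E.chu₀ F.chu)
    (hG : IsStarFunctor D₂.chu₀ E.chu₀ G.chu) :
    IsStarFunctor (StarPolyData.pullback F.chu G.chu hF hG) (pullback F G).chu₀
      (pairing F G hF hG) := by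
  have h₁ := (pullbackFst F G).chu_isStarFunctor
  have h₂ := (pullbackSnd F G).chu_isStarFunctor
  have o₁ : ∀ x, (pullbackFst F G).chu.obj ((pairing F G hF hG).obj x) = x.1.1 :=
    fun x => chuObj_ext rfl rfl rfl
  have o₂ : ∀ x, (pullbackSnd F G).chu.obj ((pairing F G hF hG).obj x) = x.1.2 :=
    fun x => chuObj_ext rfl rfl rfl
  refine ⟨⟨fun ρ τ f => ?_, fun A => ?_, fun g k f j h h' => ?_⟩, fun A => ?_, fun σ f => ?_⟩
  · exact chuArr_pullback_ext F G
      ((fst_pairing _).trans ((h₁.isFunctor.perm ρ τ _).trans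
        (congrArg (D₁.chu₀.perm ρ τ) (fst_pairing f))).symm)
      ((snd_pairing _).trans ((h₂.isFunctor.perm ρ τ _).trans
        (congrArg (D₂.chu₀.perm ρ τ) (snd_pairing f))).symm)
  · exact chuArr_pullback_ext F G
      ((fst_pairing _).trans ((h₁.isFunctor.one _).trans (congrArg D₁.chu₀.one (o₁ A))).symm)
      ((snd_pairing _).trans ((h₂.isFunctor.one _).trans (congrArg D₂.chu₀.one (o₂ A))).symm)
  · have a₁ := congrArg (pullbackFst F G).chu.obj h'
    have a₂ := congrArg (pullbackSnd F G).chu.obj h'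
    exact chuArr_pullback_ext F G
      ((fst_pairing _).trans ((h₁.isFunctor.comp _ k _ j h' a₁).trans
        (D₁.chu₀.comp_congr (fst_pairing g) k (fst_pairing f) j a₁ (congrArg (fun x => x.1.1) h))).symm)
      ((snd_pairing _).trans ((h₂.isFunctor.comp _ k _ j h' a₂).trans
        (D₂.chu₀.comp_congr (snd_pairing g) k (snd_pairing f) j a₂ (congrArg (fun x => x.1.2) h))).symm)
  · exact chuObj_pullback_ext F G
      ((o₁ _).trans ((h₁.dual _).trans (congrArg D₁.chu₀.dual (o₁ A))).symm)
      ((o₂ _).trans ((h₂.dual _).trans (congrArg D₂.chu₀.dual (o₂ A))).symm)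
  · exact chuArr_pullback_ext F G
      ((fst_pairing _).trans ((h₁.sact σ _).trans (congrArg (D₁.chu₀.sact σ) (fst_pairing f))).symm)
      ((snd_pairing _).trans ((h₂.sact σ _).trans (congrArg (D₂.chu₀.sact σ) (snd_pairing f))).symm)

end CoSub2

namespace CoSub2

variable (D : CoSub2.{u, v, w})

/-- The functor of vertical composition of the internal category of quintets. -/
noncomputable def quintetsComp :
    (pullback D.quintetsTarget D.quintetsSource).Functor D.quintets where
  obj x := D.one.post (b := true) x.1.2 x.1.1
  one :=
    { arr := fun f => Square.stack f.1.1 f.1.2 f.2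
      src_arr := fun _ _ => rfl
      tgt_arr := fun {_ _ b} _ => by cases b <;> rfl
      arr_act := fun σ f => (Square.stack_act σ f.1.1 f.1.2 f.2 _).trans rfl
      arr_one := fun A => Square.stack_one A.1.1 A.1.2 A.2.symm _
      arr_comp := fun g q f h h' => Square.stack_comp g.1.1 g.1.2 q f.1.1 f.1.2
        (congrArg (fun x => x.1.1) h) (congrArg (fun x => x.1.2) h) g.2 f.2 _ h' }
  two :=
    { arr := fun f => Cyl.stack f.1.1 f.1.2 f.2
      src_arr := fun _ _ => rfl
      tgt_arr := fun {_ _ b} _ => by cases b <;> rfl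
      arr_act := fun σ f => Cyl.stack_act σ f.1.1 f.1.2 f.2 _
      arr_one := fun A => congrArg Cyl.id (Square.stack_one A.1.1 A.1.2 A.2.symm
        (congrArg D.one.one A.2))
      arr_comp := fun g q f h h' => Cyl.stack_comp g.1.1 g.1.2 q f.1.1 f.1.2
        (congrArg (fun x => x.1.1) h) (congrArg (fun x => x.1.2) h) g.2 f.2 _ h' }
  dom_two _ := rfl
  cod_two _ := rfl
  two_idc _ := rfl
  two_vcomp _ _ _ _ := rfl

/-- The functor of compositions of the double Chu construction. -/
noncomputable def chuComp : PolyMap (StarPolyData.pullback D.quintetsTarget.chu D.quintetsSource.chu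
    D.quintetsTarget.chu_isStarFunctor D.quintetsSource.chu_isStarFunctor).toPolyData
    D.quintets.chu₀.toPolyData :=
  (pairing D.quintetsTarget D.quintetsSource D.quintetsTarget.chu_isStarFunctor
    D.quintetsSource.chu_isStarFunctor).trans D.quintetsComp.chu

section

variable {D}

theorem source_id_obj (A : D.chu₀.Obj) : D.quintetsSource.chu.obj (D.quintetsId.chu.obj A) = A :=
  chuObj_ext (D.one.src_one _ _) (D.one.src_one _ _) rfl

theorem target_id_obj (A : D.chu₀.Obj) : D.quintetsTarget.chu.obj (D.quintetsId.chu.obj A) = A :=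
  chuObj_ext (D.one.tgt_one _) (D.one.tgt_one _) rfl

theorem source_comp_obj (x y : D.quintets.chu₀.Obj)
    (h : D.quintetsTarget.chu.obj x = D.quintetsSource.chu.obj y) :
    D.quintetsSource.chu.obj (D.chuComp.obj ⟨(x, y), h⟩) = D.quintetsSource.chu.obj x :=
  chuObj_ext (CoSub.src_post (b := true) ()) (CoSub.src_post (b := true) ()) rfl

theorem target_comp_obj (x y : D.quintets.chu₀.Obj)
    (h : D.quintetsTarget.chu.obj x = D.quintetsSource.chu.obj y) :
    D.quintetsTarget.chu.obj (D.chuComp.obj ⟨(x, y), h⟩) = D.quintetsTarget.chu.obj y :=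
  chuObj_ext (CoSub.tgt_post (congrArg chuPlus h).symm) (CoSub.tgt_post (congrArg chuMinus h).symm) rfl

theorem id_comp_obj (y : D.quintets.chu₀.Obj) (h) :
    D.chuComp.obj ⟨(D.quintetsId.chu.obj (D.quintetsSource.chu.obj y), y), h⟩ = y :=
  chuObj_ext (CoSub.post_one _ _ rfl) (CoSub.post_one _ _ rfl)
    (Square.vone_stack (D := D) (chuForm y) rfl)

theorem comp_id_obj (x : D.quintets.chu₀.Obj) (h) :
    D.chuComp.obj ⟨(x, D.quintetsId.chu.obj (D.quintetsTarget.chu.obj x)), h⟩ = x :=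
  chuObj_ext (CoSub.post_id (b := true) _ _ rfl) (CoSub.post_id (b := true) _ _ rfl)
    (Square.stack_vone (D := D) (chuForm x) rfl)

theorem comp_assoc_obj (x y z : D.quintets.chu₀.Obj)
    (h : D.quintetsTarget.chu.obj x = D.quintetsSource.chu.obj y)
    (h' : D.quintetsTarget.chu.obj y = D.quintetsSource.chu.obj z) (k k') :
    D.chuComp.obj ⟨(D.chuComp.obj ⟨(x, y), h⟩, z), k⟩ =
      D.chuComp.obj ⟨(x, D.chuComp.obj ⟨(y, z), h'⟩), k'⟩ :=
  chuObj_ext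
    (CoSub.post_post (b := true) _ _ _ (congrArg chuPlus h').symm (congrArg chuPlus h).symm)
    (CoSub.post_post (b := true) _ _ _ (congrArg chuMinus h').symm (congrArg chuMinus h).symm)
    (Square.stack_assoc (D := D) (chuForm x) (chuForm y) (chuForm z) (congrArg chuForm h)
      (congrArg chuForm h') (congrArg chuForm k) (congrArg chuForm k'))

end

/-- The double Chu construction. -/
noncomputable def doubleChu : D.DoubleChu where
  isStarPoly₀ := D.chu₀_isStarPoly
  isStarPoly₁ := D.quintets.chu₀_isStarPoly
  s := D.quintetsSource.chu
  t := D.quintetsTarget.chu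
  i := D.quintetsId.chu
  s_isStar := D.quintetsSource.chu_isStarFunctor
  t_isStar := D.quintetsTarget.chu_isStarFunctor
  i_isStar := D.quintetsId.chu_isStarFunctor
  c := D.chuComp
  c_isStar := (pairing_isStarFunctor _ _ _ _).trans D.quintetsComp.chu_isStarFunctor
  s_i := source_id_obj
  s_i_arr f := chuArr_ext (fun _ => source_id_obj _) (fun _ => source_id_obj _) (fun _ => rfl)
    (fun _ _ => rfl)
  t_i := target_id_obj
  t_i_arr f := chuArr_ext (fun _ => target_id_obj _) (fun _ => target_id_obj _) (fun _ => rfl)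
    (fun _ _ => rfl)
  s_c := source_comp_obj
  s_c_arr f g h := chuArr_ext
    (fun i => source_comp_obj _ _ (congrArg (fun k => D.chu₀.src k i) h))
    (fun j => source_comp_obj _ _ (congrArg (fun k => D.chu₀.tgt k j) h))
    (fun _ => rfl) (fun _ _ => rfl)
  t_c := target_comp_obj
  t_c_arr f g h := chuArr_ext
    (fun i => target_comp_obj _ _ (congrArg (fun k => D.chu₀.src k i) h))
    (fun j => target_comp_obj _ _ (congrArg (fun k => D.chu₀.tgt k j) h))
    (fun _ => rfl) (fun _ _ => rfl)
  id_c y := id_comp_obj y _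
  id_c_arr g := chuArr_ext (fun _ => id_comp_obj _ (target_id_obj _))
    (fun _ => id_comp_obj _ (target_id_obj _))
    (fun e => Square.vone_stack (D := D) (chuPrim g e) rfl)
    (fun e e' => Cyl.vone_stack (D := D) (chuIso g e e') rfl)
  c_id x := comp_id_obj x _
  c_id_arr f := chuArr_ext (fun _ => comp_id_obj _ (source_id_obj _).symm)
    (fun _ => comp_id_obj _ (source_id_obj _).symm)
    (fun e => Square.stack_vone (D := D) (chuPrim f e) rfl)
    (fun e e' => Cyl.stack_vone (D := D) (chuIso f e e') rfl)
  c_assoc x y z h h' := comp_assoc_obj x y z h h' _ _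
  c_assoc_arr f g k h h' := chuArr_ext
    (fun i =>
      have h₁ := congrArg (fun k => D.chu₀.src k i) h
      have h₂ := congrArg (fun k => D.chu₀.src k i) h'
      comp_assoc_obj _ _ _ h₁ h₂ ((target_comp_obj _ _ h₁).trans h₂)
        (h₁.trans (source_comp_obj _ _ h₂).symm))
    (fun j =>
      have h₁ := congrArg (fun k => D.chu₀.tgt k j) h
      have h₂ := congrArg (fun k => D.chu₀.tgt k j) h'
      comp_assoc_obj _ _ _ h₁ h₂ ((target_comp_obj _ _ h₁).trans h₂)
        (h₁.trans (source_comp_obj _ _ h₂).symm))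
    (fun e =>
      have h₁ : Square.bot (chuPrim f e) = Square.top (chuPrim g e) :=
        congrArg (fun k => chuPrim k e) h
      have h₂ : Square.bot (chuPrim g e) = Square.top (chuPrim k e) :=
        congrArg (fun k => chuPrim k e) h'
      Square.stack_assoc (D := D) (chuPrim f e) (chuPrim g e) (chuPrim k e) h₁ h₂ h₂ h₁)
    (fun e e' => Cyl.stack_assoc (D := D) (chuIso f e e') (chuIso g e e') (chuIso k e e')
      (congrArg (fun k => chuIso k e e') h) (congrArg (fun k => chuIso k e e') h')
      (congrArg (fun k => chuIso k e e') h') (congrArg (fun k => chuIso k e e') h))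
  s_plus _ := rfl
  s_minus _ := rfl
  s_form _ := rfl
  s_prim _ _ := rfl
  s_iso _ _ _ := rfl
  t_plus _ := rfl
  t_minus _ := rfl
  t_form _ := rfl
  t_prim _ _ := rfl
  t_iso _ _ _ := rfl
  i_plus _ := rfl
  i_minus _ := rfl
  i_form _ := ⟨rfl, rfl, rfl⟩
  i_prim _ _ := ⟨rfl, rfl, rfl⟩
  i_iso_up _ _ _ := rfl
  i_iso_down _ _ _ := rfl
  c_plus _ _ _ := rfl
  c_minus _ _ _ := rfl
  c_form _ _ _ := ⟨rfl, rfl, _, rfl⟩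
  c_prim _ _ _ _ := ⟨rfl, rfl, _, rfl⟩
  c_iso_up _ _ _ _ _ := rfl
  c_iso_down _ _ _ _ _ := rfl

end CoSub2

end ChuDialectica

/-- If `Ω` is a presheaf of `∗`-polycategories on a multicategory `C`, then so is `Adj_C(Ω)`, with the
dual `(φ⁻, φ⁺, φ̲•)` of `(φ⁺, φ⁻, φ̲)`; and the double Chu construction of any 2-multicategory with a
2-presheaf (a co-subunary 2-polycategory) is an internal category in `∗`-polycategories. -/
theorem mainTheorem5 :
    (∀ (C : ChuDialectica.Multicat.{u, v}) (Ω : ChuDialectica.StarPshData.{u, v, u₁, v₁} C)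
      (hΩ : Ω.IsStarPsh), (Ω.adj hΩ.isPolyPsh.objs_isPsh).IsStarPsh) ∧
    (∀ D : ChuDialectica.CoSub2.{u, v, w}, Nonempty D.DoubleChu) :=
  ⟨fun _ _ hΩ => ChuDialectica.adj_isStarPsh hΩ, fun D => ⟨D.doubleChu⟩⟩
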